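/- **Setting.** Let $p$ be a prime, $q=p^a$, and $1\le r<n$. Let $f_1,\dots,f_r\in\mathbf F_q[x_0,\dots,x_n]$ be homogeneous of degrees $d_1,\dots,d_r\ge 1$ such that $f_1=\dots=f_r=0$ defines a smooth complete intersection of codimension $r$ in $\mathbf P^n$. Let $K$ be the unramified extension of $\mathbf Q_p$ of degree $a$ inside $\mathbf C_p$, $\tau$ its Frobenius, $\zeta_p$ a primitive $p$-th root of unity, and $\gamma\in\mathbf Q_p(\zeta_p)$ a zero of $\sum_{i\ge0}t^{p^i}/p^i$ with $\mathrm{ord}_p\,\gamma=1/(p-1)$; put $\gamma_l=\sum_{i=0}^l\gamma^{p^i}/p^i$. Let $b$ be a rational number with $1/(p-1)<b<p/(p-1)$, $M$ a positive integer such that $Mb/(p(p-1))$ and $M/(p-1)$ are integers, $\pi\in\mathbf C_p$ with $\pi^M=p$, $\tilde\Lambda_0=K(\zeta_p,\pi)$, and $\mathcal O$ its ring of integers. **The complex $\Omega^\bullet_{b,0}$.** Let $C(b)$ be the space of power series $\sum A_{u,v}\pi^{Mb|v|}x^uy^v$ in $x_0,\dots,x_n,y_1,\dots,y_r$, where $|v|=v_1+\cdots+v_r$,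 with $A_{u,v}\in\tilde\Lambda_0$ and $A_{u,v}\to0$. Give $x_i,dx_i$ degree $1$ and $y_j,dy_j$ degree $-d_j$, and let $\Omega^k_{b,0}$ be the space of $k$-forms $\sum\xi_{I,J}\,dx_I\,dy_J$ of degree $0$ with $\xi_{I,J}\in C(b)$. For $s\in\mathbf Z$ let $F^s\Omega^k_{b,0}$ be the $\mathcal O$-submodule of those forms in which each $\xi_{I,J}$ is of the form $\sum A_{u,v}\pi^{Mb(|v|+|J|)}x^uy^v$ with all $A_{u,v}\in\pi^s\mathcal O$. Let $\hat f_j$ be the Teichmüller lifting of $f_j$, and put $$H=\sum_{l\ge0}\gamma_l\sum_{j=1}^r y_j^{p^l}\hat f_j^{\tau^l}(x^{p^l}),\qquad D(\omega)=\pi^{Mb}\gamma^{-1}(d\omega+dH\wedge\omega).$$ With the differential $D$, $\Omega^\bullet_{b,0}$ and $F^s\Omega^\bullet_{b,0}$ are complexes. **Frobenius.** Let $E(t)=\exp\bigl(\sum_{i\ge0}t^{p^i}/p^i\bigr)$, write $\hat f_j=\sum_u\hat a_{u,j}x^u$, and put $G_0=\prod_{i=0}^{a-1}\prod_{u,j}E\bigl(\gamma(\hat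 a_{u,j}x^uy_j)^{p^i}\bigr)$. Let $\psi\bigl(\sum A_{u,v}x^uy^v\bigr)=\sum A_{pu,pv}x^uy^v$, $\alpha=\psi^a\circ G_0$, and, on $k$-forms, $\alpha_k(\xi\,dx_I\,dy_J)=q^{n+1+r-k}(x_Iy_J)^{-1}\alpha(x_Iy_J\,\xi)\,dx_I\,dy_J$, where $x_I$, $y_J$ are the products of the variables indexed by $I$, $J$. **The complex $\widehat\Omega^\bullet_{b,0}$.** Let $\theta$ be the antiderivation of $\Omega^\bullet_{b,0}$ of degree $-1$, linear over power series, with $\theta(dx_i)=x_i$ and $\theta(dy_j)=-d_jy_j$. Put $\widetilde\Omega^k_{b,0}=\theta(\Omega^{k+1}_{b,0})$ with differential $D$. Put $\widehat\Omega^0_{b,0}=\tilde\Lambda_0$ and $\widehat\Omega^k_{b,0}=\widetilde\Omega^{k-1}_{b,0}$ for $k\ge1$, with differential $0$ in degree $0$ and $-D$ in degrees $\ge1$, and Frobenius $\hat\alpha_0=q^{n+r+1}$ and $\hat\alpha_k=q^{-1}\alpha_{k-1}$ for $k\ge1$. The map of complexes $\theta:\Omega^\bullet_{b,0}\to\widehat\Omega^\bullet_{b,0}$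 is the constant term in degree $0$ and $\theta$ in degrees $\ge1$. Define $F^s\widetilde\Omega^\bullet_{b,0}$, $F^s\widehat\Omega^\bullet_{b,0}$ and $\theta$ in the same way from $F^s\Omega^\bullet_{b,0}$, with $F^s\widehat\Omega^0_{b,0}=\pi^s\mathcal O$. **The forms $\xi_r$ and $\eta_r$.** Put $$\xi_1=\pi^{Mb}\gamma^{-1}\sum_{j=1}^r\Bigl(\prod_{i\ne j}d_i\Bigr)\sum_{l\ge0}\frac{\gamma_l}{p^l}\,d\bigl(\hat f_j^{\tau^l}(x^{p^l})\bigr)\wedge d\bigl(y_j^{p^l}\bigr),\qquad \xi_k=\frac{(-1)^{k-1}}{k\,d_1\cdots d_r}\,\xi_1\wedge\xi_{k-1}\quad(k\ge2).$$ Let $\eta_0=1,\eta_1,\dots,\eta_r$ be forms with $\eta_k\in F^0\widetilde\Omega^{2k-1}_{b,0}$ for $k\ge1$ and $[\eta_k]=\delta([\eta_{k-1}])$, where $\delta:H^{2k-2}(F^0\widehat\Omega^\bullet_{b,0})\to H^{2k-1}(F^0\widetilde\Omega^\bullet_{b,0})$ is the connecting homomorphism of $0\to F^0\widetilde\Omega^\bullet_{b,0}\to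 F^0\Omega^\bullet_{b,0}\to F^0\widehat\Omega^\bullet_{b,0}\to0$. **Proposition.** Such forms $\eta_0,\dots,\eta_r$ exist, and for every choice of them the following holds. 1. For every $s\in\mathbf Z$, the $\mathcal O$-modules $H^{2r}(F^s\Omega^\bullet_{b,0})$ and $H^{2r}(F^s\widehat\Omega^\bullet_{b,0})$ are free of rank one with bases $[\pi^s\xi_r]$ and $[\pi^s\eta_r]$, and relative to these bases the map induced by $\theta$ is multiplication by $(-1)^{r(r-1)/2}d_1\cdots d_r$. 2. The $\tilde\Lambda_0$-vector spaces $H^{2r}(\Omega^\bullet_{b,0})$ and $H^{2r}(\widehat\Omega^\bullet_{b,0})$ are one-dimensional with bases $[\xi_r]$ and $[\eta_r]$, and relative to these bases the map induced by $\theta$ is multiplication by $(-1)^{r(r-1)/2}d_1\cdots d_r$. 3. The map $\theta:H^{2r}(\Omega^\bullet_{b,0})\to H^{2r}(\widehat\Omega^\bullet_{b,0})$ is an isomorphism of Frobenius modules: it is bijective and $\theta\circ\alpha_{2r}=\hat\alpha_{2r}\circ\theta$. Moreover $$\det\bigl(I-t\alpha_{2r}\mid H^{2r}(\Omega^\bullet_{b,0})\bigr)=1-q^{n+1}t.$$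 -/

import Mathlib

open Filter Topology
open scoped Padic

noncomputable section

/-! ### Cohomology of a family of submodules with differentials -/

section Cohomology

variable {R V W : Type*} [Ring R] [AddCommGroup V] [Module R V] [AddCommGroup W] [Module R W]

/-- `k`-cocycles of the complex with terms `C k ⊆ V` and differentials `δ k : C k → C (k + 1)`. -/
def cocycles (C : ℕ → Submodule R V) (δ : ℕ → V →ₗ[R] V) (k : ℕ) : Submodule R V :=
  C k ⊓ LinearMap.ker (δ k)

/-- `k`-coboundaries: the image of `C (k - 1)`, and `0` for `k = 0`. -/
def coboundaries (C : ℕ → Submodule R V) (δ : ℕ → V →ₗ[R] V) : ℕ → Submodule R V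
  | 0 => ⊥
  | k + 1 => (C k).map (δ k)

/-- The `k`-th cohomology module: cocycles modulo coboundaries. -/
abbrev Cohomology (C : ℕ → Submodule R V) (δ : ℕ → V →ₗ[R] V) (k : ℕ) : Type _ :=
  ↥(cocycles C δ k) ⧸ (coboundaries C δ k).comap (cocycles C δ k).subtype

/-- The cohomology class of a cocycle. -/
def cohClass (C : ℕ → Submodule R V) (δ : ℕ → V →ₗ[R] V) (k : ℕ) (ω : cocycles C δ k) :
    Cohomology C δ k :=
  Submodule.Quotient.mk ω

/-- `x` is the cohomology class of the element `ω` of `V` (in particular `ω` is a cocycle). -/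
def IsClassOf (C : ℕ → Submodule R V) (δ : ℕ → V →ₗ[R] V) (k : ℕ) (ω : V)
    (x : Cohomology C δ k) : Prop :=
  ∃ h : ω ∈ cocycles C δ k, x = cohClass C δ k ⟨ω, h⟩

/-- `Φ` is the map `H^k(C) → H^l(C')` induced by `φ`: the map `φ` sends cocycles to cocycles and
`Φ [ω] = [φ ω]` for every cocycle `ω`. There is at most one such `Φ`. -/
def IsInducedMap (C : ℕ → Submodule R V) (δ : ℕ → V →ₗ[R] V) (k : ℕ)
    (C' : ℕ → Submodule R W) (δ' : ℕ → W →ₗ[R] W) (l : ℕ)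
    (φ : V → W) (Φ : Cohomology C δ k →ₗ[R] Cohomology C' δ' l) : Prop :=
  ∀ ω : cocycles C δ k, IsClassOf C' δ' l (φ ω) (Φ (cohClass C δ k ω))

end Cohomology

/-! ### Formal differential forms -/

section Forms

/-- The variables `x_0, …, x_n, y_1, …, y_r`, in this order. -/
abbrev DworkVar (n r : ℕ) : Type := Fin (n + 1) ⊕ₗ Fin r

/-- Formal power series in `x_0, …, x_n, y_1, …, y_r` over `ℂ_p`. -/
abbrev DworkSeries (p : ℕ) [Fact p.Prime] (n r : ℕ) : Type :=
  MvPowerSeries (DworkVar n r) ℂ_[p]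

/-- Formal differential forms: `ω` stands for `∑_I ω(I) dz_I`, where `dz_I` is the wedge product
of the `dz_i`, `i ∈ I`, in increasing order, i.e. `dx_{i_1} ⋯ dx_{i_l} dy_{j_1} ⋯ dy_{j_m}`. -/
abbrev DworkForm (p : ℕ) [Fact p.Prime] (n r : ℕ) : Type :=
  Finset (DworkVar n r) → DworkSeries p n r

variable {p : ℕ} [Fact p.Prime] {n r : ℕ}

/-- The sign `ε(I, J)` with `dz_I ∧ dz_J = ε(I, J) dz_{I ∪ J}` for disjoint `I` and `J`. -/
def wedgeSign (I J : Finset (DworkVar n r)) : ℂ_[p] :=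
  (-1) ^ ((I ×ˢ J).filter fun ij => ij.2 < ij.1).card

/-- A power series as a `0`-form. -/
def zeroForm (φ : DworkSeries p n r) : DworkForm p n r := Pi.single ∅ φ

/-- The wedge product of formal forms. -/
def wedge (ω η : DworkForm p n r) : DworkForm p n r := fun S =>
  ∑ I ∈ S.powerset, wedgeSign (p := p) I (S \ I) • (ω I * η (S \ I))

/-- The exterior derivative `d(ξ dz_J) = ∑_i (∂ξ/∂z_i) dz_i ∧ dz_J`. -/
def formDeriv : DworkForm p n r →ₗ[ℂ_[p]] DworkForm p n r :=
  LinearMap.pi fun S => ∑ i ∈ S, wedgeSign (p := p) {i} (S.erase i) •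
    ((MvPowerSeries.pderiv ℂ_[p] i).toLinearMap ∘ₗ LinearMap.proj (S.erase i))

/-- The sum of a sequence of forms whose coefficients at any given monomial are almost all `0`. -/
def formalSum (g : ℕ → DworkForm p n r) : DworkForm p n r := fun S m =>
  ∑ᶠ l : ℕ, MvPowerSeries.coeff m (g l S)

/-- Left wedge multiplication is linear. -/
def wedgeLeft (ω : DworkForm p n r) : DworkForm p n r →ₗ[ℂ_[p]] DworkForm p n r where
  toFun := wedge ω
  map_add' η η' := by
    funext S
    simp only [wedge, Pi.add_apply, mul_add, smul_add, Finset.sum_add_distrib]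
  map_smul' c η := by
    funext S
    simp only [wedge, Pi.smul_apply, RingHom.id_apply, Finset.smul_sum, mul_smul_comm]
    exact Finset.sum_congr rfl fun I _ => smul_comm _ _ _

end Forms

/-- The Artin-Hasse exponential `E(t) = exp (∑_i t^{p^i} / p^i)`. -/
def artinHasse (p : ℕ) [Fact p.Prime] : PowerSeries ℂ_[p] :=
  (PowerSeries.exp ℂ_[p]).subst
    (PowerSeries.mk fun m => open Classical in
      if ∃ i : ℕ, m = p ^ i then (m : ℂ_[p])⁻¹ else 0)

/-- The polynomials `f_1, …, f_r` define a smooth complete intersection of codimension `r` in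
projective `n`-space (Jacobian criterion at all geometric points). -/
def IsSmoothCompleteIntersection {k : Type*} [Field k] {n r : ℕ}
    (f : Fin r → MvPolynomial (Fin (n + 1)) k) : Prop :=
  ∀ x : Fin (n + 1) → AlgebraicClosure k, x ≠ 0 →
    (∀ j, MvPolynomial.aeval x (f j) = 0) →
    LinearIndependent (AlgebraicClosure k) fun (j : Fin r) (i : Fin (n + 1)) =>
      MvPolynomial.aeval x (MvPolynomial.pderiv i (f j))

/-- The data from which the Dwork complex is built. -/
structure DworkDatum (p : ℕ) [Fact p.Prime] (k : Type*) [Field k] (n r : ℕ) where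
  /-- the exponent in `q = p ^ a` -/
  a : ℕ
  /-- the identification of `𝔽_q` with a subfield of the residue field of `ℂ_p` -/
  ι : k →+* IsLocalRing.ResidueField 𝓞_ℂ_[p]
  /-- the equations -/
  f : Fin r → MvPolynomial (Fin (n + 1)) k
  /-- their degrees -/
  d : Fin r → ℕ
  /-- a primitive `p`-th root of unity -/
  ζ : ℂ_[p]
  /-- a root `π` of `π ^ M = p` -/
  π : ℂ_[p]
  /-- a zero `γ` of `∑ t ^ (p ^ i) / p ^ i` -/
  γ : ℂ_[p]
  /-- the integer `M b` -/
  Mb : ℕ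

namespace DworkDatum

variable {p : ℕ} [Fact p.Prime] {k : Type*} [Field k] {n r : ℕ} (S : DworkDatum p k n r)

/-- `q = p ^ a`. -/
def q : ℕ := p ^ S.a

/-- The field `K(ζ_p, π)`, where `K`, generated over `ℚ_p` by the `(q - 1)`-st roots of unity, is
the unramified extension of `ℚ_p` of degree `a`. -/
def Lam : IntermediateField ℚ_[p] ℂ_[p] :=
  IntermediateField.adjoin ℚ_[p] ({x | x ^ (S.q - 1) = 1} ∪ {S.ζ, S.π})

/-- The ring of integers of `K(ζ_p, π)`. -/
def integers : Subring ℂ_[p] :=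
  (𝓞_ℂ_[p]).toSubring ⊓ S.Lam.toSubfield.toSubring

/-- The Teichmüller representative of `c`: the `z` with `z ^ q = z` that reduces to `c`. -/
def teichmuller (c : k) : ℂ_[p] :=
  Classical.epsilon fun z : ℂ_[p] => z ^ S.q = z ∧
    ∃ hz : z ∈ 𝓞_ℂ_[p], IsLocalRing.residue 𝓞_ℂ_[p] ⟨z, hz⟩ = S.ι c

/-- The exponent of the monomial `x ^ u`. -/
def xExp (u : Fin (n + 1) →₀ ℕ) : DworkVar n r →₀ ℕ :=
  u.mapDomain Sum.inlₗ

/-- The exponent of the monomial `y_j`. -/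
def yExp (j : Fin r) : DworkVar n r →₀ ℕ :=
  Finsupp.single (Sum.inrₗ j) 1

/-- `f̂_j^{τ^l}(x^{p^l})`, where `f̂_j` is the Teichmüller lifting of `f_j`; the Frobenius `τ` of `K`
raises Teichmüller representatives to the `p`-th power. -/
def fHat (j : Fin r) (l : ℕ) : DworkSeries p n r :=
  ∑ u ∈ (S.f j).support,
    MvPowerSeries.monomial (p ^ l • xExp u) (S.teichmuller ((S.f j).coeff u) ^ p ^ l)

/-- `y_j^{p^l}`. -/
def yPow (j : Fin r) (l : ℕ) : DworkSeries p n r :=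
  MvPowerSeries.monomial (p ^ l • yExp j) 1

/-- `γ_l = ∑_{i ≤ l} γ^{p^i} / p^i`. -/
def gam (l : ℕ) : ℂ_[p] := ∑ i ∈ Finset.range (l + 1), S.γ ^ p ^ i / (p : ℂ_[p]) ^ i

/-- `H = ∑_l γ_l ∑_j y_j^{p^l} f̂_j^{τ^l}(x^{p^l})`, as a `0`-form. -/
def H : DworkForm p n r :=
  formalSum fun l => zeroForm (S.gam l • ∑ j, yPow j l * S.fHat j l)

/-- `D ω = π^{Mb} γ^{-1} (dω + dH ∧ ω)`. -/
def D : DworkForm p n r →ₗ[ℂ_[p]] DworkForm p n r :=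
  (S.π ^ S.Mb * S.γ⁻¹) • (formDeriv + wedgeLeft (formDeriv S.H))

/-- The degrees of the variables: `1` for `x_i` and `-d_j` for `y_j`. -/
def wt (i : DworkVar n r) : ℤ :=
  Sum.elim (fun _ => 1) (fun j => -(S.d j : ℤ)) (ofLex i)

/-- The degree of `x^u y^v dz_I`. -/
def degree (m : DworkVar n r →₀ ℕ) (I : Finset (DworkVar n r)) : ℤ :=
  ∑ i, S.wt i * m i + ∑ i ∈ I, S.wt i

/-- `|v|` for the monomial `x^u y^v`. -/
def yDegree (m : DworkVar n r →₀ ℕ) : ℕ := ∑ j : Fin r, m (Sum.inrₗ j)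

/-- The number of factors `dy_j` in `dz_I`. -/
def yCard (I : Finset (DworkVar n r)) : ℕ :=
  (Finset.univ.filter fun j : Fin r => (Sum.inrₗ j : DworkVar n r) ∈ I).card

/-- `Ω^k_{b,0}`: the `k`-forms of degree `0` with coefficients
`∑ A_{u,v} π^{Mb|v|} x^u y^v` in `C(b)`. -/
def Omega (k : ℕ) : Submodule S.Lam (DworkForm p n r) where
  carrier := {ω | ∀ I, (I.card ≠ k → ω I = 0) ∧
    (∀ m, MvPowerSeries.coeff m (ω I) ∈ S.Lam) ∧
    (∀ m, S.degree m I ≠ 0 → MvPowerSeries.coeff m (ω I) = 0) ∧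
    Tendsto (fun m => MvPowerSeries.coeff m (ω I) / S.π ^ (S.Mb * yDegree m)) cofinite (𝓝 0)}
  add_mem' {ω η} hω hη I := by
    obtain ⟨h1, h2, h3, h4⟩ := hω I
    obtain ⟨g1, g2, g3, g4⟩ := hη I
    refine ⟨fun h => by simp [h1 h, g1 h], fun m => ?_, fun m h => ?_, ?_⟩
    · simpa using S.Lam.add_mem (h2 m) (g2 m)
    · simp [h3 m h, g3 m h]
    · simpa [add_div] using h4.add g4
  zero_mem' I := by simp [S.Lam.zero_mem]
  smul_mem' c ω hω I := by
    obtain ⟨h1, h2, h3, h4⟩ := hω I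
    have key : ∀ m, MvPowerSeries.coeff m ((c • ω) I) = c * MvPowerSeries.coeff m (ω I) :=
      fun m => rfl
    refine ⟨fun h => ?_, fun m => ?_, fun m h => ?_, ?_⟩
    · simp [h1 h]
    · rw [key]; exact S.Lam.mul_mem c.2 (h2 m)
    · rw [key, h3 m h, mul_zero]
    · have h := h4.const_mul (c : ℂ_[p])
      rw [mul_zero] at h
      exact h.congr fun m => by rw [key, mul_div_assoc]

/-- `F^s Ω^k_{b,0}`: the coefficient of `dz_I` is of the form
`∑ A_{u,v} π^{Mb(|v| + m)} x^u y^v` with `A_{u,v} ∈ π^s 𝒪`, where `m` is the number of `dy_j` in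
`dz_I`. -/
def FOmega (s : ℤ) (k : ℕ) : Submodule S.integers (DworkForm p n r) where
  carrier := {ω | ω ∈ S.Omega k ∧ ∀ I m, ∃ A ∈ S.integers,
    MvPowerSeries.coeff m (ω I) = S.π ^ (s + (S.Mb * (yDegree m + yCard I) : ℕ)) * A}
  add_mem' {ω η} hω hη := by
    refine ⟨(S.Omega k).add_mem hω.1 hη.1, fun I m => ?_⟩
    obtain ⟨A, hA, h⟩ := hω.2 I m
    obtain ⟨B, hB, g⟩ := hη.2 I m
    exact ⟨A + B, S.integers.add_mem hA hB, by simp [h, g, mul_add]⟩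
  zero_mem' := ⟨(S.Omega k).zero_mem, fun I m => ⟨0, S.integers.zero_mem, by simp⟩⟩
  smul_mem' c ω hω := by
    refine ⟨(S.Omega k).smul_mem ⟨c, c.2.2⟩ hω.1, fun I m => ?_⟩
    obtain ⟨A, hA, h⟩ := hω.2 I m
    refine ⟨c * A, S.integers.mul_mem c.2 hA, ?_⟩
    have key : MvPowerSeries.coeff m ((c • ω) I) = c * MvPowerSeries.coeff m (ω I) := rfl
    rw [key, h]; ring

/-- The contraction `θ`, with `θ(dx_i) = x_i` and `θ(dy_j) = -d_j y_j`. -/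
def theta : DworkForm p n r →ₗ[ℂ_[p]] DworkForm p n r :=
  LinearMap.pi fun I => ∑ i ∈ Iᶜ, ((S.wt i : ℂ_[p]) * wedgeSign {i} I) •
    (LinearMap.mulLeft ℂ_[p] (MvPowerSeries.X i : DworkSeries p n r) ∘ₗ
      LinearMap.proj (insert i I))

/-- The constant term of (the degree-`0` part of) a form, as a constant `0`-form. -/
def constTerm : DworkForm p n r →ₗ[ℂ_[p]] DworkForm p n r :=
  LinearMap.single ℂ_[p] (fun _ => DworkSeries p n r) ∅ ∘ₗ
    MvPowerSeries.monomial 0 ∘ₗ MvPowerSeries.coeff 0 ∘ₗ LinearMap.proj ∅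

/-- The operator `ψ`: the coefficient of `z^m` in `ψ φ` is that of `z^{pm}` in `φ`. -/
def psi : DworkSeries p n r →ₗ[ℂ_[p]] DworkSeries p n r :=
  LinearMap.pi fun m => MvPowerSeries.coeff (p • m)

/-- The splitting function `θ(t) = E(γ t)`. -/
def splitting : PowerSeries ℂ_[p] := PowerSeries.rescale S.γ (artinHasse p)

/-- `G_0 = ∏_{i < a} ∏_{u,j} θ((â_{u,j} x^u y_j)^{p^i})`. -/
def G₀ : DworkSeries p n r :=
  ∏ i ∈ Finset.range S.a, ∏ j, ∏ u ∈ (S.f j).support,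
    PowerSeries.subst
      ((MvPowerSeries.monomial (xExp u + yExp j) (S.teichmuller ((S.f j).coeff u)) :
        DworkSeries p n r) ^ p ^ i) S.splitting

/-- `α = ψ^a ∘ G_0` on power series. -/
def alphaSeries : DworkSeries p n r →ₗ[ℂ_[p]] DworkSeries p n r :=
  (psi ^ S.a) ∘ₗ LinearMap.mulLeft ℂ_[p] S.G₀

/-- The exponent of `z_I`, the product of the variables with index in `I`. -/
def setExp (I : Finset (DworkVar n r)) : DworkVar n r →₀ ℕ :=
  ∑ i ∈ I, Finsupp.single i 1

/-- Division by `z_I` (of a power series divisible by `z_I`). -/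
def divSet (I : Finset (DworkVar n r)) : DworkSeries p n r →ₗ[ℂ_[p]] DworkSeries p n r :=
  LinearMap.pi fun m => MvPowerSeries.coeff (m + setExp I)

/-- The Frobenius `α_•`: on `k`-forms, `α_k(ξ dz_I) = q^{n+1+r-k} z_I^{-1} α(z_I ξ) dz_I`. -/
def alpha : DworkForm p n r →ₗ[ℂ_[p]] DworkForm p n r :=
  LinearMap.pi fun I => (S.q : ℂ_[p]) ^ (n + 1 + r - I.card) •
    (divSet I ∘ₗ S.alphaSeries ∘ₗ
      LinearMap.mulLeft ℂ_[p] (MvPowerSeries.monomial (setExp I) 1 : DworkSeries p n r) ∘ₗ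
      LinearMap.proj I)

/-! ### The complexes `Ω̃` and `Ω̂` -/

/-- `Ω̂^0 = K(ζ_p, π)` and `Ω̂^k = Ω̃^{k-1} = θ(Ω^k)` for `k ≥ 1`. -/
def OmegaHat : ℕ → Submodule S.Lam (DworkForm p n r)
  | 0 => Submodule.span S.Lam {zeroForm 1}
  | k + 1 => (S.Omega (k + 1)).map (S.theta.restrictScalars S.Lam)

/-- `F^s Ω̃^k = θ(F^s Ω^{k+1})`. -/
def FOmegaTilde (s : ℤ) (k : ℕ) : Submodule S.integers (DworkForm p n r) :=
  (S.FOmega s (k + 1)).map (S.theta.restrictScalars S.integers)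

/-- `F^s Ω̂^0 = π^s 𝒪` and `F^s Ω̂^k = F^s Ω̃^{k-1}` for `k ≥ 1`. -/
def FOmegaHat (s : ℤ) : ℕ → Submodule S.integers (DworkForm p n r)
  | 0 => Submodule.span S.integers {(S.π ^ s) • zeroForm 1}
  | k + 1 => S.FOmegaTilde s k

/-- The differential of `Ω̂`: `0` in degree `0` and `-D` in degrees `k ≥ 1`. -/
def DHat : ℕ → DworkForm p n r →ₗ[ℂ_[p]] DworkForm p n r
  | 0 => 0
  | _ + 1 => -S.D

/-- The map of complexes `Ω → Ω̂`: the constant term in degree `0` and `θ` in degrees `k ≥ 1`. -/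
def thetaHat : ℕ → DworkForm p n r →ₗ[ℂ_[p]] DworkForm p n r
  | 0 => constTerm
  | _ + 1 => S.theta

/-- The Frobenius of `Ω̂`: multiplication by `q^{n+r+1}` in degree `0` and `q^{-1} α_{k-1}` in
degrees `k ≥ 1`. -/
def alphaHat : ℕ → DworkForm p n r →ₗ[ℂ_[p]] DworkForm p n r
  | 0 => (S.q : ℂ_[p]) ^ (n + r + 1) • LinearMap.id
  | _ + 1 => (S.q : ℂ_[p])⁻¹ • S.alpha

/-- The differentials of `Ω_{b,0}` over `K(ζ_p, π)`. -/
def dOmega (_ : ℕ) : DworkForm p n r →ₗ[S.Lam] DworkForm p n r := S.D.restrictScalars S.Lam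

/-- The differentials of `Ω̂_{b,0}` over `K(ζ_p, π)`. -/
def dOmegaHat (k : ℕ) : DworkForm p n r →ₗ[S.Lam] DworkForm p n r :=
  (S.DHat k).restrictScalars S.Lam

/-- The differentials of `F^s Ω_{b,0}` over the ring of integers. -/
def dFOmega (_ : ℕ) : DworkForm p n r →ₗ[S.integers] DworkForm p n r :=
  S.D.restrictScalars S.integers

/-- The differentials of `F^s Ω̂_{b,0}` over the ring of integers. -/
def dFOmegaHat (k : ℕ) : DworkForm p n r →ₗ[S.integers] DworkForm p n r :=
  (S.DHat k).restrictScalars S.integers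

/-! ### The forms `ξ_k` and `η_k` -/

/-- `ξ_1 = π^{Mb} γ^{-1} ∑_j (∏_{i ≠ j} d_i) ∑_l (γ_l / p^l) d(f̂_j^{τ^l}(x^{p^l})) ∧ d(y_j^{p^l})`. -/
def xiOne : DworkForm p n r :=
  (S.π ^ S.Mb * S.γ⁻¹) • ∑ j, (∏ i ∈ Finset.univ.erase j, (S.d i : ℂ_[p])) •
    formalSum fun l => (S.gam l / (p : ℂ_[p]) ^ l) •
      wedge (formDeriv (zeroForm (S.fHat j l))) (formDeriv (zeroForm (yPow j l)))

/-- `ξ_0 = d_1 ⋯ d_r`, and `ξ_k = (-1)^{k-1} / (k d_1 ⋯ d_r) ξ_1 ∧ ξ_{k-1}` for `k ≥ 2`. -/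
def xi : ℕ → DworkForm p n r
  | 0 => (∏ i, (S.d i : ℂ_[p])) • zeroForm 1
  | 1 => S.xiOne
  | k + 2 => ((-1) ^ (k + 1) / ((k + 2 : ℂ_[p]) * ∏ i, (S.d i : ℂ_[p]))) •
      wedge S.xiOne (xi (k + 1))

/-- `η_0, …, η_r` is a sequence of forms with `η_0 = 1`, `η_k ∈ F^0 Ω̃^{2k-1}` for `k ≥ 1` and
`[η_{k+1}] = δ [η_k]`, where `δ : H^{2k}(F^0 Ω̂) → H^{2k+1}(F^0 Ω̃)` is the connecting homomorphism
of the short exact sequence `0 → F^0 Ω̃ → F^0 Ω → F^0 Ω̂ → 0`: the class `δ [η_k]` is that of `D τ`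
for a lifting `τ ∈ F^0 Ω^{2k}` of `η_k`. -/
def IsEtaSequence (η : ℕ → DworkForm p n r) : Prop :=
  η 0 = zeroForm 1 ∧ ∀ k < r, η (k + 1) ∈ S.FOmegaTilde 0 (2 * k + 1) ∧
    ∃ τ ∈ S.FOmega 0 (2 * k), S.thetaHat (2 * k) τ = η k ∧
      η (k + 1) - S.D τ ∈ (S.FOmegaTilde 0 (2 * k)).map (S.D.restrictScalars S.integers)

end DworkDatum

end

noncomputable section

open Finset (sum_congr univ mul_sum smul_sum sum_eq_zero sum_add_distrib mem_univ
  exists_ne_zero_of_sum_ne_zero sum_eq_single mem_erase sum_insert mem_singleton sum_comm mem_insert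
  single_le_sum mem_sigma notMem_erase mem_powerset sum_neg_distrib prod_ne_zero_iff)
open Finset.HasAntidiagonal (mem_antidiagonal)
open Finsupp (weight single weight_apply weight_single single_eq_of_ne sum_fintype single_eq_same
  single_apply_ne_zero single_apply)
open Ideal (span ofList subset_span map_span)
open Set (range)
open Function (Injective comp_def Bijective)
open Localization (Away)
open Sum (inrₗ inlₗ)
open Submodule.Quotient (mk_surjective mk_eq_zero mk_smul mk_add)
open Module (Basis End)
open Derivation (leibniz)
open IsLocalRing (residue)
open LinearMap (map_smul_of_tower toMatrix)
open List (finRange)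
open Matrix (of)

/-- Differential forms with formal power series as coefficients. -/
abbrev SeriesForm (ι R : Type*) [CommRing R] : Type _ := Finset ι → MvPowerSeries ι R

/-- Formal power series in `x_0, …, x_n, y_1, …, y_r`. -/
abbrev VarSeries (n r : ℕ) (R : Type*) [CommRing R] : Type _ := MvPowerSeries (DworkVar n r) R

/-- Differential forms with coefficients in `VarSeries`. -/
abbrev VarForm (n r : ℕ) (R : Type*) [CommRing R] : Type _ := SeriesForm (DworkVar n r) R

/-- Polynomials in `x_0, …, x_n, y_1, …, y_r`. -/
abbrev DworkPoly (n r : ℕ) (k : Type*) [CommRing k] : Type _ := MvPolynomial (DworkVar n r) k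

/-- Differential forms with polynomial coefficients in `x_0, …, x_n, y_1, …, y_r`. -/
abbrev PolyForm (n r : ℕ) (k : Type*) [CommRing k] : Type _ :=
  Finset (DworkVar n r) → DworkPoly n r k

/-! ### Creation and annihilation operators on forms -/

section Koszul

variable {ι : Type*} [LinearOrder ι]

/-- The sign `ε(i, J)` with `dz_i ∧ dz_J = ε(i, J) dz_{J ∪ i}`. -/
def ksign (i : ι) (J : Finset ι) : ℤ := (-1) ^ (J.filter (· < i)).card

theorem ksign_mul_self (i : ι) (J : Finset ι) : ksign i J * ksign i J = 1 := by
  rw [ksign, ← mul_pow]; simp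

theorem ksign_insert {i : ι} {S : Finset ι} (h : i ∉ S) (j : ι) :
    ksign j (insert i S) = if i < j then -ksign j S else ksign j S := by
  unfold ksign
  rw [Finset.filter_insert]
  split_ifs with hij
  · rw [Finset.card_insert_of_notMem (by simp [h]), pow_succ]; simp
  · rfl

theorem ksign_erase {i : ι} {S : Finset ι} (h : i ∈ S) (j : ι) :
    ksign j (S.erase i) = if i < j then -ksign j S else ksign j S := by
  have := ksign_insert (notMem_erase i S) j
  rw [Finset.insert_erase h] at this
  rw [this]; split_ifs <;> simp

theorem ksign_erase_self (i : ι) (S : Finset ι) : ksign i (S.erase i) = ksign i S := by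
  by_cases h : i ∈ S
  · rw [ksign_erase h]; simp
  · rw [Finset.erase_eq_of_notMem h]

theorem ksign_insert_self (i : ι) (S : Finset ι) : ksign i (insert i S) = ksign i S := by
  by_cases h : i ∈ S
  · rw [Finset.insert_eq_of_mem h]
  · rw [ksign_insert h]; simp

variable (A : Type*) {M : Type*} [CommRing A] [AddCommGroup M] [Module A M]

/-- Exterior multiplication by `dz_i`. -/
def extMul (i : ι) : (Finset ι → M) →ₗ[A] (Finset ι → M) where
  toFun ω S := if i ∈ S then ksign i S • ω (S.erase i) else 0
  map_add' ω η := by funext S; simp only [Pi.add_apply]; split_ifs <;> simp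
  map_smul' c ω := by
    funext S; simp only [Pi.smul_apply, RingHom.id_apply]
    split_ifs
    · rw [smul_comm]
    · rw [smul_zero]

/-- Contraction with the vector field dual to `dz_i`. -/
def contr (i : ι) : (Finset ι → M) →ₗ[A] (Finset ι → M) where
  toFun ω S := if i ∈ S then 0 else ksign i S • ω (insert i S)
  map_add' ω η := by funext S; simp only [Pi.add_apply]; split_ifs <;> simp
  map_smul' c ω := by
    funext S; simp only [Pi.smul_apply, RingHom.id_apply]
    split_ifs
    · rw [smul_zero]
    · rw [smul_comm]

theorem extMul_apply (i : ι) (ω : Finset ι → M) (S : Finset ι) :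
    extMul A i ω S = if i ∈ S then ksign i S • ω (S.erase i) else 0 := rfl

theorem contr_apply (i : ι) (ω : Finset ι → M) (S : Finset ι) :
    contr A i ω S = if i ∈ S then 0 else ksign i S • ω (insert i S) := rfl

theorem extMul_self (i : ι) (ω : Finset ι → M) : extMul A i (extMul A i ω) = 0 := by
  funext S; simp [extMul_apply]

theorem extMul_comm (i j : ι) (ω : Finset ι → M) :
    extMul A i (extMul A j ω) = -extMul A j (extMul A i ω) := by
  rcases eq_or_ne i j with rfl | hij
  · simp [extMul_self]
  funext S
  simp only [extMul_apply, Pi.neg_apply, mem_erase]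
  by_cases hi : i ∈ S <;> by_cases hj : j ∈ S <;> simp [hi, hj, hij, hij.symm]
  rw [ksign_erase hi, ksign_erase hj, Finset.erase_right_comm]
  rcases lt_or_gt_of_ne hij with h | h
  · simp [h, h.not_gt, smul_smul, mul_comm]
  · simp [h, h.not_gt, smul_smul, mul_comm]

theorem contr_comm (i j : ι) (ω : Finset ι → M) :
    contr A i (contr A j ω) = -contr A j (contr A i ω) := by
  rcases eq_or_ne i j with rfl | hij
  · funext S; simp [contr_apply]
  funext S
  simp only [contr_apply, Pi.neg_apply, mem_insert]
  by_cases hi : i ∈ S <;> by_cases hj : j ∈ S <;> simp [hi, hj, hij, hij.symm]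
  rw [ksign_insert hi, ksign_insert hj, Finset.insert_comm]
  rcases lt_or_gt_of_ne hij with h | h
  · simp [h, h.not_gt, smul_smul, mul_comm]
  · simp [h, h.not_gt, smul_smul, mul_comm]

theorem extMul_contr (i j : ι) (ω : Finset ι → M) :
    extMul A i (contr A j ω) + contr A j (extMul A i ω) = if i = j then ω else 0 := by
  rcases eq_or_ne i j with rfl | hij
  · funext S
    by_cases hi : i ∈ S
    · simp [extMul_apply, contr_apply, hi, smul_smul, ksign_erase_self, ksign_mul_self]
    · simp [extMul_apply, contr_apply, hi, smul_smul, ksign_insert_self, ksign_mul_self]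
  funext S
  simp only [contr_apply, extMul_apply, Pi.add_apply, mem_insert, mem_erase]
  by_cases hi : i ∈ S <;> by_cases hj : j ∈ S <;> simp [hi, hj, hij, hij.symm]
  rw [ksign_insert hj, ksign_erase hi, Finset.erase_insert_of_ne hij.symm]
  rcases lt_or_gt_of_ne hij with h | h
  · simp [h, h.not_gt, smul_smul, mul_comm]
  · simp [h, h.not_gt, smul_smul, mul_comm]

/-- Forms of degree `k`. -/
def IsDeg (k : ℤ) (ω : Finset ι → M) : Prop := ∀ S : Finset ι, (S.card : ℤ) ≠ k → ω S = 0

omit [LinearOrder ι] in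
theorem IsDeg.add {k : ℤ} {ω η : Finset ι → M} (h : IsDeg k ω) (h' : IsDeg k η) :
    IsDeg k (ω + η) := fun S hS => by simp [h S hS, h' S hS]

theorem IsDeg.extMul {k : ℤ} {ω : Finset ι → M} (h : IsDeg k ω) (i : ι) :
    IsDeg (k + 1) (extMul A i ω) := fun S hS => by
  rw [extMul_apply]
  split_ifs with hi
  · rw [h, smul_zero]
    rw [Finset.card_erase_of_mem hi, Nat.cast_sub (Finset.card_pos.2 ⟨i, hi⟩)]
    push_cast; omega
  · rfl

theorem IsDeg.contr {k : ℤ} {ω : Finset ι → M} (h : IsDeg k ω) (i : ι) :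
    IsDeg (k - 1) (contr A i ω) := fun S hS => by
  rw [contr_apply]
  split_ifs with hi
  · rfl
  · rw [h, smul_zero]
    rw [Finset.card_insert_of_notMem hi]; push_cast; omega

section
omit [LinearOrder ι]

theorem IsDeg.eq_zero_of_neg {k : ℤ} (hk : k < 0) {ω : Finset ι → M} (h : IsDeg k ω) : ω = 0 := by
  funext S; exact h S (by have := Int.natCast_nonneg S.card; omega)

theorem IsDeg.sum {α : Type*} {s : Finset α} {k : ℤ} {ω : α → Finset ι → M}
    (h : ∀ a ∈ s, IsDeg k (ω a)) : IsDeg k (∑ a ∈ s, ω a) := fun S hS => by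
  rw [Finset.sum_apply]; exact sum_eq_zero fun a ha => h a ha S hS

theorem IsDeg.smul {k : ℤ} {ω : Finset ι → M} (h : IsDeg k ω) (c : A) : IsDeg k (c • ω) :=
  fun S hS => by simp [h S hS]

theorem IsDeg.sub {k : ℤ} {ω η : Finset ι → M} (h : IsDeg k ω) (h' : IsDeg k η) :
    IsDeg k (ω - η) := fun S hS => by simp [h S hS, h' S hS]

end

/-- The part of degree `k` of a form. -/
def degPart (k : ℤ) (ω : Finset ι → M) : Finset ι → M :=
  fun S => if (S.card : ℤ) = k then ω S else 0

omit [LinearOrder ι] in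
theorem isDeg_degPart (k : ℤ) (ω : Finset ι → M) : IsDeg k (degPart k ω) :=
  fun S hS => by simp [degPart, hS]

omit [LinearOrder ι] in
theorem IsDeg.degPart_eq {k : ℤ} {ω : Finset ι → M} (h : IsDeg k ω) : degPart k ω = ω := by
  funext S
  by_cases hS : (S.card : ℤ) = k
  · simp [degPart, hS]
  · simp [degPart, hS, h S hS]

theorem degPart_extMul (k : ℤ) (i : ι) (ω : Finset ι → M) :
    degPart (k + 1) (extMul A i ω) = extMul A i (degPart k ω) := by
  funext S
  simp only [degPart, extMul_apply]
  by_cases hi : i ∈ S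
  · have : ((S.erase i).card : ℤ) = S.card - 1 := by
      rw [Finset.card_erase_of_mem hi, Nat.cast_sub (Finset.card_pos.2 ⟨i, hi⟩)]; simp
    simp only [hi, if_true, this]
    by_cases h : (S.card : ℤ) = k + 1
    · simp [h]
    · simp [h, sub_eq_iff_eq_add]
  · simp [hi]

variable {A} [Fintype ι]

/-- Exterior multiplication by the `1`-form `∑ e_i dz_i`. -/
def kw (e : ι → A) : (Finset ι → M) →ₗ[A] (Finset ι → M) := ∑ i, e i • extMul A i

/-- Contraction with the vector field `∑ v_i ∂/∂z_i`. -/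
def kc (v : ι → A) : (Finset ι → M) →ₗ[A] (Finset ι → M) := ∑ i, v i • contr A i

theorem kw_eq (e : ι → A) (ω : Finset ι → M) : kw e ω = ∑ i, e i • extMul A i ω := by
  simp [kw, LinearMap.sum_apply]

theorem kc_eq (e : ι → A) (ω : Finset ι → M) : kc e ω = ∑ i, e i • contr A i ω := by
  simp [kc, LinearMap.sum_apply]

theorem kw_apply (e : ι → A) (ω : Finset ι → M) (S : Finset ι) :
    kw e ω S = ∑ i ∈ S, ksign i S • e i • ω (S.erase i) := by
  rw [kw_eq, Finset.sum_apply]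
  simp only [Pi.smul_apply, extMul_apply]
  rw [← Finset.sum_filter_add_sum_filter_not univ (· ∈ S), Finset.filter_univ_mem]
  rw [sum_eq_zero (s := univ.filter (· ∉ S)), add_zero]
  · exact sum_congr rfl fun i hi => by rw [if_pos hi, smul_comm]
  · intro i hi; simp at hi; simp [hi]

theorem kw_comm (e e' : ι → A) (ω : Finset ι → M) : kw e (kw e' ω) = -kw e' (kw e ω) := by
  simp only [kw_eq, map_sum, map_smul, smul_sum]
  rw [sum_comm, ← sum_neg_distrib]
  refine sum_congr rfl fun i _ => ?_
  rw [← sum_neg_distrib]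
  refine sum_congr rfl fun j _ => ?_
  rw [extMul_comm, smul_neg, smul_neg, smul_comm]

theorem kw_self (e : ι → A) (ω : Finset ι → M) : kw e (kw e ω) = 0 := by
  have key : ∀ s : Finset ι, (∑ i ∈ s, e i • extMul A i (∑ j ∈ s, e j • extMul A j ω)) = 0 := by
    intro s
    induction s using Finset.induction_on with
    | empty => simp
    | insert a s ha ih =>
      rw [sum_insert ha, sum_insert ha]
      simp only [map_add, map_smul, smul_add, extMul_self, smul_zero, zero_add,
        sum_add_distrib, ih, add_zero]
      simp only [map_sum, map_smul, smul_sum]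
      rw [← sum_add_distrib]
      refine sum_eq_zero fun i _ => ?_
      rw [extMul_comm, smul_neg, smul_neg, smul_comm]; simp
  have := key univ
  rwa [← kw_eq, ← kw_eq] at this

theorem kw_kc (e v : ι → A) (ω : Finset ι → M) :
    kw e (kc v ω) + kc v (kw e ω) = (∑ i, v i * e i) • ω := by
  simp only [kw_eq, kc_eq, map_sum, map_smul, smul_sum]
  rw [sum_comm, ← sum_add_distrib, Finset.sum_smul]
  refine sum_congr rfl fun i _ => ?_
  rw [← sum_add_distrib]
  have : ∀ j, v j • e i • extMul A i (contr A j ω) + e i • v j • contr A j (extMul A i ω)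
      = if i = j then (v i * e i) • ω else 0 := by
    intro j
    rw [smul_comm (e i), ← smul_add, ← smul_add, extMul_contr]
    split_ifs with h
    · subst h; rw [smul_smul]
    · simp
  simp [this]

theorem IsDeg.kw {k : ℤ} {ω : Finset ι → M} (h : IsDeg k ω) (e : ι → A) :
    IsDeg (k + 1) (kw e ω) := by
  rw [kw_eq]; exact IsDeg.sum fun i _ => (h.extMul A i).smul A _

theorem IsDeg.kc {k : ℤ} {ω : Finset ι → M} (h : IsDeg k ω) (e : ι → A) :
    IsDeg (k - 1) (kc e ω) := by
  rw [kc_eq]; exact IsDeg.sum fun i _ => (h.contr A i).smul A _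

theorem degPart_kw (k : ℤ) (e : ι → A) (ω : Finset ι → M) :
    degPart (k + 1) (kw e ω) = kw e (degPart k ω) := by
  rw [kw_eq, kw_eq]
  simp only [← degPart_extMul]
  funext S
  simp only [degPart, Finset.sum_apply, Pi.smul_apply]
  split_ifs <;> simp

theorem exists_isDeg_kw {k : ℤ} {e : ι → A} {ω σ : Finset ι → M} (hω : IsDeg k ω)
    (h : ω = kw e σ) : ∃ σ', IsDeg (k - 1) σ' ∧ ω = kw e σ' :=
  ⟨degPart (k - 1) σ, isDeg_degPart _ _, by
    rw [← degPart_kw, ← h, sub_add_cancel, hω.degPart_eq]⟩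

theorem kw_map {N : Type*} [AddCommGroup N] [Module A N] (φ : M →ₗ[A] N) (e : ι → A)
    (ω : Finset ι → M) : kw e (fun S => φ (ω S)) = fun S => φ (kw e ω S) := by
  funext S
  simp [kw_apply, map_sum]

theorem exists_kw_eq_smul {e : ι → A} {a : A} (ha : a ∈ span (range e))
    {ω : Finset ι → M} (h : kw e ω = 0) : ∃ σ, a • ω = kw e σ := by
  obtain ⟨c, rfl⟩ := (Ideal.mem_span_range_iff_exists_fun).1 ha
  exact ⟨kc c ω, by rw [← kw_kc, h, map_zero, add_zero]⟩

/-! ### Koszul cohomology and weakly regular sequences -/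

open RingTheory.Sequence
open scoped Pointwise

omit [LinearOrder ι] [Fintype ι] in
theorem exists_lift_quotSMulTop (a : A) (σ : Finset ι → QuotSMulTop a M) :
    ∃ τ : Finset ι → M, ∀ S, Submodule.Quotient.mk (τ S) = σ S :=
  ⟨fun S => (mk_surjective _ (σ S)).choose, fun S =>
    (mk_surjective _ (σ S)).choose_spec⟩

omit [LinearOrder ι] [Fintype ι] in
theorem exists_smul_of_mk_eq {a : A} {σ τ : Finset ι → M}
    (h : ∀ S, (Submodule.Quotient.mk (σ S) : QuotSMulTop a M) = Submodule.Quotient.mk (τ S)) :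
    ∃ ρ : Finset ι → M, σ = τ + a • ρ := by
  have : ∀ S, ∃ m, σ S = τ S + a • m := fun S => by
    obtain ⟨m, -, hm⟩ := (Submodule.mem_smul_pointwise_iff_exists _ _ _).1
      ((Submodule.Quotient.eq _).1 (h S))
    exact ⟨m, by rw [hm]; abel⟩
  choose ρ hρ using this
  exact ⟨ρ, funext hρ⟩

theorem kw_mk (a : A) (e : ι → A) (ω : Finset ι → M) :
    kw e (fun S => (Submodule.Quotient.mk (ω S) : QuotSMulTop a M)) =
      fun S => Submodule.Quotient.mk (kw e ω S) :=
  kw_map (Submodule.mkQ (a • (⊤ : Submodule A M))) e ω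

omit [LinearOrder ι] [Fintype ι] in
theorem smul_forms_injective {a : A} (ha : IsSMulRegular M a) {ω η : Finset ι → M}
    (h : a • ω = a • η) : ω = η :=
  funext fun S => ha (congrFun h S)

theorem exists_kw_eq_of_isWeaklyRegular {A : Type*} [CommRing A] (e : ι → A) (rs : List A) :
    ∀ {M : Type*} [AddCommGroup M] [Module A M], (∀ a ∈ rs, a ∈ span (range e)) →
      IsWeaklyRegular M rs → ∀ {k : ℤ}, k < rs.length → ∀ {ω : Finset ι → M}, IsDeg k ω →
        kw e ω = 0 → ∃ σ, ω = kw e σ := by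
  induction rs with
  | nil =>
    intro M _ _ _ _ k hk ω hω _
    exact ⟨0, by rw [hω.eq_zero_of_neg (by simpa using hk), map_zero]⟩
  | cons a rs ih =>
    intro M _ _ hmem hreg k hk ω hω hcl
    rw [isWeaklyRegular_cons_iff] at hreg
    obtain ⟨σ, hσ⟩ := exists_kw_eq_smul (hmem a (by simp)) hcl
    obtain ⟨σ, hdeg, hσ⟩ := exists_isDeg_kw (hω.smul A a) hσ
    obtain ⟨ρ, hρ⟩ := ih (M := QuotSMulTop a M) (fun b hb => hmem b (by simp [hb])) hreg.2
      (k := k - 1) (by simp at hk; omega)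
      (ω := fun S => Submodule.Quotient.mk (σ S)) (fun S hS => by simp only [hdeg S hS]; rfl)
      (by
        rw [kw_mk, ← hσ]; funext S
        exact (mk_eq_zero _).2
          ((Submodule.mem_smul_pointwise_iff_exists _ _ _).2 ⟨ω S, trivial, rfl⟩))
    obtain ⟨ρ', hρ'⟩ := exists_lift_quotSMulTop a ρ
    obtain ⟨τ, hτ⟩ := exists_smul_of_mk_eq (σ := σ) (τ := kw e ρ') (a := a) (fun S => by
      have := congrFun hρ S
      rw [← funext hρ', kw_mk] at this
      exact this)
    refine ⟨τ, smul_forms_injective hreg.1 ?_⟩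
    rw [hσ, hτ, map_add, kw_self, zero_add, map_smul]

/-- `e_1 ∧ (e_2 ∧ ⋯ ∧ m)`. -/
def wedgeList : List (A × (ι → A)) → M → Finset ι → M
  | [], m => Pi.single ∅ m
  | (_, e) :: L, m => kw e (wedgeList L m)

theorem isDeg_wedgeList (L : List (A × (ι → A))) (m : M) : IsDeg L.length (wedgeList L m) := by
  induction L with
  | nil =>
    intro S hS
    have : S ≠ ∅ := by rintro rfl; simp at hS
    simp [wedgeList, this]
  | cons x L ih => simpa [wedgeList] using ih.kw x.2

theorem wedgeList_map {N : Type*} [AddCommGroup N] [Module A N] (φ : M →ₗ[A] N)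
    (L : List (A × (ι → A))) (m : M) : wedgeList L (φ m) = fun S => φ (wedgeList L m S) := by
  induction L with
  | nil =>
    funext S
    by_cases h : S = ∅
    · subst h; simp [wedgeList]
    · simp [wedgeList, h]
  | cons x L ih => rw [wedgeList, ih, kw_map]; rfl

theorem wedgeList_smul (L : List (A × (ι → A))) (c : A) (m : M) :
    wedgeList L (c • m) = c • wedgeList L m :=
  wedgeList_map (LinearMap.lsmul A M c) L m

theorem wedgeList_add (L : List (A × (ι → A))) (m m' : M) :
    wedgeList L (m + m') = wedgeList L m + wedgeList L m' := by
  induction L with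
  | nil => simp [wedgeList, Pi.single_add]
  | cons x L ih => simp [wedgeList, ih]

theorem kw_wedgeList_of_mem {L : List (A × (ι → A))} {x : A × (ι → A)} (hx : x ∈ L) (m : M) :
    kw x.2 (wedgeList L m) = 0 := by
  induction L with
  | nil => simp at hx
  | cons y L ih =>
    rw [wedgeList]
    rcases List.mem_cons.1 hx with rfl | h
    · exact kw_self _ _
    · rw [kw_comm, ih h, map_zero, neg_zero]

theorem kw_eq_list_sum {κ : ι → A} {L : List (A × (ι → A))}
    (hκ : ∀ i (m : M), κ i • m = (L.map fun x => x.1 * x.2 i).sum • m) (ω : Finset ι → M) :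
    kw κ ω = (L.map fun x => x.1 • kw x.2 ω).sum := by
  have h1 : kw κ ω = kw (fun i => (L.map fun x => x.1 * x.2 i).sum) ω := by
    funext S; simp only [kw_apply, hκ]
  rw [h1]
  clear h1 hκ
  induction L with
  | nil => simp [kw_eq]
  | cons x L ih =>
    simp only [List.map_cons, List.sum_cons]
    rw [← ih]
    simp only [kw_eq, add_smul, sum_add_distrib, smul_sum, smul_smul]

theorem kw_wedgeList_eq_zero {κ : ι → A} {L : List (A × (ι → A))}
    (hκ : ∀ i (m : M), κ i • m = (L.map fun x => x.1 * x.2 i).sum • m) (m : M) :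
    kw κ (wedgeList L m) = 0 := by
  rw [kw_eq_list_sum hκ]
  apply List.sum_eq_zero
  simp only [List.mem_map]
  rintro _ ⟨x, hx, rfl⟩
  rw [kw_wedgeList_of_mem hx, smul_zero]

theorem kw_wedgeList_tail {κ : ι → A} {x : A × (ι → A)} {L : List (A × (ι → A))}
    (hκ : ∀ i (m : M), κ i • m = ((x :: L).map fun x => x.1 * x.2 i).sum • m) (m : M) :
    kw κ (wedgeList L m) = x.1 • wedgeList (x :: L) m := by
  rw [kw_eq_list_sum hκ, List.map_cons, List.sum_cons, wedgeList]
  rw [List.sum_eq_zero, add_zero]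
  simp only [List.mem_map]
  rintro _ ⟨y, hy, rfl⟩
  rw [kw_wedgeList_of_mem hy, smul_zero]

omit [LinearOrder ι] [Fintype ι] in
theorem list_sum_smul_quotSMulTop {κ : ι → A} {x : A × (ι → A)} {L : List (A × (ι → A))}
    (hκ : ∀ i (m : M), κ i • m = ((x :: L).map fun x => x.1 * x.2 i).sum • m) (i : ι)
    (m : QuotSMulTop x.1 M) : κ i • m = (L.map fun x => x.1 * x.2 i).sum • m := by
  obtain ⟨m, rfl⟩ := mk_surjective _ m
  rw [← mk_smul, hκ, List.map_cons, List.sum_cons, add_smul,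
    mk_add, mk_smul _ (List.sum _), add_eq_right,
    mk_eq_zero]
  exact (Submodule.mem_smul_pointwise_iff_exists _ _ _).2 ⟨x.2 i • m, trivial, by rw [smul_smul]⟩

theorem exists_eq_wedgeList_add {A : Type*} [CommRing A] (κ : ι → A) (L : List (A × (ι → A))) :
    ∀ {M : Type*} [AddCommGroup M] [Module A M], (∀ x ∈ L, x.1 ∈ span (range κ)) →
      (∀ i (m : M), κ i • m = (L.map fun x => x.1 * x.2 i).sum • m) →
      IsWeaklyRegular M (L.map Prod.fst) → ∀ {ω : Finset ι → M}, IsDeg L.length ω →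
        kw κ ω = 0 → ∃ m σ, ω = wedgeList L m + kw κ σ := by
  induction L with
  | nil =>
    intro M _ _ _ _ _ ω hω _
    refine ⟨ω ∅, 0, ?_⟩
    funext S
    by_cases h : S = ∅
    · subst h; simp [wedgeList]
    · simp [wedgeList, h, hω S (by simpa using h)]
  | cons x L ih =>
    intro M _ _ hmem hκ hreg ω hω hcl
    rw [List.map_cons, isWeaklyRegular_cons_iff] at hreg
    obtain ⟨σ, hσ⟩ := exists_kw_eq_smul (hmem x (by simp)) hcl
    obtain ⟨σ, hdeg, hσ⟩ := exists_isDeg_kw (hω.smul A x.1) hσ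
    obtain ⟨m, ρ, hρ⟩ := ih (M := QuotSMulTop x.1 M) (fun b hb => hmem b (by simp [hb]))
      (list_sum_smul_quotSMulTop hκ) hreg.2
      (ω := fun S => Submodule.Quotient.mk (σ S))
      (fun S hS => by simp only [hdeg S (by simpa using hS)]; rfl)
      (by
        rw [kw_mk, ← hσ]; funext S
        exact (mk_eq_zero _).2
          ((Submodule.mem_smul_pointwise_iff_exists _ _ _).2 ⟨ω S, trivial, rfl⟩))
    obtain ⟨ρ', hρ'⟩ := exists_lift_quotSMulTop x.1 ρ
    obtain ⟨m', rfl⟩ := mk_surjective _ m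
    obtain ⟨τ, hτ⟩ := exists_smul_of_mk_eq (σ := σ) (τ := wedgeList L m' + kw κ ρ') (a := x.1)
      (fun S => by
        have := congrFun hρ S
        rw [← funext hρ', kw_mk] at this
        rw [this]
        have h2 := congrFun (wedgeList_map (Submodule.mkQ (x.1 • (⊤ : Submodule A M))) L m') S
        simp only [Submodule.mkQ_apply] at h2
        rw [Pi.add_apply, Pi.add_apply, mk_add, ← h2])
    refine ⟨m', τ, smul_forms_injective hreg.1 ?_⟩
    rw [hσ, hτ, map_add, map_add, kw_self, add_zero, map_smul, kw_wedgeList_tail hκ, smul_add]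

theorem mem_ofList_of_wedgeList_eq {A : Type*} [CommRing A] (κ : ι → A) (L : List (A × (ι → A))) :
    ∀ {M : Type*} [AddCommGroup M] [Module A M], (∀ x ∈ L, x.1 ∈ span (range κ)) →
      (∀ i (m : M), κ i • m = (L.map fun x => x.1 * x.2 i).sum • m) →
      IsWeaklyRegular M (L.map Prod.fst) → ∀ {m : M} {σ : Finset ι → M}, wedgeList L m = kw κ σ →
        m ∈ (ofList (L.map Prod.fst) • ⊤ : Submodule A M) := by
  induction L with
  | nil =>
    intro M _ _ _ _ _ m σ h
    have := congrFun h ∅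
    rw [kw_apply] at this
    simp [wedgeList] at this
    simp [this]
  | cons x L ih =>
    intro M _ _ hmem hκ hreg m σ h
    have hreg' := hreg
    rw [List.map_cons, isWeaklyRegular_cons_iff] at hreg
    obtain ⟨σ, hdeg, h⟩ := exists_isDeg_kw (isDeg_wedgeList (x :: L) m) h
    have hcl : kw κ (wedgeList L m - x.1 • σ) = 0 := by
      rw [map_sub, kw_wedgeList_tail hκ, h, map_smul, sub_self]
    obtain ⟨ρ, hρ⟩ := exists_kw_eq_of_isWeaklyRegular κ ((x :: L).map Prod.fst)
      (by
        intro a ha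
        obtain ⟨y, hy, rfl⟩ := List.mem_map.1 ha
        exact hmem y hy) hreg' (k := L.length) (by simp)
      ((isDeg_wedgeList L m).sub (by
        have := hdeg.smul A x.1; simpa using this)) hcl
    have := ih (M := QuotSMulTop x.1 M) (fun b hb => hmem b (by simp [hb]))
      (list_sum_smul_quotSMulTop hκ) hreg.2 (m := Submodule.Quotient.mk m)
      (σ := fun S => Submodule.Quotient.mk (ρ S)) (by
        rw [kw_mk, ← hρ]
        refine (wedgeList_map (Submodule.mkQ (x.1 • (⊤ : Submodule A M))) L m).trans ?_
        funext S
        refine (Submodule.Quotient.eq _).2 ?_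
        refine (Submodule.mem_smul_pointwise_iff_exists _ _ _).2 ⟨σ S, trivial, ?_⟩
        simp)
    rw [List.map_cons, Ideal.ofList_cons, Submodule.sup_smul, Submodule.ideal_span_singleton_smul]
    have h2 : (ofList (L.map Prod.fst) • (⊤ : Submodule A (QuotSMulTop x.1 M))) =
        (ofList (L.map Prod.fst) • (⊤ : Submodule A M)).map
          (Submodule.mkQ (x.1 • (⊤ : Submodule A M))) := by
      rw [Submodule.map_smul'', Submodule.map_top, Submodule.range_mkQ]
    rw [h2] at this
    obtain ⟨m', hm', h3⟩ := this
    have h4 := (Submodule.Quotient.eq _).1 h3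
    have : m = -(m' - m) + m' := by abel
    rw [this]
    exact Submodule.add_mem_sup (neg_mem h4) hm'

end Koszul

/-! ### Weak regularity where the Jacobian determinant is invertible -/

section Jacobian

open MvPolynomial RingTheory.Sequence

variable {k : Type*} [CommRing k]

theorem isWeaklyRegular_X {κ : Type*} (L : List κ) (hL : L.Nodup) :
    IsWeaklyRegular (MvPolynomial κ k) (L.map (X : κ → MvPolynomial κ k)) := by
  rw [isWeaklyRegular_iff]
  intro i hi
  rw [List.length_map] at hi
  rw [List.getElem_map, ← List.map_take, isSMulRegular_iff_right_eq_zero_of_smul]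
  intro a
  obtain ⟨q, rfl⟩ := mk_surjective _ a
  rw [← mk_smul, mk_eq_zero, mk_eq_zero]
  have hI : (ofList ((L.take i).map (X : κ → MvPolynomial κ k)) •
      (⊤ : Submodule (MvPolynomial κ k) (MvPolynomial κ k))) =
      span (X '' {x | x ∈ L.take i}) := by
    rw [smul_eq_mul, Ideal.mul_top, ofList]
    congr 1
    ext z
    exact List.mem_map
  rw [hI, mem_ideal_span_X_image, mem_ideal_span_X_image]
  intro h m hm
  obtain ⟨j, hj, hmj⟩ := h (m + single L[i] 1) (by
    rw [smul_eq_mul, mem_support_iff, add_comm, coeff_X_mul]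
    exact mem_support_iff.1 hm)
  refine ⟨j, hj, ?_⟩
  have hne : j ≠ L[i] := by
    rintro rfl
    rw [Set.mem_ofPred_eq, List.mem_take_iff_getElem] at hj
    obtain ⟨a, ha, hja⟩ := hj
    have := (List.Nodup.getElem_inj_iff hL).1 hja
    omega
  simpa [single_apply, hne.symm] using hmj

theorem isWeaklyRegular_of_jacobian {κ ι : Type*} [Fintype κ] [DecidableEq κ] [Finite ι]
    (g : κ → MvPolynomial ι k) (e : κ ≃ ι) (L : List κ) (hL : L.Nodup) :
    IsWeaklyRegular (Away (of fun i j => pderiv (e i) (g j)).det) (L.map g) := by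
  set m := (of fun i j => pderiv (e i) (g j)).det with hm
  let alg : Algebra (MvPolynomial κ k) (MvPolynomial ι k) := (aeval g).toAlgebra
  have halg : ∀ z, algebraMap (MvPolynomial κ k) (MvPolynomial ι k) z = aeval g z := fun _ => rfl
  have : IsScalarTower (MvPolynomial κ k) (MvPolynomial ι k) (Away m) :=
    inferInstance
  let φ : MvPolynomial ι (MvPolynomial κ k) →ₐ[MvPolynomial κ k] MvPolynomial ι k := aeval X
  let sec : MvPolynomial ι k →+* MvPolynomial ι (MvPolynomial κ k) := map C
  have hsec : ∀ p, φ (sec p) = p := by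
    intro p
    have : (φ : MvPolynomial ι (MvPolynomial κ k) →+* MvPolynomial ι k).comp sec =
        RingHom.id _ := by
      ext i
      · simp [φ, sec, halg]
      · simp [φ, sec]
    exact congrArg (fun h : MvPolynomial ι k →+* MvPolynomial ι k => h p) this
  let rel : κ → MvPolynomial ι (MvPolynomial κ k) := fun j => sec (g j) - C (X j)
  have hrel : ∀ j, φ (rel j) = 0 := by
    intro j
    simp only [rel, map_sub, hsec]
    simp [φ, halg]
  have hker : span (range rel) = RingHom.ker φ := by
    apply le_antisymm
    · rw [Ideal.span_le]
      rintro _ ⟨j, rfl⟩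
      exact hrel j
    · intro p hp
      have h1 : (Ideal.Quotient.mk (span (range rel))).comp
          (sec.comp (φ : MvPolynomial ι (MvPolynomial κ k) →+* MvPolynomial ι k)) =
          Ideal.Quotient.mk (span (range rel)) := by
        ext i
        · simp [φ, sec, halg]
        · have : Ideal.Quotient.mk (span (range rel)) (rel i) = 0 :=
            Ideal.Quotient.eq_zero_iff_mem.2 (subset_span ⟨i, rfl⟩)
          simp only [rel, map_sub, sub_eq_zero] at this
          simpa [φ, halg] using this
        · simp [φ, sec]
      have h2 := congrArg (fun h : MvPolynomial ι (MvPolynomial κ k) →+* _ => h p) h1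
      simp only [RingHom.comp_apply] at h2
      rw [← Ideal.Quotient.eq_zero_iff_mem, ← h2]
      rw [show (φ : MvPolynomial ι (MvPolynomial κ k) →+* MvPolynomial ι k) p = 0 from hp]
      simp
  let gens : Algebra.Generators (MvPolynomial κ k) (MvPolynomial ι k) ι :=
    Algebra.Generators.ofSurjective X fun p => ⟨sec p, hsec p⟩
  let pres : Algebra.Presentation (MvPolynomial κ k) (MvPolynomial ι k) ι κ :=
    { gens with
      relation := rel
      span_range_relation_eq_ker := by
        rw [hker]; exact (Algebra.Generators.ker_eq_ker_aeval_val gens).symm }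
  let P : Algebra.PreSubmersivePresentation (MvPolynomial κ k) (MvPolynomial ι k) ι κ :=
    { pres with
      map := e
      map_inj := e.injective }
  have hjac : P.jacobian = m := by
    rw [Algebra.PreSubmersivePresentation.jacobian_eq_jacobiMatrix_det, hm]
    change φ _ = _
    rw [AlgHom.map_det]
    congr 1
    refine Matrix.ext fun i j => ?_
    rw [AlgHom.mapMatrix_apply, Matrix.map_apply,
      Algebra.PreSubmersivePresentation.jacobiMatrix_apply, Matrix.of_apply]
    change φ (pderiv (e i) (rel j)) = _
    simp only [rel, map_sub, pderiv_C, sub_zero]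
    change φ (pderiv (e i) (map C (g j))) = _
    rw [pderiv_map]
    exact hsec _
  let Q := Algebra.PreSubmersivePresentation.localizationAway (Away m) m
  let PQ : Algebra.SubmersivePresentation (MvPolynomial κ k) (Away m)
      (Unit ⊕ ι) (Unit ⊕ κ) :=
    { Q.comp P with
      jacobian_isUnit := by
        change IsUnit (Q.comp P).jacobian
        rw [Algebra.PreSubmersivePresentation.comp_jacobian_eq_jacobian_smul_jacobian, hjac,
          Algebra.PreSubmersivePresentation.localizationAway_jacobian, Algebra.smul_def]
        have := IsLocalization.Away.algebraMap_isUnit (S := Away m) m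
        exact this.mul this }
  have := PQ.isStandardSmooth
  have hflat : Module.Flat (MvPolynomial κ k) (Away m) := inferInstance
  have h := (isWeaklyRegular_X (k := k) L hL).of_flat (S := Away m)
  have h2 : (L.map X).map (algebraMap (MvPolynomial κ k) (Away m)) =
      (L.map g).map (algebraMap (MvPolynomial ι k) (Away m)) := by
    rw [List.map_map, List.map_map]
    apply List.map_congr_left
    intro j _
    simp only [Function.comp_apply]
    rw [IsScalarTower.algebraMap_apply (MvPolynomial κ k) (MvPolynomial ι k), halg, aeval_X]
  rwa [h2, isWeaklyRegular_map_algebraMap_iff] at h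

theorem isWeaklyRegular_of_minor {ι τ : Type*} [Fintype ι] [DecidableEq ι] {r : ℕ}
    (f : Fin r → MvPolynomial ι k) (s : Fin r → ι) (hs : Injective s) (y : τ → ι)
    (hy : Injective y) (hsy : ∀ a b, y a ≠ s b) (L : List (Fin r ⊕ τ)) (hL : L.Nodup) :
    IsWeaklyRegular (Away (of fun i j => pderiv (s i) (f j)).det)
      (L.map (Sum.elim f fun b => X (y b))) := by
  let e : Fin r ⊕ {v // v ∉ range s} ≃ ι :=
    (Equiv.sumCongr (Equiv.ofInjective s hs) (Equiv.refl _)).trans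
      (Equiv.sumCompl (· ∈ range s))
  let g : Fin r ⊕ {v // v ∉ range s} → MvPolynomial ι k := Sum.elim f fun v => X v.1
  have hdet : (of fun i j => pderiv (e i) (g j)).det =
      (of fun i j => pderiv (s i) (f j)).det := by
    have : (of fun i j => pderiv (e i) (g j)) =
        Matrix.fromBlocks (of fun i j => pderiv (s i) (f j)) 0
          (of fun (i : {v // v ∉ range s}) j => pderiv i.1 (f j)) 1 := by
      ext i j : 2
      rcases i with i | i <;> rcases j with j | j
      · rfl
      · have : j.1 ≠ s i := fun h => j.2 ⟨i, h.symm⟩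
        simp [e, g, pderiv_X, this]
      · rfl
      · by_cases h : i = j
        · subst h; simp [e, g]
        · have : j.1 ≠ i.1 := fun h' => h (Subtype.ext h'.symm)
          simp [e, g, pderiv_X, this, h]
    rw [this, Matrix.det_fromBlocks_zero₁₂, Matrix.det_one, mul_one]
  let ψ : Fin r ⊕ τ → Fin r ⊕ {v // v ∉ range s} :=
    Sum.map id fun b => ⟨y b, fun ⟨a, ha⟩ => hsy b a ha.symm⟩
  have hψ : Injective ψ :=
    Injective.sumMap Function.injective_id fun a b h => hy (congrArg Subtype.val h)
  have := isWeaklyRegular_of_jacobian g e (L.map ψ) (hL.map hψ)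
  rw [hdet, List.map_map] at this
  convert this using 2
  funext x
  rcases x with x | x <;> rfl

end Jacobian

/-! ### Local cohomology classes -/

section Local

open MvPolynomial RingTheory.Sequence

variable {ι R : Type*} [LinearOrder ι] [Fintype ι] [CommRing R]

omit [LinearOrder ι] in
theorem exists_pow_smul_eq_algebraMap (m : R) (σ : Finset ι → Away m) :
    ∃ (N : ℕ) (τ : Finset ι → R), ∀ S, algebraMap R _ (τ S) = m ^ N • σ S := by
  obtain ⟨⟨_, N, rfl⟩, hb⟩ := IsLocalization.exist_integer_multiples_of_finite
    (Submonoid.powers m) σ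
  choose τ hτ using hb
  exact ⟨N, τ, hτ⟩

omit [LinearOrder ι] in
theorem exists_pow_smul_eq_of_algebraMap_eq (m : R) (ω η : Finset ι → R)
    (h : ∀ S, algebraMap R (Away m) (ω S) = algebraMap R _ (η S)) :
    ∃ N : ℕ, m ^ N • ω = m ^ N • η := by
  have : ∀ S, ∃ N : ℕ, m ^ N * ω S = m ^ N * η S := fun S => by
    obtain ⟨⟨_, N, rfl⟩, hc⟩ := (IsLocalization.eq_iff_exists (Submonoid.powers m)
      (Away m)).1 (h S)
    exact ⟨N, hc⟩
  choose N hN using this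
  refine ⟨∑ S, N S, funext fun S => ?_⟩
  obtain ⟨c, hc⟩ := Nat.exists_eq_add_of_le (single_le_sum (f := N)
    (fun _ _ => Nat.zero_le _) (mem_univ S))
  simp only [Pi.smul_apply, smul_eq_mul]
  rw [hc, pow_add, mul_comm (m ^ N S), mul_assoc, hN, mul_assoc]

theorem kw_algebraMap (m : R) (e : ι → R) (ω : Finset ι → R) :
    kw e (fun S => algebraMap R (Away m) (ω S)) = fun S => algebraMap R (Away m) (kw e ω S) :=
  kw_map (Algebra.linearMap R (Away m)) e ω

theorem wedgeList_algebraMap (m : R) (L : List (R × (ι → R))) (b : R) :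
    wedgeList L (algebraMap R (Away m) b) = fun S => algebraMap R (Away m) (wedgeList L b S) :=
  wedgeList_map (Algebra.linearMap R (Away m)) L b

theorem kw_comp_algebraMap (B : Type*) [CommRing B] [Algebra R B] (e : ι → R)
    (ω : Finset ι → B) : kw (fun i => algebraMap R B (e i)) ω = kw e ω := by
  funext S
  simp [kw_apply, Algebra.smul_def]

theorem wedgeList_comp_algebraMap (B : Type*) [CommRing B] [Algebra R B]
    (L : List (R × (ι → R))) (b : B) :
    wedgeList (L.map fun x => (algebraMap R B x.1, fun i => algebraMap R B (x.2 i))) b =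
      wedgeList L b := by
  induction L with
  | nil => rfl
  | cons x L ih => rw [List.map_cons, wedgeList, wedgeList, ih, kw_comp_algebraMap]

theorem exists_pow_smul_eq_kw {e : ι → R} {rs : List R} {m : R}
    (hmem : ∀ a ∈ rs, algebraMap R (Away m) a ∈ span (range fun i => algebraMap R (Away m) (e i)))
    (hreg : IsWeaklyRegular (Away m) rs) {k : ℤ} (hk : k < rs.length)
    {ω : Finset ι → R} (hω : IsDeg k ω) (hcl : kw e ω = 0) :
    ∃ (N : ℕ) (σ : Finset ι → R), m ^ N • ω = kw e σ := by
  obtain ⟨σ, hσ⟩ := exists_kw_eq_of_isWeaklyRegular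
    (fun i => algebraMap R (Away m) (e i)) (rs.map (algebraMap R _))
    (by simpa using hmem)
    ((isWeaklyRegular_map_algebraMap_iff (Away m) (Away m) rs).2 hreg)
    (by simpa using hk)
    (ω := fun S => algebraMap R (Away m) (ω S))
    (fun S hS => by simp [hω S hS])
    (by rw [kw_comp_algebraMap, kw_algebraMap, hcl]; funext S; simp)
  rw [kw_comp_algebraMap] at hσ
  obtain ⟨N, τ, hτ⟩ := exists_pow_smul_eq_algebraMap m σ
  obtain ⟨N', h⟩ := exists_pow_smul_eq_of_algebraMap_eq m (m ^ N • ω) (kw e τ) (fun S => by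
    have h1 := congrFun (kw_algebraMap m e τ) S
    rw [← h1, funext hτ, show (fun S => m ^ N • σ S) = m ^ N • σ from rfl, map_smul, ← hσ]
    simp [Algebra.smul_def])
  exact ⟨N' + N, m ^ N' • τ, by rw [pow_add, mul_smul, h, map_smul]⟩

theorem exists_pow_smul_eq_wedgeList_add {κ : ι → R} {L : List (R × (ι → R))} {m : R}
    (hmem : ∀ x ∈ L, algebraMap R (Away m) x.1 ∈ span (range fun i => algebraMap R (Away m) (κ i)))
    (hκ : ∀ i, κ i = (L.map fun x => x.1 * x.2 i).sum)
    (hreg : IsWeaklyRegular (Away m) (L.map Prod.fst))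
    {ω : Finset ι → R} (hω : IsDeg L.length ω) (hcl : kw κ ω = 0) :
    ∃ (N : ℕ) (b : R) (σ : Finset ι → R), m ^ N • ω = wedgeList L b + kw κ σ := by
  obtain ⟨c, σ, hσ⟩ := exists_eq_wedgeList_add
    (fun i => algebraMap R (Away m) (κ i))
    (L.map fun x => (algebraMap R (Away m) x.1,
      fun i => algebraMap R (Away m) (x.2 i)))
    (by
      simp only [List.mem_map]
      rintro _ ⟨x, hx, rfl⟩
      exact hmem x hx)
    (fun i _ => by
      rw [hκ, map_list_sum, List.map_map, List.map_map]; simp [comp_def])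
    (by
      have := (isWeaklyRegular_map_algebraMap_iff (Away m) (Away m)
        (L.map Prod.fst)).2 hreg
      simpa [comp_def] using this)
    (ω := fun S => algebraMap R (Away m) (ω S))
    (fun S hS => by
      have := hω S (by simpa using hS)
      simp [this])
    (by rw [kw_comp_algebraMap, kw_algebraMap, hcl]; funext S; simp)
  rw [kw_comp_algebraMap, wedgeList_comp_algebraMap] at hσ
  obtain ⟨N, τ, hτ⟩ := exists_pow_smul_eq_algebraMap m σ
  obtain ⟨⟨b, _, N₁, rfl⟩, hb⟩ := IsLocalization.surj (Submonoid.powers m) c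
  replace hb : algebraMap R _ b = m ^ N₁ • c := by
    rw [Algebra.smul_def, mul_comm]; exact hb.symm
  obtain ⟨N', h⟩ := exists_pow_smul_eq_of_algebraMap_eq m (m ^ (N + N₁) • ω)
    (wedgeList L (m ^ N * b) + kw κ (m ^ N₁ • τ)) (fun S => by
      have h1 := congrFun (kw_algebraMap m κ (m ^ N₁ • τ)) S
      have h2 := congrFun (wedgeList_algebraMap m L (m ^ N * b)) S
      have h3 : (fun S => algebraMap R (Away m) ((m ^ N₁ • τ) S)) =
          m ^ (N + N₁) • σ := by
        funext S
        simp only [Pi.smul_apply, smul_eq_mul, map_mul, hτ]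
        rw [pow_add, mul_comm, mul_smul, Algebra.smul_def, Algebra.smul_def, Algebra.smul_def]
        ring
      have h4 : algebraMap R (Away m) (m ^ N * b) = m ^ (N + N₁) • c := by
        rw [map_mul, hb, pow_add, mul_smul, Algebra.smul_def (m ^ N)]
      rw [Pi.add_apply, map_add, ← h1, ← h2, h3, h4, wedgeList_smul, map_smul]
      have h5 := congrFun hσ S
      simp only [Pi.smul_apply, smul_eq_mul, map_mul]
      rw [h5, ← smul_add, Pi.add_apply, Algebra.smul_def])
  refine ⟨N' + (N + N₁), m ^ N' * (m ^ N * b), m ^ N' • m ^ N₁ • τ, ?_⟩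
  rw [pow_add, mul_smul, h, smul_add, map_smul, map_smul, map_smul, ← smul_eq_mul (m ^ N'),
    wedgeList_smul]

theorem exists_pow_mul_mem_ofList {κ : ι → R} {L : List (R × (ι → R))} {m : R}
    (hmem : ∀ x ∈ L, algebraMap R (Away m) x.1 ∈ span (range fun i => algebraMap R (Away m) (κ i)))
    (hκ : ∀ i, κ i = (L.map fun x => x.1 * x.2 i).sum)
    (hreg : IsWeaklyRegular (Away m) (L.map Prod.fst))
    {b : R} {σ : Finset ι → R} (h : wedgeList L b = kw κ σ) :
    ∃ N : ℕ, m ^ N * b ∈ ofList (L.map Prod.fst) := by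
  have h1 := mem_ofList_of_wedgeList_eq (fun i => algebraMap R (Away m) (κ i))
    (L.map fun x => (algebraMap R (Away m) x.1,
      fun i => algebraMap R (Away m) (x.2 i)))
    (by
      simp only [List.mem_map]
      rintro _ ⟨x, hx, rfl⟩
      exact hmem x hx)
    (fun i _ => by
      rw [hκ, map_list_sum, List.map_map, List.map_map]; simp [comp_def])
    (by
      have := (isWeaklyRegular_map_algebraMap_iff (Away m) (Away m)
        (L.map Prod.fst)).2 hreg
      simpa [comp_def] using this)
    (m := algebraMap R (Away m) b)
    (σ := fun S => algebraMap R (Away m) (σ S))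
    (by rw [kw_comp_algebraMap, wedgeList_comp_algebraMap, kw_algebraMap, wedgeList_algebraMap, h])
  have h2 : algebraMap R (Away m) b ∈
      (ofList (L.map Prod.fst)).map (algebraMap R (Away m)) := by
    rw [smul_eq_mul, Ideal.mul_top] at h1
    rw [Ideal.map_ofList]
    simpa [comp_def] using h1
  rw [IsLocalization.algebraMap_mem_map_algebraMap_iff (Submonoid.powers m)] at h2
  obtain ⟨_, ⟨N, rfl⟩, h3⟩ := h2
  exact ⟨N, h3⟩

theorem exists_pow_smul_mem {M : Type*} [AddCommGroup M] [Module R M] (P : Submodule R M) (ω : M)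
    {α : Type*} {I : Ideal R} {g : α → R} {x : R}
    (hx : x ∈ (I ⊔ span (range g)).radical) (hI : ∀ a ∈ I, a • ω ∈ P)
    (hg : ∀ s, ∃ N : ℕ, g s ^ N • ω ∈ P) : ∃ N : ℕ, x ^ N • ω ∈ P := by
  let J : Ideal R := P.comap (LinearMap.toSpanSingleton R M ω)
  have : (I ⊔ span (range g)).radical ≤ J.radical := by
    rw [Ideal.radical_le_radical_iff, sup_le_iff, Ideal.span_le]
    refine ⟨fun a ha => Ideal.le_radical (hI a ha), ?_⟩
    rintro _ ⟨s, rfl⟩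
    exact hg s
  exact this hx

end Local

/-! ### Laurent polynomials -/

section Laurent

/-- Laurent polynomials in the variables indexed by `ι`. -/
abbrev Laurent (ι k : Type*) [CommRing k] : Type _ := AddMonoidAlgebra k (ι → ℤ)

/-- Differential forms in the `dz_j`, `j ∈ κ`, with Laurent polynomials as coefficients. -/
abbrev LaurentForm (κ ι k : Type*) [CommRing k] : Type _ := Finset κ → Laurent ι k

variable {ι k : Type*} [CommRing k]

/-- Only the variables in `T` occur with negative exponents. -/
abbrev PolesIn (T : Finset ι) (b : Laurent ι k) : Prop :=
  ∀ u, b.coeff u ≠ 0 → ∀ i, u i < 0 → i ∈ T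

/-- Natural exponents as integral exponents. -/
def expHom (ι : Type*) : (ι →₀ ℕ) →+ (ι → ℤ) where
  toFun m i := m i
  map_zero' := by ext; simp
  map_add' m m' := by ext; simp

theorem expHom_injective : Injective (expHom ι) := fun m m' h => by
  ext i
  have := congrFun h i
  simpa [expHom] using this

/-- The inclusion of polynomials into Laurent polynomials. -/
def toLaurent : MvPolynomial ι k →+* Laurent ι k := AddMonoidAlgebra.mapDomainRingHom k (expHom ι)

theorem toLaurent_eq (p : MvPolynomial ι k) :
    toLaurent p = AddMonoidAlgebra.mapDomain (expHom ι) p := rfl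

theorem toLaurent_injective : Injective (toLaurent : MvPolynomial ι k → Laurent ι k) :=
  AddMonoidAlgebra.mapDomain_injective expHom_injective

theorem exists_of_coeff_toLaurent_ne_zero {p : MvPolynomial ι k} {u : ι → ℤ}
    (h : (toLaurent p).coeff u ≠ 0) : ∃ m, p.coeff m ≠ 0 ∧ u = expHom ι m := by
  classical
  have h1 : u ∈ (Finsupp.mapDomain (expHom ι) (AddMonoidAlgebra.coeff p)).support :=
    Finsupp.mem_support_iff.2 h
  obtain ⟨m, hm, rfl⟩ := Finset.mem_image.1 (Finsupp.mapDomain_support h1)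
  exact ⟨m, Finsupp.mem_support_iff.1 hm, rfl⟩

theorem exists_toLaurent_eq [Finite ι] {f : Laurent ι k} (h : ∀ u, f.coeff u ≠ 0 → ∀ i, 0 ≤ u i) :
    ∃ p : MvPolynomial ι k, toLaurent p = f := by
  refine ⟨AddMonoidAlgebra.comapDomain (expHom ι) expHom_injective f,
    AddMonoidAlgebra.mapDomain_comapDomain (fun u hu => ?_) _⟩
  have hu' := h u (Finsupp.mem_support_iff.1 hu)
  exact ⟨Finsupp.equivFunOnFinite.symm fun i => (u i).toNat, by
    ext i; simp [expHom, hu' i]⟩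

/-- The Laurent polynomial `z^u`. -/
def lmon (u : ι → ℤ) : Laurent ι k := AddMonoidAlgebra.single u 1

theorem lmon_mul (u v : ι → ℤ) : (lmon u : Laurent ι k) * lmon v = lmon (u + v) := by
  simp [lmon, AddMonoidAlgebra.single_mul_single]

theorem lmon_zero : (lmon 0 : Laurent ι k) = 1 := rfl

theorem coeff_lmon_mul (u v : ι → ℤ) (f : Laurent ι k) :
    (lmon u * f).coeff v = f.coeff (-u + v) := by
  simp [lmon, AddMonoidAlgebra.coeff_single_mul_apply]

theorem toLaurent_monomial (m : ι →₀ ℕ) :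
    toLaurent (MvPolynomial.monomial m (1 : k)) = lmon (expHom ι m) :=
  AddMonoidAlgebra.mapDomain_single

/-- The part of a Laurent polynomial with exponents in a given set. -/
def lfilter (P : (ι → ℤ) → Prop) : Laurent ι k →+ Laurent ι k where
  toFun f := by classical exact AddMonoidAlgebra.ofCoeff (f.coeff.filter P)
  map_zero' := by simp [Finsupp.filter_zero]
  map_add' f g := by simp [Finsupp.filter_add]

theorem coeff_lfilter (P : (ι → ℤ) → Prop) [DecidablePred P] (f : Laurent ι k) (u : ι → ℤ) :
    (lfilter P f).coeff u = if P u then f.coeff u else 0 := by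
  simp only [lfilter, AddMonoidHom.coe_mk, ZeroHom.coe_mk, AddMonoidAlgebra.coeff_ofCoeff,
    Finsupp.filter_apply]
  congr

theorem lfilter_eq_self {P : (ι → ℤ) → Prop} {f : Laurent ι k}
    (h : ∀ u, f.coeff u ≠ 0 → P u) : lfilter P f = f := by
  classical
  ext u
  rw [coeff_lfilter]
  split_ifs with hu
  · rfl
  · by_contra h'; exact hu (h u (Ne.symm h'))

theorem lfilter_eq_zero {P : (ι → ℤ) → Prop} {f : Laurent ι k}
    (h : ∀ u, f.coeff u ≠ 0 → ¬P u) : lfilter P f = 0 := by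
  classical
  ext u
  rw [coeff_lfilter]
  split_ifs with hu
  · by_contra h'; exact h u h' hu
  · rfl

theorem exists_add_of_coeff_mul_ne_zero {f g : Laurent ι k} {u : ι → ℤ}
    (h : (f * g).coeff u ≠ 0) : ∃ v w, f.coeff v ≠ 0 ∧ g.coeff w ≠ 0 ∧ u = v + w := by
  classical
  obtain ⟨v, hv, w, hw, rfl⟩ := Finset.mem_add.1
    (AddMonoidAlgebra.support_coeff_mul_subset f g (Finsupp.mem_support_iff.2 h))
  exact ⟨v, w, Finsupp.mem_support_iff.1 hv, Finsupp.mem_support_iff.1 hw, rfl⟩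

theorem lfilter_mul {P Q : (ι → ℤ) → Prop} {g : Laurent ι k}
    (h : ∀ v, g.coeff v ≠ 0 → ∀ u, (Q (v + u) ↔ P u)) (f : Laurent ι k) :
    lfilter Q (g * f) = g * lfilter P f := by
  classical
  induction f using AddMonoidAlgebra.induction_linear with
  | zero => simp
  | add f f' hf hf' => rw [mul_add, map_add, map_add, hf, hf', mul_add]
  | single u c =>
    by_cases hu : P u
    · rw [lfilter_eq_self, lfilter_eq_self]
      · intro v hv
        rw [AddMonoidAlgebra.coeff_single, single_apply_ne_zero] at hv
        rw [hv.1]; exact hu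
      · intro v hv
        obtain ⟨w, x, hw, hx, rfl⟩ := exists_add_of_coeff_mul_ne_zero hv
        rw [AddMonoidAlgebra.coeff_single, single_apply_ne_zero] at hx
        rw [h w hw, hx.1]; exact hu
    · rw [lfilter_eq_zero, lfilter_eq_zero, mul_zero]
      · intro v hv
        rw [AddMonoidAlgebra.coeff_single, single_apply_ne_zero] at hv
        rw [hv.1]; exact hu
      · intro v hv
        obtain ⟨w, x, hw, hx, rfl⟩ := exists_add_of_coeff_mul_ne_zero hv
        rw [AddMonoidAlgebra.coeff_single, single_apply_ne_zero] at hx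
        rw [h w hw, hx.1]; exact hu

end Laurent

section RingHom

variable {ι : Type*} [LinearOrder ι] [Fintype ι] {A B : Type*} [CommRing A] [CommRing B]

theorem kw_ringHom (φ : A →+* B) (e : ι → A) (ω : Finset ι → A) :
    kw (fun i => φ (e i)) (fun S => φ (ω S)) = fun S => φ (kw e ω S) := by
  funext S
  simp [kw_apply, map_sum]

theorem wedgeList_ringHom (φ : A →+* B) (L : List (A × (ι → A))) (b : A) :
    wedgeList (L.map fun x => (φ x.1, fun i => φ (x.2 i))) (φ b) = fun S => φ (wedgeList L b S) := by
  induction L with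
  | nil =>
    funext S
    by_cases h : S = ∅
    · subst h; simp [wedgeList]
    · simp [wedgeList, h]
  | cons x L ih => simp only [List.map_cons, wedgeList]; rw [ih, kw_ringHom]

end RingHom

/-! ### Graded Laurent forms -/

section GradedForms

variable {ι κ k G : Type*} [CommRing k] [LinearOrder κ] [Fintype κ] [AddCommGroup G]
variable (deg : (ι → ℤ) →+ G) (wK : κ → G)

/-- Laurent forms of weight `a` with denominators involving only the variables in `T`. -/
def IsLForm (T : Finset ι) (a : G) (ω : LaurentForm κ ι k) : Prop :=
  ∀ J u, (ω J).coeff u ≠ 0 → (∀ i, u i < 0 → i ∈ T) ∧ deg u + ∑ j ∈ J, wK j = a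

/-- `1`-forms with polynomial coefficients of weight `b`. -/
def IsHomogOne (b : G) (e : κ → Laurent ι k) : Prop :=
  ∀ j u, (e j).coeff u ≠ 0 → (∀ i, 0 ≤ u i) ∧ deg u + wK j = b

/-- The part of weight `a` of a Laurent form. -/
def weightPart (a : G) (ω : LaurentForm κ ι k) : LaurentForm κ ι k :=
  fun J => lfilter (fun u => deg u + ∑ j ∈ J, wK j = a) (ω J)

variable {deg wK}

section
omit [LinearOrder κ] [Fintype κ]

theorem IsLForm.weightPart_eq {T : Finset ι} {a : G} {ω : LaurentForm κ ι k}
    (h : IsLForm deg wK T a ω) : weightPart deg wK a ω = ω :=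
  funext fun J => lfilter_eq_self fun u hu => (h J u hu).2

theorem isLForm_weightPart {T : Finset ι} (a : G) {ω : LaurentForm κ ι k}
    (h : ∀ J, PolesIn T (ω J)) : IsLForm deg wK T a (weightPart deg wK a ω) := by
  classical
  intro J u hu
  rw [weightPart, coeff_lfilter] at hu
  split_ifs at hu with h'
  · exact ⟨h J u hu, h'⟩
  · exact absurd rfl hu

theorem isDeg_weightPart {i : ℤ} (a : G) {ω : LaurentForm κ ι k} (h : IsDeg i ω) :
    IsDeg i (weightPart deg wK a ω) := fun S hS => by simp [weightPart, h S hS]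

end

theorem weightPart_kw {b : G} {e : κ → Laurent ι k} (he : IsHomogOne deg wK b e) (a : G)
    (ω : LaurentForm κ ι k) :
    weightPart deg wK (a + b) (kw e ω) = kw e (weightPart deg wK a ω) := by
  funext J
  simp only [weightPart, kw_apply, map_sum, map_zsmul, smul_eq_mul]
  refine sum_congr rfl fun j hj => ?_
  congr 1
  refine lfilter_mul (fun v hv u => ?_) _
  rw [← (he j v hv).2, ← Finset.add_sum_erase J wK hj, map_add,
    show deg v + deg u + (wK j + ∑ x ∈ J.erase j, wK x) =
      (deg u + ∑ x ∈ J.erase j, wK x) + (deg v + wK j) by abel, add_left_inj]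

section
omit [LinearOrder κ] [Fintype κ]

theorem IsLForm.add {T : Finset ι} {a : G} {ω η : LaurentForm κ ι k}
    (h : IsLForm deg wK T a ω) (h' : IsLForm deg wK T a η) : IsLForm deg wK T a (ω + η) := by
  intro J u hu
  by_cases h0 : (ω J).coeff u = 0
  · exact h' J u (by simpa [h0] using hu)
  · exact h J u h0

theorem IsLForm.zero {T : Finset ι} {a : G} :
    IsLForm deg wK T a (0 : LaurentForm κ ι k) := fun J u hu => absurd rfl hu

theorem IsLForm.zsmul {T : Finset ι} {a : G} {ω : LaurentForm κ ι k}
    (h : IsLForm deg wK T a ω) (c : ℤ) : IsLForm deg wK T a (c • ω) := fun J u hu =>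
  h J u fun h0 => hu (by
    rw [Pi.smul_apply, AddMonoidAlgebra.coeff_smul_apply, h0, smul_zero])

theorem IsLForm.sub {T : Finset ι} {a : G} {ω η : LaurentForm κ ι k}
    (h : IsLForm deg wK T a ω) (h' : IsLForm deg wK T a η) : IsLForm deg wK T a (ω - η) := by
  have := h.add (h'.zsmul (-1))
  simpa [sub_eq_add_neg] using this

theorem IsLForm.sum {α : Type*} {s : Finset α} {T : Finset ι} {a : G}
    {ω : α → LaurentForm κ ι k} (h : ∀ x ∈ s, IsLForm deg wK T a (ω x)) :
    IsLForm deg wK T a (∑ x ∈ s, ω x) := by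
  classical
  induction s using Finset.induction_on with
  | empty => simpa using IsLForm.zero
  | insert x s hx ih =>
    rw [sum_insert hx]
    exact (h x (by simp)).add (ih fun y hy => h y (by simp [hy]))

theorem IsLForm.mono {T T' : Finset ι} (hT : T ⊆ T') {a : G} {ω : LaurentForm κ ι k}
    (h : IsLForm deg wK T a ω) : IsLForm deg wK T' a ω := fun J u hu =>
  ⟨fun i hi => hT ((h J u hu).1 i hi), (h J u hu).2⟩

end

theorem neg_mem_kw {T : Finset ι} {e : κ → Laurent ι k}
    (he : ∀ j u, (e j).coeff u ≠ 0 → ∀ i, 0 ≤ u i) {ω : LaurentForm κ ι k}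
    (h : ∀ J, PolesIn T (ω J)) : ∀ J, PolesIn T (kw e ω J) := by
  intro J u hu i hi
  rw [kw_apply] at hu
  simp only [AddMonoidAlgebra.coeff_sum, Finsupp.finsetSum_apply] at hu
  obtain ⟨j, hj, hju⟩ := exists_ne_zero_of_sum_ne_zero hu
  have : (e j * ω (J.erase j)).coeff u ≠ 0 := fun h0 => hju (by
    rw [AddMonoidAlgebra.coeff_smul_apply, smul_eq_mul, h0, smul_zero])
  obtain ⟨v, w, hv, hw, rfl⟩ := exists_add_of_coeff_mul_ne_zero this
  refine h _ w hw i ?_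
  have := he j v hv i
  simp only [Pi.add_apply] at hi; omega

theorem IsLForm.kw {b : G} {e : κ → Laurent ι k} (he : IsHomogOne deg wK b e) {T : Finset ι}
    {a : G} {ω : LaurentForm κ ι k} (h : IsLForm deg wK T a ω) :
    IsLForm deg wK T (a + b) (kw e ω) := by
  rw [← h.weightPart_eq, ← weightPart_kw he]
  exact isLForm_weightPart _ (neg_mem_kw (fun j u hu => (he j u hu).1) fun J u hu => (h J u hu).1)

theorem exists_lmon_smul_eq_toLaurent [Fintype ι] [DecidableEq ι] {α : Type*} {T : Finset ι}
    {t : Finset α} {ω : α → Laurent ι k} (h : ∀ J ∈ t, PolesIn T (ω J)) :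
    ∃ (N : ℕ) (p : α → MvPolynomial ι k),
      ∀ J ∈ t, lmon (fun i => if i ∈ T then (N : ℤ) else 0) * ω J = toLaurent (p J) := by
  classical
  have h1 : ∀ J, ∃ N : ℕ, ∀ u, (ω J).coeff u ≠ 0 → ∀ i, -(N : ℤ) ≤ u i := by
    intro J
    refine ⟨∑ u ∈ (ω J).coeff.support, ∑ i, (-(u i)).toNat, fun u hu i => ?_⟩
    have a1 := single_le_sum (f := fun i => (-(u i)).toNat) (fun _ _ => Nat.zero_le _)
      (mem_univ i)
    have a2 := single_le_sum (f := fun u : ι → ℤ => ∑ i, (-(u i)).toNat)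
      (fun _ _ => Nat.zero_le _) (Finsupp.mem_support_iff.2 hu)
    have a3 := a1.trans a2
    omega
  choose N hN using h1
  have h2 : ∀ J, ∃ p : MvPolynomial ι k, J ∈ t →
      lmon (fun i => if i ∈ T then ((∑ J ∈ t, N J : ℕ) : ℤ) else 0) * ω J = toLaurent p := by
    intro J
    by_cases hJ : J ∈ t
    · obtain ⟨p, hp⟩ := exists_toLaurent_eq
        (f := lmon (fun i => if i ∈ T then ((∑ J ∈ t, N J : ℕ) : ℤ) else 0) * ω J) (by
          intro u hu i
          rw [coeff_lmon_mul] at hu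
          have a1 := single_le_sum (f := N) (fun _ _ => Nat.zero_le _) hJ
          have a2 := hN J _ hu i
          have a3 := h J hJ _ hu i
          simp only [Pi.add_apply, Pi.neg_apply] at a2 a3
          by_cases hi : i ∈ T
          · simp only [hi, if_true] at a2; omega
          · simp only [hi, if_false] at a2 a3
            by_contra hneg
            exact a3 (by omega))
      exact ⟨p, fun _ => hp.symm⟩
    · exact ⟨0, fun h => absurd h hJ⟩
  choose p hp using h2
  exact ⟨_, p, fun J hJ => hp J hJ⟩

end GradedForms

/-! ### The Čech double complex -/

section Cech

variable {ι κ k G : Type*} [CommRing k] [LinearOrder ι] [Fintype ι] [LinearOrder κ] [Fintype κ]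
  [AddCommGroup G]

/-- The Čech differential for the variables in `X`. -/
def cechD (X : Finset ι) {M : Type*} [AddCommGroup M] (c : Finset ι → M) : Finset ι → M :=
  kw (A := ℤ) (fun t => if t ∈ X then 1 else 0) c

theorem cechD_sub (X : Finset ι) {M : Type*} [AddCommGroup M] (c c' : Finset ι → M) :
    cechD X (c - c') = cechD X c - cechD X c' := map_sub _ _ _

theorem cechD_zero (X : Finset ι) {M : Type*} [AddCommGroup M] :
    cechD X (0 : Finset ι → M) = 0 := map_zero _

theorem cechD_sum (X : Finset ι) {M : Type*} [AddCommGroup M] {α : Type*} (s : Finset α)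
    (c : α → Finset ι → M) : cechD X (∑ t ∈ s, c t) = ∑ t ∈ s, cechD X (c t) := map_sum _ _ _

theorem cechD_cechD (X : Finset ι) {M : Type*} [AddCommGroup M] (c : Finset ι → M) :
    cechD X (cechD X c) = 0 := kw_self _ _

theorem cechD_map (X : Finset ι) {M N : Type*} [AddCommGroup M] [AddCommGroup N] (φ : M →+ N)
    (c : Finset ι → M) : cechD X (fun T => φ (c T)) = fun T => φ (cechD X c T) :=
  kw_map φ.toIntLinearMap _ c

theorem cechD_apply (X : Finset ι) {M : Type*} [AddCommGroup M] (c : Finset ι → M)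
    (T : Finset ι) : cechD X c T = ∑ t ∈ T, if t ∈ X then ksign t T • c (T.erase t) else 0 := by
  rw [cechD, kw_apply]
  refine sum_congr rfl fun t _ => ?_
  split_ifs <;> simp

theorem cechD_contr {X : Finset ι} {M : Type*} [AddCommGroup M] {t : ι} (ht : t ∈ X)
    (c : Finset ι → M) : cechD X (contr ℤ t c) + contr ℤ t (cechD X c) = c := by
  have := kw_kc (fun t => if t ∈ X then (1 : ℤ) else 0) (Pi.single t 1) c
  have h1 : ∀ c : Finset ι → M, kc (Pi.single t (1 : ℤ)) c = contr ℤ t c := fun c => by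
    rw [kc_eq, sum_eq_single t] <;> simp +contextual
  rw [h1, h1] at this
  rw [cechD, cechD, this, sum_eq_single t] <;> simp +contextual [ht]

variable (deg : (ι → ℤ) →+ G) (wK : κ → G) (X : Finset ι) (a : G)

/-- Čech cochains of Čech degree `s` with values in Laurent forms of degree `i` and weight `a`. -/
def IsCochain (s i : ℤ) (c : Finset ι → LaurentForm κ ι k) : Prop :=
  ∀ T, (c T ≠ 0 → T ⊆ X ∧ (T.card : ℤ) = s) ∧ IsDeg i (c T) ∧ IsLForm deg wK T a (c T)

variable {deg wK X a}

omit [LinearOrder ι] [Fintype ι] [LinearOrder κ] [Fintype κ] in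
theorem IsCochain.sub {s i : ℤ} {c c' : Finset ι → LaurentForm κ ι k}
    (h : IsCochain deg wK X a s i c) (h' : IsCochain deg wK X a s i c') :
    IsCochain deg wK X a s i (c - c') := fun T => by
  refine ⟨fun hT => ?_, (h T).2.1.sub (h' T).2.1, (h T).2.2.sub (h' T).2.2⟩
  by_cases h0 : c T = 0
  · exact (h' T).1 fun h1 => hT (by simp [h0, h1])
  · exact (h T).1 h0

theorem IsCochain.cechD {s i : ℤ} {c : Finset ι → LaurentForm κ ι k}
    (h : IsCochain deg wK X a s i c) : IsCochain deg wK X a (s + 1) i (cechD X c) := fun T => by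
  rw [cechD_apply]
  refine ⟨fun hT => ?_, IsDeg.sum fun t _ => ?_, IsLForm.sum fun t _ => ?_⟩
  · obtain ⟨t, htT, ht⟩ := exists_ne_zero_of_sum_ne_zero hT
    split_ifs at ht with htX
    · have h0 : c (T.erase t) ≠ 0 := fun h0 => ht (by simp [h0])
      obtain ⟨h1, h2⟩ := (h _).1 h0
      refine ⟨fun x hx => ?_, ?_⟩
      · by_cases hxt : x = t
        · rw [hxt]; exact htX
        · exact h1 (mem_erase.2 ⟨hxt, hx⟩)
      · rw [Finset.card_erase_of_mem htT, Nat.cast_sub (Finset.card_pos.2 ⟨t, htT⟩)] at h2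
        push_cast at h2; omega
    · exact absurd rfl ht
  · split_ifs
    · exact (h _).2.1.smul ℤ _
    · exact fun _ _ => rfl
  · split_ifs
    · exact ((h _).2.2.mono (Finset.erase_subset _ _)).zsmul _
    · exact IsLForm.zero

omit [LinearOrder ι] [Fintype ι] in
theorem IsCochain.kw {e : κ → Laurent ι k} (he : IsHomogOne deg wK 0 e) {s i : ℤ}
    {c : Finset ι → LaurentForm κ ι k} (h : IsCochain deg wK X a s i c) :
    IsCochain deg wK X a s (i + 1) (fun T => kw e (c T)) := fun T => by
  refine ⟨fun hT => (h T).1 fun h0 => hT (by simp [h0]), (h T).2.1.kw e, ?_⟩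
  have := (h T).2.2.kw he
  rwa [add_zero] at this

theorem cechD_kw (e : κ → Laurent ι k) (c : Finset ι → LaurentForm κ ι k) :
    cechD X (fun T => kw e (c T)) = fun T => kw e (cechD X c T) :=
  cechD_map X (LinearMap.toAddMonoidHom (kw e)) c

theorem exists_cechD_eq {N s i : ℤ} (hsi : s + i ≤ N)
    (hrow : ∀ (u : ι → ℤ) (J : Finset κ), deg u + ∑ j ∈ J, wK j = a → (∀ i ∉ X, 0 ≤ u i) →
      (∀ t ∈ X, u t < 0) → N < X.card + J.card)
    {c : Finset ι → LaurentForm κ ι k} (h : IsCochain deg wK X a s i c)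
    (hc : cechD X c = 0) : ∃ b, IsCochain deg wK X a (s - 1) i b ∧ c = cechD X b := by
  classical
  let tt : (ι → ℤ) → ι → Prop := fun u t =>
    if h : ∃ t ∈ X, 0 ≤ u t then h.choose = t else False
  let P : ι → (LaurentForm κ ι k) →+ (LaurentForm κ ι k) := fun t =>
    { toFun := fun ω J => lfilter (fun u => tt u t) (ω J)
      map_zero' := by funext J; simp
      map_add' := fun ω η => by funext J; simp }
  have hgood : ∀ T J u, (c T J).coeff u ≠ 0 → ∃ t ∈ X, 0 ≤ u t := by
    intro T J u hu
    by_contra! hneg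
    have hT0 : c T ≠ 0 := fun h0 => hu (by rw [h0]; rfl)
    obtain ⟨hTX, hTs⟩ := (h T).1 hT0
    obtain ⟨h1, h2⟩ := (h T).2.2 J u hu
    have hJ : (J.card : ℤ) = i := by
      by_contra h'
      exact hu (by rw [(h T).2.1 J h']; rfl)
    have := hrow u J h2 (fun i hi => by
      by_contra hlt
      exact hi (hTX (h1 i (by omega)))) hneg
    have hXT : X ⊆ T := fun t ht => h1 t (hneg t ht)
    rw [Finset.Subset.antisymm hTX hXT] at hTs
    omega
  have htt : ∀ u t, tt u t → t ∈ X ∧ 0 ≤ u t := by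
    intro u t hut
    simp only [tt] at hut
    split_ifs at hut with h'
    rw [← hut]; exact h'.choose_spec
  have hsum : ∀ T, ∑ t ∈ X, P t (c T) = c T := by
    intro T
    funext J
    ext u
    simp only [Finset.sum_apply, AddMonoidAlgebra.coeff_sum, Finsupp.finsetSum_apply]
    by_cases hu : (c T J).coeff u = 0
    · rw [hu]
      refine sum_eq_zero fun t _ => ?_
      change (lfilter _ _).coeff u = 0
      rw [coeff_lfilter]; simp [hu]
    · have hex := hgood T J u hu
      rw [sum_eq_single hex.choose]
      · change (lfilter _ _).coeff u = _
        rw [coeff_lfilter, if_pos]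
        simp [tt, hex]
      · intro t _ hne
        change (lfilter _ _).coeff u = 0
        rw [coeff_lfilter, if_neg]
        simp only [tt, hex, dif_pos]
        exact hne.symm
      · intro hn
        exact absurd hex.choose_spec.1 hn
  refine ⟨∑ t ∈ X, contr ℤ t (fun T => P t (c T)), ?_, ?_⟩
  · intro T
    simp only [Finset.sum_apply]
    refine ⟨fun hT => ?_, IsDeg.sum fun t _ => ?_, IsLForm.sum fun t htX => ?_⟩
    · obtain ⟨t, htX, ht⟩ := exists_ne_zero_of_sum_ne_zero hT
      rw [contr_apply] at ht
      split_ifs at ht with htT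
      · exact absurd rfl ht
      · have h0 : c (insert t T) ≠ 0 := fun h0 => ht (by simp [h0])
        obtain ⟨h1, h2⟩ := (h _).1 h0
        refine ⟨(Finset.subset_insert _ _).trans h1, ?_⟩
        rw [Finset.card_insert_of_notMem htT] at h2
        push_cast at h2; omega
    · rw [contr_apply]
      split_ifs
      · exact fun _ _ => rfl
      · refine IsDeg.smul ℤ (fun S hS => ?_) _
        change lfilter _ _ = _
        rw [(h _).2.1 S hS, map_zero]
    · rw [contr_apply]
      split_ifs with htT
      · exact IsLForm.zero
      · refine IsLForm.zsmul (fun J u hu => ?_) _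
        change (lfilter _ _).coeff u ≠ 0 at hu
        rw [coeff_lfilter] at hu
        split_ifs at hu with htu
        · obtain ⟨h1, h2⟩ := (h _).2.2 J u hu
          refine ⟨fun i hi => ?_, h2⟩
          rcases mem_insert.1 (h1 i hi) with rfl | h3
          · have := (htt u i htu).2; omega
          · exact h3
        · exact absurd rfl hu
  · rw [cechD_sum]
    have : ∀ t ∈ X, cechD X (contr ℤ t fun T => P t (c T)) = fun T => P t (c T) := by
      intro t ht
      have h1 := cechD_contr ht (fun T => P t (c T))
      have h2 : cechD X (fun T => P t (c T)) = 0 := by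
        rw [cechD_map, hc]; funext T; exact map_zero _
      rwa [h2, map_zero, add_zero] at h1
    rw [sum_congr rfl this]
    funext T
    rw [Finset.sum_apply, hsum]

theorem exists_cechD_add_kw {N D : ℤ} {e : κ → Laurent ι k} (he : IsHomogOne deg wK 0 e)
    (hrow : ∀ (u : ι → ℤ) (J : Finset κ), deg u + ∑ j ∈ J, wK j = a → (∀ i ∉ X, 0 ≤ u i) →
      (∀ t ∈ X, u t < 0) → N < X.card + J.card)
    (hcol : ∀ T : Finset ι, T.Nonempty → T ⊆ X → ∀ i < D, ∀ ω : LaurentForm κ ι k,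
      IsDeg i ω → IsLForm deg wK T a ω → kw e ω = 0 →
      ∃ σ, IsDeg (i - 1) σ ∧ IsLForm deg wK T a σ ∧ ω = kw e σ) (n : ℕ) :
    ∀ s : ℤ, 1 ≤ s → s + (n - 1) ≤ N → n - 1 < D → ∀ y : Finset ι → LaurentForm κ ι k,
      IsCochain deg wK X a s (n - 1) y → (fun T => kw e (cechD X y T)) = 0 →
      ∃ z w, IsCochain deg wK X a (s - 1) (n - 1) z ∧ IsCochain deg wK X a s (n - 2) w ∧
        y = cechD X z + fun T => kw e (w T) := by
  induction n with
  | zero =>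
    intro s _ _ _ y hy _
    have h0 : ∀ (s i : ℤ), IsCochain deg wK X a s i
        (0 : Finset ι → LaurentForm κ ι k) := fun s i T =>
      ⟨fun h => absurd rfl h, fun _ _ => rfl, IsLForm.zero⟩
    refine ⟨0, 0, h0 _ _, h0 _ _, ?_⟩
    funext T
    rw [(hy T).2.1.eq_zero_of_neg (by simp), cechD_zero]
    simp
  | succ n ih =>
    intro s hs hsN hD y hy hdy
    have h1 : ∀ T, ∃ σ, IsDeg ((n + 1 : ℕ) - 1 - 1 : ℤ) σ ∧ IsLForm deg wK T a σ ∧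
        cechD X y T = kw e σ ∧ (σ ≠ 0 → T ⊆ X ∧ (T.card : ℤ) = s + 1) := by
      intro T
      by_cases hT : cechD X y T = 0
      · exact ⟨0, fun _ _ => rfl, IsLForm.zero, by simp [hT], fun h => absurd rfl h⟩
      · obtain ⟨h1, h2⟩ := (hy.cechD T).1 hT
        obtain ⟨σ, a1, a2, a3⟩ := hcol T
          (by rw [← Finset.card_pos]; omega) h1 _ hD _ (hy.cechD T).2.1 (hy.cechD T).2.2
          (congrFun hdy T)
        exact ⟨σ, a1, a2, a3, fun _ => ⟨h1, h2⟩⟩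
    choose y' hy1 hy2 hy3 hy4 using h1
    have hy' : IsCochain deg wK X a (s + 1) (n - 1) y' := fun T =>
      ⟨hy4 T, by have := hy1 T; push_cast at this; simpa using this, hy2 T⟩
    have hδ : cechD X y = fun T => kw e (y' T) := funext hy3
    obtain ⟨z', w', hz', hw', hzw⟩ := ih (s + 1) (by omega) (by push_cast at hsN; omega)
      (by push_cast at hD; omega) y' hy' (by
        rw [← cechD_kw, ← hδ, cechD_cechD])
    rw [show s + 1 - 1 = s by ring] at hz'
    have hyz : cechD X (y - fun T => kw e (z' T)) = 0 := by
      rw [cechD_sub, hδ, cechD_kw, hzw]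
      funext T
      simp [kw_self]
    have hn : ((n + 1 : ℕ) : ℤ) - 1 = n - 1 + 1 := by push_cast; ring
    have hcoch : IsCochain deg wK X a s (n - 1 + 1) (y - fun T => kw e (z' T)) := by
      refine IsCochain.sub ?_ (hz'.kw he)
      rwa [hn] at hy
    obtain ⟨b, hb, hyb⟩ := exists_cechD_eq (by push_cast at hsN; omega) hrow hcoch hyz
    refine ⟨b, z', by rw [hn]; exact hb, ?_, ?_⟩
    · rw [show ((n + 1 : ℕ) : ℤ) - 2 = n - 1 by push_cast; ring]; exact hz'
    · rw [← hyb]; simp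

end Cech

section LaurentForms

variable {ι κ k G : Type*} [CommRing k] [LinearOrder κ] [Fintype κ] [AddCommGroup G]
  {deg : (ι → ℤ) →+ G} {wK : κ → G}

theorem exists_lmon_mul_toLaurent [Fintype ι] {α : Type*} [Fintype α] {T : Finset ι}
    {ω : α → Laurent ι k} (h : ∀ x, PolesIn T (ω x)) :
    ∃ v : ι → ℤ, (∀ i ∉ T, v i = 0) ∧ ∃ p : α → MvPolynomial ι k,
      ∀ x, ω x = lmon v * toLaurent (p x) := by
  classical
  obtain ⟨N, p, hp⟩ := exists_lmon_smul_eq_toLaurent (t := univ) fun x _ => h x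
  refine ⟨-fun i => if i ∈ T then (N : ℤ) else 0, fun i hi => by simp [hi], p, fun x => ?_⟩
  rw [← hp x (mem_univ _), ← mul_assoc, lmon_mul, neg_add_cancel, lmon_zero, one_mul]

theorem neg_mem_lmon_mul_toLaurent {T : Finset ι} {v : ι → ℤ} (hv : ∀ i ∉ T, v i = 0)
    (p : MvPolynomial ι k) {u : ι → ℤ} (hu : (lmon v * toLaurent p).coeff u ≠ 0) (i : ι)
    (hi : u i < 0) : i ∈ T := by
  rw [coeff_lmon_mul] at hu
  obtain ⟨m, -, hm⟩ := exists_of_coeff_toLaurent_ne_zero hu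
  by_contra hT
  have := congrFun hm i
  simp only [Pi.add_apply, Pi.neg_apply, hv i hT, expHom, AddMonoidHom.coe_mk,
    ZeroHom.coe_mk] at this
  omega

theorem toLaurent_X_pow [DecidableEq ι] (t : ι) (N : ℕ) :
    (toLaurent (MvPolynomial.X t ^ N) : Laurent ι k) = lmon (Pi.single t (N : ℤ)) := by
  rw [MvPolynomial.X_pow_eq_monomial, toLaurent_monomial]
  congr 1
  funext i
  by_cases h : i = t
  · subst h; simp [expHom]
  · simp [expHom, h]

theorem kw_mul_left {A : Type*} [CommRing A] (c : A) (e : κ → A) (ω : Finset κ → A) :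
    kw e (fun J => c * ω J) = fun J => c * kw e ω J :=
  kw_map (LinearMap.lsmul A A c) e ω

theorem exists_isLForm_kw {e : κ → Laurent ι k} (he : IsHomogOne deg wK 0 e) {T : Finset ι} {i : ℤ}
    {a : G} {ω σ : LaurentForm κ ι k} (hω : IsDeg i ω) (hω' : IsLForm deg wK T a ω)
    (hσ : ∀ J, PolesIn T (σ J)) (h : ω = kw e σ) :
    ∃ σ', IsDeg (i - 1) σ' ∧ IsLForm deg wK T a σ' ∧ ω = kw e σ' := by
  refine ⟨weightPart deg wK a (degPart (i - 1) σ), isDeg_weightPart a (isDeg_degPart _ _),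
    isLForm_weightPart a fun J u hu => hσ J u fun h0 => hu ?_, ?_⟩
  · rw [degPart]; split_ifs
    · exact h0
    · rfl
  · rw [← weightPart_kw he, add_zero, ← degPart_kw, ← h, sub_add_cancel, hω.degPart_eq,
      hω'.weightPart_eq]

theorem exists_lmon_mul_eq_kw {e : κ → MvPolynomial ι k} {T : Finset ι} {t : ι} (ht : t ∈ T)
    {v : ι → ℤ} (hv : ∀ i ∉ T, v i = 0) {N : ℕ} {p σ : Finset κ → MvPolynomial ι k}
    (h : (MvPolynomial.X t : MvPolynomial ι k) ^ N • p = kw e σ) :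
    ∃ σ' : LaurentForm κ ι k, (∀ J, PolesIn T (σ' J)) ∧
      (fun J => lmon v * toLaurent (p J)) = kw (fun j => toLaurent (e j)) σ' := by
  classical
  set w : ι → ℤ := v - Pi.single t (N : ℤ) with hw
  have hw0 : ∀ i ∉ T, w i = 0 := fun i hi => by
    have : i ≠ t := by rintro rfl; exact hi ht
    simp [hw, hv i hi, this]
  refine ⟨fun J => lmon w * toLaurent (σ J), fun J u hu i hi =>
    neg_mem_lmon_mul_toLaurent hw0 (σ J) hu i hi, ?_⟩
  rw [kw_mul_left, kw_ringHom, ← h]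
  funext J
  change _ = lmon w * toLaurent (MvPolynomial.X t ^ N * p J)
  rw [map_mul, toLaurent_X_pow, ← mul_assoc, lmon_mul, hw, sub_add_cancel]

theorem exists_kw_eq_laurent [Fintype ι] {e : κ → MvPolynomial ι k}
    (he : IsHomogOne deg wK 0 fun j => toLaurent (e j)) {T : Finset ι} {t : ι} (ht : t ∈ T) {i : ℤ}
    (hloc : ∀ p : Finset κ → MvPolynomial ι k, IsDeg i p → kw e p = 0 →
      ∃ (N : ℕ) (σ : Finset κ → MvPolynomial ι k),
        (MvPolynomial.X t : MvPolynomial ι k) ^ N • p = kw e σ)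
    {a : G} {ω : LaurentForm κ ι k} (hω : IsDeg i ω) (hω' : IsLForm deg wK T a ω)
    (hcl : kw (fun j => toLaurent (e j)) ω = 0) :
    ∃ σ, IsDeg (i - 1) σ ∧ IsLForm deg wK T a σ ∧ ω = kw (fun j => toLaurent (e j)) σ := by
  obtain ⟨v, hv, p, hp⟩ := exists_lmon_mul_toLaurent fun J u hu => (hω' J u hu).1
  have hp' : ∀ J, toLaurent (p J) = lmon (-v) * ω J := fun J => by
    rw [hp, ← mul_assoc, lmon_mul, neg_add_cancel, lmon_zero, one_mul]
  obtain ⟨N, σ, hσ⟩ := hloc p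
    (fun S hS => toLaurent_injective (by rw [hp', hω S hS, mul_zero, map_zero]))
    (by
      funext S
      apply toLaurent_injective
      have h1 := congrFun (kw_ringHom toLaurent e p) S
      rw [← h1, funext hp', kw_mul_left, hcl]
      simp)
  obtain ⟨σ', h1, h2⟩ := exists_lmon_mul_eq_kw ht hv hσ
  exact exists_isLForm_kw he hω hω' h1 ((funext hp).trans h2)

end LaurentForms

section Cech

variable {ι κ k G : Type*} [CommRing k] [LinearOrder ι] [Fintype ι] [LinearOrder κ] [Fintype κ]
  [AddCommGroup G] {deg : (ι → ℤ) →+ G} {wK : κ → G} {X : Finset ι} {a : G}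

theorem cechD_singleton {M : Type*} [AddCommGroup M] (c : Finset ι → M) {t : ι} (ht : t ∈ X) :
    cechD X c {t} = c ∅ := by
  simp [cechD_apply, ht, ksign, Finset.filter_singleton]

theorem cechD_pair {M : Type*} [AddCommGroup M] (c : Finset ι → M) {t t' : ι} (ht : t ∈ X)
    (ht' : t' ∈ X) (h : t < t') : cechD X c {t, t'} = c {t'} - c {t} := by
  rw [cechD_apply, Finset.sum_pair h.ne, if_pos ht, if_pos ht']
  have h1 : ({t, t'} : Finset ι).erase t = {t'} := by
    ext x; simp only [mem_erase, mem_insert, mem_singleton]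
    constructor
    · tauto
    · rintro rfl; exact ⟨h.ne', Or.inr rfl⟩
  have h2 : ({t, t'} : Finset ι).erase t' = {t} := by
    ext x; simp only [mem_erase, mem_insert, mem_singleton]
    constructor
    · tauto
    · rintro rfl; exact ⟨h.ne, Or.inl rfl⟩
  have h3 : ({t, t'} : Finset ι).filter (· < t) = ∅ := by
    ext x; simp only [Finset.mem_filter, mem_insert, mem_singleton]
    constructor
    · rintro ⟨rfl | rfl, h'⟩
      · exact absurd h' (lt_irrefl _)
      · exact absurd h' h.not_gt
    · simp
  have h4 : ({t, t'} : Finset ι).filter (· < t') = {t} := by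
    ext x; simp only [Finset.mem_filter, mem_insert, mem_singleton]
    constructor
    · rintro ⟨rfl | rfl, h'⟩
      · rfl
      · exact absurd h' (lt_irrefl _)
    · rintro rfl; exact ⟨Or.inl rfl, h⟩
  rw [h1, h2, ksign, ksign, h3, h4]
  simp [sub_eq_add_neg]

/-- The cochain of Čech degree one with the given components. -/
def singletonCochain (X : Finset ι) {M : Type*} [AddCommGroup M] (c : ι → M) : Finset ι → M :=
  fun T => if h : ∃ t ∈ X, T = {t} then c h.choose else 0

theorem singletonCochain_apply {M : Type*} [AddCommGroup M] (c : ι → M) {t : ι} (ht : t ∈ X) :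
    singletonCochain X c {t} = c t := by
  have h : ∃ s ∈ X, ({t} : Finset ι) = {s} := ⟨t, ht, rfl⟩
  rw [singletonCochain, dif_pos h]
  congr 1
  exact (Finset.singleton_injective h.choose_spec.2).symm

theorem isCochain_singletonCochain {i : ℤ} {c : ι → LaurentForm κ ι k}
    (h : ∀ t ∈ X, IsDeg i (c t) ∧ IsLForm deg wK {t} a (c t)) :
    IsCochain deg wK X a 1 i (singletonCochain X c) := by
  intro T
  by_cases hT : ∃ t ∈ X, T = {t}
  · obtain ⟨t, ht, rfl⟩ := hT
    rw [singletonCochain_apply c ht]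
    exact ⟨fun _ => ⟨by simpa using ht, by simp⟩, h t ht⟩
  · rw [singletonCochain, dif_neg hT]
    exact ⟨fun h => absurd rfl h, fun _ _ => rfl, IsLForm.zero⟩

theorem exists_kw_eq_of_locally {N D : ℤ} {e : κ → Laurent ι k} (he : IsHomogOne deg wK 0 e)
    (hrow : ∀ (u : ι → ℤ) (J : Finset κ), deg u + ∑ j ∈ J, wK j = a → (∀ i ∉ X, 0 ≤ u i) →
      (∀ t ∈ X, u t < 0) → N < X.card + J.card)
    (hcol : ∀ T : Finset ι, T.Nonempty → T ⊆ X → ∀ i < D, ∀ ω : LaurentForm κ ι k,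
      IsDeg i ω → IsLForm deg wK T a ω → kw e ω = 0 →
      ∃ σ, IsDeg (i - 1) σ ∧ IsLForm deg wK T a σ ∧ ω = kw e σ) (hX : X.Nonempty)
    {i : ℤ} (hiN : i ≤ N) (hiD : i - 1 < D) {x : LaurentForm κ ι k} (hx : IsDeg i x)
    (hloc : ∀ t ∈ X, ∃ y, IsDeg (i - 1) y ∧ IsLForm deg wK {t} a y ∧ x = kw e y) :
    ∃ z, IsDeg (i - 1) z ∧ IsLForm deg wK ∅ a z ∧ x = kw e z := by
  classical
  rcases lt_or_ge i 0 with hi | hi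
  · exact ⟨0, fun _ _ => rfl, IsLForm.zero, by rw [hx.eq_zero_of_neg hi, map_zero]⟩
  obtain ⟨n, rfl⟩ := Int.eq_ofNat_of_zero_le hi
  have : ∀ t, ∃ y, t ∈ X → IsDeg (n - 1 : ℤ) y ∧ IsLForm deg wK {t} a y ∧ x = kw e y := fun t => by
    by_cases ht : t ∈ X
    · obtain ⟨y, hy⟩ := hloc t ht
      exact ⟨y, fun _ => hy⟩
    · exact ⟨0, fun h => absurd h ht⟩
  choose y0 hy0 using this
  have hy : IsCochain deg wK X a 1 (n - 1) (singletonCochain X y0) :=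
    isCochain_singletonCochain fun t ht => ⟨(hy0 t ht).1, (hy0 t ht).2.1⟩
  set y := singletonCochain X y0 with hydef
  let c : Finset ι → LaurentForm κ ι k := Pi.single ∅ x
  have hc : cechD X c = fun T => kw e (y T) := by
    funext T
    by_cases hT : ∃ t ∈ X, T = {t}
    · obtain ⟨t, ht, rfl⟩ := hT
      rw [cechD_singleton c ht, hydef, singletonCochain_apply y0 ht, ← (hy0 t ht).2.2]
      simp [c]
    · rw [hydef, singletonCochain, dif_neg hT, map_zero, cechD_apply]
      refine sum_eq_zero fun t ht => ?_
      split_ifs with htX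
      · have : T.erase t ≠ ∅ := by
          intro h0
          rw [Finset.erase_eq_empty_iff] at h0
          rcases h0 with rfl | rfl
          · simp at ht
          · exact hT ⟨t, htX, rfl⟩
        simp [c, this]
      · rfl
  obtain ⟨z, w, hz, hw, hzw⟩ := exists_cechD_add_kw he hrow hcol n 1 le_rfl (by omega) hiD y hy (by
    rw [← cechD_kw, ← hc, cechD_cechD])
  have h0 : cechD X (c - fun T => kw e (z T)) = 0 := by
    rw [cechD_sub, hc, cechD_kw, hzw]
    funext T
    simp [kw_self]
  obtain ⟨t, ht⟩ := hX
  refine ⟨z ∅, (hz ∅).2.1, (hz ∅).2.2, ?_⟩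
  have h1 := congrFun h0 {t}
  rw [cechD_singleton _ ht] at h1
  simpa [c, sub_eq_zero] using h1

theorem exists_glue {N D : ℤ} {e : κ → Laurent ι k} (he : IsHomogOne deg wK 0 e)
    (hrow : ∀ (u : ι → ℤ) (J : Finset κ), deg u + ∑ j ∈ J, wK j = a → (∀ i ∉ X, 0 ≤ u i) →
      (∀ t ∈ X, u t < 0) → N < X.card + J.card)
    (hcol : ∀ T : Finset ι, T.Nonempty → T ⊆ X → ∀ i < D, ∀ ω : LaurentForm κ ι k,
      IsDeg i ω → IsLForm deg wK T a ω → kw e ω = 0 →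
      ∃ σ, IsDeg (i - 1) σ ∧ IsLForm deg wK T a σ ∧ ω = kw e σ)
    {n : ℕ} (hiN : n + 1 ≤ N) (hiD : n - 1 < D) {c : ι → LaurentForm κ ι k}
    (hc : ∀ t ∈ X, IsDeg (n : ℤ) (c t) ∧ IsLForm deg wK {t} a (c t))
    (hglue : ∀ t ∈ X, ∀ t' ∈ X, t < t' → ∃ y, IsDeg (n - 1 : ℤ) y ∧ IsLForm deg wK {t, t'} a y ∧
      c t' - c t = kw e y) :
    ∃ b, IsDeg (n : ℤ) b ∧ IsLForm deg wK ∅ a b ∧ ∀ t ∈ X, ∃ z, IsDeg (n - 1 : ℤ) z ∧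
      IsLForm deg wK {t} a z ∧ c t = b + kw e z := by
  classical
  have hC := isCochain_singletonCochain hc
  set C := singletonCochain X c with hCdef
  have h1 : ∀ T, ∃ y, IsDeg (n - 1 : ℤ) y ∧ IsLForm deg wK T a y ∧ cechD X C T = kw e y ∧
      (y ≠ 0 → T ⊆ X ∧ (T.card : ℤ) = 2) := by
    intro T
    by_cases hT : cechD X C T = 0
    · exact ⟨0, fun _ _ => rfl, IsLForm.zero, by simp [hT], fun h => absurd rfl h⟩
    · obtain ⟨h1, h2⟩ := (hC.cechD T).1 hT
      have h3 : T.card = 2 := by omega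
      obtain ⟨t, t', htt, rfl⟩ : ∃ t t', t < t' ∧ T = {t, t'} := by
        obtain ⟨t, t', hne, rfl⟩ := Finset.card_eq_two.1 h3
        rcases lt_or_gt_of_ne hne with h | h
        · exact ⟨t, t', h, rfl⟩
        · exact ⟨t', t, h, Finset.pair_comm _ _⟩
      have ht : t ∈ X := h1 (by simp)
      have ht' : t' ∈ X := h1 (by simp)
      obtain ⟨y, a1, a2, a3⟩ := hglue t ht t' ht' htt
      exact ⟨y, a1, a2, by rw [cechD_pair _ ht ht' htt, hCdef, singletonCochain_apply c ht,
        singletonCochain_apply c ht', a3], fun _ => ⟨h1, by omega⟩⟩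
  choose y hy1 hy2 hy3 hy4 using h1
  have hy : IsCochain deg wK X a 2 (n - 1) y := fun T => ⟨hy4 T, hy1 T, hy2 T⟩
  have hδ : cechD X C = fun T => kw e (y T) := funext hy3
  obtain ⟨z, w, hz, hw, hzw⟩ := exists_cechD_add_kw he hrow hcol n 2 (by norm_num) (by omega)
    hiD y hy (by rw [← cechD_kw, ← hδ, cechD_cechD])
  have h0 : cechD X (C - fun T => kw e (z T)) = 0 := by
    rw [cechD_sub, hδ, cechD_kw, hzw]
    funext T
    simp [kw_self]
  have hz' : IsCochain deg wK X a 1 (n - 1) z := hz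
  have hC' : IsCochain deg wK X a 1 n (C - fun T => kw e (z T)) := by
    have := hz'.kw he
    rw [sub_add_cancel] at this
    exact hC.sub this
  obtain ⟨b, hb, hCb⟩ := exists_cechD_eq (by omega) hrow hC' h0
  refine ⟨b ∅, (hb ∅).2.1, (hb ∅).2.2, fun t ht => ⟨z {t}, (hz' _).2.1, (hz' _).2.2, ?_⟩⟩
  have h2 := congrFun hCb {t}
  rw [cechD_singleton _ ht, Pi.sub_apply, hCdef, singletonCochain_apply c ht] at h2
  rw [← h2, sub_add_cancel]

end Cech

/-! ### The graded Koszul complex of a smooth complete intersection -/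

section CompleteIntersection

open MvPolynomial

theorem dworkVar_cases {n r : ℕ} {P : DworkVar n r → Prop} (hx : ∀ i, P (inlₗ i))
    (hy : ∀ j, P (inrₗ j)) (v : DworkVar n r) : P v := by
  induction v using Lex.rec with
  | h v => rcases v with i | j; exacts [hx i, hy j]

theorem sum_dworkVar {n r : ℕ} {M : Type*} [AddCommMonoid M] (g : DworkVar n r → M) :
    ∑ v, g v = ∑ i, g (inlₗ i) + ∑ j, g (inrₗ j) := by
  rw [← Equiv.sum_comp toLex, Fintype.sum_sum_type]

theorem inlₗ_ne_inrₗ {n r : ℕ} (i : Fin (n + 1)) (j : Fin r) :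
    (inlₗ i : DworkVar n r) ≠ inrₗ j := by
  intro h
  have := toLex.injective h
  simp at this

theorem inlₗ_injective {n r : ℕ} : Injective (inlₗ : Fin (n + 1) → DworkVar n r) :=
  toLex.injective.comp Sum.inl_injective

theorem inrₗ_injective {n r : ℕ} : Injective (inrₗ : Fin r → DworkVar n r) :=
  toLex.injective.comp Sum.inr_injective

variable {k : Type*} [CommRing k] {n r : ℕ}

/-- The weights of the variables. -/
def dworkWt (d : Fin r → ℕ) (v : DworkVar n r) : ℤ :=
  Sum.elim (fun _ => 1) (fun j => -(d j : ℤ)) (ofLex v)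

variable (f : Fin r → MvPolynomial (Fin (n + 1)) k) (d : Fin r → ℕ)

/-- The polynomials `f_j` in the ring of polynomials in all variables. -/
def liftPoly (j : Fin r) : DworkPoly n r k := rename inlₗ (f j)

/-- The polynomial `∑ y_j f_j`. -/
def potential : DworkPoly n r k := ∑ j, X (inrₗ j) * liftPoly f j

/-- The coefficients of the differential of `∑ y_j f_j`. -/
def dPotential (v : DworkVar n r) : DworkPoly n r k := pderiv v (potential f)

/-- The regular sequence `y_1, f_1, y_2, …` with the forms `df_1, dy_1, df_2, …`. -/
def ciList : List (DworkPoly n r k × (DworkVar n r → DworkPoly n r k)) :=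
  (finRange r).flatMap fun j => [(X (inrₗ j), fun v => pderiv v (liftPoly f j)),
    (liftPoly f j, Pi.single (inrₗ j) 1)]

variable {f d}

/-- The ideal generated by the `f_j` and the `y_j`. -/
abbrev ciIdeal (f : Fin r → MvPolynomial (Fin (n + 1)) k) : Ideal (DworkPoly n r k) :=
  span (range (liftPoly f)) ⊔ span (range fun j : Fin r => (X (inrₗ j) : DworkPoly n r k))

theorem pderiv_inrₗ_liftPoly (j j' : Fin r) :
    pderiv (inrₗ j' : DworkVar n r) (liftPoly f j) = 0 := by
  apply pderiv_eq_zero_of_notMem_vars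
  intro h
  obtain ⟨i, -, hi⟩ := Finset.mem_image.1 (vars_rename _ _ h)
  exact inlₗ_ne_inrₗ i j' hi

theorem dPotential_inrₗ (j : Fin r) : dPotential f (inrₗ j) = liftPoly f j := by
  simp only [dPotential, potential, map_sum, leibniz, pderiv_inrₗ_liftPoly,
    smul_eq_mul, pderiv_X]
  rw [sum_eq_single j]
  · simp
  · intro j' _ hne
    rw [Pi.single_eq_of_ne (fun h => hne (inrₗ_injective h))]
    simp
  · simp

theorem dPotential_inlₗ (i : Fin (n + 1)) :
    dPotential f (inlₗ i) = ∑ j, X (inrₗ j) * pderiv (inlₗ i) (liftPoly f j) := by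
  simp only [dPotential, potential, map_sum, leibniz, smul_eq_mul, pderiv_X]
  refine sum_congr rfl fun j _ => ?_
  rw [Pi.single_eq_of_ne (inlₗ_ne_inrₗ i j).symm, mul_zero, add_zero]

theorem list_sum_finRange {M : Type*} [AddCommMonoid M] (g : Fin r → M) :
    ((finRange r).map g).sum = ∑ j, g j := by
  rw [← List.ofFn_eq_map, List.sum_ofFn]

theorem dPotential_eq_sum (v : DworkVar n r) :
    dPotential f v = ((ciList f).map fun x => x.1 * x.2 v).sum := by
  have : ((ciList f).map fun x => x.1 * x.2 v).sum =
      ∑ j, (X (inrₗ j) * pderiv v (liftPoly f j) +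
        liftPoly f j * (Pi.single (inrₗ j) 1 : _ → DworkPoly n r k) v) := by
    rw [← list_sum_finRange, ciList]
    induction finRange r with
    | nil => simp
    | cons j l ih => simp only [List.flatMap_cons, List.map_append, List.sum_append, ih]; simp
  rw [this, dPotential, potential, map_sum]
  refine sum_congr rfl fun j _ => ?_
  rw [leibniz, pderiv_X, smul_eq_mul, smul_eq_mul]
  congr 2
  by_cases h : v = inrₗ j
  · subst h; simp
  · rw [Pi.single_eq_of_ne h, Pi.single_eq_of_ne (Ne.symm h)]

theorem length_ciList : (ciList f).length = 2 * r := by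
  have : ∀ l : List (Fin r), (l.flatMap fun j => [((X (inrₗ j) : DworkPoly n r k),
      fun v => pderiv v (liftPoly f j)), (liftPoly f j, Pi.single (inrₗ j) 1)]).length =
      2 * l.length := by
    intro l
    induction l with
    | nil => rfl
    | cons j l ih => simp only [List.flatMap_cons, List.length_append, ih]; simp; ring
  rw [ciList, this, List.length_finRange]

theorem mem_ciList {x} : x ∈ ciList f ↔ ∃ j, x = (X (inrₗ j), fun v => pderiv v (liftPoly f j)) ∨
    x = (liftPoly f j, Pi.single (inrₗ j) 1) := by
  simp [ciList]

theorem ofList_ciList : ofList ((ciList f).map Prod.fst) = ciIdeal f := by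
  rw [ciIdeal, ← Ideal.span_union, ofList]
  congr 1
  ext x
  simp only [Set.mem_ofPred_eq, List.mem_map, mem_ciList, Set.mem_union, Set.mem_range]
  constructor
  · rintro ⟨_, ⟨j, rfl | rfl⟩, rfl⟩
    · exact Or.inr ⟨j, rfl⟩
    · exact Or.inl ⟨j, rfl⟩
  · rintro (⟨j, rfl⟩ | ⟨j, rfl⟩)
    · exact ⟨_, ⟨j, Or.inr rfl⟩, rfl⟩
    · exact ⟨_, ⟨j, Or.inl rfl⟩, rfl⟩

/-- The Jacobian minor belonging to the variables `x_{s(1)}, …, x_{s(r)}`. -/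
def minor (f : Fin r → MvPolynomial (Fin (n + 1)) k) (s : Fin r → Fin (n + 1)) :
    MvPolynomial (Fin (n + 1)) k := (of fun i j => pderiv (s i) (f j)).det

theorem minor_eq_zero {s : Fin r → Fin (n + 1)} (hs : ¬Injective s) : minor f s = 0 := by
  simp only [Injective, not_forall] at hs
  obtain ⟨i, j, h, hne⟩ := hs
  exact Matrix.det_zero_of_row_eq hne (by funext l; simp [h])

/-- The Jacobian minors in the ring of polynomials in all variables. -/
def liftMinor (f : Fin r → MvPolynomial (Fin (n + 1)) k) (s : Fin r → Fin (n + 1)) :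
    DworkPoly n r k := rename inlₗ (minor f s)

theorem liftMinor_eq (s : Fin r → Fin (n + 1)) : liftMinor f s =
    (of fun i j => pderiv (inlₗ (s i) : DworkVar n r) (liftPoly f j)).det := by
  rw [liftMinor, minor, AlgHom.map_det]
  congr 1
  refine Matrix.ext fun i j => ?_
  simp only [AlgHom.mapMatrix_apply, Matrix.map_apply, Matrix.of_apply, liftPoly]
  rw [pderiv_rename inlₗ_injective]

theorem liftMinor_mul_X_mem (s : Fin r → Fin (n + 1)) (j : Fin r) :
    liftMinor f s * X (inrₗ j) ∈ span (range (dPotential f)) := by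
  set A := of fun i j => pderiv (inlₗ (s i) : DworkVar n r) (liftPoly f j) with hA
  let y : Fin r → DworkPoly n r k := fun j => X (inrₗ j)
  have h1 : A.mulVec y = fun i => dPotential f (inlₗ (s i)) := by
    funext i
    rw [dPotential_inlₗ, Matrix.mulVec, dotProduct]
    exact sum_congr rfl fun j _ => mul_comm _ _
  have h2 : A.adjugate.mulVec (A.mulVec y) = A.det • y := by
    rw [Matrix.mulVec_mulVec, Matrix.adjugate_mul, Matrix.smul_mulVec, Matrix.one_mulVec]
  have h3 := congrFun h2 j
  rw [h1, Pi.smul_apply, smul_eq_mul, hA, ← liftMinor_eq] at h3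
  rw [← h3, Matrix.mulVec, dotProduct]
  exact Ideal.sum_mem _ fun i _ => Ideal.mul_mem_left _ _ (subset_span ⟨_, rfl⟩)

theorem isWeaklyRegular_ciList (s : Fin r → Fin (n + 1)) (hs : Injective s) :
    RingTheory.Sequence.IsWeaklyRegular (Away (liftMinor f s)) ((ciList f).map Prod.fst) := by
  have h1 := isWeaklyRegular_of_minor (liftPoly f) (fun i => (inlₗ (s i) : DworkVar n r))
    (inlₗ_injective.comp hs) (fun j : Fin r => (inrₗ j : DworkVar n r)) inrₗ_injective
    (fun a b => (inlₗ_ne_inrₗ _ _).symm)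
    ((finRange r).flatMap fun j => [Sum.inr j, Sum.inl j]) (by
      rw [List.nodup_flatMap]
      refine ⟨fun j _ => by simp, ?_⟩
      refine (List.nodup_finRange r).imp fun {a b} hab => ?_
      simp [Function.onFun, List.Disjoint, hab])
  rw [← liftMinor_eq] at h1
  convert h1 using 1
  rw [ciList, List.map_flatMap, List.map_flatMap]
  rfl

theorem isWeaklyRegular_liftPoly (s : Fin r → Fin (n + 1)) (hs : Injective s) :
    RingTheory.Sequence.IsWeaklyRegular (Away (liftMinor f s)) ((finRange r).map (liftPoly f)) := by
  have h1 := isWeaklyRegular_of_minor (liftPoly f) (fun i => (inlₗ (s i) : DworkVar n r))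
    (inlₗ_injective.comp hs) (fun j : Fin r => (inrₗ j : DworkVar n r)) inrₗ_injective
    (fun a b => (inlₗ_ne_inrₗ _ _).symm)
    ((finRange r).map Sum.inl) ((List.nodup_finRange r).map Sum.inl_injective)
  rwa [← liftMinor_eq, List.map_map] at h1

/-- The Jacobian criterion: every variable lies in the radical of the ideal generated by the
`f_j` and the Jacobian minors. -/
def JacobianCriterion (f : Fin r → MvPolynomial (Fin (n + 1)) k) : Prop :=
  ∀ t, X t ∈ (span (range f) ⊔ span (range (minor f))).radical

theorem JacobianCriterion.mem_radical (hJ : JacobianCriterion f) (t : Fin (n + 1)) :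
    (X (inlₗ t) : DworkPoly n r k) ∈
      (span (range (liftPoly f)) ⊔ span (range (liftMinor f))).radical := by
  have h1 := Ideal.mem_map_of_mem (rename (inlₗ : _ → DworkVar n r)).toRingHom (hJ t)
  have h2 := Ideal.map_radical_le _ h1
  rw [Ideal.map_sup, map_span, map_span, ← Set.range_comp, ← Set.range_comp] at h2
  have h3 : (rename (inlₗ : _ → DworkVar n r)).toRingHom (X t : MvPolynomial _ k) =
      X (inlₗ t) := rename_X _ _
  rwa [h3] at h2

theorem liftPoly_mem (j : Fin r) : liftPoly f j ∈ span (range (dPotential f)) :=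
  subset_span ⟨_, dPotential_inrₗ j⟩

theorem span_liftPoly_le : span (range (liftPoly f)) ≤ span (range (dPotential f)) := by
  rw [Ideal.span_le]
  rintro _ ⟨j, rfl⟩
  exact liftPoly_mem j

theorem ciList_mem (s : Fin r → Fin (n + 1)) : ∀ x ∈ ciList f,
    algebraMap _ (Away (liftMinor f s)) x.1 ∈ span (range fun v =>
      algebraMap _ (Away (liftMinor f s)) (dPotential f v)) := by
  have key : ∀ a ∈ span (range (dPotential f)),
      algebraMap _ (Away (liftMinor f s)) a ∈ span (range fun v =>
      algebraMap _ (Away (liftMinor f s)) (dPotential f v)) := by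
    intro a ha
    have := Ideal.mem_map_of_mem (algebraMap _ (Away (liftMinor f s))) ha
    rwa [map_span, ← Set.range_comp] at this
  intro x hx
  obtain ⟨j, rfl | rfl⟩ := mem_ciList.1 hx
  · have h1 := key _ (liftMinor_mul_X_mem (f := f) s j)
    rw [map_mul] at h1
    exact (Ideal.unit_mul_mem_iff_mem _
      (IsLocalization.Away.algebraMap_isUnit (S := Away (liftMinor f s)) _)).1 h1
  · exact key _ (liftPoly_mem j)

theorem JacobianCriterion.exists_pow_smul_mem (hJ : JacobianCriterion f) (t : Fin (n + 1))
    {M : Type*} [AddCommGroup M] [Module (DworkPoly n r k) M]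
    (P : Submodule (DworkPoly n r k) M) (ω : M) (hI : ∀ a ∈ span (range (liftPoly f)), a • ω ∈ P)
    (hg : ∀ s, Injective s → ∃ N : ℕ, liftMinor f s ^ N • ω ∈ P) :
    ∃ N : ℕ, (X (inlₗ t) : DworkPoly n r k) ^ N • ω ∈ P := by
  refine _root_.exists_pow_smul_mem P ω (hJ.mem_radical t) hI fun s => ?_
  by_cases hs : Injective s
  · exact hg s hs
  · exact ⟨1, by rw [liftMinor, minor_eq_zero hs]; simp⟩

theorem JacobianCriterion.exists_pow_smul_eq_kw (hJ : JacobianCriterion f) (t : Fin (n + 1))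
    {i : ℤ} (hi : i < 2 * r) {ω : PolyForm n r k}
    (hω : IsDeg i ω) (hcl : kw (dPotential f) ω = 0) : ∃ (N : ℕ) (σ : _),
    (X (inlₗ t) : DworkPoly n r k) ^ N • ω = kw (dPotential f) σ := by
  obtain ⟨N, σ, h⟩ := hJ.exists_pow_smul_mem t (LinearMap.range (kw (dPotential f))) ω
    (fun a ha => by
      obtain ⟨σ, h⟩ := exists_kw_eq_smul (span_liftPoly_le ha) hcl
      exact ⟨σ, h.symm⟩)
    (fun s hs => by
      obtain ⟨N, σ, h⟩ := _root_.exists_pow_smul_eq_kw (rs := (ciList f).map Prod.fst)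
        (m := liftMinor f s) (e := dPotential f) (by
          intro a ha
          obtain ⟨x, hx, rfl⟩ := List.mem_map.1 ha
          exact ciList_mem s x hx) (isWeaklyRegular_ciList s hs) (k := i)
        (by simpa [length_ciList] using hi) hω hcl
      exact ⟨N, σ, h.symm⟩)
  exact ⟨N, σ, h.symm⟩

theorem JacobianCriterion.exists_pow_smul_eq_wedgeList_add (hJ : JacobianCriterion f)
    (t : Fin (n + 1)) {ω : PolyForm n r k}
    (hω : IsDeg (2 * r : ℤ) ω) (hcl : kw (dPotential f) ω = 0) : ∃ (N : ℕ) (b : _) (σ : _),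
    (X (inlₗ t) : DworkPoly n r k) ^ N • ω = wedgeList (ciList f) b + kw (dPotential f) σ := by
  let W : DworkPoly n r k →ₗ[DworkPoly n r k]
      (PolyForm n r k) :=
    { toFun := wedgeList (ciList f)
      map_add' := wedgeList_add _
      map_smul' := wedgeList_smul _ }
  obtain ⟨N, h⟩ := hJ.exists_pow_smul_mem t
    (LinearMap.range W ⊔ LinearMap.range (kw (dPotential f))) ω
    (fun a ha => by
      obtain ⟨σ, h⟩ := exists_kw_eq_smul (span_liftPoly_le ha) hcl
      exact Submodule.mem_sup_right ⟨σ, h.symm⟩)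
    (fun s hs => by
      obtain ⟨N, b, σ, h⟩ := _root_.exists_pow_smul_eq_wedgeList_add (L := ciList f)
        (m := liftMinor f s) (κ := dPotential f) (ciList_mem s) dPotential_eq_sum
        (isWeaklyRegular_ciList s hs) (ω := ω) (by rw [length_ciList]; exact_mod_cast hω) hcl
      exact ⟨N, h ▸ Submodule.add_mem_sup ⟨b, rfl⟩ ⟨σ, rfl⟩⟩)
  obtain ⟨_, ⟨b, rfl⟩, _, ⟨σ, rfl⟩, h⟩ := Submodule.mem_sup.1 h
  exact ⟨N, b, σ, h.symm⟩

theorem JacobianCriterion.exists_pow_mul_mem (hJ : JacobianCriterion f) (t : Fin (n + 1))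
    {b : DworkPoly n r k} {σ : _} (h : wedgeList (ciList f) b = kw (dPotential f) σ) : ∃ N : ℕ,
    X (inlₗ t) ^ N * b ∈ ciIdeal f := by
  rw [← ofList_ciList]
  refine hJ.exists_pow_smul_mem t _ b (fun a ha => ?_) fun s hs => ?_
  · rw [ofList_ciList]
    exact Ideal.mul_mem_right _ _ (Ideal.mem_sup_left ha)
  · exact exists_pow_mul_mem_ofList (ciList_mem s) dPotential_eq_sum
      (isWeaklyRegular_ciList s hs) h

theorem JacobianCriterion.exists_pow_smul_eq_kw_liftPoly (hJ : JacobianCriterion f)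
    (t : Fin (n + 1)) {i : ℤ} (hi : i < r) {ω : Finset (Fin r) → DworkPoly n r k}
    (hω : IsDeg i ω) (hcl : kw (liftPoly f) ω = 0) : ∃ (N : ℕ) (σ : _),
    (X (inlₗ t) : DworkPoly n r k) ^ N • ω = kw (liftPoly f) σ := by
  obtain ⟨N, σ, h⟩ := hJ.exists_pow_smul_mem t (LinearMap.range (kw (liftPoly f))) ω
    (fun a ha => by
      obtain ⟨σ, h⟩ := exists_kw_eq_smul ha hcl
      exact ⟨σ, h.symm⟩)
    (fun s hs => by
      obtain ⟨N, σ, h⟩ := _root_.exists_pow_smul_eq_kw (rs := (finRange r).map (liftPoly f))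
        (m := liftMinor f s) (e := liftPoly f) (by
          intro a ha
          obtain ⟨j, -, rfl⟩ := List.mem_map.1 ha
          exact subset_span ⟨j, rfl⟩) (isWeaklyRegular_liftPoly s hs) (k := i)
        (by simpa using hi) hω hcl
      exact ⟨N, σ, h.symm⟩)
  exact ⟨N, σ, h.symm⟩

theorem JacobianCriterion.exists_pow_mul_X_mem (hJ : JacobianCriterion f) (t : Fin (n + 1))
    {b : DworkPoly n r k} (hb : b ∈ ciIdeal f) :
    ∃ N : ℕ, X (inlₗ t) ^ N * b ∈ span (range (dPotential f)) := by
  refine hJ.exists_pow_smul_mem t _ b (fun a ha => ?_) fun s _ => ⟨1, ?_⟩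
  · exact Ideal.mul_mem_right _ _ (span_liftPoly_le ha)
  · rw [pow_one, smul_eq_mul]
    obtain ⟨a, ha, c, hc, rfl⟩ := Submodule.mem_sup.1 hb
    obtain ⟨g, rfl⟩ := Ideal.mem_span_range_iff_exists_fun.1 hc
    rw [mul_add, mul_sum]
    refine add_mem (Ideal.mul_mem_left _ _ (span_liftPoly_le ha)) (Ideal.sum_mem _ fun j _ => ?_)
    rw [mul_left_comm]
    exact Ideal.mul_mem_left _ _ (liftMinor_mul_X_mem s j)

end CompleteIntersection

section LaurentWeights

variable {ι κ k G : Type*} [CommRing k] [LinearOrder κ] [Fintype κ] [AddCommGroup G]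

theorem coeff_toLaurent (p : MvPolynomial ι k) (m : ι →₀ ℕ) :
    (toLaurent p).coeff (expHom ι m) = p.coeff m :=
  Finsupp.mapDomain_apply expHom_injective (AddMonoidAlgebra.coeff p) m

/-- The degree function with the given weights. -/
def degHom [Fintype ι] (w : ι → ℤ) : (ι → ℤ) →+ ℤ where
  toFun u := ∑ v, u v * w v
  map_zero' := by simp
  map_add' u u' := by simp [add_mul, sum_add_distrib]

theorem degHom_expHom [Fintype ι] (w : ι → ℤ) (m : ι →₀ ℕ) :
    degHom w (expHom ι m) = weight w m := by
  rw [Finsupp.weight_eq_sum]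
  simp [degHom, expHom]

theorem isHomogOne_toLaurent [Fintype ι] {w : ι → ℤ} {b : ℤ} {wK : κ → ℤ}
    {e : κ → MvPolynomial ι k} (he : ∀ v, (e v).IsWeightedHomogeneous w (b - wK v)) :
    IsHomogOne (degHom w) wK b fun v => toLaurent (e v) := by
  intro v u hu
  obtain ⟨m, hm, rfl⟩ := exists_of_coeff_toLaurent_ne_zero hu
  refine ⟨fun i => Int.natCast_nonneg _, ?_⟩
  rw [degHom_expHom, he v hm, sub_add_cancel]

theorem IsLForm.exists_toLaurent_eq [Finite ι] {deg : (ι → ℤ) →+ G} {wK : κ → G} {a : G}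
    {ω : LaurentForm κ ι k} (h : IsLForm deg wK ∅ a ω) (J : Finset κ) :
    ∃ p : MvPolynomial ι k, toLaurent p = ω J :=
  _root_.exists_toLaurent_eq fun u hu i => by
    by_contra hi
    simpa using (h J u hu).1 i (not_le.1 hi)

theorem weightPart_wedgeList {deg : (ι → ℤ) →+ G} {wK : κ → G}
    {L : List (Laurent ι k × (κ → Laurent ι k))} {ws : List G}
    (h : List.Forall₂ (fun x b => IsHomogOne deg wK b x.2) L ws) (a : G) (b : Laurent ι k) :
    weightPart deg wK (a + ws.sum) (wedgeList L b) =
      wedgeList L (lfilter (fun u => deg u = a) b) := by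
  induction h with
  | nil =>
    funext J
    by_cases hJ : J = ∅
    · subst hJ; simp [weightPart, wedgeList]
    · simp [weightPart, wedgeList, hJ]
  | cons hx _ ih =>
    rw [List.sum_cons, add_left_comm, add_comm _ (a + _), wedgeList, wedgeList, weightPart_kw hx, ih]

theorem weightPart_sub {deg : (ι → ℤ) →+ G} {wK : κ → G} (a : G) (ω η : LaurentForm κ ι k) :
    weightPart deg wK a (ω - η) = weightPart deg wK a ω - weightPart deg wK a η := by
  funext J; simp [weightPart]

theorem exists_single_univ_eq_kw {A : Type*} [CommRing A] (e g : κ → A) :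
    ∃ σ : Finset κ → A, (∀ S, σ S = 0 ∨ ∃ j, σ S = ksign j univ • g j) ∧
      Pi.single univ (∑ j, g j * e j) = kw e σ := by
  classical
  let σ : Finset κ → A := fun S => if h : ∃ j, S = univ.erase j then
    ksign h.choose univ • g h.choose else 0
  have hσ : ∀ j, σ (univ.erase j) = ksign j univ • g j := by
    intro j
    have h : ∃ j', (univ : Finset κ).erase j = univ.erase j' := ⟨j, rfl⟩
    have h2 : h.choose = j := by
      by_contra hne
      have : h.choose ∈ univ.erase j := mem_erase.2 ⟨hne, mem_univ _⟩
      exact absurd (h.choose_spec ▸ this : h.choose ∈ univ.erase h.choose) (by simp)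
    simp only [σ]
    rw [dif_pos h, h2]
  refine ⟨σ, fun S => ?_, ?_⟩
  · by_cases h : ∃ j, S = univ.erase j
    · obtain ⟨j, rfl⟩ := h
      exact Or.inr ⟨j, hσ j⟩
    · exact Or.inl (dif_neg h)
  · funext S
    rw [kw_apply]
    by_cases hS : S = univ
    · subst hS
      rw [Pi.single_eq_same]
      refine sum_congr rfl fun j _ => ?_
      rw [hσ, smul_comm (e j), smul_smul, ksign_mul_self, one_smul, smul_eq_mul, mul_comm]
    · rw [Pi.single_eq_of_ne hS, eq_comm]
      refine sum_eq_zero fun i hi => ?_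
      have : σ (S.erase i) = 0 := by
        refine dif_neg ?_
        rintro ⟨j, hj⟩
        refine hS (Finset.eq_univ_iff_forall.2 fun x => ?_)
        have hij : i = j := by
          by_contra hne
          have : i ∈ univ.erase j := mem_erase.2 ⟨hne, mem_univ _⟩
          rw [← hj] at this
          simp at this
        by_cases hx : x = i
        · rw [hx]; exact hi
        · have : x ∈ univ.erase j := mem_erase.2 ⟨hij ▸ hx, mem_univ _⟩
          rw [← hj] at this
          exact Finset.mem_of_mem_erase this
      rw [this, smul_zero, smul_zero]

end LaurentWeights

section CompleteIntersection

open MvPolynomial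

variable {k : Type*} [CommRing k] {n r : ℕ} {f : Fin r → MvPolynomial (Fin (n + 1)) k}
  {d : Fin r → ℕ}

/-- Polynomial forms of weight zero. -/
def IsWeightZero (d : Fin r → ℕ) (ω : PolyForm n r k) : Prop :=
  ∀ J m, (ω J).coeff m ≠ 0 → weight (dworkWt d) m + ∑ j ∈ J, dworkWt d j = 0

theorem IsWeightZero.isLForm {ω : PolyForm n r k} (h : IsWeightZero d ω) :
    IsLForm (degHom (dworkWt d)) (dworkWt d) ∅ 0 fun J => toLaurent (ω J) := by
  intro J u hu
  obtain ⟨m, hm, rfl⟩ := exists_of_coeff_toLaurent_ne_zero hu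
  refine ⟨fun i hi => absurd hi (not_lt.2 (Int.natCast_nonneg _)), ?_⟩
  rw [degHom_expHom]
  exact h J m hm

theorem exists_isWeightZero {i : ℤ} {z : LaurentForm (DworkVar n r) (DworkVar n r) k}
    (h1 : IsDeg i z) (h2 : IsLForm (degHom (dworkWt d)) (dworkWt d) ∅ 0 z) :
    ∃ q : PolyForm n r k, IsDeg i q ∧ IsWeightZero d q ∧ z = fun J => toLaurent (q J) := by
  choose q hq using h2.exists_toLaurent_eq
  refine ⟨q, fun S hS => toLaurent_injective (by rw [hq, h1 S hS, map_zero]), fun J m hm => ?_,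
    funext fun J => (hq J).symm⟩
  rw [← coeff_toLaurent, hq] at hm
  rw [← degHom_expHom]
  exact (h2 J _ hm).2

theorem isWeightedHomogeneous_liftPoly (hf : ∀ j, (f j).IsHomogeneous (d j)) (j : Fin r) :
    (liftPoly f j).IsWeightedHomogeneous (dworkWt d) (d j : ℤ) := by
  intro m hm
  obtain ⟨m', rfl, h'⟩ := coeff_rename_ne_zero _ _ _ hm
  have := hf j h'
  rw [weight_apply, Finsupp.sum_mapDomain_index (by simp) (by intros; simp [add_mul])]
  rw [← this, weight_apply, Finsupp.sum, Finsupp.sum]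
  simp [dworkWt]

theorem isWeightedHomogeneous_potential (hf : ∀ j, (f j).IsHomogeneous (d j)) :
    (potential f).IsWeightedHomogeneous (dworkWt d) 0 := by
  refine IsWeightedHomogeneous.sum _ _ _ fun j _ => ?_
  have := (isWeightedHomogeneous_X k (dworkWt d) (inrₗ j : DworkVar n r)).mul
    (isWeightedHomogeneous_liftPoly hf j)
  simpa [dworkWt] using this

theorem isHomogOne_dPotential (hf : ∀ j, (f j).IsHomogeneous (d j)) :
    IsHomogOne (degHom (dworkWt d)) (dworkWt d) 0 fun v => toLaurent (dPotential f v) :=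
  isHomogOne_toLaurent fun v =>
    (isWeightedHomogeneous_potential hf).pderiv (by ring)

/-- The list `ciList` over the ring of Laurent polynomials. -/
def ciListL (f : Fin r → MvPolynomial (Fin (n + 1)) k) :
    List (Laurent (DworkVar n r) k × (DworkVar n r → Laurent (DworkVar n r) k)) :=
  (ciList f).map fun x => (toLaurent x.1, fun v => toLaurent (x.2 v))

theorem wedgeList_ciListL (b : DworkPoly n r k) :
    wedgeList (ciListL f) (toLaurent b) = fun J => toLaurent (wedgeList (ciList f) b J) :=
  wedgeList_ringHom toLaurent (ciList f) b

theorem weightPart_wedgeList_ciListL (hf : ∀ j, (f j).IsHomogeneous (d j)) (a : ℤ)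
    (b : Laurent (DworkVar n r) k) :
    weightPart (degHom (dworkWt d)) (dworkWt d) a (wedgeList (ciListL f) b) =
      wedgeList (ciListL f) (lfilter (fun u => degHom (dworkWt d) u = a) b) := by
  have key : ∀ l : List (Fin r), List.Forall₂
      (fun x b => IsHomogOne (degHom (dworkWt d)) (dworkWt d) b x.2)
      ((l.flatMap fun j => [((X (inrₗ j) : DworkPoly n r k),
        fun v => pderiv v (liftPoly f j)), (liftPoly f j, Pi.single (inrₗ j) 1)]).map
        fun x => (toLaurent x.1, fun v => toLaurent (x.2 v)))
      (l.flatMap fun j => [(d j : ℤ), -(d j : ℤ)]) := by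
    intro l
    induction l with
    | nil => simp
    | cons j l ih =>
      simp only [List.flatMap_cons, List.map_append, List.map_cons, List.map_nil]
      refine List.Forall₂.cons ?_ (List.Forall₂.cons ?_ ih)
      · exact isHomogOne_toLaurent fun v =>
          (isWeightedHomogeneous_liftPoly hf j).pderiv (by ring)
      · refine isHomogOne_toLaurent fun v => ?_
        by_cases hv : v = inrₗ j
        · subst hv
          rw [Pi.single_eq_same]
          convert isWeightedHomogeneous_one k (dworkWt d : DworkVar n r → ℤ)
          simp [dworkWt]
        · rw [Pi.single_eq_of_ne hv]
          exact isWeightedHomogeneous_zero _ _ _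
  have hsum : ∀ l : List (Fin r), (l.flatMap fun j => [(d j : ℤ), -(d j : ℤ)]).sum = 0 := by
    intro l
    induction l with
    | nil => rfl
    | cons j l ih => simp [List.flatMap_cons, ih]
  have := weightPart_wedgeList (key (finRange r)) a b
  rwa [hsum, add_zero] at this

/-- The set of the variables `x_i`. -/
def xVars (n r : ℕ) : Finset (DworkVar n r) := univ.image inlₗ

theorem card_xVars : (xVars n r).card = n + 1 := by
  rw [xVars, Finset.card_image_of_injective _ inlₗ_injective, Finset.card_univ, Fintype.card_fin]

theorem inlₗ_mem_xVars (i : Fin (n + 1)) : (inlₗ i : DworkVar n r) ∈ xVars n r :=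
  Finset.mem_image_of_mem _ (mem_univ _)

theorem mem_xVars {v : DworkVar n r} : v ∈ xVars n r ↔ ∃ i, v = inlₗ i := by
  simp [xVars, eq_comm]

theorem inrₗ_notMem_xVars (j : Fin r) : (inrₗ j : DworkVar n r) ∉ xVars n r := fun h => by
  obtain ⟨i, hi⟩ := mem_xVars.1 h
  exact inlₗ_ne_inrₗ i j hi.symm

theorem card_lt_of_weight_eq_zero (hrn : r < n) (u : DworkVar n r → ℤ)
    (J : Finset (DworkVar n r)) (h : degHom (dworkWt d) u + ∑ j ∈ J, dworkWt d j = 0)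
    (h1 : ∀ i ∉ xVars n r, 0 ≤ u i) (h2 : ∀ t ∈ xVars n r, u t < 0) :
    (2 * r : ℤ) < (xVars n r).card + J.card := by
  have h3 : degHom (dworkWt d) u ≤ -(n + 1 : ℤ) := by
    change ∑ v, u v * dworkWt d v ≤ _
    rw [sum_dworkVar]
    have a1 : ∑ i : Fin (n + 1), u (inlₗ i) * dworkWt d (inlₗ i) ≤
        ∑ _i : Fin (n + 1), (-1 : ℤ) := Finset.sum_le_sum fun i _ => by
      have := h2 _ (inlₗ_mem_xVars i)
      simp only [dworkWt, ofLex_toLex, Sum.elim_inl]; omega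
    have a2 : ∑ j : Fin r, u (inrₗ j) * dworkWt d (inrₗ j : DworkVar n r) ≤ 0 :=
      Finset.sum_nonpos fun j _ => by
        have := h1 _ (inrₗ_notMem_xVars j)
        simp only [dworkWt, ofLex_toLex, Sum.elim_inr]
        nlinarith [Int.natCast_nonneg (d j)]
    simp only [Finset.sum_const, Finset.card_univ, Fintype.card_fin, nsmul_eq_mul] at a1
    push_cast at a1
    linarith
  have h4 : ∑ j ∈ J, dworkWt d j ≤ J.card := by
    have : ∀ j ∈ J, dworkWt d j ≤ 1 := fun j _ => by
      induction j using dworkVar_cases with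
      | hx i => simp [dworkWt]
      | hy j => simp only [dworkWt, ofLex_toLex, Sum.elim_inr]; omega
    simpa using Finset.sum_le_card_nsmul J _ 1 this
  rw [card_xVars]
  push_cast
  omega

theorem JacobianCriterion.column (hJ : JacobianCriterion f) (hf : ∀ j, (f j).IsHomogeneous (d j))
    (T : Finset (DworkVar n r)) (hT : T.Nonempty) (hTX : T ⊆ xVars n r) (i : ℤ) (hi : i < 2 * r)
    (ω : LaurentForm (DworkVar n r) (DworkVar n r) k) (h1 : IsDeg i ω)
    (h2 : IsLForm (degHom (dworkWt d)) (dworkWt d) T 0 ω)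
    (h3 : kw (fun v => toLaurent (dPotential f v)) ω = 0) :
    ∃ σ, IsDeg (i - 1) σ ∧ IsLForm (degHom (dworkWt d)) (dworkWt d) T 0 σ ∧
      ω = kw (fun v => toLaurent (dPotential f v)) σ := by
  obtain ⟨t, ht⟩ := hT
  obtain ⟨t, rfl⟩ := mem_xVars.1 (hTX ht)
  exact exists_kw_eq_laurent (isHomogOne_dPotential hf) ht
    (fun p hp hcl => hJ.exists_pow_smul_eq_kw t hi hp hcl) h1 h2 h3

theorem toLaurent_kw_injective {e : DworkVar n r → DworkPoly n r k} {ω σ : PolyForm n r k}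
    (h : (fun J => toLaurent (ω J)) = kw (fun v => toLaurent (e v)) fun J => toLaurent (σ J)) :
    ω = kw e σ := by
  rw [kw_ringHom] at h
  funext J
  exact toLaurent_injective (congrFun h J)

theorem JacobianCriterion.exists_kw_of_locally (hJ : JacobianCriterion f)
    (hf : ∀ j, (f j).IsHomogeneous (d j)) (hrn : r < n) {i : ℤ} (hi : i ≤ 2 * r)
    {ω : PolyForm n r k} (hω : IsDeg i ω) (hloc : ∀ t ∈ xVars n r, ∃ y, IsDeg (i - 1) y ∧
      IsLForm (degHom (dworkWt d)) (dworkWt d) {t} 0 y ∧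
      (fun J => toLaurent (ω J)) = kw (fun v => toLaurent (dPotential f v)) y) :
    ∃ σ, IsDeg (i - 1) σ ∧ IsWeightZero d σ ∧ ω = kw (dPotential f) σ := by
  obtain ⟨z, hz1, hz2, hz⟩ := exists_kw_eq_of_locally (D := 2 * r) (isHomogOne_dPotential hf)
    (card_lt_of_weight_eq_zero hrn) (hJ.column hf) ⟨_, inlₗ_mem_xVars 0⟩ hi (by omega)
    (x := fun J => toLaurent (ω J)) (fun S hS => by simp [hω S hS]) hloc
  obtain ⟨q, hq1, hq2, rfl⟩ := exists_isWeightZero hz1 hz2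
  exact ⟨q, hq1, hq2, toLaurent_kw_injective hz⟩

theorem JacobianCriterion.exists_kw_eq (hJ : JacobianCriterion f)
    (hf : ∀ j, (f j).IsHomogeneous (d j)) (hrn : r < n) {i : ℤ} (hi : i < 2 * r)
    {ω : PolyForm n r k} (hω : IsDeg i ω) (hω' : IsWeightZero d ω) (hcl : kw (dPotential f) ω = 0) :
    ∃ σ, IsDeg (i - 1) σ ∧ IsWeightZero d σ ∧ ω = kw (dPotential f) σ := by
  refine hJ.exists_kw_of_locally hf hrn hi.le hω fun t ht =>
    hJ.column hf {t} (Finset.singleton_nonempty t) (by simpa using ht) i hi _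
      (fun S hS => by simp [hω S hS]) (hω'.isLForm.mono (Finset.empty_subset _)) ?_
  rw [kw_ringHom, hcl]
  funext S
  exact map_zero _

/-! ### The structure sheaf of the complete intersection -/

/-- The `y`-part of an exponent. -/
def yHom (n r : ℕ) : (DworkVar n r → ℤ) →+ (Fin r → ℤ) where
  toFun u j := u (inrₗ j)
  map_zero' := rfl
  map_add' _ _ := rfl

theorem isHomogOne_liftPoly : IsHomogOne (yHom n r) (fun _ : Fin r => 0) 0
    fun j => toLaurent (liftPoly f j) := by
  intro j u hu
  obtain ⟨m, hm, rfl⟩ := exists_of_coeff_toLaurent_ne_zero hu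
  refine ⟨fun i => Int.natCast_nonneg _, ?_⟩
  obtain ⟨m', rfl, -⟩ := coeff_rename_ne_zero _ _ _ hm
  funext j'
  simp only [yHom, expHom, AddMonoidHom.coe_mk, ZeroHom.coe_mk, Pi.add_apply, Pi.zero_apply,
    add_zero, Nat.cast_eq_zero]
  exact Finsupp.mapDomain_of_notMem_range _ _ fun ⟨i, hi⟩ => inlₗ_ne_inrₗ i j' hi

theorem JacobianCriterion.column_liftPoly (hJ : JacobianCriterion f)
    (T : Finset (DworkVar n r)) (hT : T.Nonempty) (hTX : T ⊆ xVars n r) (i : ℤ) (hi : i < r)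
    (ω : Finset (Fin r) → Laurent (DworkVar n r) k) (h1 : IsDeg i ω)
    (h2 : IsLForm (yHom n r) (fun _ : Fin r => 0) T 0 ω)
    (h3 : kw (fun j => toLaurent (liftPoly f j)) ω = 0) :
    ∃ σ, IsDeg (i - 1) σ ∧ IsLForm (yHom n r) (fun _ : Fin r => 0) T 0 σ ∧
      ω = kw (fun j => toLaurent (liftPoly f j)) σ := by
  obtain ⟨t, ht⟩ := hT
  obtain ⟨t, rfl⟩ := mem_xVars.1 (hTX ht)
  exact exists_kw_eq_laurent isHomogOne_liftPoly ht
    (fun p hp hcl => hJ.exists_pow_smul_eq_kw_liftPoly t hi hp hcl) h1 h2 h3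

/-- A Laurent polynomial as a form of top degree. -/
def topForm (b : Laurent (DworkVar n r) k) : Finset (Fin r) → Laurent (DworkVar n r) k :=
  Pi.single univ b

theorem isDeg_topForm (b : Laurent (DworkVar n r) k) : IsDeg (r : ℤ) (topForm b) := fun S hS => by
  have : S ≠ univ := by rintro rfl; simp at hS
  simp [topForm, this]

/-- The part free of the variables `y_j`. -/
def yFree : Laurent (DworkVar n r) k →+ Laurent (DworkVar n r) k :=
  lfilter fun u => ∀ j : Fin r, u (inrₗ j) = 0

theorem coeff_yFree_of {b : Laurent (DworkVar n r) k} {u : DworkVar n r → ℤ}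
    (hu : ∀ j : Fin r, u (inrₗ j) = 0) : (yFree b).coeff u = b.coeff u := by
  classical
  rw [yFree, coeff_lfilter, if_pos hu]

theorem of_coeff_yFree_ne_zero {b : Laurent (DworkVar n r) k} {u : DworkVar n r → ℤ}
    (hu : (yFree b).coeff u ≠ 0) : (∀ j : Fin r, u (inrₗ j) = 0) ∧ b.coeff u ≠ 0 := by
  classical
  rw [yFree, coeff_lfilter] at hu
  split_ifs at hu with h
  · exact ⟨h, hu⟩
  · exact absurd rfl hu

theorem isLForm_topForm {T : Finset (DworkVar n r)} {b : Laurent (DworkVar n r) k}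
    (hb : PolesIn T b) : IsLForm (yHom n r) (fun _ : Fin r => 0) T 0 (topForm (yFree b)) := by
  intro J u hu
  by_cases hJ : J = univ
  · subst hJ
    rw [topForm, Pi.single_eq_same] at hu
    obtain ⟨h1, h2⟩ := of_coeff_yFree_ne_zero hu
    refine ⟨hb u h2, ?_⟩
    funext j
    simp [yHom, h1 j]
  · rw [topForm, Pi.single_eq_of_ne hJ] at hu
    exact absurd rfl hu

theorem yFree_liftPoly_mul (j : Fin r) (g : Laurent (DworkVar n r) k) :
    yFree (toLaurent (liftPoly f j) * g) = toLaurent (liftPoly f j) * yFree g := by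
  refine lfilter_mul (fun v hv u => ?_) _
  have h := (isHomogOne_liftPoly j v hv).2
  have h' : ∀ j', v (inrₗ j') = 0 := fun j' => by simpa [yHom] using congrFun h j'
  simp [h']

theorem yFree_X_mul (j : Fin r) {T : Finset (DworkVar n r)} (hT : T ⊆ xVars n r)
    {g : Laurent (DworkVar n r) k} (hg : PolesIn T g) : yFree (toLaurent (X (inrₗ j)) * g) = 0 := by
  refine lfilter_eq_zero fun u hu h => ?_
  obtain ⟨v, w, hv, hw, rfl⟩ := exists_add_of_coeff_mul_ne_zero hu
  obtain ⟨m, hm, rfl⟩ := exists_of_coeff_toLaurent_ne_zero hv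
  have h1 := h j
  have h2 : 0 ≤ w (inrₗ j) := by
    by_contra h'
    exact inrₗ_notMem_xVars j (hT (hg w hw _ (not_le.1 h')))
  have h3 : m = single (inrₗ j) 1 := by
    by_contra hne
    exact hm (by rw [coeff_X, if_neg (Ne.symm hne)])
  subst h3
  simp only [expHom, AddMonoidHom.coe_mk, ZeroHom.coe_mk, Pi.add_apply, single_eq_same,
    Nat.cast_one] at h1
  omega

theorem exists_yFree_eq {T : Finset (DworkVar n r)} (hT : T ⊆ xVars n r) {v : DworkVar n r → ℤ}
    (hv : ∀ i ∉ T, v i = 0) {t : DworkVar n r} (ht : t ∈ T) {N : ℕ}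
    {β : DworkPoly n r k} (h : X t ^ N * β ∈ ciIdeal f) :
    ∃ g : Fin r → Laurent (DworkVar n r) k, (∀ j, PolesIn T (g j)) ∧
      yFree (lmon v * toLaurent β) = ∑ j, g j * toLaurent (liftPoly f j) := by
  obtain ⟨a, ha, c, hc, hac⟩ := Submodule.mem_sup.1 h
  obtain ⟨A, rfl⟩ := Ideal.mem_span_range_iff_exists_fun.1 ha
  obtain ⟨B, rfl⟩ := Ideal.mem_span_range_iff_exists_fun.1 hc
  set w : DworkVar n r → ℤ := v - Pi.single t (N : ℤ) with hw
  have hw0 : ∀ i ∉ T, w i = 0 := fun i hi => by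
    have : i ≠ t := by rintro rfl; exact hi ht
    simp [hw, hv i hi, this]
  refine ⟨fun j => yFree (lmon w * toLaurent (A j)), fun j u hu =>
    neg_mem_lmon_mul_toLaurent hw0 (A j) (of_coeff_yFree_ne_zero hu).2, ?_⟩
  have h1 : lmon v * toLaurent β = lmon w * toLaurent (X t ^ N * β) := by
    rw [map_mul, toLaurent_X_pow, ← mul_assoc, lmon_mul, hw, sub_add_cancel]
  rw [h1, ← hac, map_add, map_sum, map_sum, mul_add, mul_sum, mul_sum, map_add,
    map_sum, map_sum, sum_eq_zero (s := univ)
      (f := fun j => yFree (lmon w * toLaurent (B j * X (inrₗ j)))), add_zero]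
  · refine sum_congr rfl fun j _ => ?_
    rw [map_mul toLaurent, ← mul_assoc, mul_comm, yFree_liftPoly_mul, mul_comm]
  · intro j _
    rw [map_mul toLaurent, ← mul_assoc, mul_comm]
    exact yFree_X_mul j hT fun u hu => neg_mem_lmon_mul_toLaurent hw0 (B j) hu

theorem exists_topForm_eq_kw {T : Finset (DworkVar n r)} (hT : T ⊆ xVars n r)
    {v : DworkVar n r → ℤ} (hv : ∀ i ∉ T, v i = 0) {t : DworkVar n r} (ht : t ∈ T) {N : ℕ}
    {β : DworkPoly n r k} (h : X t ^ N * β ∈ ciIdeal f) :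
    ∃ σ, IsDeg (r - 1 : ℤ) σ ∧ IsLForm (yHom n r) (fun _ : Fin r => 0) T 0 σ ∧
      topForm (yFree (lmon v * toLaurent β)) = kw (fun j => toLaurent (liftPoly f j)) σ := by
  obtain ⟨g, hg, hgs⟩ := exists_yFree_eq hT hv ht h
  obtain ⟨σ, hσ, h1⟩ := exists_single_univ_eq_kw (fun j => toLaurent (liftPoly f j)) g
  refine exists_isLForm_kw isHomogOne_liftPoly (isDeg_topForm _)
    (isLForm_topForm fun u hu => neg_mem_lmon_mul_toLaurent hv β hu) (σ := σ) (fun J u hu => ?_)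
    (by rw [hgs]; exact h1)
  rcases hσ J with h0 | ⟨j, hj⟩
  · rw [h0] at hu; exact absurd rfl hu
  · refine hg j u fun h0 => hu ?_
    rw [hj, AddMonoidAlgebra.coeff_smul_apply, h0, smul_zero]

theorem JacobianCriterion.exists_topForm_eq_kw (hJ : JacobianCriterion f)
    {T : Finset (DworkVar n r)} (hT : T ⊆ xVars n r) (hT' : T.Nonempty)
    {b : Laurent (DworkVar n r) k} (hb : PolesIn T b)
    {σ : LaurentForm (DworkVar n r) (DworkVar n r) k} (hσ : ∀ J, PolesIn T (σ J))
    (h : wedgeList (ciListL f) b = kw (fun v => toLaurent (dPotential f v)) σ) :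
    ∃ σ, IsDeg (r - 1 : ℤ) σ ∧ IsLForm (yHom n r) (fun _ : Fin r => 0) T 0 σ ∧
      topForm (yFree b) = kw (fun j => toLaurent (liftPoly f j)) σ := by
  obtain ⟨v, hv, p, hp⟩ := exists_lmon_mul_toLaurent (T := T)
    (ω := fun x : Option (Finset (DworkVar n r)) => x.elim b σ) (by
      rintro (_ | J)
      exacts [hb, hσ J])
  obtain ⟨t, ht⟩ := hT'
  obtain ⟨t, rfl⟩ := mem_xVars.1 (hT ht)
  have hp0 : b = lmon v * toLaurent (p none) := hp none
  have hp1 : σ = fun J => lmon v * toLaurent (p (some J)) := funext fun J => hp (some J)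
  have h2 : wedgeList (ciList f) (p none) = kw (dPotential f) fun J => p (some J) := by
    rw [hp0, hp1, kw_mul_left, ← smul_eq_mul, wedgeList_smul, wedgeList_ciListL, kw_ringHom] at h
    funext J
    apply toLaurent_injective
    have h3 : lmon v * toLaurent (wedgeList (ciList f) (p none) J) =
      lmon v * toLaurent (kw (dPotential f) (fun J => p (some J)) J) := congrFun h J
    have h4 := congrArg (lmon (-v) * ·) h3
    simpa only [← mul_assoc, lmon_mul, neg_add_cancel, lmon_zero, one_mul] using h4
  obtain ⟨N, hN⟩ := hJ.exists_pow_mul_mem t h2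
  rw [hp0]
  exact _root_.exists_topForm_eq_kw hT hv ht hN

theorem card_lt_of_lt (hrn : r < n) (u : DworkVar n r → ℤ) (J : Finset (Fin r))
    (_ : yHom n r u + ∑ _j ∈ J, (0 : Fin r → ℤ) = 0) (_ : ∀ i ∉ xVars n r, 0 ≤ u i)
    (_ : ∀ t ∈ xVars n r, u t < 0) : (r + 1 : ℤ) < (xVars n r).card + J.card := by
  rw [card_xVars]; push_cast; omega

theorem constantCoeff_liftPoly (hd : ∀ j, 1 ≤ d j) (hf : ∀ j, (f j).IsHomogeneous (d j))
    (j : Fin r) : constantCoeff (liftPoly f j) = 0 := by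
  rw [liftPoly, constantCoeff_rename, constantCoeff_eq]
  refine (hf j).coeff_eq_zero ?_
  have := hd j
  simp; omega

theorem toLaurent_C (c : k) : (toLaurent (C c) : Laurent (DworkVar n r) k) =
    AddMonoidAlgebra.single 0 c := by
  rw [toLaurent_eq]
  refine AddMonoidAlgebra.mapDomain_single.trans ?_
  rw [map_zero]

theorem yFree_toLaurent_C (c : k) :
    yFree (toLaurent (C c) : Laurent (DworkVar n r) k) = toLaurent (C c) := by
  refine lfilter_eq_self fun u hu j => ?_
  rw [toLaurent_C, AddMonoidAlgebra.coeff_single, single_apply_ne_zero] at hu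
  rw [hu.1]; rfl

theorem JacobianCriterion.eq_zero_of_wedgeList_eq (hJ : JacobianCriterion f)
    (hd : ∀ j, 1 ≤ d j) (hf : ∀ j, (f j).IsHomogeneous (d j)) (hrn : r < n) {c : k}
    {σ : PolyForm n r k} (h : wedgeList (ciList f) (C c) = kw (dPotential f) σ) : c = 0 := by
  obtain ⟨z, -, hz, hkz⟩ := exists_kw_eq_of_locally (N := r + 1) (D := r)
    (e := fun j => toLaurent (liftPoly f j)) isHomogOne_liftPoly (card_lt_of_lt hrn)
    hJ.column_liftPoly ⟨_, inlₗ_mem_xVars 0⟩ (i := r) (by omega) (by omega)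
    (x := topForm (toLaurent (C c))) (isDeg_topForm _) (by
      intro t ht
      obtain ⟨t, rfl⟩ := mem_xVars.1 ht
      obtain ⟨N, hN⟩ := hJ.exists_pow_mul_mem t h
      have := _root_.exists_topForm_eq_kw (T := {inlₗ t}) (by simpa using ht) (v := 0)
        (fun _ _ => rfl) (Finset.mem_singleton_self _) hN
      rwa [lmon_zero, one_mul, yFree_toLaurent_C] at this)
  choose q hq using hz.exists_toLaurent_eq
  have h1 := congrFun hkz univ
  rw [← funext hq, kw_ringHom, topForm, Pi.single_eq_same] at h1
  have h2 := congrArg constantCoeff (toLaurent_injective h1)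
  rw [constantCoeff_C, kw_apply, map_sum] at h2
  rw [h2]
  refine sum_eq_zero fun j _ => ?_
  rw [map_zsmul, smul_eq_mul, map_mul, constantCoeff_liftPoly hd hf, zero_mul, smul_zero]

theorem JacobianCriterion.exists_eq_wedgeList_add_laurent (hJ : JacobianCriterion f)
    {t : DworkVar n r} (ht : t ∈ xVars n r) {ω : PolyForm n r k}
    (hω : IsDeg (2 * r : ℤ) ω) (hcl : kw (dPotential f) ω = 0) :
    ∃ (b : Laurent (DworkVar n r) k) (σ : LaurentForm (DworkVar n r) (DworkVar n r) k),
      PolesIn {t} b ∧ (∀ J, PolesIn {t} (σ J)) ∧ (fun J => toLaurent (ω J)) =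
        wedgeList (ciListL f) b + kw (fun v => toLaurent (dPotential f v)) σ := by
  obtain ⟨t, rfl⟩ := mem_xVars.1 ht
  obtain ⟨N, b, σ, h⟩ := hJ.exists_pow_smul_eq_wedgeList_add t hω hcl
  set w : DworkVar n r → ℤ := -Pi.single (inlₗ t) (N : ℤ) with hw
  have hw0 : ∀ i ∉ ({inlₗ t} : Finset (DworkVar n r)), w i = 0 := fun i hi => by
    rw [mem_singleton] at hi
    simp [hw, hi]
  refine ⟨lmon w * toLaurent b, fun J => lmon w * toLaurent (σ J),
    fun u hu => neg_mem_lmon_mul_toLaurent hw0 b hu,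
    fun J u hu => neg_mem_lmon_mul_toLaurent hw0 (σ J) hu, ?_⟩
  rw [kw_mul_left, ← smul_eq_mul, wedgeList_smul, wedgeList_ciListL, kw_ringHom]
  funext J
  have h1 : toLaurent (X (inlₗ t) ^ N * ω J) = toLaurent (wedgeList (ciList f) b J) +
      toLaurent (kw (dPotential f) σ J) := by
    rw [← map_add]; exact congrArg toLaurent (congrFun h J)
  change _ = lmon w * toLaurent (wedgeList (ciList f) b J) + lmon w * toLaurent _
  rw [← mul_add, ← h1, map_mul, toLaurent_X_pow, ← mul_assoc, lmon_mul, hw, neg_add_cancel,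
    lmon_zero, one_mul]

theorem JacobianCriterion.exists_wedgeList_eq_kw (hJ : JacobianCriterion f)
    {t : DworkVar n r} (ht : t ∈ xVars n r) {b : Laurent (DworkVar n r) k} (hb : PolesIn {t} b)
    {g : Fin r → Laurent (DworkVar n r) k} (hg : ∀ j, PolesIn {t} (g j))
    (h : yFree b = ∑ j, toLaurent (liftPoly f j) * g j) :
    ∃ σ : LaurentForm (DworkVar n r) (DworkVar n r) k, (∀ J, PolesIn {t} (σ J)) ∧
      wedgeList (ciListL f) b = kw (fun v => toLaurent (dPotential f v)) σ := by
  obtain ⟨v, hv, p, hp⟩ := exists_lmon_mul_toLaurent (T := {t})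
    (ω := fun x : Option (Fin r) => x.elim b g) (by
      rintro (_ | J)
      exacts [hb, hg J])
  obtain ⟨t, rfl⟩ := mem_xVars.1 ht
  have hp0 : b = lmon v * toLaurent (p none) := hp none
  have hp1 : ∀ j, g j = lmon v * toLaurent (p (some j)) := fun j => hp (some j)
  have hmem : p none ∈ ciIdeal f := by
    set D := p none - ∑ j, liftPoly f j * p (some j) with hD
    have hD' : p none = ∑ j, liftPoly f j * p (some j) + D := by rw [hD]; ring
    rw [hD']
    refine Submodule.add_mem_sup (Ideal.sum_mem _ fun j _ =>
      Ideal.mul_mem_right _ _ (subset_span ⟨j, rfl⟩)) ?_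
    have hrange : (range fun j : Fin r => (X (inrₗ j) : DworkPoly n r k)) =
        X '' range (inrₗ : Fin r → DworkVar n r) := by
      rw [← Set.range_comp]; rfl
    rw [hrange, mem_ideal_span_X_image]
    intro m hm
    by_contra! hm0
    have hlD : lmon v * toLaurent D = b - yFree b := by
      rw [h, hD, map_sub, map_sum, mul_sub, ← hp0, mul_sum]
      congr 1
      refine sum_congr rfl fun j _ => ?_
      rw [hp1, map_mul, mul_left_comm]
    have hy : ∀ j : Fin r, (v + expHom _ m) (inrₗ j) = 0 := fun j => by
      have h1 : m (inrₗ j) = 0 := hm0 _ ⟨j, rfl⟩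
      have h2 : v (inrₗ j) = 0 := hv _ (by
        rw [mem_singleton]; exact (inlₗ_ne_inrₗ t j).symm)
      simp [expHom, h1, h2]
    have h3 : (lmon v * toLaurent D).coeff (v + expHom _ m) = D.coeff m := by
      rw [coeff_lmon_mul, neg_add_cancel_left, coeff_toLaurent]
    rw [hlD, AddMonoidAlgebra.coeff_sub, Finsupp.sub_apply, coeff_yFree_of hy, sub_self] at h3
    exact (mem_support_iff.1 hm) h3.symm
  obtain ⟨N, hN⟩ := hJ.exists_pow_mul_X_mem t hmem
  obtain ⟨σ, hσ⟩ := exists_kw_eq_smul hN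
    (ω := wedgeList (ciList f) (1 : DworkPoly n r k))
    (kw_wedgeList_eq_zero (fun i m => by rw [dPotential_eq_sum]) 1)
  rw [← wedgeList_smul, smul_eq_mul, mul_one, ← smul_eq_mul, wedgeList_smul] at hσ
  obtain ⟨σ', h1, h2⟩ := exists_lmon_mul_eq_kw (Finset.mem_singleton_self _) hv hσ
  refine ⟨σ', h1, ?_⟩
  rw [← h2, hp0, ← smul_eq_mul, wedgeList_smul, wedgeList_ciListL]
  rfl

theorem JacobianCriterion.exists_eq_wedgeList_add (hJ : JacobianCriterion f)
    (hf : ∀ j, (f j).IsHomogeneous (d j)) (hrn : r < n)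
    {ω : PolyForm n r k} (hω : IsDeg (2 * r : ℤ) ω)
    (hω' : IsWeightZero d ω) (hcl : kw (dPotential f) ω = 0) :
    ∃ (c : k) (σ : _), IsDeg (2 * r - 1 : ℤ) σ ∧ IsWeightZero d σ ∧
      ω = wedgeList (ciList f) (C c) + kw (dPotential f) σ := by
  have h1 : ∀ t, ∃ (b : Laurent (DworkVar n r) k)
      (σ : LaurentForm (DworkVar n r) (DworkVar n r) k), t ∈ xVars n r →
      PolesIn {t} b ∧ (∀ J, PolesIn {t} (σ J)) ∧ (fun J => toLaurent (ω J)) =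
        wedgeList (ciListL f) b + kw (fun v => toLaurent (dPotential f v)) σ := fun t => by
    by_cases ht : t ∈ xVars n r
    · obtain ⟨b, σ, h⟩ := hJ.exists_eq_wedgeList_add_laurent ht hω hcl
      exact ⟨b, σ, fun _ => h⟩
    · exact ⟨0, 0, fun h => absurd h ht⟩
  choose b σ hbσ using h1
  have hsub : ∀ (T : Finset (DworkVar n r)) (x y : Laurent (DworkVar n r) k),
      PolesIn T x → PolesIn T y → PolesIn T (x - y) := by
    intro T x y hx hy u hu
    by_cases h0 : x.coeff u = 0
    · exact hy u fun h1 => hu (by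
        rw [AddMonoidAlgebra.coeff_sub, Finsupp.sub_apply, h0, h1, sub_zero])
    · exact hx u h0
  obtain ⟨B, -, hB, hz⟩ := exists_glue (N := r + 1) (D := r)
    (e := fun j => toLaurent (liftPoly f j)) isHomogOne_liftPoly (card_lt_of_lt hrn)
    hJ.column_liftPoly (n := r) le_rfl (by omega) (c := fun t => topForm (yFree (b t)))
    (fun t ht => ⟨isDeg_topForm _, isLForm_topForm (hbσ t ht).1⟩) (by
      intro t ht t' ht' htt
      have hT : {t, t'} ⊆ xVars n r := by simp [Finset.insert_subset_iff, ht, ht']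
      have hm : ({t} : Finset _) ⊆ {t, t'} := by simp
      have hm' : ({t'} : Finset _) ⊆ {t, t'} := by simp
      obtain ⟨a1, a2, a3⟩ := hbσ t ht
      obtain ⟨b1, b2, b3⟩ := hbσ t' ht'
      obtain ⟨y, h1, h2, h3⟩ := hJ.exists_topForm_eq_kw hT ⟨t, by simp⟩ (b := b t' - b t)
        (σ := σ t - σ t')
        (hsub _ _ _ (fun u hu i hi => hm' (b1 u hu i hi)) fun u hu i hi => hm (a1 u hu i hi))
        (fun J => hsub _ _ _ (fun u hu i hi => hm (a2 J u hu i hi))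
          fun u hu i hi => hm' (b2 J u hu i hi)) (by
          have h4 : b t' = (b t' - b t) + b t := by abel
          rw [a3, h4, wedgeList_add] at b3
          rw [map_sub, eq_sub_iff_add_eq, ← add_left_inj (wedgeList (ciListL f) (b t)), add_right_comm,
            ← b3, add_comm])
      refine ⟨y, h1, h2, ?_⟩
      rw [← h3, map_sub, topForm, topForm, topForm, Pi.single_sub])
  obtain ⟨β, hβ⟩ := hB.exists_toLaurent_eq univ
  have hB0 : ∀ u, (B univ).coeff u ≠ 0 → ∀ j : Fin r, u (inrₗ j) = 0 := fun u hu j => by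
    have := congrFun (hB _ u hu).2 j
    simpa [yHom] using this
  let c := (B univ).coeff 0
  have hc : lfilter (fun u => degHom (dworkWt d) u = 0) (toLaurent β) = toLaurent (C c) := by
    classical
    rw [hβ, toLaurent_C]
    ext u
    rw [coeff_lfilter, AddMonoidAlgebra.coeff_single, single_apply]
    by_cases hu : (B univ).coeff u = 0
    · rw [hu, ite_self, eq_comm]
      split_ifs with h
      · rw [← h] at hu; exact hu
      · rfl
    · split_ifs with h h' h'
      · rw [← h']
      · refine absurd ?_ h'
        have h1 : ∀ i, 0 ≤ u i := fun i => by
          by_contra hi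
          simpa using (hB _ u hu).1 i (not_le.1 hi)
        change ∑ v, u v * dworkWt d v = 0 at h
        rw [sum_dworkVar] at h
        simp only [hB0 u hu, zero_mul, Finset.sum_const_zero, add_zero, dworkWt, ofLex_toLex,
          Sum.elim_inl, mul_one] at h
        rw [Finset.sum_eq_zero_iff_of_nonneg fun i _ => h1 _] at h
        funext v
        induction v using dworkVar_cases with
        | hx i => exact (h i (mem_univ _)).symm
        | hy j => exact (hB0 u hu j).symm
      · rw [← h'] at h; exact absurd (map_zero _) h
      · rfl
  let W : PolyForm n r k := wedgeList (ciList f) (C c)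
  have hdeg : IsDeg (2 * r : ℤ) (ω - W) := hω.sub (by
      have := isDeg_wedgeList (ciList f) (C c : DworkPoly n r k)
      rw [length_ciList] at this; exact_mod_cast this)
  obtain ⟨τ, h1, h2, h3⟩ := hJ.exists_kw_of_locally hf hrn le_rfl hdeg (by
    intro t ht
    obtain ⟨z, hz1, hz2, hz3⟩ := hz t ht
    obtain ⟨a1, a2, a3⟩ := hbσ t ht
    have hβt : PolesIn {t} (toLaurent β) := fun u hu i hi => by
      rw [hβ] at hu
      simpa using (hB _ u hu).1 i hi
    obtain ⟨ρ, hρ1, hρ2⟩ := hJ.exists_wedgeList_eq_kw ht (b := b t - toLaurent β)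
      (g := fun j => ksign j univ • z (univ.erase j)) (hsub _ _ _ a1 hβt)
      (fun j u hu => (hz2 _ u fun h0 => hu (by
        rw [AddMonoidAlgebra.coeff_smul_apply, h0, smul_zero])).1) (by
        have h4 := congrFun hz3 univ
        rw [Pi.add_apply, kw_apply] at h4
        simp only [topForm, Pi.single_eq_same] at h4
        rw [map_sub, h4, hβ, show yFree (B univ) = B univ from
          lfilter_eq_self hB0, add_sub_cancel_left]
        refine sum_congr rfl fun j _ => ?_
        rw [smul_eq_mul, mul_smul_comm])
    have h5 : (fun J => toLaurent (ω J)) - wedgeList (ciListL f) (toLaurent β) =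
        kw (fun v => toLaurent (dPotential f v)) (ρ + σ t) := by
      have h6 : b t = (b t - toLaurent β) + toLaurent β := by abel
      rw [a3, h6, wedgeList_add, hρ2, map_add]
      abel
    have h7 := congrArg (weightPart (degHom (dworkWt d)) (dworkWt d) 0) h5
    rw [weightPart_sub, weightPart_wedgeList_ciListL hf, hc,
      (hω'.isLForm).weightPart_eq] at h7
    have h8 := weightPart_kw (isHomogOne_dPotential hf) 0 (ρ + σ t)
    rw [add_zero] at h8
    rw [h8, wedgeList_ciListL] at h7
    have h9 : IsLForm (degHom (dworkWt d)) (dworkWt d) {t} 0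
        (weightPart (degHom (dworkWt d)) (dworkWt d) 0 (ρ + σ t)) :=
      isLForm_weightPart 0 fun J => by
        have := hsub {t} (ρ J) (-σ t J) (hρ1 J) fun u hu => a2 J u fun h0 => hu (by
          rw [AddMonoidAlgebra.coeff_neg, Finsupp.neg_apply, h0, neg_zero])
        rwa [sub_neg_eq_add] at this
    have h10 : (fun J => toLaurent ((ω - W) J)) =
        kw (fun v => toLaurent (dPotential f v))
          (weightPart (degHom (dworkWt d)) (dworkWt d) 0 (ρ + σ t)) := by
      rw [← h7]
      funext J
      exact map_sub toLaurent _ _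
    refine exists_isLForm_kw (isHomogOne_dPotential hf) (fun S hS => by simp [hdeg S hS]) ?_
      (fun J u hu => (h9 J u hu).1) h10
    rw [h10]
    have := h9.kw (isHomogOne_dPotential hf)
    rwa [add_zero] at this)
  exact ⟨c, τ, h1, h2, by rw [← h3]; exact (add_sub_cancel _ _).symm⟩

end CompleteIntersection

section Nullstellensatz

open MvPolynomial

theorem exists_det_ne_zero_of_linearIndependent {K : Type*} [Field K] {r m : ℕ}
    {v : Fin r → Fin m → K} (h : LinearIndependent K v) :
    ∃ s : Fin r → Fin m, (of fun i j => v j (s i)).det ≠ 0 := by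
  have h1 : (of v).rank = r := by
    have : LinearIndependent K (of v).row := h
    simpa using this.rank_matrix
  have h2 : Submodule.span K (range (of v).col) = ⊤ := by
    rw [← Matrix.range_mulVecLin]
    refine Submodule.eq_top_of_finrank_eq ?_
    rw [← Matrix.rank, h1]; simp
  obtain ⟨b, hb, hspan, hli⟩ := exists_linearIndependent K (range (of v).col)
  rw [h2] at hspan
  let B : Basis b K (Fin r → K) := Basis.mk hli (by
    rw [Subtype.range_coe_subtype, Set.setOf_mem_eq, hspan])
  have e : Fin r ≃ b := (Pi.basisFun K (Fin r)).indexEquiv B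
  have hs : ∀ i, ∃ j, (of v).col j = (e i : Fin r → K) := fun i => hb (e i).2
  choose s hs using hs
  refine ⟨s, ?_⟩
  have hli2 : LinearIndependent K (of fun i j => v j (s i)).row := by
    have h3 : (of fun i j => v j (s i)).row = fun i => (e i : Fin r → K) := by
      funext i; rw [← hs i]; rfl
    rw [h3]
    exact hli.comp e e.injective
  rw [Matrix.linearIndependent_rows_iff_isUnit, Matrix.isUnit_iff_isUnit_det] at hli2
  exact hli2.ne_zero

theorem IsSmoothCompleteIntersection.jacobianCriterion {k : Type*} [Field k] {n r : ℕ}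
    {f : Fin r → MvPolynomial (Fin (n + 1)) k} (h : IsSmoothCompleteIntersection f) :
    JacobianCriterion f := by
  intro t
  rw [← vanishingIdeal_zeroLocus_eq_radical (K := AlgebraicClosure k), mem_vanishingIdeal_iff]
  intro x hx
  rw [aeval_X]
  by_contra hxt
  have hx0 : x ≠ 0 := fun h0 => hxt (by rw [h0]; rfl)
  rw [mem_zeroLocus_iff] at hx
  have h1 := h x hx0 fun j => hx _ (Ideal.mem_sup_left (subset_span ⟨j, rfl⟩))
  obtain ⟨s, hs⟩ := exists_det_ne_zero_of_linearIndependent h1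
  have h2 := hx _ (Ideal.mem_sup_right (subset_span ⟨s, rfl⟩))
  rw [minor, AlgHom.map_det] at h2
  exact hs h2

theorem JacobianCriterion.map {k R : Type*} [CommRing k] [CommRing R] (φ : k →+* R) {n r : ℕ}
    {f : Fin r → MvPolynomial (Fin (n + 1)) k} (h : JacobianCriterion f) :
    JacobianCriterion fun j => MvPolynomial.map φ (f j) := by
  intro t
  have h1 := Ideal.mem_map_of_mem (MvPolynomial.map φ) (h t)
  have h2 := Ideal.map_radical_le _ h1
  rw [Ideal.map_sup, map_span, map_span, ← Set.range_comp, ← Set.range_comp, map_X] at h2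
  have h3 : MvPolynomial.map φ ∘ minor f = minor fun j => MvPolynomial.map φ (f j) := by
    funext s
    rw [Function.comp_apply, minor, minor, RingHom.map_det]
    congr 1
    refine Matrix.ext fun i j => ?_
    simp [pderiv_map]
  rwa [h3] at h2

end Nullstellensatz

/-! ### Lifting cohomology from a quotient ring -/

section Twisted

open MvPowerSeries

variable {ι : Type*} [LinearOrder ι] [Fintype ι] {R : Type*} [CommRing R]

/-- The exterior derivative of forms with power series coefficients. -/
def dForm : (SeriesForm ι R) →ₗ[R] (SeriesForm ι R) :=
  ∑ i, extMul R i ∘ₗ (pderiv R i).toLinearMap.compLeft (Finset ι)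

theorem dForm_eq (ω : SeriesForm ι R) : dForm ω = ∑ i, extMul R i fun J => pderiv R i (ω J) := by
  simp [dForm, LinearMap.sum_apply]; rfl

theorem dForm_apply (ω : SeriesForm ι R) (S : Finset ι) :
    dForm ω S = ∑ i ∈ S, ksign i S • pderiv R i (ω (S.erase i)) := by
  rw [dForm_eq, Finset.sum_apply]
  simp only [extMul_apply]
  rw [Finset.sum_ite, Finset.sum_const_zero, add_zero, Finset.filter_univ_mem]

/-- The operator `c d + (∑ G_i dz_i) ∧`. -/
def twD (c : R) (G : ι → MvPowerSeries ι R) : (SeriesForm ι R) →ₗ[R] (SeriesForm ι R) :=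
  c • dForm + (kw G).restrictScalars R

theorem twD_apply (c : R) (G : ι → MvPowerSeries ι R) (ω : SeriesForm ι R) :
    twD c G ω = c • dForm ω + kw G ω := rfl

theorem pderiv_map_coeff {S : Type*} [CommRing S] (φ : R →+* S) (i : ι) (g : MvPowerSeries ι R) :
    pderiv S i (MvPowerSeries.map φ g) = MvPowerSeries.map φ (pderiv R i g) := by
  ext m
  simp [coeff_pderiv]

theorem dForm_map {S : Type*} [CommRing S] (φ : R →+* S) (ω : SeriesForm ι R) :
    dForm (fun J => MvPowerSeries.map φ (ω J)) = fun J => MvPowerSeries.map φ (dForm ω J) := by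
  funext J
  simp only [dForm_apply, map_sum, map_zsmul, pderiv_map_coeff]

theorem twD_map {S : Type*} [CommRing S] (φ : R →+* S) (c : R) (G : ι → MvPowerSeries ι R)
    (ω : SeriesForm ι R) :
    twD (φ c) (fun i => MvPowerSeries.map φ (G i)) (fun J => MvPowerSeries.map φ (ω J)) =
      fun J => MvPowerSeries.map φ (twD c G ω J) := by
  rw [twD_apply, dForm_map, kw_ringHom]
  funext J
  rw [twD_apply]
  ext m
  simp

theorem IsDeg.dForm {k : ℤ} {ω : SeriesForm ι R} (h : IsDeg k ω) : IsDeg (k + 1) (dForm ω) := by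
  rw [dForm_eq]
  refine IsDeg.sum fun i _ => IsDeg.extMul R (fun S hS => ?_) i
  rw [h S hS, map_zero]

theorem IsDeg.twD {k : ℤ} {ω : SeriesForm ι R} (h : IsDeg k ω) (c : R)
    (G : ι → MvPowerSeries ι R) : IsDeg (k + 1) (twD c G ω) :=
  (h.dForm.smul R c).add (h.kw G)

omit [Fintype ι] in
theorem sum_erase_add_apply (w : ι → ℤ) {J : Finset ι} {j : ι} (hj : j ∈ J) :
    ∑ x ∈ J.erase j, w x + w j = ∑ x ∈ J, w x := Finset.sum_erase_add J w hj

/-! ### Null power series -/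

/-- Power series whose coefficients tend to zero `π`-adically. -/
def IsNull (π : R) (g : MvPowerSeries ι R) : Prop :=
  ∀ N : ℕ, {m | ¬π ^ N ∣ coeff m g}.Finite

variable {π : R}

section
omit [LinearOrder ι] [Fintype ι]

theorem IsNull.zero : IsNull π (0 : MvPowerSeries ι R) := fun N => by simp

theorem IsNull.add {g h : MvPowerSeries ι R} (hg : IsNull π g) (hh : IsNull π h) :
    IsNull π (g + h) := fun N => ((hg N).union (hh N)).subset fun m hm => by
  by_contra h'
  rw [Set.mem_union, not_or] at h'
  simp only [Set.mem_ofPred_eq, not_not] at h' hm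
  exact hm (by rw [map_add]; exact dvd_add h'.1 h'.2)

theorem IsNull.smul {g : MvPowerSeries ι R} (hg : IsNull π g) (c : R) : IsNull π (c • g) :=
  fun N => (hg N).subset fun m hm h => hm (by
    rw [coeff_smul]; exact h.mul_left c)

theorem IsNull.zsmul {g : MvPowerSeries ι R} (hg : IsNull π g) (c : ℤ) : IsNull π (c • g) := by
  have := hg.smul (c : R)
  rwa [Int.cast_smul_eq_zsmul] at this

theorem IsNull.sum {α : Type*} {s : Finset α} {g : α → MvPowerSeries ι R}
    (h : ∀ a ∈ s, IsNull π (g a)) : IsNull π (∑ a ∈ s, g a) := by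
  classical
  induction s using Finset.induction_on with
  | empty => simpa using IsNull.zero
  | insert a s ha ih =>
    rw [sum_insert ha]
    exact (h a (by simp)).add (ih fun b hb => h b (by simp [hb]))

theorem IsNull.mul {g h : MvPowerSeries ι R} (hg : IsNull π g) (hh : IsNull π h) :
    IsNull π (g * h) := by
  classical
  refine fun N => (Set.Finite.image2 (· + ·) (hg N) (hh N)).subset fun m hm => ?_
  by_contra hn
  refine hm ?_
  rw [coeff_mul]
  refine Finset.dvd_sum fun x hx => ?_
  replace hx := mem_antidiagonal.1 hx
  by_cases h1 : π ^ N ∣ coeff x.1 g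
  · exact h1.mul_right _
  · by_cases h2 : π ^ N ∣ coeff x.2 h
    · exact h2.mul_left _
    · exact absurd ⟨x.1, h1, x.2, h2, hx⟩ hn

theorem IsNull.pderiv {g : MvPowerSeries ι R} (hg : IsNull π g) (i : ι) :
    IsNull π (pderiv R i g) := fun N =>
  ((hg N).preimage (f := (· + single i 1)) (add_left_injective _).injOn).subset
    fun m hm h => hm (by rw [coeff_pderiv]; exact h.mul_right _)

end

theorem isNull_twD {c : R} {G : ι → MvPowerSeries ι R} (hG : ∀ i, IsNull π (G i))
    {ω : SeriesForm ι R} (hω : ∀ J, IsNull π (ω J)) (J : Finset ι) : IsNull π (twD c G ω J) := by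
  rw [twD_apply, Pi.add_apply, Pi.smul_apply, dForm_apply, kw_apply]
  exact ((IsNull.sum fun i _ => ((hω _).pderiv i).zsmul _).smul c).add
    (IsNull.sum fun i _ => ((hG i).mul (hω _)).zsmul _)

end Twisted

section Lifting

open MvPowerSeries

/-- The completeness properties of a discrete valuation ring that are used for lifting. -/
structure IsPiComplete {R : Type*} [CommRing R] (π : R) : Prop where
  reg : ∀ x, π * x = 0 → x = 0
  sep : ∀ x, (∀ N : ℕ, π ^ N ∣ x) → x = 0
  compl : ∀ a : ℕ → R, ∃ s, ∀ N, π ^ N ∣ s - ∑ j ∈ Finset.range N, π ^ j * a j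

/-- `φ` is a surjection with kernel generated by `π`. -/
structure IsReduction {R F : Type*} [CommRing R] [CommRing F] (π : R) (φ : R →+* F) : Prop where
  surj : Function.Surjective φ
  eq_zero_iff : ∀ x, φ x = 0 ↔ π ∣ x

variable {n r : ℕ} {R : Type*} [CommRing R] {π : R} {d : Fin r → ℕ}

/-- Forms of degree `i` and weight zero with coefficients tending to zero. -/
def IsGood (π : R) (d : Fin r → ℕ) (i : ℤ) (ω : VarForm n r R) : Prop :=
  IsDeg i ω ∧ (∀ J, IsNull π (ω J)) ∧
    ∀ J m, coeff m (ω J) ≠ 0 → weight (dworkWt d) m + ∑ j ∈ J, dworkWt d j = 0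

variable {i : ℤ} {ω η : VarForm n r R}

theorem IsGood.add (h : IsGood π d i ω) (h' : IsGood π d i η) : IsGood π d i (ω + η) :=
  ⟨h.1.add h'.1, fun J => (h.2.1 J).add (h'.2.1 J), fun J m hm => by
    by_cases h0 : coeff m (ω J) = 0
    · exact h'.2.2 J m fun h1 => hm (by rw [Pi.add_apply, map_add, h0, h1, add_zero])
    · exact h.2.2 J m h0⟩

theorem IsGood.smul (h : IsGood π d i ω) (c : R) : IsGood π d i (c • ω) :=
  ⟨h.1.smul R c, fun J => (h.2.1 J).smul c, fun J m hm => h.2.2 J m fun h0 => hm (by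
    rw [Pi.smul_apply, coeff_smul, h0, mul_zero])⟩

theorem IsGood.sub (h : IsGood π d i ω) (h' : IsGood π d i η) : IsGood π d i (ω - η) := by
  have := h.add (h'.smul (-1))
  rwa [neg_one_smul, ← sub_eq_add_neg] at this

theorem IsGood.twD (h : IsGood π d i ω) (c : R)
    {G : DworkVar n r → VarSeries n r R} (hG : ∀ v, IsNull π (G v))
    (hGw : ∀ v m, coeff m (G v) ≠ 0 → weight (dworkWt d) m + dworkWt d v = 0) :
    IsGood π d (i + 1) (twD c G ω) := by
  refine ⟨h.1.twD c G, isNull_twD hG h.2.1, fun J m hm => ?_⟩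
  by_contra hne
  refine hm ?_
  rw [twD_apply, Pi.add_apply, Pi.smul_apply, dForm_apply, kw_apply, map_add, coeff_smul, map_sum,
    map_sum, sum_eq_zero, mul_zero, zero_add, sum_eq_zero]
  · intro j hj
    rw [map_zsmul, smul_eq_mul, coeff_mul, sum_eq_zero, smul_zero]
    intro x hx
    replace hx := mem_antidiagonal.1 hx
    by_contra h0
    have h1 := hGw j x.1 (left_ne_zero_of_mul h0)
    have h2 := h.2.2 _ x.2 (right_ne_zero_of_mul h0)
    refine hne ?_
    rw [← hx, map_add, ← sum_erase_add_apply (dworkWt d) hj]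
    linarith
  · intro j hj
    rw [map_zsmul, coeff_pderiv]
    by_contra h0
    have h2 := h.2.2 _ _ (left_ne_zero_of_mul (right_ne_zero_of_smul h0))
    refine hne ?_
    rw [map_add, weight_single, one_smul] at h2
    rw [← sum_erase_add_apply (dworkWt d) hj]
    linarith

theorem smul_form_injective (hπ : IsPiComplete π) {N : ℕ} (h : π ^ N • ω = π ^ N • η) : ω = η := by
  have key : ∀ N : ℕ, ∀ x : R, π ^ N * x = 0 → x = 0 := by
    intro N
    induction N with
    | zero => intro x hx; simpa using hx
    | succ N ih => intro x hx; exact ih x (hπ.reg _ (by rw [← hx]; ring))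
  funext J
  ext m
  have h1 := congrArg (coeff m) (congrFun h J)
  simp only [Pi.smul_apply, coeff_smul] at h1
  rw [← sub_eq_zero]
  exact key N _ (by rw [mul_sub, h1, sub_self])

theorem exists_eq_smul_of_map_eq_zero {F : Type*} [CommRing F] {φ : R →+* F}
    (hφ : IsReduction π φ) (hπ : IsPiComplete π) (h : IsGood π d i ω)
    (h0 : ∀ J, MvPowerSeries.map φ (ω J) = 0) : ∃ η, IsGood π d i η ∧ ω = π • η := by
  have h1 : ∀ J m, ∃ a, coeff m (ω J) = π * a := fun J m => by
    have := congrArg (coeff m) (h0 J)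
    rwa [coeff_map, map_zero, hφ.eq_zero_iff] at this
  choose a ha using h1
  have hz : ∀ J m, coeff m (ω J) = 0 → a J m = 0 := fun J m h' =>
    hπ.reg _ (by rw [← ha, h'])
  refine ⟨fun J m => a J m, ⟨fun S hS => ?_, fun J N => ?_, fun J m hm => ?_⟩, ?_⟩
  · ext m
    exact hz S m (by rw [h.1 S hS, map_zero])
  · refine (h.2.1 J (N + 1)).subset fun m hm h' => hm ?_
    obtain ⟨b, hb⟩ := h'
    refine ⟨b, ?_⟩
    have : π * (a J m - π ^ N * b) = 0 := by rw [mul_sub, ← ha, hb]; ring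
    exact sub_eq_zero.1 (hπ.reg _ this)
  · exact h.2.2 J m fun h' => hm (hz J m h')
  · funext J
    ext m
    exact ha J m

theorem exists_sum_of_isGood (hπ : IsPiComplete π) {σ : ℕ → VarForm n r R}
    (h : ∀ j, IsGood π d i (σ j)) : ∃ τ, IsGood π d i τ ∧
      ∀ N, ∃ ρ, τ = ∑ j ∈ Finset.range N, π ^ j • σ j + π ^ N • ρ := by
  have h1 : ∀ J m, ∃ s, ∀ N, π ^ N ∣ s - ∑ j ∈ Finset.range N, π ^ j * coeff m (σ j J) :=
    fun J m => hπ.compl _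
  choose s hs using h1
  have hz : ∀ J m, (∀ j, coeff m (σ j J) = 0) → s J m = 0 := fun J m h0 =>
    hπ.sep _ fun N => by simpa [h0] using hs J m N
  have hc : ∀ J m N, coeff m ((∑ j ∈ Finset.range N, π ^ j • σ j) J) =
      ∑ j ∈ Finset.range N, π ^ j * coeff m (σ j J) := fun J m N => by
    rw [Finset.sum_apply, map_sum]
    exact sum_congr rfl fun j _ => coeff_smul _ _ _
  refine ⟨fun J m => s J m, ⟨fun S hS => ?_, fun J N => ?_, fun J m hm => ?_⟩, fun N => ?_⟩
  · ext m
    exact hz S m fun j => by rw [(h j).1 S hS, map_zero]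
  · have h2 : IsNull π ((∑ j ∈ Finset.range N, π ^ j • σ j) J) := by
      rw [Finset.sum_apply]
      exact IsNull.sum fun j _ => ((h j).2.1 J).smul _
    refine (h2 N).subset fun m hm h' => hm ?_
    rw [hc] at h'
    have := dvd_add (hs J m N) h'
    rwa [sub_add_cancel] at this
  · by_contra hne
    refine hm (hz J m fun j => ?_)
    by_contra h0
    exact hne ((h j).2.2 J m h0)
  · choose b hb using fun J m => hs J m N
    refine ⟨fun J m => b J m, ?_⟩
    funext J
    ext m
    change s J m = coeff m ((∑ j ∈ Finset.range N, π ^ j • σ j) J) + π ^ N * b J m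
    rw [hc]
    exact sub_eq_iff_eq_add'.1 (hb J m)

theorem exists_eq_smul_add_twD (hπ : IsPiComplete π) (c : R) (G : DworkVar n r → VarSeries n r R)
    (ξ : VarForm n r R) (Q : (VarForm n r R) → Prop)
    (step : ∀ ω, Q ω → ∃ (a : R) (σ ω' : _), IsGood π d i σ ∧ Q ω' ∧
      ω = a • ξ + twD c G σ + π • ω') (hω : Q ω) :
    ∃ (a : R) (σ : _), IsGood π d i σ ∧ ω = a • ξ + twD c G σ := by
  choose! a σ nxt hσ hQ hstep using step
  let W : ℕ → VarForm n r R := fun N => nxt^[N] ω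
  have hW : ∀ N, Q (W N) := fun N => by
    induction N with
    | zero => exact hω
    | succ N ih => simp only [W, Function.iterate_succ_apply'] at ih ⊢; exact hQ _ ih
  have hWs : ∀ N, W N = a (W N) • ξ + twD c G (σ (W N)) + π • W (N + 1) := fun N => by
    have := hstep _ (hW N)
    simpa only [W, Function.iterate_succ_apply'] using this
  have hpart : ∀ N, ω = (∑ j ∈ Finset.range N, π ^ j * a (W j)) • ξ +
      twD c G (∑ j ∈ Finset.range N, π ^ j • σ (W j)) + π ^ N • W N := fun N => by
    induction N with
    | zero => simp [W]
    | succ N ih =>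
      rw [Finset.sum_range_succ, Finset.sum_range_succ, map_add, map_smul]
      conv_lhs => rw [ih, hWs N]
      rw [smul_add, smul_add, add_smul, smul_smul, smul_smul, pow_succ]
      abel
  obtain ⟨τ, hτ, hτN⟩ := exists_sum_of_isGood hπ fun j => hσ _ (hW j)
  obtain ⟨s, hs⟩ := hπ.compl fun j => a (W j)
  refine ⟨s, τ, hτ, ?_⟩
  funext J
  ext m
  rw [← sub_eq_zero]
  refine hπ.sep _ fun N => ?_
  obtain ⟨ρ, hρ⟩ := hτN N
  obtain ⟨b, hb⟩ := hs N
  have h1 : ω - (s • ξ + twD c G τ) = π ^ N • (W N - twD c G ρ - b • ξ) := by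
    conv_lhs => rw [hpart N, hρ, map_add, map_smul, sub_eq_iff_eq_add'.1 hb]
    rw [smul_sub, smul_sub, add_smul, smul_smul]
    abel
  have h2 := congrArg (coeff m) (congrFun h1 J)
  rw [Pi.sub_apply, map_sub] at h2
  rw [h2, Pi.smul_apply, coeff_smul]
  exact dvd_mul_right _ _

end Lifting

section Reduction

open MvPowerSeries

variable {n r : ℕ} {R : Type*} [CommRing R] {π : R} {d : Fin r → ℕ} {i : ℤ}
  {ω : VarForm n r R} {F : Type*} [CommRing F]
  {φ : R →+* F}

theorem exists_coe_eq {σ k : Type*} [CommSemiring k] {g : MvPowerSeries σ k}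
    (h : {m | coeff m g ≠ 0}.Finite) : ∃ p : MvPolynomial σ k, (p : MvPowerSeries σ k) = g := by
  refine ⟨AddMonoidAlgebra.ofCoeff (Finsupp.onFinset h.toFinset (fun m => coeff m g) fun m hm => by
    simpa using hm), ?_⟩
  ext m
  rw [MvPolynomial.coeff_coe]
  rfl

theorem IsGood.exists_map_eq (hφ : IsReduction π φ) (h : IsGood π d i ω) :
    ∃ q : PolyForm n r F, IsDeg i q ∧ IsWeightZero d q ∧
      ∀ J, MvPowerSeries.map φ (ω J) = (q J : VarSeries n r F) := by
  have h1 : ∀ J, ∃ p : DworkPoly n r F,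
      (p : VarSeries n r F) = MvPowerSeries.map φ (ω J) := fun J =>
    exists_coe_eq ((h.2.1 J 1).subset fun m hm hd => hm (by
      rw [coeff_map, hφ.eq_zero_iff]
      simpa using hd))
  choose q hq using h1
  refine ⟨q, fun S hS => ?_, fun J m hm => h.2.2 J m fun h0 => hm ?_, fun J => (hq J).symm⟩
  · apply MvPolynomial.coe_injective
    rw [hq, h.1 S hS, map_zero]; rfl
  · rw [← MvPolynomial.coeff_coe, hq, coeff_map, h0, map_zero]

theorem exists_isGood_map_eq (hφ : IsReduction π φ) {q : PolyForm n r F}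
    (h1 : IsDeg i q) (h2 : IsWeightZero d q) : ∃ σ : VarForm n r R, IsGood π d i σ ∧
      ∀ J, MvPowerSeries.map φ (σ J) = (q J : VarSeries n r F) := by
  classical
  let sec : F → R := fun x => if x = 0 then 0 else (hφ.surj x).choose
  have hsec : ∀ x, φ (sec x) = x := fun x => by
    by_cases hx : x = 0
    · simp [sec, hx]
    · simp only [sec, hx, if_false]
      exact (hφ.surj x).choose_spec
  have hsec0 : sec 0 = 0 := if_pos rfl
  refine ⟨fun J m => sec ((q J).coeff m), ⟨fun S hS => ?_, fun J N => ?_, fun J m hm => ?_⟩,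
    fun J => ?_⟩
  · funext m
    change sec ((q S).coeff m) = 0
    rw [h1 S hS, MvPolynomial.coeff_zero, hsec0]
  · refine (q J).support.finite_toSet.subset fun m hm => ?_
    rw [Finset.mem_coe, MvPolynomial.mem_support_iff]
    intro h0
    refine hm ?_
    change π ^ N ∣ sec ((q J).coeff m)
    rw [h0, hsec0]; exact dvd_zero _
  · refine h2 J m fun h0 => hm ?_
    change sec ((q J).coeff m) = 0
    rw [h0, hsec0]
  · ext m
    rw [MvPolynomial.coeff_coe]
    exact hsec _

theorem map_twD (hφ : IsReduction π φ) {c : R} (hc : π ∣ c) {G : DworkVar n r → VarSeries n r R}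
    {e : DworkVar n r → DworkPoly n r F}
    (hG : ∀ v, MvPowerSeries.map φ (G v) = (e v : VarSeries n r F)) {q : PolyForm n r F}
    (hq : ∀ J, MvPowerSeries.map φ (ω J) = (q J : VarSeries n r F))
    (J : Finset (DworkVar n r)) : MvPowerSeries.map φ (twD c G ω J) =
      (kw e q J : DworkPoly n r F) := by
  have h1 := congrFun (twD_map φ c G ω) J
  have h2 : φ c = 0 := by
    rw [hφ.eq_zero_iff]; exact hc
  have h3 : ∀ (G' : DworkVar n r → VarSeries n r F)
      (ω' : VarForm n r F),
      twD (0 : F) G' ω' = kw G' ω' := fun G' ω' => by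
    rw [twD_apply, zero_smul, zero_add]
  have h4 := congrFun (kw_ringHom (MvPolynomial.coeToMvPowerSeries.ringHom (R := F)) e q) J
  simp only [MvPolynomial.coeToMvPowerSeries.ringHom_apply] at h4
  rw [h2, h3, funext hG, funext hq] at h1
  exact h1.symm.trans h4

theorem IsPiComplete.twD_eq_zero (hπ : IsPiComplete π) {c : R}
    {G : DworkVar n r → VarSeries n r R} (h : twD c G (π • ω) = 0) : twD c G ω = 0 := by
  rw [map_smul] at h
  exact smul_form_injective hπ (N := 1) (by rw [pow_one, h, smul_zero])

variable {f : Fin r → MvPolynomial (Fin (n + 1)) F} {c : R}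
  {G : DworkVar n r → VarSeries n r R}

/-- A twisted differential lifting the Koszul differential of `∑ y_j f_j`. -/
structure IsDworkLift (π : R) (φ : R →+* F) (d : Fin r → ℕ)
    (f : Fin r → MvPolynomial (Fin (n + 1)) F) (c : R)
    (G : DworkVar n r → VarSeries n r R) : Prop where
  complete : IsPiComplete π
  red : IsReduction π φ
  jac : JacobianCriterion f
  hom : ∀ j, (f j).IsHomogeneous (d j)
  lt : r < n
  dvd : π ∣ c
  null : ∀ v, IsNull π (G v)
  weight : ∀ v m, coeff m (G v) ≠ 0 → weight (dworkWt d) m + dworkWt d v = 0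
  map_eq : ∀ v, MvPowerSeries.map φ (G v) = (dPotential f v : VarSeries n r F)
  comp_self : ∀ ω, twD c G (twD c G ω) = 0

theorem IsDworkLift.exists_isGood_eq_twD_add (hL : IsDworkLift π φ d f c G) (hi : i < 2 * r)
    (hω : IsGood π d i ω)
    (hcl : ∀ J, MvPowerSeries.map φ (twD c G ω J) = 0) :
    ∃ σ ω', IsGood π d (i - 1) σ ∧ IsGood π d i ω' ∧ ω = twD c G σ + π • ω' := by
  obtain ⟨q, hq1, hq2, hq⟩ := hω.exists_map_eq hL.red
  obtain ⟨ρ, hρ1, hρ2, hρ⟩ := hL.jac.exists_kw_eq hL.hom hL.lt hi hq1 hq2 (by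
    funext J
    apply MvPolynomial.coe_injective
    rw [← map_twD hL.red hL.dvd hL.map_eq hq, hcl]; rfl)
  obtain ⟨σ, hσ, hσρ⟩ := exists_isGood_map_eq hL.red hρ1 hρ2
  have hDσ := hσ.twD c hL.null hL.weight
  rw [sub_add_cancel] at hDσ
  obtain ⟨ω', hω', h⟩ := exists_eq_smul_of_map_eq_zero hL.red hL.complete (hω.sub hDσ) fun J => by
    rw [Pi.sub_apply, map_sub, map_twD hL.red hL.dvd hL.map_eq hσρ, hq, ← hρ, sub_self]
  exact ⟨σ, ω', hσ, hω', by rw [← h]; abel⟩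

theorem IsDworkLift.exists_eq_twD (hL : IsDworkLift π φ d f c G) (hi : i < 2 * r)
    (hω : IsGood π d i ω)
    (hcl : twD c G ω = 0) : ∃ σ, IsGood π d (i - 1) σ ∧ ω = twD c G σ := by
  obtain ⟨a, σ, h1, h2⟩ := exists_eq_smul_add_twD (d := d) (i := i - 1) hL.complete c G 0
    (fun ω => IsGood π d i ω ∧ twD c G ω = 0) (fun ω ⟨hω, hcl⟩ => by
      obtain ⟨σ, ω', h1, h2, h3⟩ := hL.exists_isGood_eq_twD_add hi hω
        fun J => by rw [hcl]; exact map_zero _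
      refine ⟨0, σ, ω', h1, ⟨h2, hL.complete.twD_eq_zero ?_⟩, by rw [smul_zero, zero_add]; exact h3⟩
      rw [h3, map_add, hL.comp_self, zero_add] at hcl
      exact hcl) ⟨hω, hcl⟩
  exact ⟨σ, h1, by rw [h2, smul_zero, zero_add]⟩

variable {ξ : VarForm n r R} {u : F}

theorem IsDworkLift.exists_eq_smul_add_twD_of_isGood (hL : IsDworkLift π φ d f c G)
    (hξ : IsGood π d (2 * r) ξ) (hξc : twD c G ξ = 0)
    (hu : IsUnit u) (hξu : ∀ J, MvPowerSeries.map φ (ξ J) =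
      (wedgeList (ciList f) (MvPolynomial.C u) J : DworkPoly n r F))
    (hω : IsGood π d (2 * r) ω) (hcl : twD c G ω = 0) :
    ∃ (a : R) (σ : _), IsGood π d (2 * r - 1) σ ∧ ω = a • ξ + twD c G σ := by
  refine exists_eq_smul_add_twD (d := d) hL.complete c G ξ
    (fun ω => IsGood π d (2 * r) ω ∧ twD c G ω = 0) (fun ω ⟨hω, hcl⟩ => ?_) ⟨hω, hcl⟩
  obtain ⟨q, hq1, hq2, hq⟩ := hω.exists_map_eq hL.red
  obtain ⟨b, ρ, hρ1, hρ2, hρ⟩ := hL.jac.exists_eq_wedgeList_add hL.hom hL.lt hq1 hq2 (by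
    funext J
    apply MvPolynomial.coe_injective
    rw [← map_twD hL.red hL.dvd hL.map_eq hq, hcl]; exact map_zero _)
  obtain ⟨σ, hσ, hσρ⟩ := exists_isGood_map_eq hL.red hρ1 hρ2
  have hDσ := hσ.twD c hL.null hL.weight
  rw [sub_add_cancel] at hDσ
  obtain ⟨u', rfl⟩ := hu
  obtain ⟨a, ha⟩ := hL.red.surj (b * (u'⁻¹ : Fˣ))
  have hab : φ a * u' = b := by rw [ha, mul_assoc, Units.inv_mul, mul_one]
  obtain ⟨ω', hω', h⟩ := exists_eq_smul_of_map_eq_zero hL.red hL.complete ((hω.sub (hξ.smul a)).sub hDσ)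
    fun J => by
      have h1 : MvPowerSeries.map φ ((a • ξ) J) =
          (wedgeList (ciList f) (MvPolynomial.C b) J : DworkPoly n r F) := by
        rw [← hab, map_mul, ← smul_eq_mul, wedgeList_smul, Pi.smul_apply, Pi.smul_apply,
          smul_eq_mul, MvPolynomial.coe_mul, ← hξu]
        ext m
        rw [coeff_map, coeff_smul, MvPolynomial.coe_C, coeff_C_mul, coeff_map, map_mul]
      rw [Pi.sub_apply, Pi.sub_apply, map_sub, map_sub, map_twD hL.red hL.dvd hL.map_eq hσρ, hq, h1, hρ,
        Pi.add_apply, MvPolynomial.coe_add]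
      ring
  have h3 : ω = a • ξ + twD c G σ + π • ω' := by rw [← h]; abel
  refine ⟨a, σ, ω', hσ, ⟨hω', hL.complete.twD_eq_zero ?_⟩, h3⟩
  rwa [h3, map_add, map_add, map_smul (twD c G) a, hξc, hL.comp_self, smul_zero, zero_add, zero_add] at hcl

theorem IsDworkLift.eq_zero_of_smul_eq_twD (hL : IsDworkLift π φ d f c G) (hd : ∀ j, 1 ≤ d j)
    (hu : IsUnit u) (hξu : ∀ J, MvPowerSeries.map φ (ξ J) =
      (wedgeList (ciList f) (MvPolynomial.C u) J : DworkPoly n r F)) {a : R} {σ : VarForm n r R}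
    (hσ : IsGood π d (2 * r - 1) σ) (h : a • ξ = twD c G σ) : a = 0 := by
  refine hL.complete.sep a fun N => ?_
  induction N generalizing a σ with
  | zero => simp
  | succ N ih =>
    obtain ⟨q, hq1, hq2, hq⟩ := hσ.exists_map_eq hL.red
    have h1 : wedgeList (ciList f) (MvPolynomial.C (φ a * u)) = kw (dPotential f) q := by
      funext J
      apply MvPolynomial.coe_injective
      rw [← map_twD hL.red hL.dvd hL.map_eq hq, ← h, map_mul, ← smul_eq_mul, wedgeList_smul, Pi.smul_apply,
        Pi.smul_apply, smul_eq_mul, MvPolynomial.coe_mul, ← hξu]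
      ext m
      rw [coeff_map, coeff_smul, MvPolynomial.coe_C, coeff_C_mul, coeff_map, map_mul]
    have h2 := hu.mul_left_eq_zero.1 (hL.jac.eq_zero_of_wedgeList_eq hd hL.hom hL.lt h1)
    have h2' := h2
    rw [hL.red.eq_zero_iff] at h2'
    obtain ⟨b, rfl⟩ := h2'
    obtain ⟨ρ, σ', hρ, hσ', hs⟩ := hL.exists_isGood_eq_twD_add
      (by omega) hσ fun J => by
        rw [← h]
        ext m
        rw [Pi.smul_apply, coeff_map, coeff_smul, map_mul, h2, zero_mul, map_zero]
    rw [pow_succ, mul_comm π b]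
    refine mul_dvd_mul_right (ih hσ' ?_) π
    apply smul_form_injective hL.complete (N := 1)
    rw [pow_one, smul_smul, h, hs, map_add, hL.comp_self, zero_add, map_smul]

end Reduction

/-! ### Logarithmic coefficients of forms -/

section LogForms

open MvPowerSeries

variable {ι : Type*} [LinearOrder ι] {R : Type*} [CommRing R]

/-- The exponent of the product of the variables in `J`. -/
def setMon (J : Finset ι) : ι →₀ ℕ := ∑ i ∈ J, single i 1

theorem setMon_apply (J : Finset ι) (i : ι) : setMon J i = if i ∈ J then 1 else 0 := by
  simp [setMon, Finsupp.finset_sum_apply, single_apply]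

theorem setMon_insert {J : Finset ι} {i : ι} (h : i ∉ J) :
    setMon (insert i J) = single i 1 + setMon J := by
  rw [setMon, sum_insert h]; rfl

theorem setMon_erase {J : Finset ι} {i : ι} (h : i ∈ J) :
    setMon J = single i 1 + setMon (J.erase i) := by
  conv_lhs => rw [← Finset.insert_erase h]
  exact setMon_insert (notMem_erase i J)

/-- The coefficients of a form with respect to the logarithmic forms `dz_J / z_J`. -/
def logForm (ω : SeriesForm ι R) (J : Finset ι) : MvPowerSeries ι R :=
  monomial (setMon J) 1 * ω J

/-- The coefficients of `z^e dz_J / z_J` in a form. -/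
def logCoeff (e : ι →₀ ℕ) (ω : SeriesForm ι R) (J : Finset ι) : R :=
  coeff e (logForm ω J)

theorem logCoeff_apply (e : ι →₀ ℕ) (ω : SeriesForm ι R) (J : Finset ι) :
    logCoeff e ω J = if setMon J ≤ e then coeff (e - setMon J) (ω J) else 0 := by
  rw [logCoeff, logForm, coeff_monomial_mul, one_mul]

theorem logCoeff_add_setMon (m : ι →₀ ℕ) (ω : SeriesForm ι R) (J : Finset ι) :
    logCoeff (m + setMon J) ω J = coeff m (ω J) := by
  rw [logCoeff_apply, if_pos le_add_self, add_tsub_cancel_right]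

theorem form_ext {ω η : SeriesForm ι R} (h : ∀ e J, logCoeff e ω J = logCoeff e η J) : ω = η := by
  funext J
  ext m
  rw [← logCoeff_add_setMon, h, logCoeff_add_setMon]

theorem form_ext_log {ω η : SeriesForm ι R} (h : logForm ω = logForm η) : ω = η :=
  form_ext fun e J => congrArg (coeff e) (congrFun h J)

theorem logForm_add (ω η : SeriesForm ι R) : logForm (ω + η) = logForm ω + logForm η := by
  funext J; simp [logForm, mul_add]

theorem logForm_smul (c : R) (ω : SeriesForm ι R) : logForm (c • ω) = c • logForm ω := by
  funext J; simp [logForm]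

theorem logCoeff_add (e : ι →₀ ℕ) (ω η : SeriesForm ι R) :
    logCoeff e (ω + η) = logCoeff e ω + logCoeff e η := by
  funext J; simp [logCoeff, logForm_add]

theorem logCoeff_zero (e : ι →₀ ℕ) : logCoeff e (0 : SeriesForm ι R) = 0 := by
  funext J; simp [logCoeff, logForm]

theorem coeff_X_mul_pderiv (i : ι) (g : MvPowerSeries ι R) (e : ι →₀ ℕ) :
    coeff e (X i * pderiv R i g) = e i * coeff e g := by
  rw [X, coeff_monomial_mul, one_mul]
  split_ifs with h
  · have h1 : e - single i 1 + single i 1 = e := tsub_add_cancel_of_le h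
    have h2 := DFunLike.congr_fun h1 i
    rw [Finsupp.add_apply, single_eq_same] at h2
    rw [coeff_pderiv, h1, ← h2]
    push_cast
    ring
  · have : e i = 0 := by
      by_contra h0
      exact h (Finsupp.single_le_iff.2 (Nat.one_le_iff_ne_zero.2 h0))
    rw [this, Nat.cast_zero, zero_mul]

theorem X_mul_cancel {i : ι} {g h : MvPowerSeries ι R} (H : X i * g = X i * h) : g = h := by
  ext m
  have := congrArg (coeff (single i 1 + m)) H
  rwa [X, coeff_add_monomial_mul, coeff_add_monomial_mul, one_mul, one_mul] at this

variable [Fintype ι]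

theorem logForm_kw (g : ι → MvPowerSeries ι R) (ω : SeriesForm ι R) :
    logForm (kw g ω) = kw (fun i => X i * g i) (logForm ω) := by
  funext J
  rw [logForm, kw_apply, kw_apply, mul_sum]
  refine sum_congr rfl fun i hi => ?_
  rw [mul_smul_comm, logForm, smul_eq_mul, smul_eq_mul, X]
  congr 1
  rw [mul_mul_mul_comm, monomial_mul_monomial, one_mul, ← setMon_erase hi]

theorem logCoeff_dForm (e : ι →₀ ℕ) (ω : SeriesForm ι R) :
    logCoeff e (dForm ω) = kw (fun i => (e i : R)) (logCoeff e ω) := by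
  funext J
  rw [logCoeff, logForm, dForm_apply, kw_apply, mul_sum, map_sum]
  refine sum_congr rfl fun i hi => ?_
  rw [mul_smul_comm, map_zsmul]
  congr 1
  rw [logCoeff, logForm, smul_eq_mul, ← coeff_X_mul_pderiv, leibniz, smul_eq_mul,
    smul_eq_mul]
  have h0 : pderiv R i (monomial (setMon (J.erase i)) (1 : R)) = 0 := by
    apply X_mul_cancel (i := i)
    ext m
    rw [coeff_X_mul_pderiv, mul_zero, map_zero, coeff_monomial]
    split_ifs with h
    · rw [h, setMon_apply, if_neg (notMem_erase _ _), Nat.cast_zero, zero_mul]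
    · rw [mul_zero]
  rw [h0, mul_zero, add_zero, ← mul_assoc, X, monomial_mul_monomial, one_mul, ← setMon_erase hi]

theorem kc_apply {M : Type*} [AddCommGroup M] [Module R M] (v : ι → R) (ω : Finset ι → M)
    (S : Finset ι) : kc v ω S = ∑ i ∈ Sᶜ, ksign i S • v i • ω (insert i S) := by
  rw [kc_eq, Finset.sum_apply]
  simp only [Pi.smul_apply, contr_apply]
  rw [← Finset.sum_filter_add_sum_filter_not univ (· ∈ S), sum_eq_zero, zero_add]
  · refine sum_congr (by ext; simp) fun i hi => ?_
    rw [if_neg (by simpa using hi), smul_comm]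
  · intro i hi
    rw [if_pos (by simpa using hi), smul_zero]

theorem logForm_kc (w : ι → R) (ω : SeriesForm ι R) :
    logForm (kc (fun i => C (w i) * X i) ω) = kc w (logForm ω) := by
  funext J
  rw [logForm, kc_apply, kc_apply, mul_sum]
  refine sum_congr rfl fun i hi => ?_
  rw [mul_smul_comm, logForm, smul_eq_mul, setMon_insert (by simpa using hi),
    ← one_mul (1 : R), ← monomial_mul_monomial, ← X, one_mul, smul_eq_C_mul]
  congr 1
  ring

theorem logCoeff_kc (e : ι →₀ ℕ) (w : ι → R) (ω : SeriesForm ι R) :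
    logCoeff e (kc (fun i => C (w i) * X i) ω) = kc w (logCoeff e ω) := by
  funext J
  rw [logCoeff, logForm_kc, kc_apply, kc_apply, map_sum]
  refine sum_congr rfl fun i _ => ?_
  rw [map_zsmul, coeff_smul]; rfl

theorem logCoeff_kw_pderiv (e : ι →₀ ℕ) (H : MvPowerSeries ι R) (ω : SeriesForm ι R) :
    logCoeff e (kw (fun i => pderiv R i H) ω) = ∑ x ∈ Finset.HasAntidiagonal.antidiagonal e,
      coeff x.1 H • kw (fun i => (x.1 i : R)) (logCoeff x.2 ω) := by
  funext J
  rw [logCoeff, logForm_kw, kw_apply, map_sum, Finset.sum_apply]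
  simp only [Pi.smul_apply, kw_apply, smul_sum]
  rw [sum_comm]
  refine sum_congr rfl fun i _ => ?_
  rw [map_zsmul, smul_eq_mul, coeff_mul, smul_sum]
  refine sum_congr rfl fun x _ => ?_
  rw [smul_comm, coeff_X_mul_pderiv, logCoeff, smul_eq_mul, smul_eq_mul]
  congr 1
  ring

theorem kw_add_left {M : Type*} [AddCommGroup M] [Module R M] (e e' : ι → R) (ω : Finset ι → M) :
    kw (e + e') ω = kw e ω + kw e' ω := by
  simp only [kw_eq, Pi.add_apply, add_smul, sum_add_distrib]

theorem dForm_dForm (ω : SeriesForm ι R) : dForm (dForm ω) = 0 :=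
  form_ext fun e J => by rw [logCoeff_dForm, logCoeff_dForm, kw_self, logCoeff_zero]

theorem dForm_kw_pderiv (H : MvPowerSeries ι R) (ω : SeriesForm ι R) :
    dForm (kw (fun i => pderiv R i H) ω) = -kw (fun i => pderiv R i H) (dForm ω) := by
  rw [eq_neg_iff_add_eq_zero]
  refine form_ext fun e J => congrFun (?_ : _ = logCoeff e 0) J
  rw [logCoeff_add, logCoeff_dForm, logCoeff_kw_pderiv, logCoeff_kw_pderiv, map_sum,
    ← sum_add_distrib, logCoeff_zero]
  refine sum_eq_zero fun x hx => ?_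
  rw [logCoeff_dForm, map_smul, ← smul_add]
  have h1 : (fun i => (e i : R)) = (fun i => (x.1 i : R)) + fun i => (x.2 i : R) := by
    funext i
    rw [← mem_antidiagonal.1 hx]
    simp
  rw [h1, kw_add_left, kw_self, zero_add, kw_comm, neg_add_cancel, smul_zero]

theorem twD_twD (c : R) (H : MvPowerSeries ι R) (ω : SeriesForm ι R) :
    twD c (fun i => pderiv R i H) (twD c (fun i => pderiv R i H) ω) = 0 := by
  simp only [twD_apply, map_add, map_smul, dForm_dForm, dForm_kw_pderiv, kw_self,
    map_smul_of_tower]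
  simp

/-! #### Base change and rescaling -/

section Scale

variable {S : Type*} [CommRing S] (ψ : R →+* S) (a : ι → S)

/-- Base change followed by the substitution `z_i ↦ a_i z_i`. -/
def scaleHom : MvPowerSeries ι R →+* MvPowerSeries ι S := (rescale a).comp (MvPowerSeries.map ψ)

section
omit [Fintype ι]

theorem coeff_scaleHom (g : MvPowerSeries ι R) (m : ι →₀ ℕ) :
    coeff m (scaleHom ψ a g) = (m.prod fun i k => a i ^ k) * ψ (coeff m g) := by
  rw [scaleHom, RingHom.comp_apply, coeff_rescale, coeff_map]

theorem scaleHom_monomial (e : ι →₀ ℕ) (c : R) :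
    scaleHom ψ a (monomial e c) = monomial e ((e.prod fun i k => a i ^ k) * ψ c) := by
  ext m
  rw [coeff_scaleHom, coeff_monomial, coeff_monomial]
  split_ifs with h
  · rw [h]
  · simp

/-- Base change of forms followed by the substitution `z_i ↦ a_i z_i`. -/
def scaleForm (ω : SeriesForm ι R) (J : Finset ι) : MvPowerSeries ι S :=
  C (∏ i ∈ J, a i) * scaleHom ψ a (ω J)

theorem prod_setMon (J : Finset ι) : ((setMon J).prod fun i k => a i ^ k) = ∏ i ∈ J, a i := by
  classical
  induction J using Finset.induction_on with
  | empty => simp [setMon]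
  | insert i J h ih =>
    rw [setMon_insert h, Finsupp.prod_add_index' (by simp) (by simp [pow_add]), ih,
      Finset.prod_insert h, Finsupp.prod_single_index (by simp), pow_one]

theorem logForm_scaleForm (ω : SeriesForm ι R) :
    logForm (scaleForm ψ a ω) = fun J => scaleHom ψ a (logForm ω J) := by
  funext J
  rw [logForm, logForm, scaleForm, map_mul, scaleHom_monomial, prod_setMon, map_one ψ, mul_one,
    ← mul_assoc]
  congr 1
  rw [← monomial_zero_eq_C_apply, monomial_mul_monomial, add_zero, one_mul]

theorem logCoeff_scaleForm (e : ι →₀ ℕ) (ω : SeriesForm ι R) (J : Finset ι) :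
    logCoeff e (scaleForm ψ a ω) J = (e.prod fun i k => a i ^ k) * ψ (logCoeff e ω J) := by
  rw [logCoeff, logForm_scaleForm, coeff_scaleHom]; rfl

theorem coeff_scaleForm (ω : SeriesForm ι R) (J : Finset ι) (m : ι →₀ ℕ) :
    coeff m (scaleForm ψ a ω J) =
      (∏ i ∈ J, a i) * ((m.prod fun i k => a i ^ k) * ψ (coeff m (ω J))) := by
  rw [scaleForm, coeff_C_mul, coeff_scaleHom]

theorem scaleForm_add (ω η : SeriesForm ι R) :
    scaleForm ψ a (ω + η) = scaleForm ψ a ω + scaleForm ψ a η := by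
  funext J; simp [scaleForm, mul_add]

theorem scaleForm_smul (c : R) (ω : SeriesForm ι R) :
    scaleForm ψ a (c • ω) = ψ c • scaleForm ψ a ω := by
  funext J
  ext m
  simp only [coeff_scaleForm, Pi.smul_apply, coeff_smul, map_mul]
  ring

theorem scaleForm_zero : scaleForm ψ a (0 : SeriesForm ι R) = 0 := by
  funext J; simp [scaleForm]

end

theorem scaleForm_dForm (ω : SeriesForm ι R) :
    dForm (scaleForm ψ a ω) = scaleForm ψ a (dForm ω) := by
  refine form_ext fun e J => ?_
  rw [logCoeff_scaleForm, logCoeff_dForm, logCoeff_dForm, kw_apply, kw_apply, map_sum,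
    mul_sum]
  refine sum_congr rfl fun i _ => ?_
  rw [logCoeff_scaleForm, map_zsmul, smul_eq_mul, smul_eq_mul, map_mul, map_natCast, mul_smul_comm]
  congr 1
  ring

theorem scaleForm_kc (w : ι → ℤ) (ω : SeriesForm ι R) :
    kc (fun i => C (w i : S) * X i) (scaleForm ψ a ω) =
      scaleForm ψ a (kc (fun i => C (w i : R) * X i) ω) := by
  refine form_ext fun e J => ?_
  rw [logCoeff_scaleForm, logCoeff_kc, logCoeff_kc, kc_apply, kc_apply, map_sum,
    mul_sum]
  refine sum_congr rfl fun i _ => ?_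
  rw [logCoeff_scaleForm, map_zsmul, smul_eq_mul, smul_eq_mul, map_mul, map_intCast, mul_smul_comm]
  congr 1
  ring

theorem scaleForm_kw {g : ι → MvPowerSeries ι R} {g' : ι → MvPowerSeries ι S}
    (h : ∀ i, X i * g' i = scaleHom ψ a (X i * g i)) (ω : SeriesForm ι R) :
    kw g' (scaleForm ψ a ω) = scaleForm ψ a (kw g ω) := by
  apply form_ext_log
  rw [logForm_kw, logForm_scaleForm, logForm_scaleForm, logForm_kw, funext h, kw_ringHom]

omit [Fintype ι] in
theorem scaleForm_injective {ψ : R →+* S} {a : ι → S} [IsDomain S] (hψ : Injective ψ)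
    (ha : ∀ i, a i ≠ 0) {ω η : SeriesForm ι R} (h : scaleForm ψ a ω = scaleForm ψ a η) : ω = η := by
  funext J
  ext m
  have h1 := congrArg (coeff m) (congrFun h J)
  rw [coeff_scaleForm, coeff_scaleForm] at h1
  refine hψ (mul_left_cancel₀ ?_ (mul_left_cancel₀ ?_ h1))
  · exact prod_ne_zero_iff.2 fun i _ => pow_ne_zero _ (ha i)
  · exact prod_ne_zero_iff.2 fun i _ => ha i

end Scale

/-! #### Contraction with the Euler vector field -/

theorem kc_extMul {M : Type*} [AddCommGroup M] [Module R M] (v : ι → R) (i : ι)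
    (ω : Finset ι → M) : kc v (extMul R i ω) = v i • ω - extMul R i (kc v ω) := by
  rw [eq_sub_iff_add_eq', kc_eq, kc_eq, map_sum, ← sum_add_distrib,
    sum_eq_single i]
  · rw [map_smul, ← smul_add, extMul_contr, if_pos rfl]
  · intro j _ hj
    rw [map_smul, ← smul_add, extMul_contr, if_neg hj.symm, smul_zero]
  · simp

theorem kc_self {M : Type*} [AddCommGroup M] [Module R M] (v : ι → R) (ω : Finset ι → M) :
    kc v (kc v ω) = 0 := by
  have key : ∀ s : Finset ι, (∑ i ∈ s, v i • contr R i (∑ j ∈ s, v j • contr R j ω)) = 0 := by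
    intro s
    induction s using Finset.induction_on with
    | empty => simp
    | insert i s hi ih =>
      have h1 : contr R i (contr R i ω) = 0 := by funext S; simp [contr_apply]
      have h2 : ∑ j ∈ s, v j • contr R j (contr R i ω) = -contr R i (∑ j ∈ s, v j • contr R j ω) := by
        rw [map_sum, ← sum_neg_distrib]
        refine sum_congr rfl fun j _ => ?_
        rw [contr_comm, map_smul, smul_neg]
      have h3 : ∑ j ∈ s, v j • v i • contr R j (contr R i ω) =
          v i • -contr R i (∑ j ∈ s, v j • contr R j ω) := by
        rw [← h2, smul_sum]
        exact sum_congr rfl fun j _ => smul_comm _ _ _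
      rw [sum_insert hi, sum_insert hi]
      simp only [map_add, map_smul, smul_add, sum_add_distrib, h1, ih, h3]
      simp
  have := key univ
  rwa [← kc_eq, ← kc_eq] at this

/-- A homotopy for the contraction with the Euler vector field. -/
def eulerHomotopy (i₀ : (ι →₀ ℕ) → ι) (ω : SeriesForm ι R) (J : Finset ι) : MvPowerSeries ι R :=
  fun m => extMul R (i₀ (m + setMon J)) (logCoeff (m + setMon J) ω) J

section
omit [Fintype ι]

theorem coeff_eulerHomotopy (i₀ : (ι →₀ ℕ) → ι) (ω : SeriesForm ι R) (J : Finset ι)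
    (m : ι →₀ ℕ) : coeff m (eulerHomotopy i₀ ω J) =
      extMul R (i₀ (m + setMon J)) (logCoeff (m + setMon J) ω) J := rfl

theorem coeff_eulerHomotopy_eq_or (i₀ : (ι →₀ ℕ) → ι) (ω : SeriesForm ι R)
    (J : Finset ι) (m : ι →₀ ℕ) : coeff m (eulerHomotopy i₀ ω J) = 0 ∨ ∃ j ∈ J,
      coeff m (eulerHomotopy i₀ ω J) = ksign j J • coeff (m + single j 1) (ω (J.erase j)) := by
  rw [coeff_eulerHomotopy, extMul_apply]
  split_ifs with hi
  · refine Or.inr ⟨_, hi, ?_⟩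
    generalize i₀ (m + setMon J) = v at hi
    have h1 := logCoeff_add_setMon (m + single v 1) ω (J.erase v)
    rw [add_assoc, ← setMon_erase hi] at h1
    rw [h1]
  · exact Or.inl rfl

theorem IsDeg.eulerHomotopy {ω : SeriesForm ι R} {i : ℤ} (h : IsDeg i ω)
    (i₀ : (ι →₀ ℕ) → ι) : IsDeg (i + 1) (eulerHomotopy i₀ ω) := fun J hJ => by
  ext m
  rcases coeff_eulerHomotopy_eq_or i₀ ω J m with h0 | ⟨j, hj, h0⟩
  · rw [h0, map_zero]
  · rw [h0, h _ ?_, map_zero, smul_zero, map_zero]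
    have := Finset.card_erase_add_one hj
    intro h1
    apply hJ
    rw [← this]
    push_cast
    linarith

theorem logCoeff_eulerHomotopy {i₀ : (ι →₀ ℕ) → ι} {ω : SeriesForm ι R}
    (h : ∀ e, logCoeff e ω ≠ 0 → e (i₀ e) ≠ 0) (e : ι →₀ ℕ) :
    logCoeff e (eulerHomotopy i₀ ω) = extMul R (i₀ e) (logCoeff e ω) := by
  funext J
  rw [logCoeff_apply]
  split_ifs with hJ
  · rw [coeff_eulerHomotopy, tsub_add_cancel_of_le hJ]
  · rw [extMul_apply]
    split_ifs with hi
    · by_cases h0 : logCoeff e ω = 0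
      · rw [h0]; simp
      · rw [logCoeff_apply, if_neg, smul_zero]
        intro hle
        refine hJ fun j => ?_
        rw [setMon_erase hi, Finsupp.add_apply]
        by_cases hj : j = i₀ e
        · rw [hj, single_eq_same, setMon_apply, if_neg (notMem_erase _ _)]
          exact Nat.one_le_iff_ne_zero.2 (h e h0)
        · rw [single_eq_of_ne hj, zero_add]
          exact hle j
    · rfl

end

theorem kc_eulerHomotopy {i₀ : (ι →₀ ℕ) → ι} {ω : SeriesForm ι R} {w : ι → R}
    (h : ∀ e, logCoeff e ω ≠ 0 → e (i₀ e) ≠ 0 ∧ w (i₀ e) = 1)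
    (hω : kc (fun i => C (w i) * X i) ω = 0) :
    kc (fun i => C (w i) * X i) (eulerHomotopy i₀ ω) = ω := by
  refine form_ext fun e J => congrFun ?_ J
  rw [logCoeff_kc, logCoeff_eulerHomotopy fun e he => (h e he).1, kc_extMul, ← logCoeff_kc, hω,
    logCoeff_zero, map_zero, sub_zero]
  by_cases h0 : logCoeff e ω = 0
  · rw [h0, smul_zero]
  · rw [(h e h0).2, one_smul]

omit [Fintype ι] in
theorem weight_setMon (w : ι → ℤ) (J : Finset ι) : weight w (setMon J) = ∑ j ∈ J, w j := by
  rw [setMon, map_sum]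
  simp [weight_single]

theorem dForm_kc_add (w : ι → ℤ) {ω : SeriesForm ι R}
    (h : ∀ J m, coeff m (ω J) ≠ 0 → weight w m + ∑ j ∈ J, w j = 0) :
    dForm (kc (fun i => C (w i : R) * X i) ω) + kc (fun i => C (w i : R) * X i) (dForm ω) = 0 := by
  refine form_ext fun e J => congrFun (?_ : _ = logCoeff e 0) J
  rw [logCoeff_add, logCoeff_dForm, logCoeff_kc, logCoeff_kc, logCoeff_dForm, kw_kc, logCoeff_zero]
  funext J
  rw [Pi.smul_apply, Pi.zero_apply, smul_eq_mul]
  by_contra h0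
  have h1 := right_ne_zero_of_mul h0
  rw [logCoeff_apply] at h1
  have hle : setMon J ≤ e := by by_contra hle; rw [if_neg hle] at h1; exact h1 rfl
  rw [if_pos hle] at h1
  have h2 := h J _ h1
  rw [← weight_setMon, ← map_add, tsub_add_cancel_of_le hle] at h2
  refine left_ne_zero_of_mul h0 ?_
  rw [weight_apply, sum_fintype _ _ (by simp)] at h2
  have h3 := congrArg (Int.cast : ℤ → R) h2
  push_cast at h3
  rw [← h3]
  exact sum_congr rfl fun i _ => by simp [mul_comm]

theorem kc_twD_add (w : ι → ℤ) {ω : SeriesForm ι R} (c : R)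
    {g : ι → MvPowerSeries ι R} (hg : ∑ i, C (w i : R) * X i * g i = 0)
    (h : ∀ J m, coeff m (ω J) ≠ 0 → weight w m + ∑ j ∈ J, w j = 0) :
    kc (fun i => C (w i : R) * X i) (twD c g ω) = -twD c g (kc (fun i => C (w i : R) * X i) ω) := by
  have h1 := kw_kc g (fun i => C (w i : R) * X i) ω
  rw [hg, zero_smul] at h1
  rw [twD_apply, twD_apply, map_add, map_smul_of_tower,
    eq_neg_of_add_eq_zero_right (dForm_kc_add w h), eq_neg_of_add_eq_zero_right h1, smul_neg,
    neg_add]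

end LogForms

section EulerExact

open MvPowerSeries

variable {n r : ℕ} {R : Type*} [CommRing R] {π : R} {d : Fin r → ℕ} {i : ℤ}
  {ω : VarForm n r R}

/-- Contraction with the Euler vector field. -/
def eulerContr (R : Type*) [CommRing R] (d : Fin r → ℕ) : (VarForm n r R) →ₗ[VarSeries n r R]
      (VarForm n r R) :=
  kc fun v => C (dworkWt d v : R) * X v

theorem exists_var_of_weight_eq_zero (hd : ∀ j, 1 ≤ d j) {e : DworkVar n r →₀ ℕ} (he : e ≠ 0)
    (hw : weight (dworkWt d) e = 0) : ∃ i : Fin (n + 1), e (inlₗ i) ≠ 0 := by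
  by_contra! h
  refine he (Finsupp.ext fun v => ?_)
  rw [weight_apply, sum_fintype _ _ (by simp), sum_dworkVar] at hw
  simp only [h, zero_smul, Finset.sum_const_zero, zero_add] at hw
  have h1 : ∑ j, e (inrₗ j) * d j = 0 := by
    have h2 : ∀ j, e (inrₗ j) • dworkWt d (inrₗ j : DworkVar n r) =
        -((e (inrₗ j) * d j : ℕ) : ℤ) := fun j => by
      change e (inrₗ j) • (-(d j : ℤ)) = _
      simp
    simp only [h2, sum_neg_distrib] at hw
    exact_mod_cast neg_eq_zero.1 hw
  induction v using dworkVar_cases with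
  | hx i => exact h i
  | hy j =>
    have := (Finset.sum_eq_zero_iff.1 h1) j (mem_univ j)
    rcases mul_eq_zero.1 this with h3 | h3
    · exact h3
    · exact absurd (hd j) (by omega)

theorem IsGood.weight_of_logCoeff_ne (h : IsGood π d i ω) {e : DworkVar n r →₀ ℕ}
    {J : Finset (DworkVar n r)} (h0 : logCoeff e ω J ≠ 0) : weight (dworkWt d) e = 0 := by
  rw [logCoeff_apply] at h0
  have hle : setMon J ≤ e := by by_contra hle; rw [if_neg hle] at h0; exact h0 rfl
  rw [if_pos hle] at h0
  rw [← h.2.2 J _ h0, ← weight_setMon, ← map_add, tsub_add_cancel_of_le hle]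

theorem IsGood.eulerHomotopy (h : IsGood π d i ω) (i₀ : (DworkVar n r →₀ ℕ) → DworkVar n r) :
    IsGood π d (i + 1) (eulerHomotopy i₀ ω) := by
  refine ⟨h.1.eulerHomotopy i₀, fun J N => ?_, fun J m hm => ?_⟩
  · have h1 : ∀ x : DworkVar n r × Finset (DworkVar n r),
        {m | ¬π ^ N ∣ coeff (m + single x.1 1) (ω x.2)}.Finite := fun x =>
      (h.2.1 x.2 N).preimage (f := (· + single x.1 1)) (add_left_injective _).injOn
    refine (Set.finite_iUnion h1).subset fun m hm => ?_
    rcases coeff_eulerHomotopy_eq_or i₀ ω J m with h0 | ⟨j, hj, h0⟩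
    · exact absurd (h0 ▸ dvd_zero _) hm
    · by_contra hx
      rw [Set.mem_iUnion, not_exists] at hx
      replace hm : ¬π ^ N ∣ _ := hm
      rw [h0, zsmul_eq_mul] at hm
      exact hm (Dvd.dvd.mul_left (not_not.1 (hx (j, _))) _)
  · rcases coeff_eulerHomotopy_eq_or i₀ ω J m with h0 | ⟨j, hj, h0⟩
    · exact absurd h0 hm
    · rw [h0] at hm
      have h1 := h.2.2 _ _ (right_ne_zero_of_smul hm)
      rw [map_add, weight_single, one_smul] at h1
      have h2 := sum_erase_add_apply (dworkWt d) hj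
      linarith

theorem IsGood.exists_eulerContr_eq (hd : ∀ j, 1 ≤ d j) (h : IsGood π d i ω)
    (h0 : eulerContr R d ω = 0) (hc : coeff 0 (ω ∅) = 0) :
    ∃ σ, IsGood π d (i + 1) σ ∧ eulerContr R d σ = ω := by
  classical
  let i₀ : (DworkVar n r →₀ ℕ) → DworkVar n r := fun e =>
    if h : ∃ i : Fin (n + 1), e (inlₗ i) ≠ 0 then inlₗ h.choose else inlₗ 0
  refine ⟨_, h.eulerHomotopy i₀, kc_eulerHomotopy (fun e he => ?_) h0⟩
  obtain ⟨J, hJ⟩ := Function.ne_iff.1 he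
  have h1 := h.weight_of_logCoeff_ne hJ
  have h2 : e ≠ 0 := by
    rintro rfl
    rw [Pi.zero_apply, logCoeff_apply] at hJ
    by_cases hJe : J = ∅
    · subst hJe
      simp [setMon, hc] at hJ
    · obtain ⟨j, hj⟩ := Finset.nonempty_iff_ne_empty.2 hJe
      refine hJ (if_neg fun hle => ?_)
      have := hle j
      rw [setMon_apply, if_pos hj] at this
      simp at this
  have h3 := exists_var_of_weight_eq_zero hd h2 h1
  simp only [i₀, dif_pos h3]
  refine ⟨h3.choose_spec, ?_⟩
  change ((1 : ℤ) : R) = 1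
  simp

end EulerExact

/-! ### Power series in a monomial -/

section MonoSubst

open MvPowerSeries

variable {ι R : Type*} [CommRing R]

open Classical in
/-- The power series `F(c z^e)`. -/
def monoSubst (e : ι →₀ ℕ) (c : R) (F : PowerSeries R) : MvPowerSeries ι R := fun m =>
  if h : ∃ k : ℕ, k • e = m then PowerSeries.coeff h.choose F * c ^ h.choose else 0

variable {e : ι →₀ ℕ} {c : R} {F : PowerSeries R}

theorem smul_exp_injective (he : e ≠ 0) : Injective fun k : ℕ => k • e := fun k l h => by
  obtain ⟨i, hi⟩ := Finsupp.ne_iff.1 he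
  have := DFunLike.congr_fun h i
  simp only [Finsupp.smul_apply, smul_eq_mul] at this
  exact Nat.eq_of_mul_eq_mul_right (Nat.pos_of_ne_zero hi) this

theorem coeff_monoSubst_smul (he : e ≠ 0) (c : R) (F : PowerSeries R) (k : ℕ) :
    coeff (k • e) (monoSubst e c F) = PowerSeries.coeff k F * c ^ k := by
  have h : ∃ l : ℕ, l • e = k • e := ⟨k, rfl⟩
  have h1 : h.choose = k := smul_exp_injective he h.choose_spec
  rw [show coeff (k • e) (monoSubst e c F) = _ from dif_pos h, h1]

theorem coeff_monoSubst_of_forall_ne {m : ι →₀ ℕ} (h : ∀ k : ℕ, k • e ≠ m) (c : R)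
    (F : PowerSeries R) : coeff m (monoSubst e c F) = 0 :=
  dif_neg (by simpa using h)

theorem eq_monoSubst (he : e ≠ 0) {g : MvPowerSeries ι R}
    (h1 : ∀ k : ℕ, coeff (k • e) g = PowerSeries.coeff k F * c ^ k)
    (h2 : ∀ m, (∀ k : ℕ, k • e ≠ m) → coeff m g = 0) : g = monoSubst e c F := by
  ext m
  by_cases h : ∃ k : ℕ, k • e = m
  · obtain ⟨k, rfl⟩ := h
    rw [h1, coeff_monoSubst_smul he]
  · rw [h2 m (by simpa using h), coeff_monoSubst_of_forall_ne (by simpa using h)]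

theorem exists_of_coeff_monoSubst_ne {m : ι →₀ ℕ} (h : coeff m (monoSubst e c F) ≠ 0) :
    ∃ k : ℕ, m = k • e := by
  by_contra! h'
  exact h (coeff_monoSubst_of_forall_ne (fun k hk => h' k hk.symm) c F)

/-- The Euler operator `t d/dt`. -/
def eulerSeries (F : PowerSeries R) : PowerSeries R :=
  PowerSeries.mk fun m => m * PowerSeries.coeff m F

theorem X_mul_pderiv_monoSubst [LinearOrder ι] (he : e ≠ 0) (i : ι) :
    X i * pderiv R i (monoSubst e c F) = (e i : R) • monoSubst e c (eulerSeries F) := by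
  ext m
  rw [coeff_X_mul_pderiv, coeff_smul]
  by_cases h : ∃ k : ℕ, k • e = m
  · obtain ⟨k, rfl⟩ := h
    rw [coeff_monoSubst_smul he, coeff_monoSubst_smul he, eulerSeries, PowerSeries.coeff_mk,
      Finsupp.smul_apply, smul_eq_mul, Nat.cast_mul]
    ring
  · rw [coeff_monoSubst_of_forall_ne (by simpa using h),
      coeff_monoSubst_of_forall_ne (by simpa using h)]
    simp

theorem map_monoSubst {S : Type*} [CommRing S] (ψ : R →+* S) (he : e ≠ 0) :
    MvPowerSeries.map ψ (monoSubst e c F) = monoSubst e (ψ c) (PowerSeries.map ψ F) := by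
  refine eq_monoSubst he (fun k => ?_) fun m h => ?_
  · rw [coeff_map, coeff_monoSubst_smul he, map_mul, map_pow, PowerSeries.coeff_map]
  · rw [coeff_map, coeff_monoSubst_of_forall_ne h, map_zero]

theorem scaleHom_monoSubst [LinearOrder ι] {S : Type*} [CommRing S] (ψ : R →+* S) (a : ι → S)
    (he : e ≠ 0) : scaleHom ψ a (monoSubst e c F) =
      monoSubst e ((e.prod fun i k => a i ^ k) * ψ c) (PowerSeries.map ψ F) := by
  refine eq_monoSubst he (fun k => ?_) fun m h => ?_
  · rw [coeff_scaleHom, coeff_monoSubst_smul he, map_mul, map_pow, PowerSeries.coeff_map, mul_pow,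
      Finsupp.prod_of_support_subset (s := e.support) _ Finsupp.support_smul _ (by simp),
      Finsupp.prod, ← Finset.prod_pow]
    simp only [Finsupp.smul_apply, smul_eq_mul, mul_comm k, pow_mul]
    ring
  · rw [coeff_scaleHom, coeff_monoSubst_of_forall_ne h, map_zero, mul_zero]

theorem monoSubst_mul_left (he : e ≠ 0) (b : R) : monoSubst e (b * c) F =
    monoSubst e c (PowerSeries.rescale b F) := by
  refine eq_monoSubst he (fun k => ?_) fun m h => coeff_monoSubst_of_forall_ne h _ _
  rw [coeff_monoSubst_smul he, PowerSeries.coeff_rescale]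
  ring

theorem monoSubst_smul (he : e ≠ 0) (b : R) : monoSubst e c (b • F) = b • monoSubst e c F := by
  refine (eq_monoSubst he (fun k => ?_) fun m h => ?_).symm
  · rw [coeff_smul, coeff_monoSubst_smul he, PowerSeries.coeff_smul, smul_eq_mul, mul_assoc]
  · rw [coeff_smul, coeff_monoSubst_of_forall_ne h, mul_zero]

theorem monoSubst_sub (he : e ≠ 0) (F G : PowerSeries R) :
    monoSubst e c (F - G) = monoSubst e c F - monoSubst e c G := by
  refine (eq_monoSubst he (fun k => ?_) fun m h => ?_).symm
  · rw [map_sub, coeff_monoSubst_smul he, coeff_monoSubst_smul he, map_sub, sub_mul]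
  · rw [map_sub, coeff_monoSubst_of_forall_ne h, coeff_monoSubst_of_forall_ne h, sub_zero]

theorem monoSubst_X (he : e ≠ 0) : monoSubst e c PowerSeries.X = monomial e c := by
  refine (eq_monoSubst he (fun k => ?_) fun m h => ?_).symm
  · classical
    rw [coeff_monomial, PowerSeries.coeff_X]
    by_cases hk : k = 1
    · rw [hk, one_smul, if_pos rfl, if_pos rfl, one_mul, pow_one]
    · rw [if_neg hk, zero_mul, if_neg]
      intro h
      exact hk (smul_exp_injective he (h.trans (one_smul ℕ e).symm))
  · classical
    rw [coeff_monomial, if_neg]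
    rintro rfl
    exact h 1 (one_smul _ _)

theorem subst_monomial (he : e ≠ 0) : PowerSeries.subst (monomial e c) F = monoSubst e c F := by
  classical
  have hs : PowerSeries.HasSubst (monomial e c : MvPowerSeries ι R) :=
    PowerSeries.HasSubst.monomial he c
  have h0 : ∀ m, coeff m (PowerSeries.subst (monomial e c) F) =
      ∑ᶠ k : ℕ, PowerSeries.coeff k F * if m = k • e then c ^ k else 0 := fun m => by
    rw [PowerSeries.coeff_subst hs]
    refine finsum_congr fun k => ?_
    rw [monomial_pow, coeff_monomial, smul_eq_mul]
  refine eq_monoSubst he (fun k => ?_) fun m h => ?_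
  · rw [h0, finsum_eq_single _ k, if_pos rfl]
    intro l hl
    rw [if_neg, mul_zero]
    intro h
    exact hl (smul_exp_injective he h).symm
  · rw [h0, finsum_eq_zero_of_forall_eq_zero]
    intro k
    rw [if_neg (fun h' => h k h'.symm), mul_zero]

theorem monoSubst_mul (he : e ≠ 0) (F G : PowerSeries R) :
    monoSubst e c (F * G) = monoSubst e c F * monoSubst e c G := by
  simp only [← subst_monomial he]
  exact PowerSeries.subst_mul (PowerSeries.HasSubst.monomial he c) F G

theorem isNull_monoSubst {π : R} (he : e ≠ 0)
    (hF : ∀ N : ℕ, {k | ¬π ^ N ∣ PowerSeries.coeff k F}.Finite) :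
    IsNull π (monoSubst e c F) := fun N => by
  refine ((hF N).image fun k : ℕ => k • e).subset fun m hm => ?_
  by_cases h : ∃ k : ℕ, k • e = m
  · obtain ⟨k, rfl⟩ := h
    refine ⟨k, fun hd => hm ?_, rfl⟩
    rw [coeff_monoSubst_smul he]
    exact hd.mul_right _
  · refine absurd ?_ hm
    rw [coeff_monoSubst_of_forall_ne (by simpa using h)]
    exact dvd_zero _

/-! ### Division by a variable and Cartier operators -/

/-- Division by the variable `z_i`. -/
def divVar (i : ι) (g : MvPowerSeries ι R) : MvPowerSeries ι R := fun m =>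
  coeff (m + single i 1) g

theorem coeff_divVar (i : ι) (g : MvPowerSeries ι R) (m : ι →₀ ℕ) :
    coeff m (divVar i g) = coeff (m + single i 1) g := rfl

theorem X_mul_divVar {i : ι} {g : MvPowerSeries ι R} (h : ∀ m, m i = 0 → coeff m g = 0) :
    X i * divVar i g = g := by
  ext m
  rw [X, coeff_monomial_mul, one_mul]
  split_ifs with hm
  · rw [coeff_divVar, tsub_add_cancel_of_le hm]
  · rw [h]
    by_contra h0
    exact hm (Finsupp.single_le_iff.2 (Nat.one_le_iff_ne_zero.2 h0))

theorem IsNull.divVar {π : R} {g : MvPowerSeries ι R} (hg : IsNull π g) (i : ι) :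
    IsNull π (divVar i g) := fun N =>
  (hg N).preimage (f := (· + single i 1)) (add_left_injective _).injOn

/-- The operator that maps `∑ A_m z^m` to `∑ A_{qm} z^m`. -/
def cartier (q : ℕ) : MvPowerSeries ι R →ₗ[R] MvPowerSeries ι R :=
  LinearMap.pi fun m => coeff (q • m)

theorem coeff_cartier (q : ℕ) (g : MvPowerSeries ι R) (m : ι →₀ ℕ) :
    coeff m (cartier q g) = coeff (q • m) g := rfl

theorem cartier_mul {q : ℕ} (hq : q ≠ 0) {h : MvPowerSeries ι R}
    (hh : ∀ m, coeff m h ≠ 0 → ∃ m', m = q • m') (g : MvPowerSeries ι R) :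
    cartier q (h * g) = cartier q h * cartier q g := by
  classical
  have hinj : Injective fun m : ι →₀ ℕ => q • m := fun x y hxy => by
    ext i
    have := DFunLike.congr_fun hxy i
    simpa [hq] using this
  ext m
  rw [coeff_cartier, coeff_mul, coeff_mul]
  symm
  refine Finset.sum_of_injOn (fun x => (q • x.1, q • x.2)) ?_ ?_ ?_ ?_
  · intro x _ y _ hxy
    rw [Prod.mk.injEq] at hxy
    exact Prod.ext (hinj hxy.1) (hinj hxy.2)
  · intro x hx
    have hx' := mem_antidiagonal.1 hx
    refine mem_antidiagonal.2 ?_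
    rw [← hx', smul_add]
  · intro x hx hne
    have hx' := mem_antidiagonal.1 hx
    by_contra h0
    obtain ⟨m', hm'⟩ := hh _ (left_ne_zero_of_mul h0)
    have hle : m' ≤ m := fun i => by
      have := DFunLike.congr_fun hx' i
      rw [hm'] at this
      simp only [Finsupp.add_apply, Finsupp.smul_apply, smul_eq_mul] at this
      refine Nat.le_of_mul_le_mul_left ?_ (Nat.pos_of_ne_zero hq)
      omega
    refine hne ⟨(m', m - m'), mem_antidiagonal.2 (add_tsub_cancel_of_le hle),
      Prod.ext hm'.symm ?_⟩
    have h1 : q • m' + q • (m - m') = q • m' + x.2 := by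
      rw [← smul_add, add_tsub_cancel_of_le hle, ← hx', hm']
    exact add_left_cancel h1
  · intro x _
    rfl

theorem cartier_monoSubst {q : ℕ} (hq : q ≠ 0) (he : e ≠ 0) :
    cartier q (monoSubst (q • e) c F) = monoSubst e c F := by
  have hinj : Injective fun m : ι →₀ ℕ => q • m := fun x y hxy => by
    ext i
    have := DFunLike.congr_fun hxy i
    simpa [hq] using this
  have hqe : q • e ≠ 0 := smul_ne_zero hq he
  refine eq_monoSubst he (fun k => ?_) fun m h => ?_
  · rw [coeff_cartier, smul_comm, coeff_monoSubst_smul hqe]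
  · rw [coeff_cartier, coeff_monoSubst_of_forall_ne]
    intro k hk
    rw [smul_comm] at hk
    exact h k (hinj hk)

theorem exists_of_coeff_monoSubst_smul_ne {q : ℕ} {m : ι →₀ ℕ}
    (h : coeff m (monoSubst (q • e) c F) ≠ 0) : ∃ m', m = q • m' := by
  obtain ⟨k, rfl⟩ := exists_of_coeff_monoSubst_ne h
  exact ⟨k • e, smul_comm _ _ _⟩

theorem X_mul_pderiv_cartier [LinearOrder ι] (q : ℕ) (i : ι) (g : MvPowerSeries ι R) :
    (q : R) • (X i * pderiv R i (cartier q g)) = cartier q (X i * pderiv R i g) := by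
  ext m
  rw [coeff_smul, coeff_X_mul_pderiv, coeff_cartier, coeff_cartier, coeff_X_mul_pderiv,
    Finsupp.smul_apply, smul_eq_mul, Nat.cast_mul, mul_assoc]

end MonoSubst

/-! ### The ring of integers and Teichmüller representatives -/

/-! ### Power series supported on powers of `p` -/

section PSeries

variable {R : Type*} [CommRing R] {p : ℕ}

/-- The power series `∑ c_l t^{p^l}`. -/
def pSeries (p : ℕ) (c : ℕ → R) : PowerSeries R :=
  PowerSeries.mk fun m => if m = p ^ Nat.log p m then c (Nat.log p m) else 0

theorem coeff_pSeries_pow (hp : 1 < p) (c : ℕ → R) (l : ℕ) :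
    PowerSeries.coeff (p ^ l) (pSeries p c) = c l := by
  rw [pSeries, PowerSeries.coeff_mk, Nat.log_pow hp, if_pos rfl]

theorem coeff_pSeries_of_forall_ne {m : ℕ} (h : ∀ l, m ≠ p ^ l) (c : ℕ → R) :
    PowerSeries.coeff m (pSeries p c) = 0 := by
  rw [pSeries, PowerSeries.coeff_mk, if_neg (h _)]

theorem eq_pSeries (hp : 1 < p) {c : ℕ → R} {F : PowerSeries R}
    (h1 : ∀ l, PowerSeries.coeff (p ^ l) F = c l)
    (h2 : ∀ m, (∀ l, m ≠ p ^ l) → PowerSeries.coeff m F = 0) : F = pSeries p c := by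
  ext m
  by_cases h : ∃ l, m = p ^ l
  · obtain ⟨l, rfl⟩ := h
    rw [h1, coeff_pSeries_pow hp]
  · rw [h2 m (by simpa using h), coeff_pSeries_of_forall_ne (by simpa using h)]

theorem map_pSeries {S : Type*} [CommRing S] (hp : 1 < p) (ψ : R →+* S) (c : ℕ → R) :
    PowerSeries.map ψ (pSeries p c) = pSeries p fun l => ψ (c l) :=
  eq_pSeries hp (fun l => by rw [PowerSeries.coeff_map, coeff_pSeries_pow hp]) fun m h => by
    rw [PowerSeries.coeff_map, coeff_pSeries_of_forall_ne h, map_zero]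

theorem eulerSeries_pSeries (hp : 1 < p) (c : ℕ → R) :
    eulerSeries (pSeries p c) = pSeries p fun l => (p : R) ^ l * c l :=
  eq_pSeries hp (fun l => by
    rw [eulerSeries, PowerSeries.coeff_mk, coeff_pSeries_pow hp, Nat.cast_pow]) fun m h => by
    rw [eulerSeries, PowerSeries.coeff_mk, coeff_pSeries_of_forall_ne h, mul_zero]

theorem rescale_pSeries (hp : 1 < p) (b : R) (c : ℕ → R) :
    PowerSeries.rescale b (pSeries p c) = pSeries p fun l => b ^ p ^ l * c l :=
  eq_pSeries hp (fun l => by rw [PowerSeries.coeff_rescale, coeff_pSeries_pow hp]) fun m h => by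
    rw [PowerSeries.coeff_rescale, coeff_pSeries_of_forall_ne h, mul_zero]

theorem smul_pSeries (hp : 1 < p) (b : R) (c : ℕ → R) :
    b • pSeries p c = pSeries p fun l => b * c l :=
  eq_pSeries hp (fun l => by
    rw [PowerSeries.coeff_smul, coeff_pSeries_pow hp, smul_eq_mul]) fun m h => by
    rw [PowerSeries.coeff_smul, coeff_pSeries_of_forall_ne h, smul_zero]

theorem pSeries_eq_X (hp : 1 < p) {c : ℕ → R} (h0 : c 0 = 1) (h : ∀ l, 0 < l → c l = 0) :
    pSeries p c = PowerSeries.X := by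
  refine (eq_pSeries hp (fun l => ?_) fun m hm => ?_).symm
  · rw [PowerSeries.coeff_X]
    rcases Nat.eq_zero_or_pos l with rfl | hl
    · rw [pow_zero, if_pos rfl, h0]
    · rw [if_neg (Nat.one_lt_pow hl.ne' hp).ne', h l hl]
  · rw [PowerSeries.coeff_X, if_neg]
    rintro rfl
    exact hm 0 (by simp)

end PSeries

/-! ### The wedge product of forms -/

section Wedge

open MvPowerSeries

variable {ι : Type*} [LinearOrder ι] {R : Type*} [CommRing R]

/-- The wedge product. -/
def wedgeForm (ω η : SeriesForm ι R) (S : Finset ι) : MvPowerSeries ι R :=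
  ∑ I ∈ S.powerset, (∏ i ∈ I, ksign i (S \ I)) • (ω I * η (S \ I))

theorem ksign_disjUnion (i : ι) {I J : Finset ι} (h : Disjoint I J) :
    ksign i (I ∪ J) = ksign i I * ksign i J := by
  rw [ksign, ksign, ksign, ← pow_add, Finset.filter_union, Finset.card_union_of_disjoint]
  exact Finset.disjoint_filter_filter h

theorem wedgeForm_one (ω : SeriesForm ι R) : wedgeForm (Pi.single ∅ 1) ω = ω := by
  funext S
  rw [wedgeForm, sum_eq_single ∅]
  · simp
  · intro I _ hI
    rw [Pi.single_eq_of_ne hI, zero_mul, smul_zero]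
  · simp

theorem X_mul_pderiv_monomial (v : ι) (e : ι →₀ ℕ)
    (c : R) : X v * pderiv R v (monomial e c) = (e v : R) • monomial e c := by
  ext m
  rw [coeff_X_mul_pderiv, coeff_smul, coeff_monomial]
  split_ifs with h
  · rw [h]
  · rw [mul_zero, mul_zero]

variable [Fintype ι]

theorem wedgeForm_kw (g : ι → MvPowerSeries ι R) (ω η : SeriesForm ι R) :
    wedgeForm (kw g ω) η = kw g (wedgeForm ω η) := by
  funext S
  rw [wedgeForm, kw_apply]
  simp only [wedgeForm, kw_apply, Finset.sum_mul, smul_sum]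
  rw [Finset.sum_sigma', Finset.sum_sigma']
  refine Finset.sum_bij' (fun x _ => ⟨x.2, x.1.erase x.2⟩) (fun x _ => ⟨insert x.1 x.2, x.1⟩)
    ?_ ?_ ?_ ?_ ?_
  · rintro ⟨I, i⟩ h
    simp only [mem_sigma, mem_powerset] at h ⊢
    exact ⟨h.1 h.2, Finset.erase_subset_erase _ h.1⟩
  · rintro ⟨i, I⟩ h
    simp only [mem_sigma, mem_powerset] at h ⊢
    exact ⟨Finset.insert_subset h.1 (h.2.trans (Finset.erase_subset _ _)),
      Finset.mem_insert_self _ _⟩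
  · rintro ⟨I, i⟩ h
    simp only [mem_sigma, mem_powerset] at h
    simp [Finset.insert_erase h.2]
  · rintro ⟨i, I⟩ h
    simp only [mem_sigma, mem_powerset] at h
    have hi : i ∉ I := fun hi => notMem_erase _ _ (h.2 hi)
    simp [Finset.erase_insert hi]
  · rintro ⟨I, i⟩ h
    simp only [mem_sigma, mem_powerset] at h
    obtain ⟨hIS, hi⟩ := h
    have h1 : S.erase i \ I.erase i = S \ I := by
      ext j
      simp only [Finset.mem_sdiff, mem_erase]
      by_cases hj : j = i
      · subst hj; simp [hi]
      · simp [hj]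
    have h2 : ksign i S = ksign i I * ksign i (S \ I) := by
      rw [← ksign_disjUnion i Finset.disjoint_sdiff, Finset.union_sdiff_of_subset hIS]
    have h3 : ∏ j ∈ I, ksign j (S \ I) = ksign i (S \ I) * ∏ j ∈ I.erase i, ksign j (S \ I) :=
      (Finset.mul_prod_erase I _ hi).symm
    dsimp only
    rw [h1, h2, h3, smul_mul_assoc, smul_smul, smul_eq_mul, smul_eq_mul, mul_smul_comm, smul_smul,
      mul_assoc]
    congr 1
    · ring
    · ring

/-- The form of degree zero with coefficient `H`. -/
def constForm (H : MvPowerSeries ι R) : SeriesForm ι R := Pi.single ∅ H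

omit [LinearOrder ι] [Fintype ι] in
theorem constForm_empty [LinearOrder ι] (H : MvPowerSeries ι R) : constForm H ∅ = H :=
  Pi.single_eq_same _ _

omit [Fintype ι] in
theorem constForm_of_ne {S : Finset ι} (h : S ≠ ∅) (H : MvPowerSeries ι R) : constForm H S = 0 :=
  Pi.single_eq_of_ne h _

theorem dForm_constForm (H : MvPowerSeries ι R) :
    dForm (constForm H) = kw (fun i => pderiv R i H) (constForm 1) := by
  rw [dForm_eq, kw_eq]
  refine sum_congr rfl fun i _ => ?_
  funext S
  rw [Pi.smul_apply, extMul_apply, extMul_apply]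
  split_ifs
  · rw [smul_comm]
    congr 1
    by_cases h0 : S.erase i = ∅
    · rw [h0, constForm_empty, constForm_empty, smul_eq_mul, mul_one]
    · rw [constForm_of_ne h0, constForm_of_ne h0, map_zero, smul_zero]
  · rw [smul_zero]

theorem wedgeForm_dForm (H : MvPowerSeries ι R) (ω : SeriesForm ι R) :
    wedgeForm (dForm (constForm H)) ω = kw (fun i => pderiv R i H) ω := by
  rw [dForm_constForm, wedgeForm_kw, constForm, wedgeForm_one]

end Wedge

section Translation

open MvPowerSeries

variable {p : ℕ} [Fact p.Prime] {n r : ℕ}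

theorem wedgeSign_eq (I J : Finset (DworkVar n r)) :
    wedgeSign (p := p) I J = ((∏ i ∈ I, ksign i J : ℤ) : ℂ_[p]) := by
  have h1 : ((I ×ˢ J).filter fun ij => ij.2 < ij.1).card =
      ∑ i ∈ I, (J.filter (· < i)).card := by
    simp only [Finset.card_filter]
    rw [Finset.sum_product]
  simp only [wedgeSign, ksign]
  rw [h1, Finset.prod_pow_eq_pow_sum]
  push_cast
  rfl

theorem wedgeSign_smul (I J : Finset (DworkVar n r)) (g : DworkSeries p n r) :
    wedgeSign (p := p) I J • g = (∏ i ∈ I, ksign i J) • g := by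
  rw [wedgeSign_eq, Int.cast_smul_eq_zsmul]

theorem wedge_eq (ω η : DworkForm p n r) : wedge ω η = wedgeForm ω η := by
  funext S
  simp only [wedge, wedgeForm, wedgeSign_smul]
  refine sum_congr rfl fun I _ => ?_
  congr!

theorem formDeriv_eq (ω : DworkForm p n r) : formDeriv ω = dForm ω := by
  funext S
  rw [dForm_apply]
  simp only [formDeriv, LinearMap.pi_apply, LinearMap.sum_apply, LinearMap.smul_apply,
    LinearMap.comp_apply, LinearMap.proj_apply, wedgeSign_smul, Finset.prod_singleton]
  refine sum_congr rfl fun i _ => ?_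
  rw [show ksign i S = ksign i (S.erase i) from (ksign_erase_self i S).symm]
  congr!

theorem zeroForm_eq (H : DworkSeries p n r) : zeroForm H = constForm H := by
  rw [zeroForm, constForm]
  congr!

theorem zeroForm_empty (H : DworkSeries p n r) : (zeroForm H : DworkForm p n r) ∅ = H := by
  rw [zeroForm_eq, constForm_empty]

theorem zeroForm_of_ne {J : Finset (DworkVar n r)} (h : J ≠ ∅) (H : DworkSeries p n r) :
    (zeroForm H : DworkForm p n r) J = 0 := by
  rw [zeroForm_eq, constForm_of_ne h]

theorem wedge_dForm_zeroForm (H : DworkSeries p n r) (ω : DworkForm p n r) :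
    wedge (formDeriv (zeroForm H)) ω = kw (fun i => pderiv ℂ_[p] i H) ω := by
  rw [wedge_eq, formDeriv_eq, zeroForm_eq, wedgeForm_dForm]

end Translation

section CohomologyClasses

variable {R V W : Type*} [CommRing R] [AddCommGroup V] [Module R V] [AddCommGroup W] [Module R W]
  {C : ℕ → Submodule R V} {d : ℕ → V →ₗ[R] V} {C' : ℕ → Submodule R W} {d' : ℕ → W →ₗ[R] W}
  {k l : ℕ}

theorem mem_coboundaries_succ {ω : V} : ω ∈ coboundaries C d (k + 1) ↔ ∃ σ ∈ C k, d k σ = ω := Iff.rfl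

theorem mem_coboundaries_zero {ω : V} : ω ∈ coboundaries C d 0 ↔ ω = 0 := Iff.rfl

theorem mem_cocycles {ω : V} : ω ∈ cocycles C d k ↔ ω ∈ C k ∧ d k ω = 0 := Iff.rfl

/-- A cocycle that freely generates the cocycles modulo the coboundaries. -/
structure IsFreeGenerator (C : ℕ → Submodule R V) (d : ℕ → V →ₗ[R] V) (k : ℕ) (x : V) : Prop where
  mem : x ∈ cocycles C d k
  span : ∀ ω ∈ cocycles C d k, ∃ a : R, ω - a • x ∈ coboundaries C d k
  free : ∀ a : R, a • x ∈ coboundaries C d k → a = 0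

theorem cohClass_eq_iff (ω η : cocycles C d k) :
    cohClass C d k ω = cohClass C d k η ↔ (ω : V) - η ∈ coboundaries C d k := by
  rw [cohClass, cohClass, Submodule.Quotient.eq]; rfl

theorem cohClass_smul (a : R) (ω : cocycles C d k) :
    cohClass C d k (a • ω) = a • cohClass C d k ω := rfl

theorem IsFreeGenerator.exists_basis {x : V} (h : IsFreeGenerator C d k x) :
    ∃ B : Basis Unit R (Cohomology C d k), IsClassOf C d k x (B ()) := by
  let b : Unit → Cohomology C d k := fun _ => cohClass C d k ⟨x, h.mem⟩
  have hl : LinearIndependent R b := by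
    refine Fintype.linearIndependent_iff.2 fun g ha i => ?_
    rw [Fintype.sum_unique] at ha
    change g i • cohClass C d k ⟨x, h.mem⟩ = 0 at ha
    rw [← cohClass_smul] at ha
    have h1 := (cohClass_eq_iff (g i • ⟨x, h.mem⟩) 0).1 ha
    rw [Submodule.coe_zero, sub_zero] at h1
    exact h.free _ h1
  have hs : ⊤ ≤ Submodule.span R (range b) := by
    rintro y -
    obtain ⟨ω, rfl⟩ := mk_surjective _ y
    obtain ⟨a, ha⟩ := h.span ω ω.2
    have h1 : cohClass C d k ω = a • b () := by
      rw [← cohClass_smul, cohClass_eq_iff]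
      exact ha
    change cohClass C d k ω ∈ _
    rw [h1]
    exact Submodule.smul_mem _ _ (Submodule.subset_span ⟨(), rfl⟩)
  exact ⟨Basis.mk hl hs, h.mem, by rw [Basis.mk_apply]⟩

theorem exists_isInducedMap (φ : V →ₗ[R] W) (h : ∀ ω ∈ cocycles C d k, φ ω ∈ cocycles C' d' l)
    (h' : ∀ ω ∈ coboundaries C d k, φ ω ∈ coboundaries C' d' l) :
    ∃ Φ : Cohomology C d k →ₗ[R] Cohomology C' d' l, IsInducedMap C d k C' d' l φ Φ :=
  ⟨Submodule.mapQ _ _ (φ.restrict h) fun ω hω => h' ω hω, fun ω => ⟨h ω ω.2, rfl⟩⟩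

theorem IsInducedMap.apply_basis {φ : V →ₗ[R] W}
    {Φ : Cohomology C d k →ₗ[R] Cohomology C' d' l} (hΦ : IsInducedMap C d k C' d' l φ Φ)
    {x : V} {y : W} {c : R} {X : Cohomology C d k} {Y : Cohomology C' d' l}
    (hx : IsClassOf C d k x X) (hy : IsClassOf C' d' l y Y)
    (h : φ x - c • y ∈ coboundaries C' d' l) : Φ X = c • Y := by
  obtain ⟨hx, rfl⟩ := hx
  obtain ⟨hy, rfl⟩ := hy
  obtain ⟨h1, h2⟩ := hΦ ⟨x, hx⟩
  rw [h2, ← cohClass_smul, cohClass_eq_iff]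
  exact h

theorem toMatrix_unit_eq {M N : Type*} [AddCommGroup M] [Module R M] [AddCommGroup N] [Module R N]
    (B : Basis Unit R M) (B' : Basis Unit R N) {Φ : M →ₗ[R] N} {c : R}
    (h : Φ (B ()) = c • B' ()) : toMatrix B B' Φ = of fun _ _ => c := by
  ext i j
  rw [LinearMap.toMatrix_apply, h, LinearEquiv.map_smul]
  simp

theorem IsInducedMap.comp_eq {t : V → W} {α : V → V} {α' : W → W}
    {Θ : Cohomology C d k →ₗ[R] Cohomology C' d' l} {A : End R (Cohomology C d k)}
    {A' : End R (Cohomology C' d' l)} (hΘ : IsInducedMap C d k C' d' l t Θ)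
    (hA : IsInducedMap C d k C d k α A) (hA' : IsInducedMap C' d' l C' d' l α' A')
    (h : ∀ ω, t (α ω) = α' (t ω)) : Θ ∘ₗ A = A' ∘ₗ Θ := by
  refine LinearMap.ext fun x => ?_
  obtain ⟨ω, rfl⟩ := mk_surjective _ x
  obtain ⟨h1, e1⟩ := hA ω
  obtain ⟨h2, e2⟩ := hΘ ⟨_, h1⟩
  obtain ⟨h3, e3⟩ := hΘ ω
  obtain ⟨h4, e4⟩ := hA' ⟨_, h3⟩
  change Θ (A (cohClass C d k ω)) = A' (Θ (cohClass C d k ω))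
  rw [e1, e2, e3, e4]
  congr 2
  exact h ω

theorem bijective_of_apply_basis {M N : Type*} [AddCommGroup M] [Module R M] [AddCommGroup N]
    [Module R N] (B : Basis Unit R M) (B' : Basis Unit R N) {Φ : M →ₗ[R] N} {c : R}
    (hc : IsUnit c) (h : Φ (B ()) = c • B' ()) : Bijective Φ := by
  obtain ⟨c, rfl⟩ := hc
  have h1 : Φ = B.equiv (B'.unitsSMul fun _ => c) (Equiv.refl _) :=
    B.ext fun _ => by simpa [Basis.unitsSMul_apply, Units.smul_def] using h
  rw [h1]
  exact LinearEquiv.bijective _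

theorem charpolyRev_unit (c : R) : (of fun _ _ => c : Matrix Unit Unit R).charpolyRev =
      1 - Polynomial.C c * Polynomial.X := by
  rw [Matrix.charpolyRev, Matrix.det_unique, Matrix.sub_apply, Matrix.one_apply_eq,
    Matrix.smul_apply, Matrix.map_apply, Matrix.of_apply, smul_eq_mul, mul_comm]

/-- A linear map that induces a map on cohomology. -/
def MapsCohomology (C : ℕ → Submodule R V) (d : ℕ → V →ₗ[R] V) (k : ℕ)
    (C' : ℕ → Submodule R W) (d' : ℕ → W →ₗ[R] W) (l : ℕ) (φ : V →ₗ[R] W) : Prop :=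
  (∀ ω ∈ cocycles C d k, φ ω ∈ cocycles C' d' l) ∧
    ∀ ω ∈ coboundaries C d k, φ ω ∈ coboundaries C' d' l

theorem exists_bases_toMatrix_eq {x : V} {y : W} {t : V →ₗ[R] W} {c : R}
    (hx : IsFreeGenerator C d k x) (hy : IsFreeGenerator C' d' l y)
    (ht : MapsCohomology C d k C' d' l t) (hc : t x - c • y ∈ coboundaries C' d' l) :
    ∃ (B : Basis Unit R (Cohomology C d k)) (B' : Basis Unit R (Cohomology C' d' l))
      (Θ : Cohomology C d k →ₗ[R] Cohomology C' d' l),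
      IsClassOf C d k x (B ()) ∧ IsClassOf C' d' l y (B' ()) ∧ IsInducedMap C d k C' d' l t Θ ∧
        toMatrix B B' Θ = of fun _ _ => c := by
  obtain ⟨B, hB⟩ := hx.exists_basis
  obtain ⟨B', hB'⟩ := hy.exists_basis
  obtain ⟨Θ, hΘ⟩ := exists_isInducedMap t ht.1 ht.2
  exact ⟨B, B', Θ, hB, hB', hΘ, toMatrix_unit_eq B B' (hΘ.apply_basis hB hB' hc)⟩

theorem exists_bases_charpolyRev_eq {x : V} {y : W} {t : V →ₗ[R] W}
    {α : V →ₗ[R] V} {α' : W →ₗ[R] W} {a c : R}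
    (hx : IsFreeGenerator C d k x) (hy : IsFreeGenerator C' d' l y)
    (ht : MapsCohomology C d k C' d' l t) (hα : MapsCohomology C d k C d k α)
    (hα' : MapsCohomology C' d' l C' d' l α') (h : ∀ ω, t (α ω) = α' (t ω)) (hc0 : IsUnit c)
    (hc : t x - c • y ∈ coboundaries C' d' l) (ha : α x - a • x ∈ coboundaries C d k) :
    ∃ (B : Basis Unit R (Cohomology C d k)) (B' : Basis Unit R (Cohomology C' d' l))
      (Θ : Cohomology C d k →ₗ[R] Cohomology C' d' l)
      (A : End R (Cohomology C d k)) (A' : End R (Cohomology C' d' l)),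
      IsClassOf C d k x (B ()) ∧ IsClassOf C' d' l y (B' ()) ∧ IsInducedMap C d k C' d' l t Θ ∧
        IsInducedMap C d k C d k α A ∧ IsInducedMap C' d' l C' d' l α' A' ∧
        toMatrix B B' Θ = of (fun _ _ => c) ∧ Bijective Θ ∧ Θ ∘ₗ A = A' ∘ₗ Θ ∧
        (toMatrix B B A).charpolyRev = 1 - Polynomial.C a * Polynomial.X := by
  obtain ⟨B, hB⟩ := hx.exists_basis
  obtain ⟨B', hB'⟩ := hy.exists_basis
  obtain ⟨Θ, hΘ⟩ := exists_isInducedMap t ht.1 ht.2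
  obtain ⟨A, hA⟩ := exists_isInducedMap α hα.1 hα.2
  obtain ⟨A', hA'⟩ := exists_isInducedMap α' hα'.1 hα'.2
  have h1 := hΘ.apply_basis hB hB' hc
  exact ⟨B, B', Θ, A, A', hB, hB', hΘ, hA, hA', toMatrix_unit_eq B B' h1,
    bijective_of_apply_basis B B' hc0 h1, hΘ.comp_eq hA hA' h,
    by rw [toMatrix_unit_eq B B (hA.apply_basis hB hB ha), charpolyRev_unit]⟩

end CohomologyClasses

section ThetaComplex

variable {R V : Type*} [CommRing R] [AddCommGroup V] [Module R V] {C Ĉ : ℕ → Submodule R V}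
  {d d' t : ℕ → V →ₗ[R] V} {r : ℕ}

theorem isFreeGenerator_zero {x : V} (hC : Ĉ 0 = Submodule.span R {x}) (hd : d' 0 = 0)
    (hx : ∀ a : R, a • x = 0 → a = 0) : IsFreeGenerator Ĉ d' 0 x where
  mem := mem_cocycles.2 ⟨hC ▸ Submodule.mem_span_singleton_self x, by rw [hd]; rfl⟩
  span ω hω := by
    obtain ⟨a, ha⟩ := Submodule.mem_span_singleton.1 (hC ▸ hω.1)
    exact ⟨a, mem_coboundaries_zero.2 (sub_eq_zero.2 ha.symm)⟩
  free a ha := hx a (mem_coboundaries_zero.1 ha)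

/-- Two complexes `C`, `Ĉ` and maps `t : C → Ĉ` with the kernel of `t` in degree `k` equal to
`Ĉ^{k+1}` (up to the sign of the differential), `C` being acyclic below degree `2 r`. -/
structure IsThetaComplex (C Ĉ : ℕ → Submodule R V) (d d' t : ℕ → V →ₗ[R] V) (r : ℕ) : Prop where
  d_mem : ∀ {k ω}, ω ∈ C k → d k ω ∈ C (k + 1)
  d_d : ∀ {k ω}, ω ∈ C k → d (k + 1) (d k ω) = 0
  map_t : ∀ k, (C k).map (t k) = Ĉ k
  t_d : ∀ {k ω}, ω ∈ C k → t (k + 1) (d k ω) = d' k (t k ω)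
  t_eq_zero : ∀ {k ω}, ω ∈ C k → (t k ω = 0 ↔ ω ∈ Ĉ (k + 1))
  hat_le : ∀ k, Ĉ (k + 1) ≤ C k
  hat_d : ∀ {k z}, z ∈ Ĉ (k + 1) → d' (k + 1) z = -d k z
  exact : ∀ {k ω}, k < 2 * r → ω ∈ C k → d k ω = 0 → ω ∈ coboundaries C d k

namespace IsThetaComplex

variable (h : IsThetaComplex C Ĉ d d' t r)
include h

theorem t_mem {k : ℕ} {ω : V} (hω : ω ∈ C k) : t k ω ∈ Ĉ k := h.map_t k ▸ ⟨ω, hω, rfl⟩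

theorem t_cocycle {k : ℕ} {ω : V} (hω : ω ∈ cocycles C d k) : t k ω ∈ cocycles Ĉ d' k :=
  mem_cocycles.2 ⟨h.t_mem hω.1, by rw [← h.t_d hω.1, (mem_cocycles.1 hω).2, map_zero]⟩

theorem t_coboundary {k : ℕ} {ω : V} (hω : ω ∈ coboundaries C d k) :
    t k ω ∈ coboundaries Ĉ d' k := by
  cases k with
  | zero => rw [mem_coboundaries_zero.1 hω, map_zero]; exact zero_mem _
  | succ k =>
    obtain ⟨σ, hσ, rfl⟩ := hω
    exact ⟨t k σ, h.t_mem hσ, (h.t_d hσ).symm⟩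

theorem mem_hat_coboundaries_iff {k : ℕ} {ω : V} :
    ω ∈ coboundaries Ĉ d' (k + 2) ↔ ∃ σ ∈ Ĉ (k + 1), d k σ = ω := by
  constructor
  · rintro ⟨σ, hσ, rfl⟩
    exact ⟨-σ, neg_mem hσ, by rw [h.hat_d hσ, map_neg]⟩
  · rintro ⟨σ, hσ, rfl⟩
    exact ⟨-σ, neg_mem hσ, by rw [h.hat_d (neg_mem hσ), map_neg, neg_neg]⟩

theorem exists_of_t_sub_mem {k : ℕ} {ω τ : V} (hω : ω ∈ C k) (hτ : τ ∈ C k)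
    (hc : t k ω - t k τ ∈ coboundaries Ĉ d' k) : ∃ ρ ∈ Ĉ (k + 1), d k ω = d k τ + d k ρ := by
  have key : ∃ ν ∈ coboundaries C d k, t k (ω - τ - ν) = 0 := by
    cases k with
    | zero => exact ⟨0, zero_mem _, by rw [sub_zero, map_sub]; exact hc⟩
    | succ k =>
      obtain ⟨μ, hμ, hμt⟩ := hc
      rw [← h.map_t k] at hμ
      obtain ⟨ν, hν, rfl⟩ := hμ
      exact ⟨d k ν, ⟨ν, hν, rfl⟩, by rw [map_sub, map_sub, h.t_d hν, hμt, sub_self]⟩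
  obtain ⟨ν, hν, h0⟩ := key
  have h1 : ν ∈ C k ∧ d k ν = 0 := by
    cases k with
    | zero => rw [mem_coboundaries_zero.1 hν]; exact ⟨zero_mem _, map_zero _⟩
    | succ k =>
      obtain ⟨σ, hσ, rfl⟩ := hν
      exact ⟨h.d_mem hσ, h.d_d hσ⟩
  refine ⟨ω - τ - ν, (h.t_eq_zero (sub_mem (sub_mem hω hτ) h1.1)).1 h0, ?_⟩
  rw [map_sub, map_sub, h1.2]
  abel

theorem exists_seq {z : V} (hz : z ∈ cocycles Ĉ d' 0) : ∃ η : ℕ → V, η 0 = z ∧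
    ∀ k, η (k + 1) ∈ Ĉ (2 * k + 2) ∧ ∃ τ ∈ C (2 * k), t (2 * k) τ = η k ∧
      η (k + 1) = d (2 * k) τ := by
  have key : ∀ (k : ℕ) (z : V), ∃ z', z ∈ cocycles Ĉ d' (2 * k) →
      z' ∈ cocycles Ĉ d' (2 * k + 2) ∧ ∃ τ ∈ C (2 * k), t (2 * k) τ = z ∧ z' = d (2 * k) τ := by
    intro k z
    by_cases hz : z ∈ cocycles Ĉ d' (2 * k)
    · have h1 : z ∈ Ĉ (2 * k) := hz.1
      rw [← h.map_t] at h1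
      obtain ⟨τ, hτ, hτz⟩ := h1
      have h2 : d (2 * k) τ ∈ Ĉ (2 * k + 1 + 1) := by
        rw [← h.t_eq_zero (h.d_mem hτ), h.t_d hτ, hτz]
        exact hz.2
      exact ⟨d (2 * k) τ, fun _ => ⟨mem_cocycles.2 ⟨h2, by
        rw [h.hat_d h2, h.d_d hτ, neg_zero]⟩, τ, hτ, hτz, rfl⟩⟩
    · exact ⟨0, fun h0 => absurd h0 hz⟩
  choose F hF using key
  let η : ℕ → V := fun k => Nat.rec z F k
  have hη : ∀ k, η k ∈ cocycles Ĉ d' (2 * k) := fun k => by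
    induction k with
    | zero => exact hz
    | succ k ih => exact (hF k (η k) ih).1
  exact ⟨η, rfl, fun k => ⟨(hη (k + 1)).1, (hF k (η k) (hη k)).2⟩⟩

theorem mapsCohomology (k : ℕ) : MapsCohomology C d k Ĉ d' k (t k) :=
  ⟨fun _ => h.t_cocycle, fun _ => h.t_coboundary⟩

variable {η : ℕ → V} (hη : ∀ k < r, ∃ τ ∈ C (2 * k), t (2 * k) τ = η k ∧
  η (k + 1) - d (2 * k) τ ∈ (Ĉ (2 * k + 1)).map (d (2 * k)))
include hη

theorem step {k : ℕ} (hk : k < r) {ω : V} (hω : ω ∈ C (2 * k)) {b : R}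
    (hc : t (2 * k) ω - b • η k ∈ coboundaries Ĉ d' (2 * k)) :
    d (2 * k) ω - b • η (k + 1) ∈ coboundaries Ĉ d' (2 * (k + 1)) := by
  obtain ⟨τ, hτ, hτη, ρ, hρ, hρη⟩ := hη k hk
  rw [← hτη, ← map_smul] at hc
  obtain ⟨ρ', hρ', h1⟩ := h.exists_of_t_sub_mem hω (Submodule.smul_mem _ _ hτ) hc
  refine (h.mem_hat_coboundaries_iff (k := 2 * k)).2 ⟨ρ' - b • ρ,
    sub_mem hρ' (Submodule.smul_mem _ _ hρ), ?_⟩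
  rw [h1, map_sub, map_smul, map_smul, hρη, smul_sub]
  abel

theorem isFreeGenerator (h0 : IsFreeGenerator Ĉ d' 0 (η 0)) {k : ℕ} (hk : k ≤ r) :
    IsFreeGenerator Ĉ d' (2 * k) (η k) := by
  induction k with
  | zero => exact h0
  | succ k ih =>
    have ih := ih (by omega)
    obtain ⟨τ, hτ, hτη, ρ, hρ, hρη⟩ := hη k (by omega)
    have hη1 : η (k + 1) = d (2 * k) (τ + ρ) := by rw [map_add, hρη]; abel
    have hdτ : d (2 * k) τ ∈ Ĉ (2 * k + 2) ∧ d (2 * k) ρ ∈ Ĉ (2 * k + 2) := by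
      constructor
      · refine (h.t_eq_zero (h.d_mem hτ)).1 ?_
        rw [h.t_d hτ, hτη]
        exact ih.mem.2
      · refine (h.t_eq_zero (h.d_mem (h.hat_le _ hρ))).1 ?_
        rw [h.t_d (h.hat_le _ hρ), (h.t_eq_zero (h.hat_le _ hρ)).2 hρ, map_zero]
    have hmem : η (k + 1) ∈ cocycles Ĉ d' (2 * k + 2) := by
      have h1 : η (k + 1) ∈ Ĉ (2 * k + 2) := by
        rw [hη1, map_add]
        exact add_mem hdτ.1 hdτ.2
      refine mem_cocycles.2 ⟨h1, ?_⟩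
      rw [h.hat_d h1, hη1, h.d_d (add_mem hτ (h.hat_le _ hρ)), neg_zero]
    refine ⟨hmem, fun z hz => ?_, fun a ha => ?_⟩
    · have hz1 : z ∈ C (2 * k + 1) := h.hat_le _ hz.1
      have hz2 : d (2 * k + 1) z = 0 := by
        have : d' (2 * k + 1 + 1) z = 0 := (mem_cocycles.1 hz).2
        have hz' : z ∈ Ĉ (2 * k + 1 + 1) := hz.1
        rwa [h.hat_d hz', neg_eq_zero] at this
      obtain ⟨σ, hσ, rfl⟩ := h.exact (by omega) hz1 hz2
      obtain ⟨a, ha⟩ := ih.span (t (2 * k) σ) (mem_cocycles.2 ⟨h.t_mem hσ, by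
        rw [← h.t_d hσ]
        exact (h.t_eq_zero hz1).2 hz.1⟩)
      exact ⟨a, h.step hη (by omega) hσ ha⟩
    · obtain ⟨ρ', hρ', h1⟩ := (h.mem_hat_coboundaries_iff (k := 2 * k)).1 ha
      replace h1 : d (2 * k) ρ' = a • η (k + 1) := h1
      replace hρ' : ρ' ∈ Ĉ (2 * k + 1) := hρ'
      have hm : ρ' - a • ρ ∈ C (2 * k) := h.hat_le _ (sub_mem hρ' (Submodule.smul_mem _ a hρ))
      have h2 := h.exact (k := 2 * k) (by omega) (sub_mem (Submodule.smul_mem _ a hτ) hm) (by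
        rw [map_sub, map_sub, h1, hη1, ← map_smul, smul_add, map_add, map_smul, map_smul]
        abel)
      have h3 := h.t_coboundary h2
      rw [map_sub, (h.t_eq_zero hm).2 (sub_mem hρ' (Submodule.smul_mem _ a hρ)), sub_zero,
        map_smul, hτη] at h3
      exact ih.free a h3

theorem t_sub_mem {ω : ℕ → V} {e : ℕ → R} {b : R} (hω : ∀ k, ω k ∈ C (2 * k)) (h0 : t 0 (ω 0) = b • η 0)
    (he : ∀ k, t (2 * (k + 1)) (ω (k + 1)) = e k • d (2 * k) (ω k)) {k : ℕ} (hk : k ≤ r) :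
    t (2 * k) (ω k) - (b * ∏ i ∈ Finset.range k, e i) • η k ∈ coboundaries Ĉ d' (2 * k) := by
  induction k with
  | zero =>
    rw [Finset.prod_range_zero, mul_one]
    exact mem_coboundaries_zero.2 (sub_eq_zero.2 h0)
  | succ k ih =>
    have h1 := Submodule.smul_mem _ (e k) (h.step hη (by omega) (hω k) (ih (by omega)))
    rwa [smul_sub, ← he, smul_smul, mul_left_comm, mul_comm (e k), ← Finset.prod_range_succ] at h1

end IsThetaComplex

end ThetaComplex

section Good

open MvPowerSeries

variable {n r : ℕ} {R : Type*} [CommRing R] {π : R} {d : Fin r → ℕ} {i : ℤ}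
  {ω : VarForm n r R}

theorem IsNull.X_mul {g : VarSeries n r R} (hg : IsNull π g) (v : DworkVar n r) :
    IsNull π (X v * g) := fun N => by
  refine ((hg N).image (single v 1 + ·)).subset fun m hm => ?_
  rw [Set.mem_ofPred_eq, X, coeff_monomial_mul, one_mul] at hm
  split_ifs at hm with hv
  · exact ⟨_, hm, add_tsub_cancel_of_le hv⟩
  · exact absurd (dvd_zero _) hm

theorem IsGood.eulerContr (h : IsGood π d (i + 1) ω) : IsGood π d i (eulerContr R d ω) := by
  refine ⟨?_, fun J => ?_, fun J m hm => ?_⟩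
  · have := h.1.kc fun v => C (dworkWt d v : R) * X v
    rwa [add_sub_cancel_right] at this
  · rw [_root_.eulerContr, kc_apply]
    refine IsNull.sum fun v _ => IsNull.zsmul ?_ _
    rw [smul_eq_mul, mul_assoc, ← smul_eq_C_mul]
    exact ((h.2.1 _).X_mul v).smul _
  · rw [_root_.eulerContr, kc_apply, map_sum] at hm
    obtain ⟨v, hv, h1⟩ := exists_ne_zero_of_sum_ne_zero hm
    rw [map_zsmul] at h1
    replace h1 := right_ne_zero_of_smul h1
    rw [smul_eq_mul, mul_assoc, coeff_C_mul] at h1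
    replace h1 := right_ne_zero_of_mul h1
    rw [X, coeff_monomial_mul, one_mul] at h1
    split_ifs at h1 with hle
    · have h2 := h.2.2 _ _ h1
      rw [sum_insert (by simpa using hv)] at h2
      have h3 : weight (dworkWt d) m = dworkWt d v +
          weight (dworkWt d) (m - single v 1) := by
        conv_lhs => rw [← add_tsub_cancel_of_le hle]
        rw [map_add, weight_single, one_smul]
      linarith
    · exact absurd rfl h1

end Good

section General

open MvPowerSeries

theorem list_sum_pow_length {A : Type*} [Ring A] (L : List A)
    (hc : ∀ a ∈ L, ∀ b ∈ L, Commute a b) (hs : ∀ a ∈ L, a * a = 0) :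
    L.sum ^ L.length = L.length.factorial • L.prod ∧ L.sum ^ (L.length + 1) = 0 := by
  induction L with
  | nil => simp
  | cons b L ih =>
    obtain ⟨h1, h2⟩ := ih (fun a ha c hc' => hc a (by simp [ha]) c (by simp [hc']))
      (fun a ha => hs a (by simp [ha]))
    have hb : Commute b L.sum := Commute.list_sum_right _ _ fun a ha => hc b (by simp) a (by simp [ha])
    have hbb : b * b = 0 := hs b (by simp)
    have key : ∀ m : ℕ, (b + L.sum) ^ (m + 1) = L.sum ^ (m + 1) + (m + 1) • (b * L.sum ^ m) := by
      intro m
      induction m with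
      | zero => simp [add_comm]
      | succ m ih =>
        have h3 : b * L.sum ^ m * b = 0 := by
          rw [mul_assoc, ← (hb.pow_right m).eq, ← mul_assoc, hbb, zero_mul]
        rw [pow_succ, ih, add_mul, mul_add, mul_add, smul_mul_assoc, h3, smul_mul_assoc, mul_assoc,
          ← pow_succ, ← pow_succ, ← (hb.pow_right (m + 1)).eq, smul_zero, zero_add,
          succ_nsmul _ (m + 1)]
        abel
    rw [List.sum_cons, List.length_cons, key, key, h2, zero_add, pow_succ L.sum, h2, h1, zero_mul,
      mul_zero, smul_zero, add_zero, List.prod_cons, Nat.factorial_succ, mul_smul, mul_smul_comm]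
    exact ⟨rfl, rfl⟩

variable {ι R : Type*} [LinearOrder ι] [CommRing R]

theorem weight_mul_X_mul_pderiv [Fintype ι] (w : ι → ℤ) {c : ℤ} {g : MvPowerSeries ι R}
    (hg : ∀ m, coeff m g ≠ 0 → weight w m = c) :
    ∑ v, C (w v : R) * X v * pderiv R v g = C (c : R) * g := by
  ext m
  rw [map_sum, coeff_C_mul]
  simp only [mul_assoc, coeff_C_mul, coeff_X_mul_pderiv]
  simp only [← mul_assoc, ← Finset.sum_mul]
  by_cases h0 : coeff m g = 0
  · rw [h0, mul_zero, mul_zero]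
  · rw [← hg m h0, weight_apply, sum_fintype _ _ (by simp)]
    push_cast
    congr 1
    exact sum_congr rfl fun v _ => by rw [nsmul_eq_mul]; push_cast; ring

variable [Fintype ι]

theorem kw_smul_left {A M : Type*} [CommRing A] [AddCommGroup M] [Module A M] (c : A) (e : ι → A)
    (ω : Finset ι → M) : kw (fun i => c * e i) ω = c • kw e ω := by
  simp only [kw_eq, smul_sum, mul_smul]

theorem kw_kw_congr {A M : Type*} [CommRing A] [AddCommGroup M] [Module A M] {y : ι}
    {a a' s s' : ι → A} (hs : ∀ v, v ≠ y → s v = 0) (hs' : ∀ v, v ≠ y → s' v = 0)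
    (hy : s y = s' y) (ha : ∀ v, v ≠ y → a v = a' v) (ω : Finset ι → M) :
    kw a (kw s ω) = kw a' (kw s' ω) := by
  have h0 : s = s' := funext fun v => by
    by_cases hv : v = y
    · rw [hv, hy]
    · rw [hs v hv, hs' v hv]
  have h1 : kw s ω = s y • extMul A y ω := by
    rw [kw_eq, sum_eq_single y (fun v _ hv => by rw [hs v hv, zero_smul]) (by simp)]
  rw [← h0, h1, kw_eq, kw_eq]
  refine sum_congr rfl fun v _ => ?_
  by_cases hv : v = y
  · rw [hv, map_smul, extMul_self, smul_zero, smul_zero, smul_zero]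
  · rw [ha v hv]

theorem kw_kw_X_pderiv {h : MvPowerSeries ι R} (y : ι) (ω : SeriesForm ι R) :
    kw (fun v => pderiv R v (X y * h : MvPowerSeries ι R)) ω =
      (X y : MvPowerSeries ι R) • kw (fun v => pderiv R v h) ω + h • kw (fun v => pderiv R v (X y : MvPowerSeries ι R)) ω := by
  rw [← kw_smul_left, ← kw_smul_left, ← kw_add_left]
  congr 2
  funext v
  rw [leibniz]; rfl

theorem finsum_coeff_kw {a : ℕ → ι → MvPowerSeries ι R} {b : ι → MvPowerSeries ι R}
    (hfin : ∀ v m, (Function.support fun l => coeff m (a l v)).Finite)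
    (hb : ∀ v m, ∑ᶠ l, coeff m (a l v) = coeff m (b v)) (c : Finset ι → R) (J : Finset ι)
    (m : ι →₀ ℕ) : ∑ᶠ l, coeff m (kw (a l) (fun J => C (c J)) J) =
      coeff m (kw b (fun J => C (c J)) J) := by
  have h1 : ∀ e : ι → MvPowerSeries ι R, coeff m (kw e (fun J => C (c J)) J) =
      ∑ v ∈ J, coeff m (e v) * ((ksign v J : R) * c (J.erase v)) := fun e => by
    rw [kw_apply, map_sum]
    refine sum_congr rfl fun v _ => ?_
    rw [map_zsmul, smul_eq_mul, coeff_mul_C, zsmul_eq_mul]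
    ring
  simp only [h1]
  rw [finsum_sum_comm]
  · refine sum_congr rfl fun v _ => ?_
    rw [← hb, finsum_mul' _ _ (hfin v m)]
  · exact fun v _ => (hfin v m).subset fun l hl => left_ne_zero_of_mul hl

/-- Multiplication by a fixed form on the right is linear. -/
def wedgeRight (η : SeriesForm ι R) : (SeriesForm ι R) →ₗ[R] (SeriesForm ι R) where
  toFun ω := wedgeForm ω η
  map_add' ω ω' := by
    funext S
    simp only [wedgeForm, Pi.add_apply, add_mul, smul_add, sum_add_distrib]
  map_smul' c ω := by
    funext S
    simp only [wedgeForm, Pi.smul_apply, RingHom.id_apply, smul_sum, smul_mul_assoc]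
    exact sum_congr rfl fun I _ => smul_comm _ _ _

theorem kw_constForm_one (s : ι → MvPowerSeries ι R) (c : ι → R) (hs : ∀ v, s v = C (c v)) :
    ∃ c' : Finset ι → R, kw s (constForm 1) = fun J => C (c' J) := by
  refine ⟨kw c (Pi.single ∅ 1), ?_⟩
  have h1 : s = fun v => C (c v) := funext hs
  rw [h1, ← kw_ringHom]
  congr 1
  funext J
  by_cases hJ : J = ∅
  · rw [hJ, constForm_empty, Pi.single_eq_same, map_one]
  · rw [constForm_of_ne hJ, Pi.single_eq_of_ne hJ, map_zero]

end General

section Weight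

open MvPowerSeries

variable {n r : ℕ} {R : Type*} [CommRing R]

theorem weight_of_coeff_kw_ne {w : DworkVar n r → ℤ} {a b : ℤ} {G : DworkVar n r → VarSeries n r R}
    (hG : ∀ v m, coeff m (G v) ≠ 0 → weight w m + w v = a) {ω : VarForm n r R}
    (hω : ∀ J m, coeff m (ω J) ≠ 0 → weight w m + ∑ j ∈ J, w j = b)
    {J : Finset (DworkVar n r)} {m : DworkVar n r →₀ ℕ} (hm : coeff m (kw G ω J) ≠ 0) :
    weight w m + ∑ j ∈ J, w j = a + b := by
  rw [kw_apply, map_sum] at hm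
  obtain ⟨v, hv, h1⟩ := exists_ne_zero_of_sum_ne_zero hm
  rw [map_zsmul, smul_eq_mul, coeff_mul] at h1
  obtain ⟨x, hx, h2⟩ := exists_ne_zero_of_sum_ne_zero (right_ne_zero_of_smul h1)
  rw [← mem_antidiagonal.1 hx, map_add, ← hG v x.1 (left_ne_zero_of_mul h2),
    ← hω _ x.2 (right_ne_zero_of_mul h2), ← sum_erase_add_apply w hv]
  ring

theorem isNull_kw {π : R} {G : DworkVar n r → VarSeries n r R}
    (hG : ∀ v, IsNull π (G v)) {ω : VarForm n r R}
    (hω : ∀ J, IsNull π (ω J)) (J : Finset (DworkVar n r)) : IsNull π (kw G ω J) := by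
  have := isNull_twD (c := 0) hG hω J
  rwa [twD_apply, zero_smul, zero_add] at this

theorem constForm_C_mem {π : R} (d : Fin r → ℕ) (c : R) :
    IsGood π d 0 (constForm (C c : VarSeries n r R)) := by
  classical
  refine ⟨fun J hJ => constForm_of_ne (by rintro rfl; simp at hJ) _, fun J N => ?_,
    fun J m hm => ?_⟩
  · refine (Set.finite_singleton 0).subset fun m hm => ?_
    by_contra h0
    refine hm ?_
    by_cases hJ : J = ∅
    · rw [hJ, constForm_empty, coeff_C, if_neg (by exact h0)]; exact dvd_zero _
    · rw [constForm_of_ne hJ, map_zero]; exact dvd_zero _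
  · by_cases hJ : J = ∅
    · rw [hJ, constForm_empty, coeff_C] at hm
      have h0 : m = 0 := by by_contra h0; exact hm (if_neg h0)
      rw [h0, hJ, map_zero, Finset.sum_empty, add_zero]
    · rw [constForm_of_ne hJ, map_zero] at hm
      exact absurd rfl hm

theorem isNull_C_pderiv_X (π : R) (y v : DworkVar n r) :
    IsNull π (pderiv R v (X y : VarSeries n r R)) := by
  classical
  rw [pderiv_X, Pi.single_apply]
  split_ifs with hv
  · have := (constForm_C_mem (n := n) (r := r) (π := π) (fun _ => 0) 1).2.1 ∅
    rwa [constForm_empty, map_one] at this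
  · exact .zero

end Weight

section ArtinHasse

open PowerSeries

section Euler

variable {R : Type*} [CommRing R]

theorem eulerSeries_eq (F : PowerSeries R) : eulerSeries F = X * derivative R F := by
  ext m
  rw [eulerSeries, coeff_mk]
  cases m with
  | zero => simp
  | succ m => rw [coeff_succ_X_mul, coeff_derivative, Nat.cast_succ, mul_comm]

theorem eulerSeries_mul (F G : PowerSeries R) :
    eulerSeries (F * G) = F * eulerSeries G + G * eulerSeries F := by
  simp only [eulerSeries_eq, leibniz, smul_eq_mul]
  ring

theorem eulerSeries_rescale (c : R) (F : PowerSeries R) :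
    eulerSeries (rescale c F) = rescale c (eulerSeries F) := by
  ext m
  simp only [eulerSeries, coeff_mk, coeff_rescale]
  ring

theorem eulerSeries_expand {p : ℕ} (hp : p ≠ 0) (F : PowerSeries R) :
    eulerSeries (expand p hp F) = (p : R) • expand p hp (eulerSeries F) := by
  ext m
  simp only [eulerSeries, coeff_mk, coeff_smul, coeff_expand]
  split_ifs with h
  · obtain ⟨l, rfl⟩ := h
    rw [Nat.mul_div_cancel_left _ (Nat.pos_of_ne_zero hp), smul_eq_mul, Nat.cast_mul, mul_assoc]
  · rw [mul_zero, smul_zero]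

theorem eq_of_eulerSeries_eq [IsDomain R] [CharZero R] {L F G : PowerSeries R}
    (hL : coeff 0 L = 0) (hF : eulerSeries F = F * L) (hG : eulerSeries G = G * L)
    (h0 : coeff 0 F = coeff 0 G) : F = G := by
  ext m
  induction m using Nat.strong_induction_on with
  | _ m ih =>
    rcases Nat.eq_zero_or_pos m with rfl | hm
    · exact h0
    have h1 := congrArg (coeff m) hF
    have h2 := congrArg (coeff m) hG
    rw [eulerSeries, coeff_mk, coeff_mul] at h1 h2
    refine mul_left_cancel₀ (Nat.cast_ne_zero.2 hm.ne') (h1.trans (Eq.trans ?_ h2.symm))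
    refine sum_congr rfl fun x hx => ?_
    have hx := mem_antidiagonal.1 hx
    rcases Nat.eq_zero_or_pos x.2 with h | h
    · rw [h, hL, mul_zero, mul_zero]
    · rw [ih x.1 (by omega)]

end Euler

variable (p : ℕ) [Fact p.Prime]

theorem artinHasse_eq : artinHasse p = (exp ℂ_[p]).subst (pSeries p fun i => ((p : ℂ_[p]) ^ i)⁻¹) := by
  have hp : 1 < p := (Fact.out : p.Prime).one_lt
  rw [artinHasse]
  congr 1
  refine eq_pSeries hp (fun l => ?_) fun m h => ?_
  · rw [coeff_mk, if_pos ⟨l, rfl⟩, Nat.cast_pow]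
  · rw [coeff_mk, if_neg fun ⟨l, hl⟩ => h l hl]

theorem pSeries_eq_add {R : Type*} [CommRing R] (c : ℕ → R) :
    pSeries p c = c 0 • X + expand p (Fact.out : p.Prime).ne_zero (pSeries p fun l => c (l + 1)) := by
  have hp : 1 < p := (Fact.out : p.Prime).one_lt
  refine (eq_pSeries hp (fun l => ?_) fun m hm => ?_).symm
  · cases l with
    | zero =>
      rw [pow_zero, map_add, coeff_smul, coeff_one_X, coeff_expand_of_not_dvd, add_zero,
        smul_eq_mul, mul_one]
      exact fun h => by have := Nat.le_of_dvd one_pos h; omega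
    | succ l =>
      rw [map_add, pow_succ', coeff_expand_mul, coeff_pSeries_pow hp, coeff_smul, coeff_X, if_neg,
        smul_zero, zero_add]
      rw [← pow_succ']
      exact (Nat.one_lt_pow (by omega) hp).ne'
  · rw [map_add, coeff_smul, coeff_X, if_neg fun h => hm 0 (by rw [h, pow_zero]), smul_zero,
      zero_add, coeff_expand]
    split_ifs with h
    · obtain ⟨l, rfl⟩ := h
      rw [Nat.mul_div_cancel_left _ (by omega), coeff_pSeries_of_forall_ne]
      rintro l' rfl
      exact hm (l' + 1) (pow_succ' _ _).symm
    · rfl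

theorem hasSubst_pSeries (c : ℕ → ℂ_[p]) : HasSubst (pSeries p c) := by
  refine HasSubst.of_constantCoeff_zero' ?_
  rw [← coeff_zero_eq_constantCoeff_apply, coeff_pSeries_of_forall_ne]
  exact fun l => (pow_ne_zero l (Fact.out : p.Prime).ne_zero).symm

theorem eulerSeries_artinHasse :
    eulerSeries (artinHasse p) = artinHasse p * pSeries p fun _ => 1 := by
  have hp : 1 < p := (Fact.out : p.Prime).one_lt
  have hp0 : (p : ℂ_[p]) ≠ 0 := Nat.cast_ne_zero.2 (by omega)
  rw [artinHasse_eq, eulerSeries_eq, derivative_subst (hasSubst_pSeries p _), derivative_exp,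
    mul_left_comm, ← eulerSeries_eq, eulerSeries_pSeries hp]
  congr 2
  funext l
  exact mul_inv_cancel₀ (pow_ne_zero _ hp0)

theorem coeff_zero_artinHasse : coeff 0 (artinHasse p) = 1 := by
  have h := hasSubst_pSeries p fun i => ((p : ℂ_[p]) ^ i)⁻¹
  have h0 : (pSeries p fun i => ((p : ℂ_[p]) ^ i)⁻¹).constantCoeff = 0 := by
    rw [← coeff_zero_eq_constantCoeff_apply, coeff_pSeries_of_forall_ne]
    exact fun l => (pow_ne_zero l (Fact.out : p.Prime).ne_zero).symm
  have h1 : constantCoeff ((exp ℂ_[p] - 1).subst (pSeries p fun i => ((p : ℂ_[p]) ^ i)⁻¹)) = 0 :=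
    constantCoeff_subst_eq_zero h0 _ (by simp)
  rw [← coe_substAlgHom h, map_sub, map_one, map_sub, map_one, sub_eq_zero] at h1
  rw [artinHasse_eq, coeff_zero_eq_constantCoeff_apply, ← coe_substAlgHom h, h1]

theorem artinHasse_pow : artinHasse p ^ p =
    expand p (Fact.out : p.Prime).ne_zero (artinHasse p) * rescale (p : ℂ_[p]) (exp ℂ_[p]) := by
  have hp : 1 < p := (Fact.out : p.Prime).one_lt
  have h0 := coeff_zero_artinHasse p
  rw [coeff_zero_eq_constantCoeff_apply] at h0
  refine eq_of_eulerSeries_eq (L := (p : ℂ_[p]) • pSeries p fun _ => 1) ?_ ?_ ?_ ?_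
  · rw [coeff_smul, coeff_pSeries_of_forall_ne, smul_zero]
    exact fun l => (pow_ne_zero l (by omega : p ≠ 0)).symm
  · rw [eulerSeries_eq, Derivation.leibniz_pow, nsmul_eq_mul, smul_eq_mul, mul_left_comm X,
      mul_left_comm X, ← eulerSeries_eq, eulerSeries_artinHasse, smul_eq_C_mul, map_natCast,
      ← mul_assoc (_ ^ _), ← pow_succ, Nat.sub_add_cancel hp.le]
    ring
  · have h1 : expand p (Fact.out : p.Prime).ne_zero (pSeries p fun _ => (1 : ℂ_[p])) =
        (pSeries p fun _ => 1) - X := by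
      rw [eq_sub_iff_add_eq', ← one_smul ℂ_[p] X]
      exact (pSeries_eq_add p fun _ => 1).symm
    have h2 : eulerSeries (exp ℂ_[p]) = exp ℂ_[p] * X := by
      rw [eulerSeries_eq, derivative_exp, mul_comm]
    rw [eulerSeries_mul, eulerSeries_rescale, h2, eulerSeries_expand, eulerSeries_artinHasse,
      map_mul, map_mul, h1, rescale_X, smul_eq_C_mul, smul_eq_C_mul]
    ring
  · simp only [coeff_zero_eq_constantCoeff_apply, map_pow, map_mul, h0, one_pow,
      constantCoeff_expand]
    rw [← coeff_zero_eq_constantCoeff_apply, coeff_rescale, coeff_exp]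
    simp

/-- The inclusion of the `p`-adic integers. -/
def padicIncl : ℤ_[p] →+* ℂ_[p] := (algebraMap ℚ_[p] ℂ_[p]).comp PadicInt.Coe.ringHom

theorem exists_coeff_rescale_exp {j : ℕ} (hj : j ≠ 0) : ∃ y : ℤ_[p],
    coeff j (rescale (p : ℂ_[p]) (exp ℂ_[p])) = padicIncl p (p * y) := by
  have hp0 : (p : ℚ_[p]) ≠ 0 := Nat.cast_ne_zero.2 (Fact.out : p.Prime).ne_zero
  have h1 : ‖(p : ℚ_[p]) ^ j / (j.factorial : ℚ_[p])‖ < 1 := by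
    have h2 : ¬(p : ℤ) ^ j ∣ (j.factorial : ℤ) := by
      norm_cast
      rw [padicValNat_dvd_iff_le j.factorial_ne_zero, not_le]
      exact padicValNat_factorial_lt_of_ne_zero p hj
    rw [← Padic.norm_int_le_pow_iff_dvd, not_le] at h2
    rw [norm_div, norm_pow, Padic.norm_p, div_lt_one (norm_pos_iff.2
      (Nat.cast_ne_zero.2 j.factorial_ne_zero))]
    refine lt_of_eq_of_lt ?_ h2
    rw [zpow_neg, zpow_natCast, inv_pow]
  obtain ⟨y, hy⟩ := (PadicInt.norm_lt_one_iff_dvd (⟨_, h1.le⟩ : ℤ_[p])).1 h1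
  refine ⟨y, ?_⟩
  rw [← hy, coeff_rescale, coeff_exp]
  change _ = algebraMap ℚ_[p] ℂ_[p] ((p : ℚ_[p]) ^ j / (j.factorial : ℚ_[p]))
  simp [div_eq_mul_inv]

theorem exists_coeff_artinHasse (m : ℕ) : ∃ z : ℤ_[p], coeff m (artinHasse p) = padicIncl p z := by
  have hp : 1 < p := (Fact.out : p.Prime).one_lt
  induction m using Nat.strong_induction_on with
  | _ m ih =>
    rcases Nat.eq_zero_or_pos m with rfl | hm
    · exact ⟨1, by rw [coeff_zero_artinHasse, map_one]⟩
    have ih' : ∀ i, ∃ z : ℤ_[p], i < m → coeff i (artinHasse p) = padicIncl p z := fun i => by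
      by_cases hi : i < m
      · exact (ih i hi).imp fun z hz _ => hz
      · exact ⟨0, fun h => absurd h hi⟩
    choose z hz using ih'
    choose! y hy using fun j (hj : j ≠ 0) => exists_coeff_rescale_exp p hj
    let P : Polynomial ℤ_[p] := ∑ i ∈ Finset.range m, Polynomial.monomial i (z i)
    have hP : ∀ i, P.coeff i = if i < m then z i else 0 := fun i => by
      simp [P, Polynomial.coeff_monomial]
    let Pc : PowerSeries ℂ_[p] := map (padicIncl p) (P : PowerSeries ℤ_[p])
    let W : PowerSeries ℂ_[p] := mk fun i => coeff (i + m) (artinHasse p)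
    have hE : artinHasse p = Pc + X ^ m * W := by
      ext i
      rw [map_add, coeff_X_pow_mul', coeff_map, Polynomial.coeff_coe, hP]
      by_cases hi : i < m
      · rw [if_pos hi, if_neg (by omega), add_zero, hz i hi]
      · rw [if_neg hi, if_pos (by omega), map_zero, zero_add, coeff_mk, Nat.sub_add_cancel
          (by omega)]
    obtain ⟨K, hK⟩ := Polynomial.powAddExpansion Pc (X ^ m * W) p
    have h1 := congrArg (coeff m) (artinHasse_pow p)
    have hPc0 : coeff 0 (Pc ^ (p - 1)) = 1 := by
      have : coeff 0 Pc = 1 := by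
        rw [coeff_map, Polynomial.coeff_coe, hP, if_pos hm, ← hz 0 hm, coeff_zero_artinHasse]
      rw [coeff_zero_eq_constantCoeff_apply] at this ⊢
      rw [map_pow, this, one_pow]
    have hl : coeff m (artinHasse p ^ p) =
        padicIncl p ((P ^ p).coeff m) + p * coeff m (artinHasse p) := by
      conv_lhs => rw [hE, hK]
      have e1 : (p : PowerSeries ℂ_[p]) * Pc ^ (p - 1) * (X ^ m * W) =
          X ^ m * (C (p : ℂ_[p]) * (Pc ^ (p - 1) * W)) := by rw [map_natCast]; ring
      have e2 : K * (X ^ m * W) ^ 2 = X ^ (m + m) * (K * W ^ 2) := by rw [pow_add]; ring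
      rw [e1, e2, map_add, map_add, coeff_X_pow_mul', coeff_X_pow_mul', if_pos le_rfl,
        if_neg (by omega), add_zero, Nat.sub_self, coeff_C_mul, coeff_zero_eq_constantCoeff_apply,
        map_mul, ← coeff_zero_eq_constantCoeff_apply, hPc0, one_mul,
        ← coeff_zero_eq_constantCoeff_apply, coeff_mk, zero_add, ← map_pow, ← Polynomial.coe_pow,
        coeff_map, Polynomial.coeff_coe]
    let e : ℕ → ℤ_[p] := fun i => if p ∣ i then z (i / p) else 0
    have hlt : ∀ i ≤ m, i / p < m := fun i hi => by
      rcases Nat.eq_zero_or_pos i with rfl | h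
      · rwa [Nat.zero_div]
      · exact (Nat.div_lt_self h hp).trans_le hi
    have he : ∀ i ≤ m, coeff i (expand p (Fact.out : p.Prime).ne_zero (artinHasse p)) =
        padicIncl p (e i) := fun i hi => by
      rw [coeff_expand]
      simp only [e]
      split_ifs
      · exact hz _ (hlt i hi)
      · rw [map_zero]
    have hr : coeff m (expand p (Fact.out : p.Prime).ne_zero (artinHasse p) *
        rescale (p : ℂ_[p]) (exp ℂ_[p])) =
        padicIncl p (p * (∑ i ∈ Finset.range m, e i * y (m - i)) + e m) := by
      rw [coeff_mul, Finset.Nat.sum_antidiagonal_eq_sum_range_succ_mk, Finset.sum_range_succ,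
        map_add, mul_sum, map_sum, he m le_rfl, Nat.sub_self, coeff_rescale, coeff_exp]
      congr 1
      · refine sum_congr rfl fun i hi => ?_
        have hi := Finset.mem_range.1 hi
        rw [he i hi.le, hy (m - i) (by omega), ← map_mul]
        congr 1
        ring
      · simp
    have hdvd : (p : ℤ_[p]) ∣ e m - (P ^ p).coeff m := by
      rw [← Ideal.mem_span_singleton, ← PadicInt.maximalIdeal_eq_span_p, ← PadicInt.ker_toZMod,
        RingHom.mem_ker, map_sub, sub_eq_zero, ← Polynomial.coeff_map, Polynomial.map_pow,
        ← ZMod.expand_card, Polynomial.coeff_expand (Fact.out : p.Prime).pos, Polynomial.coeff_map,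
        hP, if_pos (hlt m le_rfl)]
      simp only [e]
      split_ifs
      · rfl
      · rw [map_zero]
    obtain ⟨w, hw⟩ := hdvd
    refine ⟨(∑ i ∈ Finset.range m, e i * y (m - i)) + w,
      mul_left_cancel₀ (Nat.cast_ne_zero.2 (by omega : p ≠ 0)) ?_⟩
    rw [hl, hr, ← eq_sub_iff_add_eq', ← map_sub] at h1
    rw [h1, ← map_natCast (padicIncl p), ← map_mul, mul_add, ← hw]
    congr 1
    ring

end ArtinHasse

section LogarithmicDerivative

open MvPowerSeries

variable {ι R : Type*} [CommRing R]

theorem monoSubst_expand {e : ι →₀ ℕ} (he : e ≠ 0) {p : ℕ} (hp : p ≠ 0) (c : R)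
    (F : PowerSeries R) :
    monoSubst e c (PowerSeries.expand p hp F) = monoSubst (p • e) (c ^ p) F := by
  have hpe : p • e ≠ 0 := smul_ne_zero hp he
  refine (eq_monoSubst he (fun l => ?_) fun m hm => ?_).symm
  · rw [PowerSeries.coeff_expand]
    split_ifs with h
    · obtain ⟨l, rfl⟩ := h
      rw [Nat.mul_div_cancel_left _ (Nat.pos_of_ne_zero hp), mul_comm p, mul_smul,
        coeff_monoSubst_smul hpe, ← pow_mul, mul_comm p]
    · rw [zero_mul, coeff_monoSubst_of_forall_ne]
      intro l' hl
      rw [← mul_smul] at hl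
      exact h ⟨l', by rw [← smul_exp_injective he hl, mul_comm]⟩
  · refine coeff_monoSubst_of_forall_ne (fun l hl => hm (l * p) ?_) _ _
    rw [mul_smul, hl]

variable [LinearOrder ι]

theorem X_mul_pderiv_prod {α : Type*} (s : Finset α) (F L : α → MvPowerSeries ι R) (i : ι)
    (h : ∀ x ∈ s, X i * pderiv R i (F x) = F x * L x) :
    X i * pderiv R i (∏ x ∈ s, F x) = (∏ x ∈ s, F x) * ∑ x ∈ s, L x := by
  classical
  induction s using Finset.induction_on with
  | empty => simp [pderiv_one]
  | insert x s hx ih =>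
    rw [Finset.prod_insert hx, sum_insert hx, leibniz, smul_eq_mul, smul_eq_mul,
      mul_add, mul_left_comm, ih fun y hy => h y (Finset.mem_insert_of_mem hy), mul_left_comm (X i),
      h x (Finset.mem_insert_self x s)]
    ring

theorem logForm_dForm [Fintype ι] (ω : SeriesForm ι R) (J : Finset ι) : logForm (dForm ω) J =
      ∑ i ∈ J, ksign i J • (X i * pderiv R i (logForm ω (J.erase i))) := by
  ext e
  have h := congrFun (logCoeff_dForm e ω) J
  rw [kw_apply] at h
  rw [map_sum]
  refine h.trans (sum_congr rfl fun i _ => ?_)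
  rw [map_zsmul, coeff_X_mul_pderiv]; rfl

end LogarithmicDerivative

namespace DworkDatum

open MvPowerSeries

variable {p : ℕ} [Fact p.Prime] {k : Type*} [Field k] {n r : ℕ} {S : DworkDatum p k n r}

theorem mem_padicComplexInt_iff {x : ℂ_[p]} : x ∈ 𝓞_ℂ_[p] ↔ ‖x‖ ≤ 1 := by
  rw [PadicComplex.norm_eq_norm]
  exact (Valued.toNormedField.norm_le_one_iff (L := ℂ_[p]) (Γ₀ := NNReal)).symm

theorem norm_natCast_p : ‖(p : ℂ_[p])‖ = (p : ℝ)⁻¹ := by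
  have := PadicComplex.norm_extends' p (p : ℚ_[p])
  rw [Padic.norm_p] at this
  rw [← this]
  simp

theorem residue_eq_iff {x y : 𝓞_ℂ_[p]} : residue 𝓞_ℂ_[p] x =
    residue 𝓞_ℂ_[p] y ↔ ‖(x : ℂ_[p]) - y‖ < 1 := by
  rw [← sub_eq_zero, ← map_sub, IsLocalRing.residue_eq_zero_iff, IsLocalRing.mem_maximalIdeal,
    mem_nonunits_iff]
  have h1 : ‖(x : ℂ_[p]) - y‖ ≤ 1 := mem_padicComplexInt_iff.1 (x - y).2
  constructor
  · intro h
    refine lt_of_le_of_ne h1 fun h2 => h ?_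
    have h3 : (x : ℂ_[p]) - y ≠ 0 := by
      intro h0; rw [h0, norm_zero] at h2; exact zero_ne_one h2
    refine ⟨⟨x - y, ⟨((x : ℂ_[p]) - y)⁻¹, mem_padicComplexInt_iff.2 (by rw [norm_inv, h2, inv_one])⟩,
      Subtype.ext (mul_inv_cancel₀ h3), Subtype.ext (inv_mul_cancel₀ h3)⟩, rfl⟩
  · rintro h ⟨u, hu⟩
    have h2 : ((u : 𝓞_ℂ_[p]) : ℂ_[p]) * ((u⁻¹ : (𝓞_ℂ_[p])ˣ) : 𝓞_ℂ_[p]) = 1 :=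
      congrArg Subtype.val (Units.mul_inv u)
    have h3 : ‖(((u⁻¹ : (𝓞_ℂ_[p])ˣ) : 𝓞_ℂ_[p]) : ℂ_[p])‖ ≤ 1 :=
      mem_padicComplexInt_iff.1 (Subtype.property _)
    have h4 := congrArg norm h2
    rw [norm_mul, norm_one, hu] at h4
    change ‖(x : ℂ_[p]) - y‖ * _ = 1 at h4
    nlinarith [norm_nonneg ((x : ℂ_[p]) - y)]

theorem norm_sub_eq_of_pow {q : ℕ} (hq : p ∣ q) {z t : ℂ_[p]} (hz : ‖z‖ ≤ 1) (ht : ‖t‖ ≤ 1)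
    (h : ‖z - t‖ < 1) : ‖z - t‖ = ‖z ^ q - z - (t ^ q - t)‖ := by
  have h1 : ‖∑ i ∈ Finset.range q, z ^ i * t ^ (q - 1 - i)‖ < 1 := by
    have h2 : ∀ i, ‖z ^ i - t ^ i‖ ≤ ‖z - t‖ := fun i => by
      rw [← (Commute.all z t).geom_sum₂_mul i, norm_mul]
      refine mul_le_of_le_one_left (norm_nonneg _) ?_
      refine IsUltrametricDist.norm_sum_le_of_forall_le_of_nonneg zero_le_one fun j _ => ?_
      rw [norm_mul, norm_pow, norm_pow]
      exact mul_le_one₀ (pow_le_one₀ (norm_nonneg _) hz) (by positivity)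
        (pow_le_one₀ (norm_nonneg _) ht)
    have h3 : ∑ i ∈ Finset.range q, z ^ i * t ^ (q - 1 - i) =
        ∑ i ∈ Finset.range q, (z ^ i - t ^ i) * t ^ (q - 1 - i) + q * t ^ (q - 1) := by
      have : (q : ℂ_[p]) * t ^ (q - 1) = ∑ i ∈ Finset.range q, t ^ i * t ^ (q - 1 - i) := by
        rw [sum_congr rfl (g := fun _ => t ^ (q - 1)), Finset.sum_const, Finset.card_range,
          nsmul_eq_mul]
        intro i hi
        rw [← pow_add]
        congr 1
        have := Finset.mem_range.1 hi
        omega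
      rw [this, ← sum_add_distrib]
      exact sum_congr rfl fun i _ => by ring
    rw [h3]
    refine lt_of_le_of_lt (IsUltrametricDist.norm_add_le_max _ _) (max_lt ?_ ?_)
    · refine lt_of_le_of_lt (IsUltrametricDist.norm_sum_le_of_forall_le_of_nonneg (norm_nonneg _)
        fun i _ => ?_) h
      rw [norm_mul, norm_pow]
      exact (mul_le_of_le_one_right (norm_nonneg _)
        (pow_le_one₀ (norm_nonneg _) ht)).trans (h2 i)
    · obtain ⟨m, rfl⟩ := hq
      rw [norm_mul, norm_pow]
      refine lt_of_le_of_lt (mul_le_of_le_one_right (norm_nonneg _)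
        (pow_le_one₀ (norm_nonneg _) ht)) ?_
      rw [Nat.cast_mul, norm_mul, norm_natCast_p]
      refine lt_of_le_of_lt (mul_le_of_le_one_right (by positivity)
        (IsUltrametricDist.norm_natCast_le_one _ _)) ?_
      exact inv_lt_one_of_one_lt₀ (by exact_mod_cast (Fact.out : p.Prime).one_lt)
  have h5 : z ^ q - z - (t ^ q - t) =
      (∑ i ∈ Finset.range q, z ^ i * t ^ (q - 1 - i) - 1) * (z - t) := by
    rw [sub_mul, (Commute.all z t).geom_sum₂_mul]; ring
  have h6 : ‖∑ i ∈ Finset.range q, z ^ i * t ^ (q - 1 - i) - 1‖ = ‖(1 : ℂ_[p])‖ := by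
    apply IsUltrametricDist.norm_eq_of_add_norm_lt_max
    rw [sub_add_cancel, norm_one]
    exact lt_max_of_lt_right h1
  rw [h5, norm_mul, h6, norm_one, one_mul]

/-! ### The normalized complex -/

variable (S) in
/-- The scaling `y_j ↦ π^{Mb} y_j`. -/
def scal (v : DworkVar n r) : ℂ_[p] := Sum.elim (fun _ => 1) (fun _ => S.π ^ S.Mb) (ofLex v)

variable (S) in
theorem prod_scal (m : DworkVar n r →₀ ℕ) :
    (m.prod fun i l => S.scal i ^ l) = S.π ^ (S.Mb * yDegree m) := by
  rw [Finsupp.prod_fintype _ _ (by simp), ← Equiv.prod_comp toLex, Fintype.prod_sum_type]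
  have h1 : ∀ i : Fin (n + 1), S.scal (toLex (Sum.inl i)) = 1 := fun _ => rfl
  have h2 : ∀ j : Fin r, S.scal (toLex (Sum.inr j)) = S.π ^ S.Mb := fun _ => rfl
  simp only [h1, h2, one_pow, Finset.prod_const_one, one_mul]
  rw [Finset.prod_pow_eq_pow_sum, ← pow_mul]
  rfl

theorem yDegree_setMon (J : Finset (DworkVar n r)) : yDegree (setMon J) = yCard J := by
  rw [yDegree, yCard, Finset.card_filter]
  refine sum_congr rfl fun j _ => ?_
  rw [setMon_apply]
  congr!

variable (S) in
/-- The passage from normalized forms to forms. -/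
def denorm (Φ : VarForm n r S.integers) : DworkForm p n r := scaleForm S.integers.subtype S.scal Φ

theorem coeff_denorm (Φ : VarForm n r S.integers)
    (J : Finset (DworkVar n r)) (m : DworkVar n r →₀ ℕ) : coeff m (S.denorm Φ J) =
      S.π ^ (S.Mb * (yDegree m + yCard J)) * ((coeff m (Φ J) : S.integers) : ℂ_[p]) := by
  rw [denorm, coeff_scaleForm, ← prod_setMon, prod_scal, prod_scal, yDegree_setMon, ← mul_assoc,
    ← pow_add, ← mul_add, add_comm (yCard J)]
  rfl

theorem degree_eq (m : DworkVar n r →₀ ℕ) (J : Finset (DworkVar n r)) :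
    S.degree m J = weight (dworkWt S.d) m + ∑ j ∈ J, dworkWt S.d j := by
  rw [degree, weight_apply, sum_fintype _ _ (by simp)]
  simp only [nsmul_eq_mul, mul_comm]
  rfl

variable (S)

theorem theta_eq (ω : DworkForm p n r) : S.theta ω = eulerContr ℂ_[p] S.d ω := by
  funext J
  rw [eulerContr, kc_apply]
  simp only [theta, LinearMap.pi_apply, LinearMap.sum_apply, LinearMap.smul_apply,
    LinearMap.comp_apply, LinearMap.proj_apply, mul_smul, wedgeSign_smul, Finset.prod_singleton,
    LinearMap.mulLeft_apply]
  refine sum_congr (by ext; simp) fun i _ => ?_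
  rw [smul_eq_C_mul, mul_smul_comm]
  simp only [smul_eq_mul, mul_assoc]
  congr!

/-- The exponent of the monomial `x^u y_j`. -/
def expo (j : Fin r) (u : Fin (n + 1) →₀ ℕ) : DworkVar n r →₀ ℕ := xExp u + yExp j

theorem xExp_inlₗ (u : Fin (n + 1) →₀ ℕ) (i : Fin (n + 1)) :
    (xExp u : DworkVar n r →₀ ℕ) (inlₗ i) = u i :=
  Finsupp.mapDomain_apply inlₗ_injective u i

theorem xExp_inrₗ (u : Fin (n + 1) →₀ ℕ) (j : Fin r) :
    (xExp u : DworkVar n r →₀ ℕ) (inrₗ j) = 0 := by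
  rw [xExp, Finsupp.mapDomain_of_notMem_range]
  rintro ⟨i, hi⟩
  exact inlₗ_ne_inrₗ i j hi

theorem expo_inlₗ (j : Fin r) (u : Fin (n + 1) →₀ ℕ) (i : Fin (n + 1)) :
    expo j u (inlₗ i) = u i := by
  rw [expo, Finsupp.add_apply, xExp_inlₗ, yExp, single_eq_of_ne (inlₗ_ne_inrₗ i j),
    add_zero]

theorem expo_inrₗ (j j' : Fin r) (u : Fin (n + 1) →₀ ℕ) :
    expo j u (inrₗ j') = if j = j' then 1 else 0 := by
  rw [expo, Finsupp.add_apply, xExp_inrₗ, yExp, zero_add, single_apply]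
  congr 1
  exact propext inrₗ_injective.eq_iff

theorem expo_ne_zero (j : Fin r) (u : Fin (n + 1) →₀ ℕ) : expo j u ≠ 0 := fun h => by
  have := DFunLike.congr_fun h (inrₗ j)
  rw [expo_inrₗ, if_pos rfl] at this
  exact one_ne_zero this

theorem weight_expo (j : Fin r) (u : Fin (n + 1) →₀ ℕ)
    (hu : u.degree = S.d j) : weight (dworkWt S.d) (expo j u) = 0 := by
  rw [weight_apply, sum_fintype _ _ (by simp), sum_dworkVar]
  simp only [expo_inlₗ, expo_inrₗ]
  rw [sum_eq_single j (by intro j' _ h; simp [h.symm]) (by simp), if_pos rfl, one_smul]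
  have h1 : ∀ i : Fin (n + 1), u i • dworkWt S.d (inlₗ i : DworkVar n r) = (u i : ℤ) := fun i => by
    change u i • (1 : ℤ) = _
    simp
  have h2 : dworkWt S.d (inrₗ j : DworkVar n r) = -(S.d j : ℤ) := rfl
  rw [sum_congr rfl fun i _ => h1 i, h2, ← hu, Finsupp.degree_eq_sum]
  push_cast
  ring

/-- The part of `H` that involves `f_j`. -/
def Hpart (j : Fin r) : DworkSeries p n r :=
  ∑ u ∈ (S.f j).support,
    monoSubst (expo j u) (S.teichmuller ((S.f j).coeff u)) (pSeries p S.gam)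

omit [Field k] in
theorem coeff_monoSubst_pSeries {ι R : Type*} [CommRing R] {p : ℕ} (hp : 1 < p) {e : ι →₀ ℕ}
    (he : e ≠ 0) [DecidableEq (ι →₀ ℕ)] (c : R) (γ : ℕ → R) (m : ι →₀ ℕ) :
    coeff m (monoSubst e c (pSeries p γ)) =
      ∑ᶠ l : ℕ, if m = p ^ l • e then γ l * c ^ p ^ l else 0 := by
  by_cases h : ∃ l, m = p ^ l • e
  · obtain ⟨l, rfl⟩ := h
    rw [coeff_monoSubst_smul he, coeff_pSeries_pow hp, finsum_eq_single _ l, if_pos rfl]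
    intro l' hl'
    rw [if_neg]
    intro h
    exact hl' (Nat.pow_right_injective hp (smul_exp_injective he h)).symm
  · rw [finsum_eq_zero_of_forall_eq_zero fun l => if_neg fun hl => h ⟨l, hl⟩]
    by_cases h' : ∃ k : ℕ, k • e = m
    · obtain ⟨k, rfl⟩ := h'
      rw [coeff_monoSubst_smul he, coeff_pSeries_of_forall_ne, zero_mul]
      rintro l rfl
      exact h ⟨l, rfl⟩
    · exact coeff_monoSubst_of_forall_ne (by simpa using h') _ _

theorem finite_support_pow_smul {ι R : Type*} [Zero R] {p : ℕ} (hp : 1 < p) {e : ι →₀ ℕ}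
    (he : e ≠ 0) [DecidableEq (ι →₀ ℕ)] (γ : ℕ → R) (m : ι →₀ ℕ) :
    (Function.support fun l : ℕ => if m = p ^ l • e then γ l else 0).Finite := by
  refine Set.Subsingleton.finite fun l hl l' hl' => ?_
  have h1 : m = p ^ l • e := by by_contra h; exact hl (if_neg h)
  have h2 : m = p ^ l' • e := by by_contra h; exact hl' (if_neg h)
  exact Nat.pow_right_injective hp (smul_exp_injective he (h1.symm.trans h2))

theorem coeff_Hpart [DecidableEq (DworkVar n r →₀ ℕ)] (j : Fin r) (m : DworkVar n r →₀ ℕ) :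
    coeff m (S.Hpart j) = ∑ᶠ l : ℕ, coeff m (S.gam l • (yPow j l * S.fHat j l)) := by
  have hp : 1 < p := (Fact.out : p.Prime).one_lt
  have h1 : ∀ l, coeff m (S.gam l • (yPow j l * S.fHat j l)) = ∑ u ∈ (S.f j).support,
      if m = p ^ l • expo j u then
        S.gam l * S.teichmuller ((S.f j).coeff u) ^ p ^ l else 0 := fun l => by
    rw [yPow, fHat, mul_sum, coeff_smul, map_sum, mul_sum]
    refine sum_congr rfl fun u _ => ?_
    rw [monomial_mul_monomial, one_mul, coeff_monomial, mul_ite, mul_zero, expo, smul_add,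
      add_comm]
    congr!
  simp only [h1]
  rw [finsum_sum_comm _ _ fun u _ => finite_support_pow_smul hp (expo_ne_zero j u) _ m, Hpart,
    map_sum]
  exact sum_congr rfl fun u _ => coeff_monoSubst_pSeries hp (expo_ne_zero j u) _ _ m

theorem finite_support_coeff_Hpart (j : Fin r) (m : DworkVar n r →₀ ℕ) :
    (Function.support fun l : ℕ => coeff m (S.gam l • (yPow j l * S.fHat j l))).Finite := by
  classical
  have hp : 1 < p := (Fact.out : p.Prime).one_lt
  refine Set.Subsingleton.finite fun l hl l' hl' => ?_
  have key : ∀ l : ℕ, coeff m (S.gam l • (yPow j l * S.fHat j l)) ≠ 0 →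
      m (inrₗ j) = p ^ l := fun l hl => by
    rw [yPow, fHat, mul_sum, coeff_smul, map_sum] at hl
    obtain ⟨u, _, hu⟩ := exists_ne_zero_of_sum_ne_zero (right_ne_zero_of_mul hl)
    rw [monomial_mul_monomial, coeff_monomial] at hu
    have h1 : m = p ^ l • yExp j + p ^ l • xExp u := by by_contra h; exact hu (if_neg h)
    rw [h1, Finsupp.add_apply, Finsupp.smul_apply, Finsupp.smul_apply, xExp_inrₗ, yExp,
      single_eq_same]
    simp
  exact Nat.pow_right_injective hp ((key l hl).symm.trans (key l' hl'))

theorem H_eq : S.H = zeroForm (∑ j, S.Hpart j) := by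
  classical
  funext J
  by_cases hJ : J = ∅
  · subst hJ
    ext m
    change (∑ᶠ l : ℕ, coeff m (zeroForm (S.gam l • ∑ j, yPow j l * S.fHat j l) ∅)) = _
    simp only [zeroForm_empty, smul_sum, map_sum]
    rw [finsum_sum_comm _ _ fun j _ => S.finite_support_coeff_Hpart j m]
    exact sum_congr rfl fun j _ => (S.coeff_Hpart j m).symm
  · rw [zeroForm_of_ne hJ]
    ext m
    change (∑ᶠ l : ℕ, coeff m (zeroForm (S.gam l • ∑ j, yPow j l * S.fHat j l) J)) = 0
    simp only [zeroForm_of_ne hJ, map_zero, finsum_zero]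

theorem D_eq (ω : DworkForm p n r) : S.D ω = twD (S.π ^ S.Mb * S.γ⁻¹)
    (fun i => pderiv ℂ_[p] i ((S.π ^ S.Mb * S.γ⁻¹) • ∑ j, S.Hpart j)) ω := by
  rw [twD_apply, D, LinearMap.smul_apply, LinearMap.add_apply, smul_add, formDeriv_eq]
  congr 1
  change _ • wedge (formDeriv S.H) ω = _
  rw [H_eq, wedge_dForm_zeroForm]
  funext J
  rw [Pi.smul_apply, kw_apply, kw_apply, smul_sum]
  refine sum_congr rfl fun i _ => ?_
  rw [Derivation.map_smul, smul_comm]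
  congr 1
  rw [smul_eq_mul, smul_eq_mul, smul_mul_assoc]

theorem D_D (ω : DworkForm p n r) : S.D (S.D ω) = 0 := by rw [D_eq, D_eq, twD_twD]

/-- The power series `∑_l γ_l y_j^{p^l - 1} f̂_j^{τ^l}(x^{p^l})`. -/
def hpart (j : Fin r) : DworkSeries p n r := divVar (inrₗ j) (S.Hpart j)

theorem coeff_Hpart_ne {j : Fin r} {m : DworkVar n r →₀ ℕ} (hm : coeff m (S.Hpart j) ≠ 0) :
    m (inrₗ j) ≠ 0 ∧ ∃ u ∈ (S.f j).support, ∃ l : ℕ, m = l • expo j u := by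
  have hp : 1 < p := (Fact.out : p.Prime).one_lt
  rw [Hpart, map_sum] at hm
  obtain ⟨u, hu, hne⟩ := exists_ne_zero_of_sum_ne_zero hm
  obtain ⟨l, rfl⟩ := exists_of_coeff_monoSubst_ne hne
  refine ⟨?_, u, hu, l, rfl⟩
  rw [Finsupp.smul_apply, expo_inrₗ, if_pos rfl, smul_eq_mul, mul_one]
  rintro rfl
  refine hne ?_
  rw [coeff_monoSubst_smul (expo_ne_zero j u), coeff_pSeries_of_forall_ne, zero_mul]
  exact fun l => (pow_ne_zero l (by omega : p ≠ 0)).symm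

theorem X_mul_hpart (j : Fin r) : X (inrₗ j) * S.hpart j = S.Hpart j :=
  X_mul_divVar fun m hm => by
    by_contra h0
    exact (S.coeff_Hpart_ne h0).1 hm

theorem weight_of_coeff_hpart_ne (hf : ∀ j, (S.f j).IsHomogeneous (S.d j)) {j : Fin r}
    {m : DworkVar n r →₀ ℕ} (hm : coeff m (S.hpart j) ≠ 0) : weight (dworkWt S.d) m = S.d j := by
  rw [hpart, coeff_divVar] at hm
  obtain ⟨-, u, hu, l, hl⟩ := S.coeff_Hpart_ne hm
  have h1 := congrArg (weight (dworkWt S.d)) hl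
  rw [map_nsmul, S.weight_expo j u (by
    rw [← hf j (MvPolynomial.mem_support_iff.1 hu), Finsupp.degree_eq_weight_one]; rfl),
    smul_zero, map_add, weight_single, one_smul] at h1
  have h2 : dworkWt S.d (inrₗ j : DworkVar n r) = -(S.d j : ℤ) := rfl
  linarith

/-- Multiplication by the two-form `dh_j ∧ dy_j`. -/
def pairMul (j : Fin r) : End (DworkSeries p n r) (DworkForm p n r) :=
  kw (fun v => pderiv ℂ_[p] v (S.hpart j)) ∘ₗ kw (fun v => pderiv ℂ_[p] v (X (inrₗ j)))

theorem formalSum_eq (j : Fin r) : formalSum (fun l => (S.gam l / (p : ℂ_[p]) ^ l) •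
      wedge (formDeriv (zeroForm (S.fHat j l))) (formDeriv (zeroForm (yPow j l)))) =
      S.pairMul j (constForm 1) := by
  have hp0 : (p : ℂ_[p]) ≠ 0 := Nat.cast_ne_zero.2 (Fact.out : p.Prime).ne_zero
  set y : DworkVar n r := inrₗ j with hy
  let s : DworkVar n r → DworkSeries p n r := fun v => pderiv ℂ_[p] v (X y)
  let Z : ℕ → DworkSeries p n r := fun l => monomial ((p ^ l - 1) • yExp j) 1
  have hpl : ∀ l, p ^ l - 1 + 1 = p ^ l := fun l =>
    Nat.sub_add_cancel (Nat.one_le_pow _ _ (Fact.out : p.Prime).pos)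
  have hXZ : ∀ l, X y * Z l = yPow j l := fun l => by
    rw [X, monomial_mul_monomial, one_mul, yPow, ← hpl l, succ_nsmul']
    rfl
  have hsv : ∀ v, v ≠ y → s v = 0 := fun v hv => pderiv_X_of_ne (Ne.symm hv)
  have hyPow : ∀ l v, pderiv ℂ_[p] v (yPow j l : DworkSeries p n r) =
      C ((p : ℂ_[p]) ^ l) * Z l * s v := fun l v => by
    apply X_mul_cancel (i := v)
    by_cases hv : v = y
    · rw [hv, yPow, X_mul_pderiv_monomial, ← yPow, ← hXZ,
        show s y = 1 from pderiv_X_self, smul_eq_C_mul, Finsupp.smul_apply, yExp,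
        single_eq_same, smul_eq_mul, mul_one]
      push_cast
      ring
    · rw [yPow, X_mul_pderiv_monomial, hsv v hv, Finsupp.smul_apply, yExp,
        single_eq_of_ne hv]
      simp
  obtain ⟨c, hc⟩ := kw_constForm_one (R := ℂ_[p]) s (fun v => if v = y then (1 : ℂ_[p]) else 0) fun v => by
    by_cases hv : v = y
    · rw [if_pos hv, hv, map_one]; exact pderiv_X_self
    · rw [if_neg hv, map_zero]; exact hsv v hv
  let a : ℕ → DworkVar n r → DworkSeries p n r := fun l v =>
    if v = y then 0 else C (S.gam l) * (Z l * pderiv ℂ_[p] v (S.fHat j l))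
  have hterm : ∀ l, (S.gam l / (p : ℂ_[p]) ^ l) •
      wedge (formDeriv (zeroForm (S.fHat j l))) (formDeriv (zeroForm (yPow j l))) =
      kw (a l) (kw s (constForm (1 : DworkSeries p n r))) := fun l => by
    rw [wedge_dForm_zeroForm, formDeriv_eq, zeroForm_eq, dForm_constForm, funext (hyPow l),
      kw_smul_left, map_smul]
    have h1 : kw (a l) (kw s (constForm (1 : DworkSeries p n r))) =
        kw (fun v => C (S.gam l) * Z l * pderiv ℂ_[p] v (S.fHat j l)) (kw s (constForm 1)) :=
      kw_kw_congr hsv hsv rfl (fun v hv => by rw [show a l v = _ from if_neg hv, mul_assoc]) _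
    rw [h1, kw_smul_left]
    funext J
    simp only [Pi.smul_apply, smul_eq_C_mul, smul_eq_mul, ← mul_assoc, ← map_mul]
    rw [div_mul_cancel₀ _ (pow_ne_zero _ hp0)]
  let b : DworkVar n r → DworkSeries p n r := fun v =>
    if v = y then 0 else pderiv ℂ_[p] v (S.hpart j)
  have hcoeff : ∀ l v m, v ≠ y → coeff m (a l v) = coeff (m + single y 1 +
      single v 1) (S.gam l • (yPow j l * S.fHat j l)) * (m v + 1) := fun l v m hv => by
    have h1 : X y * a l v = pderiv ℂ_[p] v (S.gam l • (yPow j l * S.fHat j l)) := by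
      rw [show a l v = _ from if_neg hv, Derivation.map_smul, leibniz, hyPow,
        hsv v hv, mul_zero, smul_zero, add_zero, smul_eq_C_mul, smul_eq_mul, ← hXZ]
      ring
    have h2 := congrArg (coeff (single y 1 + m)) h1
    rwa [X, coeff_add_monomial_mul, one_mul, coeff_pderiv, Finsupp.add_apply,
      single_eq_of_ne hv, zero_add, add_comm (single y 1) m] at h2
  have hb : kw b (kw s (constForm (1 : DworkSeries p n r))) = S.pairMul j (constForm 1) :=
    kw_kw_congr hsv hsv rfl (fun v hv => if_neg hv) _
  rw [← hb]
  simp only [hterm, hc]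
  funext J
  ext m
  refine finsum_coeff_kw (fun v m => ?_) (fun v m => ?_) c J m
  · by_cases hv : v = y
    · simp [a, hv]
    · simp only [hcoeff _ v m hv]
      exact (S.finite_support_coeff_Hpart j _).subset fun l hl => left_ne_zero_of_mul hl
  · by_cases hv : v = y
    · simp [a, b, hv]
    · classical
      simp only [hcoeff _ v m hv]
      rw [← finsum_mul' _ _ (S.finite_support_coeff_Hpart j _), ← coeff_Hpart,
        show b v = _ from if_neg hv, coeff_pderiv, hpart, coeff_divVar, add_right_comm]

theorem pairMul_apply (j : Fin r) (ω : DworkForm p n r) :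
    S.pairMul j ω = kw (fun v => pderiv ℂ_[p] v (S.hpart j))
      (kw (fun v => pderiv ℂ_[p] v (X (inrₗ j) : DworkSeries p n r)) ω) := rfl

theorem kw_pairMul (e : DworkVar n r → DworkSeries p n r) (j : Fin r) (ω : DworkForm p n r) :
    kw e (S.pairMul j ω) = S.pairMul j (kw e ω) := by
  rw [pairMul_apply, pairMul_apply, kw_comm, kw_comm e, map_neg, neg_neg]

theorem pairMul_commute (i j : Fin r) : Commute (S.pairMul i) (S.pairMul j) := by
  refine LinearMap.ext fun ω => ?_
  change S.pairMul i (S.pairMul j ω) = S.pairMul j (S.pairMul i ω)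
  rw [pairMul_apply _ i, kw_pairMul, kw_pairMul, ← pairMul_apply]

theorem pairMul_mul_self (j : Fin r) : S.pairMul j * S.pairMul j = 0 := by
  refine LinearMap.ext fun ω => ?_
  change S.pairMul j (S.pairMul j ω) = 0
  rw [pairMul_apply, kw_pairMul, pairMul_apply, kw_self]

theorem dForm_pairMul (j : Fin r) (ω : DworkForm p n r) :
    dForm (S.pairMul j ω) = S.pairMul j (dForm ω) := by
  rw [pairMul_apply, pairMul_apply, dForm_kw_pderiv, dForm_kw_pderiv, map_neg, neg_neg]

theorem theta_pairMul (hf : ∀ j, (S.f j).IsHomogeneous (S.d j)) (j : Fin r)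
    (ω : DworkForm p n r) : S.theta (S.pairMul j ω) = S.pairMul j (S.theta ω) +
      (S.d j : ℂ_[p]) • kw (fun v => pderiv ℂ_[p] v (S.Hpart j)) ω := by
  have h1 : ∑ v, C (dworkWt S.d v : ℂ_[p]) * X v * pderiv ℂ_[p] v (S.hpart j) =
      C (S.d j : ℂ_[p]) * S.hpart j := by
    have := weight_mul_X_mul_pderiv (R := ℂ_[p]) (dworkWt S.d)
      fun m hm => S.weight_of_coeff_hpart_ne hf (j := j) (m := m) hm
    simpa using this
  have h2 : ∑ v, C (dworkWt S.d v : ℂ_[p]) * X v *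
      pderiv ℂ_[p] v (X (inrₗ j) : DworkSeries p n r) =
      -(C (S.d j : ℂ_[p]) * X (inrₗ j)) := by
    rw [sum_eq_single (inrₗ j), pderiv_X_self, mul_one,
      show dworkWt S.d (inrₗ j : DworkVar n r) = -(S.d j : ℤ) from rfl]
    · simp
    · intro v _ hv
      rw [pderiv_X_of_ne (Ne.symm hv), mul_zero]
    · simp
  have e1 := fun (a : DworkVar n r → DworkSeries p n r) (η : DworkForm p n r) =>
    eq_sub_of_add_eq' (kw_kc a (fun v => C (dworkWt S.d v : ℂ_[p]) * X v) η)
  rw [theta_eq, theta_eq, pairMul_apply, pairMul_apply, eulerContr, e1, e1, h1, h2, ← X_mul_hpart,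
    kw_kw_X_pderiv, map_sub, map_smul]
  funext J
  simp only [Pi.sub_apply, Pi.add_apply, Pi.smul_apply, smul_eq_mul, smul_eq_C_mul]
  ring

theorem psi_pow (a : ℕ) : ((psi : DworkSeries p n r →ₗ[ℂ_[p]] DworkSeries p n r) ^ a) =
    cartier (p ^ a) := by
  induction a with
  | zero =>
    refine LinearMap.ext fun g => MvPowerSeries.ext fun m => ?_
    rw [coeff_cartier, pow_zero, pow_zero, one_smul]; rfl
  | succ a ih =>
    refine LinearMap.ext fun g => MvPowerSeries.ext fun m => ?_
    rw [pow_succ', ih, coeff_cartier, pow_succ, mul_smul]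
    rfl

theorem logForm_alpha (hq : S.q ≠ 0) (ω : DworkForm p n r) (J : Finset (DworkVar n r)) :
    logForm (S.alpha ω) J =
      (S.q : ℂ_[p]) ^ (n + 1 + r - J.card) • cartier S.q (S.G₀ * logForm ω J) := by
  have h1 : S.alpha ω J = (S.q : ℂ_[p]) ^ (n + 1 + r - J.card) •
      divSet J ((psi ^ S.a) (S.G₀ * logForm ω J)) := rfl
  rw [logForm, h1, mul_smul_comm, psi_pow]
  congr 1
  ext m
  rw [coeff_monomial_mul, one_mul]
  split_ifs with hm
  · change coeff (m - setMon J + setMon J) (cartier S.q (S.G₀ * logForm ω J)) = _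
    rw [tsub_add_cancel_of_le hm]
  · rw [coeff_cartier, logForm, mul_left_comm, coeff_monomial_mul, if_neg]
    intro h
    refine hm fun i => ?_
    have := h i
    rw [setMon_apply, Finsupp.smul_apply, smul_eq_mul] at this
    rw [setMon_apply]
    split_ifs at this ⊢
    · by_contra h0
      rw [Nat.lt_one_iff.1 (not_le.1 h0)] at this
      omega
    · exact Nat.zero_le _

theorem logForm_theta (ω : DworkForm p n r) :
    logForm (S.theta ω) = kc (fun v => (dworkWt S.d v : ℂ_[p])) (logForm ω) := by
  rw [theta_eq]
  exact logForm_kc _ _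

/-- The factors of `G₀`. -/
def factor (s : ℕ) (j : Fin r) (u : Fin (n + 1) →₀ ℕ) : DworkSeries p n r :=
  monoSubst (p ^ s • expo j u) (S.teichmuller ((S.f j).coeff u) ^ p ^ s) S.splitting

theorem pow_smul_expo_ne_zero (s : ℕ) (j : Fin r) (u : Fin (n + 1) →₀ ℕ) : p ^ s • expo j u ≠ 0 :=
  smul_ne_zero (pow_ne_zero _ (Fact.out : p.Prime).ne_zero) (expo_ne_zero j u)

theorem G₀_eq : S.G₀ = ∏ s ∈ Finset.range S.a, ∏ j, ∏ u ∈ (S.f j).support, S.factor s j u := by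
  refine Finset.prod_congr rfl fun s _ => Finset.prod_congr rfl fun j _ =>
    Finset.prod_congr rfl fun u _ => ?_
  rw [monomial_pow, factor, ← subst_monomial (pow_smul_expo_ne_zero s j u)]
  rfl

/-- The Euler derivative of the series with coefficients `γ_l`. -/
def eulerH : PowerSeries ℂ_[p] := eulerSeries (pSeries p S.gam)

theorem eulerH_eq : S.eulerH = pSeries p (fun l => S.γ ^ p ^ l) +
    (p : ℂ_[p]) • PowerSeries.expand p (Fact.out : p.Prime).ne_zero S.eulerH := by
  have hp : 1 < p := (Fact.out : p.Prime).one_lt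
  have h0 : (p : ℂ_[p]) ≠ 0 := Nat.cast_ne_zero.2 (by omega)
  rw [eulerH, eulerSeries_pSeries hp, ← map_smul, smul_pSeries hp]
  conv_lhs => rw [pSeries_eq_add]
  conv_rhs => rw [pSeries_eq_add]
  rw [add_assoc, ← map_add]
  congr 2
  · simp [gam]
  · congr 1
    refine (eq_pSeries hp (fun l => ?_) fun m hm => ?_).symm
    · rw [map_add, coeff_pSeries_pow hp, coeff_pSeries_pow hp, gam, gam,
        Finset.sum_range_succ _ (l + 1), mul_add, mul_div_cancel₀ _ (pow_ne_zero _ h0)]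
      ring
    · rw [map_add, coeff_pSeries_of_forall_ne hm, coeff_pSeries_of_forall_ne hm, add_zero]

theorem eulerSeries_splitting :
    eulerSeries S.splitting = S.splitting * pSeries p fun l => S.γ ^ p ^ l := by
  have hp : 1 < p := (Fact.out : p.Prime).one_lt
  rw [splitting, eulerSeries_rescale, eulerSeries_artinHasse, map_mul, rescale_pSeries hp]
  simp only [mul_one]

/-- The terms of the logarithmic derivative of `G₀`. -/
def dlogTerm (s : ℕ) (j : Fin r) (u : Fin (n + 1) →₀ ℕ) : DworkSeries p n r :=
  ((p : ℂ_[p]) ^ s) •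
    monoSubst (p ^ s • expo j u) (S.teichmuller ((S.f j).coeff u) ^ p ^ s) S.eulerH

theorem X_mul_pderiv_factor (s : ℕ) (j : Fin r) (u : Fin (n + 1) →₀ ℕ) (i : DworkVar n r) :
    X i * pderiv ℂ_[p] i (S.factor s j u) = S.factor s j u *
      ((expo j u i : ℂ_[p]) • (S.dlogTerm s j u - S.dlogTerm (s + 1) j u)) := by
  have he := pow_smul_expo_ne_zero (p := p) s j u
  have h1 : S.dlogTerm (s + 1) j u = (p : ℂ_[p]) ^ s • (p : ℂ_[p]) •
      monoSubst (p ^ s • expo j u) (S.teichmuller ((S.f j).coeff u) ^ p ^ s)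
        (PowerSeries.expand p (Fact.out : p.Prime).ne_zero S.eulerH) := by
    rw [monoSubst_expand he, ← mul_smul, ← pow_mul, dlogTerm, pow_succ, pow_succ, smul_smul,
      mul_comm (p ^ s) p]
  rw [h1, dlogTerm, ← smul_sub, ← monoSubst_smul he, ← monoSubst_sub he, sub_eq_of_eq_add S.eulerH_eq,
    factor, X_mul_pderiv_monoSubst he, eulerSeries_splitting, monoSubst_mul he, mul_smul_comm,
    mul_smul_comm, smul_smul, Finsupp.smul_apply, smul_eq_mul, Nat.cast_mul, Nat.cast_pow,
    mul_comm ((p : ℂ_[p]) ^ s)]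

theorem X_mul_pderiv_Hpart (i : DworkVar n r) : X i * pderiv ℂ_[p] i (∑ j, S.Hpart j) =
    ∑ j, ∑ u ∈ (S.f j).support, (expo j u i : ℂ_[p]) • S.dlogTerm 0 j u := by
  rw [map_sum, mul_sum]
  refine sum_congr rfl fun j _ => ?_
  rw [Hpart, map_sum, mul_sum]
  refine sum_congr rfl fun u _ => ?_
  rw [X_mul_pderiv_monoSubst (expo_ne_zero j u), dlogTerm, pow_zero, pow_zero, one_smul, one_smul,
    pow_one, eulerH]

theorem X_mul_pderiv_G₀ (i : DworkVar n r) : X i * pderiv ℂ_[p] i S.G₀ =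
    S.G₀ * (X i * pderiv ℂ_[p] i (∑ j, S.Hpart j) -
      ∑ j, ∑ u ∈ (S.f j).support, (expo j u i : ℂ_[p]) • S.dlogTerm S.a j u) := by
  rw [G₀_eq, X_mul_pderiv_prod _ _ _ i fun s _ => X_mul_pderiv_prod _ _ _ i fun j _ =>
    X_mul_pderiv_prod _ _ _ i fun u _ => S.X_mul_pderiv_factor s j u i, X_mul_pderiv_Hpart]
  congr 1
  rw [sum_comm, ← Finset.sum_sub_distrib]
  refine sum_congr rfl fun j _ => ?_
  rw [sum_comm, ← Finset.sum_sub_distrib]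
  refine sum_congr rfl fun u _ => ?_
  rw [← smul_sum, Finset.sum_range_sub', smul_sub]

theorem yDegree_add (m m' : DworkVar n r →₀ ℕ) : yDegree (m + m') = yDegree m + yDegree m' :=
  sum_add_distrib

theorem yDegree_smul (l : ℕ) (m : DworkVar n r →₀ ℕ) : yDegree (l • m) = l * yDegree m :=
  (mul_sum _ _ _).symm

theorem degree_le_weight_add (m : DworkVar n r →₀ ℕ) : (m.degree : ℤ) ≤
    weight (dworkWt S.d) m + (1 + ∑ j, (S.d j : ℤ)) * yDegree m := by
  have h1 : ∀ i : Fin (n + 1), dworkWt S.d (inlₗ i : DworkVar n r) = 1 := fun _ => rfl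
  have h2 : ∀ j : Fin r, dworkWt S.d (inrₗ j : DworkVar n r) = -(S.d j : ℤ) := fun _ => rfl
  have h3 : ∑ j, (m (inrₗ j) : ℤ) * S.d j ≤ (∑ j, (S.d j : ℤ)) * yDegree m := by
    rw [yDegree, Nat.cast_sum, mul_sum]
    refine Finset.sum_le_sum fun j _ => ?_
    rw [mul_comm]
    exact mul_le_mul_of_nonneg_right
      (single_le_sum (f := fun j => (S.d j : ℤ)) (fun _ _ => by positivity)
        (mem_univ j)) (by positivity)
  rw [weight_apply, sum_fintype _ _ (by simp), Finsupp.degree_eq_sum, sum_dworkVar,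
    sum_dworkVar]
  simp only [h1, h2, nsmul_eq_mul, mul_one, mul_neg, sum_neg_distrib]
  rw [add_mul, one_mul]
  have h4 : (yDegree m : ℤ) = ∑ j, (m (inrₗ j) : ℤ) := by rw [yDegree, Nat.cast_sum]
  push_cast
  linarith

/-- Power series over `S.Lam` of weight zero with coefficients bounded by powers of `t`. -/
def bounded (t : NNReal) : Submonoid (DworkSeries p n r) where
  carrier := {φ | ∀ m, coeff m φ ∈ S.Lam ∧ ‖coeff m φ‖ ≤ t ^ yDegree m ∧
    (coeff m φ ≠ 0 → weight (dworkWt S.d) m = 0)}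
  one_mem' m := by
    classical
    rw [coeff_one]
    split_ifs with h
    · subst h
      exact ⟨S.Lam.one_mem, by simp [yDegree], fun _ => map_zero _⟩
    · exact ⟨S.Lam.zero_mem, by rw [norm_zero]; positivity, fun h0 => absurd rfl h0⟩
  mul_mem' {φ χ} hφ hχ m := by
    rw [coeff_mul]
    refine ⟨sum_mem fun x _ => S.Lam.mul_mem (hφ _).1 (hχ _).1, ?_, fun h0 => ?_⟩
    · refine IsUltrametricDist.norm_sum_le_of_forall_le_of_nonneg (by positivity) fun x hx => ?_
      rw [← mem_antidiagonal.1 hx, yDegree_add, pow_add, norm_mul]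
      exact mul_le_mul (hφ _).2.1 (hχ _).2.1 (norm_nonneg _) (by positivity)
    · obtain ⟨x, hx, h0⟩ := exists_ne_zero_of_sum_ne_zero h0
      rw [← mem_antidiagonal.1 hx, map_add,
        (hφ _).2.2 (left_ne_zero_of_mul h0), (hχ _).2.2 (right_ne_zero_of_mul h0), add_zero]

theorem coeff_zero_G₀ : coeff 0 S.G₀ = 1 := by
  rw [G₀_eq, coeff_zero_eq_constantCoeff_apply]
  simp only [map_prod]
  refine Finset.prod_eq_one fun s _ => Finset.prod_eq_one fun j _ => Finset.prod_eq_one fun u _ => ?_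
  rw [← coeff_zero_eq_constantCoeff_apply, factor, ← zero_smul ℕ (p ^ s • expo j u),
    coeff_monoSubst_smul (pow_smul_expo_ne_zero s j u), splitting, PowerSeries.coeff_rescale,
    coeff_zero_artinHasse, pow_zero, pow_zero, one_mul, one_mul]

variable {S} [Fintype k]

/-- The hypotheses on the data. -/
structure IsSetup (S : DworkDatum p k n r) (M g : ℕ) : Prop where
  card : Fintype.card k = p ^ S.a
  M_eq : M = g * (p - 1)
  g_pos : 0 < g
  g_lt : g < S.Mb
  lt_g : S.Mb < p * g
  π_pow : S.π ^ M = p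
  ζ_pow : S.ζ ^ p = 1
  γ_mem : S.γ ∈ S.Lam
  γ_sum : HasSum (fun i : ℕ => S.γ ^ p ^ i / (p : ℂ_[p]) ^ i) 0
  γ_norm : ‖S.γ‖ = ‖S.π‖ ^ g
  pos : 1 ≤ r
  lt : r < n
  deg_pos : ∀ j, 1 ≤ S.d j
  hom : ∀ j, (S.f j).IsHomogeneous (S.d j)
  smooth : IsSmoothCompleteIntersection S.f

variable {M g : ℕ}

namespace IsSetup

theorem one_lt_p : 1 < p := (Fact.out : p.Prime).one_lt

variable (h : S.IsSetup M g)
include h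

theorem a_ne_zero : S.a ≠ 0 := by
  intro h0
  have := Fintype.one_lt_card (α := k)
  rw [h.card, h0, pow_zero] at this
  exact lt_irrefl _ this

theorem p_dvd_q : p ∣ S.q := dvd_pow_self p h.a_ne_zero

theorem one_lt_q : 1 < S.q := by
  have := Fintype.one_lt_card (α := k)
  rwa [h.card] at this

theorem M_pos : 0 < M := by
  have := one_lt_p (p := p)
  rw [h.M_eq]
  exact Nat.mul_pos h.g_pos (by omega)

theorem norm_π_pow : ‖S.π‖ ^ M = (p : ℝ)⁻¹ := by
  rw [← norm_pow, h.π_pow, norm_natCast_p]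

theorem π_ne_zero : S.π ≠ 0 := by
  intro h0
  have := h.norm_π_pow
  rw [h0, norm_zero, zero_pow h.M_pos.ne'] at this
  have hp := one_lt_p (p := p)
  have : (0 : ℝ) < (p : ℝ)⁻¹ := by positivity
  linarith

theorem norm_π_pos : 0 < ‖S.π‖ := norm_pos_iff.2 h.π_ne_zero

theorem norm_π_lt_one : ‖S.π‖ < 1 := by
  by_contra hge
  have h1 := one_le_pow₀ (n := M) (not_lt.1 hge)
  rw [h.norm_π_pow] at h1
  exact absurd (inv_lt_one_of_one_lt₀ (by exact_mod_cast one_lt_p (p := p))) (not_lt.2 h1)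

theorem γ_ne_zero : S.γ ≠ 0 := by
  intro h0
  have := h.γ_norm
  rw [h0, norm_zero] at this
  exact (pow_pos h.norm_π_pos g).ne this

omit h in
theorem π_mem_Lam : S.π ∈ S.Lam := IntermediateField.subset_adjoin _ _ (by simp)

omit h in
theorem mem_integers_iff {x : ℂ_[p]} : x ∈ S.integers ↔ ‖x‖ ≤ 1 ∧ x ∈ S.Lam := by
  rw [← mem_padicComplexInt_iff]; rfl

theorem π_mem : S.π ∈ S.integers := mem_integers_iff.2 ⟨h.norm_π_lt_one.le, π_mem_Lam⟩

/-- The uniformizer as an element of the ring of integers. -/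
def ϖ : S.integers := ⟨S.π, h.π_mem⟩

theorem dvd_iff (x : S.integers) (N : ℕ) : h.ϖ ^ N ∣ x ↔ ‖(x : ℂ_[p])‖ ≤ ‖S.π‖ ^ N := by
  constructor
  · rintro ⟨y, rfl⟩
    rw [Subring.coe_mul, Subring.coe_pow, norm_mul, norm_pow]
    exact mul_le_of_le_one_right (by positivity) (mem_integers_iff.1 y.2).1
  · intro hx
    have hπ := pow_pos h.norm_π_pos N
    have hne : S.π ^ N ≠ 0 := pow_ne_zero _ h.π_ne_zero
    refine ⟨⟨x / S.π ^ N, mem_integers_iff.2 ⟨?_, ?_⟩⟩, Subtype.ext ?_⟩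
    · rw [norm_div, norm_pow]
      exact (div_le_one hπ).2 hx
    · exact S.Lam.div_mem (mem_integers_iff.1 x.2).2 (pow_mem π_mem_Lam N)
    · rw [Subring.coe_mul, Subring.coe_pow]
      exact (mul_div_cancel₀ _ hne).symm

theorem finiteDimensional : FiniteDimensional ℚ_[p] S.Lam := by
  have hq := h.one_lt_q
  have hp := one_lt_p (p := p)
  have hfin : ({x : ℂ_[p] | x ^ (S.q - 1) = 1} ∪ {S.ζ, S.π} : Set ℂ_[p]).Finite := by
    classical
    refine Set.Finite.union ?_ (by simp)
    refine ((Polynomial.nthRoots (S.q - 1) (1 : ℂ_[p])).toFinset.finite_toSet).subset fun x hx => ?_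
    rw [Finset.mem_coe, Multiset.mem_toFinset, Polynomial.mem_nthRoots (by omega)]
    exact hx
  have := hfin.to_subtype
  have key : ∀ (x : ℂ_[p]) (m : ℕ) (c : ℚ_[p]), 0 < m → x ^ m = algebraMap ℚ_[p] ℂ_[p] c →
      IsIntegral ℚ_[p] x := fun x m c hm hx => by
    refine IsIntegral.of_pow hm ?_
    rw [hx]
    exact isIntegral_algebraMap
  refine IntermediateField.finiteDimensional_adjoin fun x hx => ?_
  rcases hx with hx | rfl | rfl
  · exact key x (S.q - 1) 1 (by omega) (by rw [map_one]; exact hx)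
  · exact key _ p 1 (by omega) (by rw [map_one]; exact h.ζ_pow)
  · exact key _ M p h.M_pos (by rw [map_natCast]; exact h.π_pow)

theorem isClosed_Lam : IsClosed (S.Lam : Set ℂ_[p]) := by
  have := h.finiteDimensional
  exact Submodule.closed_of_finiteDimensional (S.Lam.toSubalgebra.toSubmodule)

theorem isPiComplete : IsPiComplete h.ϖ where
  reg x hx := by
    rcases mul_eq_zero.1 hx with h0 | h0
    · exact absurd (congrArg Subtype.val h0) h.π_ne_zero
    · exact h0
  sep x hx := by
    apply Subtype.ext
    rw [ZeroMemClass.coe_zero, ← norm_le_zero_iff]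
    exact ge_of_tendsto' (tendsto_pow_atTop_nhds_zero_of_lt_one (norm_nonneg _) h.norm_π_lt_one)
      fun N => (h.dvd_iff x N).1 (hx N)
  compl a := by
    have hb : ∀ N j, ‖S.π ^ (j + N) * (a (j + N) : ℂ_[p])‖ ≤ ‖S.π‖ ^ N * ‖S.π‖ ^ j := fun N j => by
      rw [norm_mul, norm_pow, pow_add, mul_comm (‖S.π‖ ^ j)]
      exact mul_le_of_le_one_right (by positivity) (mem_integers_iff.1 (a _).2).1
    have hgeo := summable_geometric_of_lt_one (norm_nonneg _) h.norm_π_lt_one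
    have hs : Summable fun j => S.π ^ j * (a j : ℂ_[p]) :=
      Summable.of_norm_bounded hgeo fun j => by simpa using hb 0 j
    have hLam : ∑' j, S.π ^ j * (a j : ℂ_[p]) ∈ S.Lam :=
      h.isClosed_Lam.mem_of_tendsto hs.hasSum.tendsto_sum_nat (Filter.Eventually.of_forall fun N =>
        sum_mem fun j _ => S.Lam.mul_mem (pow_mem π_mem_Lam j) (mem_integers_iff.1 (a j).2).2)
    have htail : ∀ N, ‖∑' j, S.π ^ j * (a j : ℂ_[p]) -
        ∑ j ∈ Finset.range N, S.π ^ j * (a j : ℂ_[p])‖ ≤ ‖S.π‖ ^ N := fun N => by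
      rw [← hs.sum_add_tsum_nat_add N, add_sub_cancel_left]
      refine IsUltrametricDist.norm_tsum_le_of_forall_le_of_nonneg (by positivity) fun j => ?_
      exact (hb N j).trans (mul_le_of_le_one_right (by positivity)
        (pow_le_one₀ (norm_nonneg _) h.norm_π_lt_one.le))
    refine ⟨⟨_, mem_integers_iff.2 ⟨by simpa using htail 0, hLam⟩⟩, fun N => ?_⟩
    rw [h.dvd_iff]
    convert htail N
    push_cast
    rfl

theorem exists_teichmuller (c : k) : ∃ z : ℂ_[p], z ^ S.q = z ∧
    ∃ hz : z ∈ 𝓞_ℂ_[p], residue 𝓞_ℂ_[p] ⟨z, hz⟩ = S.ι c := by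
  have hq := h.one_lt_q
  obtain ⟨z₀, hz₀⟩ := IsLocalRing.residue_surjective (S.ι c)
  have h1 : ‖(z₀ : ℂ_[p]) ^ S.q - z₀‖ < 1 := by
    have : residue 𝓞_ℂ_[p] (z₀ ^ S.q) = residue 𝓞_ℂ_[p] z₀ := by
      rw [map_pow, hz₀, ← map_pow, show S.q = Fintype.card k from h.card.symm, FiniteField.pow_card]
    exact residue_eq_iff.1 this
  let P : Polynomial ℂ_[p] := Polynomial.X ^ S.q - Polynomial.X
  have hP : P.Monic := Polynomial.monic_X_pow_sub (by
    rw [Polynomial.degree_X]; exact_mod_cast hq)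
  have h2 := (IsAlgClosed.splits P).eval_eq_prod_roots_of_monic hP (z₀ : ℂ_[p])
  have h3 : ∃ z ∈ P.roots, ‖(z₀ : ℂ_[p]) - z‖ < 1 := by
    by_contra! hcon
    have h4 : ∀ s : Multiset ℂ_[p], (∀ z ∈ s, 1 ≤ ‖(z₀ : ℂ_[p]) - z‖) →
        1 ≤ ‖(s.map fun a => (z₀ : ℂ_[p]) - a).prod‖ := by
      intro s
      induction s using Multiset.induction_on with
      | empty => simp
      | cons a s ih =>
        intro hs
        rw [Multiset.map_cons, Multiset.prod_cons, norm_mul]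
        exact one_le_mul_of_one_le_of_one_le (hs a (by simp))
          (ih fun z hz => hs z (Multiset.mem_cons_of_mem hz))
    have h5 := h4 _ hcon
    rw [← h2] at h5
    simp only [P, Polynomial.eval_sub, Polynomial.eval_pow, Polynomial.eval_X] at h5
    exact absurd h1 (not_lt.2 h5)
  obtain ⟨z, hz, hlt⟩ := h3
  have hzq : z ^ S.q = z := by
    have := Polynomial.isRoot_of_mem_roots hz
    rw [Polynomial.IsRoot.def] at this
    simp only [P, Polynomial.eval_sub, Polynomial.eval_pow, Polynomial.eval_X] at this
    exact sub_eq_zero.1 this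
  have hzO : z ∈ 𝓞_ℂ_[p] := by
    have h6 : z = z₀ - (z₀ - z) := by ring
    rw [h6]
    exact sub_mem z₀.2 (mem_padicComplexInt_iff.2 hlt.le)
  refine ⟨z, hzq, hzO, ?_⟩
  rw [← hz₀]
  exact (residue_eq_iff.2 hlt).symm

theorem teichmuller_spec (c : k) : S.teichmuller c ^ S.q = S.teichmuller c ∧
    ∃ hz : S.teichmuller c ∈ 𝓞_ℂ_[p], residue 𝓞_ℂ_[p] ⟨_, hz⟩ = S.ι c :=
  Classical.epsilon_spec (h.exists_teichmuller c)

theorem teichmuller_pow (c : k) : S.teichmuller c ^ S.q = S.teichmuller c :=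
  (h.teichmuller_spec c).1

theorem teichmuller_mem (c : k) : S.teichmuller c ∈ S.integers := by
  obtain ⟨h1, h2, -⟩ := h.teichmuller_spec c
  refine ⟨h2, ?_⟩
  by_cases h0 : S.teichmuller c = 0
  · rw [h0]; exact S.Lam.zero_mem
  · refine IntermediateField.subset_adjoin _ _ (Or.inl ?_)
    have hq := h.one_lt_q
    apply mul_right_cancel₀ h0
    rw [← pow_succ, Nat.sub_add_cancel hq.le, h1, one_mul]

/-- The Teichmüller representative as an element of the ring of integers. -/
def tei (c : k) : S.integers := ⟨S.teichmuller c, h.teichmuller_mem c⟩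

theorem dvd_sub_tei {z : S.integers} {c : k} (hz : ‖(z : ℂ_[p]) ^ S.q - z‖ ≤ (p : ℝ)⁻¹)
    (hc : residue 𝓞_ℂ_[p] ⟨z, z.2.1⟩ = S.ι c) : h.ϖ ∣ z - h.tei c := by
  obtain ⟨h1, h2, h3⟩ := h.teichmuller_spec c
  have h4 : ‖(z : ℂ_[p]) - S.teichmuller c‖ < 1 := residue_eq_iff.1 (hc.trans h3.symm)
  have h5 := norm_sub_eq_of_pow h.p_dvd_q (mem_integers_iff.1 z.2).1
    (mem_padicComplexInt_iff.1 h2) h4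
  rw [h1, sub_self, sub_zero] at h5
  rw [← pow_one h.ϖ, h.dvd_iff, pow_one]
  refine (h5.trans_le hz).trans ?_
  rw [← h.norm_π_pow]
  exact pow_le_of_le_one (norm_nonneg _) h.norm_π_lt_one.le h.M_pos.ne'

theorem residue_tei (c : k) : residue 𝓞_ℂ_[p] ⟨h.tei c, (h.tei c).2.1⟩ = S.ι c := by
  obtain ⟨-, h2, h3⟩ := h.teichmuller_spec c
  exact h3

/-- The reduction of the ring of integers modulo `π`. -/
abbrev Red : Type := S.integers ⧸ span {h.ϖ}

/-- The reduction map. -/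
def red : S.integers →+* h.Red := Ideal.Quotient.mk _

theorem isReduction : IsReduction h.ϖ h.red where
  surj := Ideal.Quotient.mk_surjective
  eq_zero_iff x := by
    rw [red, Ideal.Quotient.eq_zero_iff_mem, Ideal.mem_span_singleton]

theorem red_eq_iff {x y : S.integers} : h.red x = h.red y ↔ h.ϖ ∣ x - y := by
  rw [← h.isReduction.eq_zero_iff, map_sub, sub_eq_zero]

/-- The embedding of the finite field in the reduction of the ring of integers. -/
def incl : k →+* h.Red where
  toFun c := h.red (h.tei c)
  map_one' := by
    rw [← map_one h.red, eq_comm, red_eq_iff]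
    refine h.dvd_sub_tei ?_ ?_
    · simp
    · rw [map_one S.ι]; exact map_one _
  map_zero' := by
    rw [← map_zero h.red, eq_comm, red_eq_iff]
    refine h.dvd_sub_tei ?_ ?_
    · have hq := h.one_lt_q
      rw [ZeroMemClass.coe_zero, zero_pow (by omega), sub_self, norm_zero]
      positivity
    · rw [map_zero S.ι]; exact map_zero _
  map_mul' c c' := by
    rw [← map_mul h.red, eq_comm, red_eq_iff]
    refine h.dvd_sub_tei ?_ ?_
    · rw [Subring.coe_mul, mul_pow]
      simp only [tei, h.teichmuller_pow]
      simp
    · rw [map_mul S.ι, ← h.residue_tei c, ← h.residue_tei c', ← map_mul]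
      rfl
  map_add' c c' := by
    rw [← map_add h.red, eq_comm, red_eq_iff]
    refine h.dvd_sub_tei ?_ ?_
    · obtain ⟨y, hy⟩ := exists_add_pow_prime_pow_eq (Fact.out : p.Prime) (h.tei c) (h.tei c') S.a
      have h1 := congrArg Subtype.val hy
      have h2 : ∀ c, ((h.tei c : S.integers) : ℂ_[p]) ^ p ^ S.a = h.tei c := h.teichmuller_pow
      push_cast at h1
      rw [h2, h2] at h1
      rw [Subring.coe_add, q, h1, mul_assoc, mul_assoc, add_sub_cancel_left, norm_mul,
        norm_natCast_p]
      refine mul_le_of_le_one_right (by positivity) ?_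
      exact (mem_integers_iff.1 (h.tei c * (h.tei c' * y)).2).1
    · rw [map_add S.ι, ← h.residue_tei c, ← h.residue_tei c', ← map_add]
      rfl

theorem incl_apply (c : k) : h.incl c = h.red (h.tei c) := rfl

/-! #### The constants -/

omit h in
/-- The constant `π^{Mb} / γ`. -/
def κ (_ : S.IsSetup M g) : ℂ_[p] := S.π ^ S.Mb * S.γ⁻¹

theorem κ_mem : h.κ ∈ S.Lam := S.Lam.mul_mem (pow_mem π_mem_Lam _) (S.Lam.inv_mem h.γ_mem)

theorem norm_κ : ‖h.κ‖ = ‖S.π‖ ^ (S.Mb - g) := by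
  have hg := pow_pos h.norm_π_pos g
  rw [κ, norm_mul, norm_inv, norm_pow, h.γ_norm, ← div_eq_mul_inv, div_eq_iff hg.ne', ← pow_add,
    Nat.sub_add_cancel h.g_lt.le]

/-- The constant `π^{Mb} / γ` as an element of the ring of integers. -/
def κO : S.integers := ⟨h.κ, mem_integers_iff.2 ⟨by
  rw [h.norm_κ]; exact pow_le_one₀ (norm_nonneg _) h.norm_π_lt_one.le, h.κ_mem⟩⟩

theorem dvd_κO : h.ϖ ∣ h.κO := by
  have := h.g_lt
  rw [← pow_one h.ϖ, h.dvd_iff, κO, h.norm_κ]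
  exact pow_le_pow_of_le_one (norm_nonneg _) h.norm_π_lt_one.le (by omega)

theorem norm_gam_le (l : ℕ) :
    ‖S.gam l‖ ≤ ‖S.π‖ ^ ((g : ℤ) * (p : ℤ) ^ (l + 1) - (M : ℤ) * ((l : ℤ) + 1)) := by
  have hp := one_lt_p (p := p)
  have hρ := h.norm_π_pos
  have hnorm : ∀ i : ℕ, ‖S.γ ^ p ^ i / (p : ℂ_[p]) ^ i‖ =
      ‖S.π‖ ^ ((g : ℤ) * (p : ℤ) ^ i - (M : ℤ) * (i : ℤ)) := fun i => by
    rw [norm_div, norm_pow, norm_pow, h.γ_norm, norm_natCast_p, ← h.norm_π_pow, ← pow_mul, ← pow_mul,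
      zpow_sub₀ hρ.ne']
    norm_cast
  have hmono : Monotone fun i : ℕ => (g : ℤ) * (p : ℤ) ^ i - (M : ℤ) * (i : ℤ) := by
    refine monotone_nat_of_le_succ fun i => ?_
    have h1 : (M : ℤ) = g * (p - 1) := by
      rw [h.M_eq]; push_cast [Nat.cast_sub hp.le]; ring
    have h2 : (1 : ℤ) ≤ (p : ℤ) ^ i := one_le_pow₀ (by exact_mod_cast hp.le)
    have h3 : (0 : ℤ) ≤ (g : ℤ) * (p - 1) := by
      have : (1 : ℤ) < p := by exact_mod_cast hp
      exact mul_nonneg (by positivity) (by linarith)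
    rw [h1, pow_succ]
    push_cast
    nlinarith
  have h1 := h.γ_sum.summable.sum_add_tsum_nat_add (l + 1)
  rw [h.γ_sum.tsum_eq] at h1
  rw [gam, eq_neg_of_add_eq_zero_left h1, norm_neg]
  refine IsUltrametricDist.norm_tsum_le_of_forall_le_of_nonneg (by positivity) fun i => ?_
  rw [hnorm]
  refine zpow_le_zpow_right_of_le_one₀ hρ h.norm_π_lt_one.le ?_
  have := hmono (show l + 1 ≤ i + (l + 1) by omega)
  push_cast at this ⊢
  exact this

theorem gam_mem (l : ℕ) : S.gam l ∈ S.Lam :=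
  sum_mem fun _ _ => S.Lam.div_mem (pow_mem h.γ_mem _) (pow_mem (natCast_mem S.Lam p) _)

theorem norm_eps_le (l : ℕ) : ‖h.κ * S.gam l * (p : ℂ_[p]) ^ l / S.π ^ (S.Mb * p ^ l)‖ ≤
    ‖S.π‖ ^ (p ^ l - 1) := by
  have hp := one_lt_p (p := p)
  have hρ := h.norm_π_pos
  have h2 : 1 ≤ p ^ l := Nat.one_le_pow _ _ (by omega)
  rw [norm_div, norm_mul, norm_mul, norm_pow, norm_pow, h.norm_κ, norm_natCast_p, ← h.norm_π_pow,
    div_le_iff₀ (by positivity)]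
  calc ‖S.π‖ ^ (S.Mb - g) * ‖S.gam l‖ * (‖S.π‖ ^ M) ^ l
      ≤ ‖S.π‖ ^ (S.Mb - g) * ‖S.π‖ ^ ((g : ℤ) * (p : ℤ) ^ (l + 1) - (M : ℤ) * ((l : ℤ) + 1)) *
        (‖S.π‖ ^ M) ^ l := by
        gcongr
        exact h.norm_gam_le l
    _ = ‖S.π‖ ^ (((S.Mb - g : ℕ) : ℤ) + ((g : ℤ) * (p : ℤ) ^ (l + 1) - (M : ℤ) * ((l : ℤ) + 1)) +
        ((M * l : ℕ) : ℤ)) := by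
        rw [zpow_add₀ hρ.ne', zpow_add₀ hρ.ne', zpow_natCast, zpow_natCast, pow_mul]
    _ ≤ ‖S.π‖ ^ (((p ^ l - 1 + S.Mb * p ^ l : ℕ) : ℤ)) := by
        refine zpow_le_zpow_right_of_le_one₀ hρ h.norm_π_lt_one.le ?_
        have h1 : (M : ℤ) = g * (p - 1) := by
          rw [h.M_eq]; push_cast [Nat.cast_sub hp.le]; ring
        have h3 : (1 : ℤ) ≤ (p : ℤ) ^ l := by exact_mod_cast h2
        have h4 : (S.Mb : ℤ) < p * g := by exact_mod_cast h.lt_g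
        push_cast [Nat.cast_sub h2, Nat.cast_sub h.g_lt.le]
        rw [h1, pow_succ]
        nlinarith
    _ = _ := by rw [zpow_natCast, pow_add]

/-- The coefficients of the normalized derivatives of `H`. -/
def eps (l : ℕ) : S.integers :=
  ⟨h.κ * S.gam l * (p : ℂ_[p]) ^ l / S.π ^ (S.Mb * p ^ l), mem_integers_iff.2
    ⟨(h.norm_eps_le l).trans (pow_le_one₀ (norm_nonneg _) h.norm_π_lt_one.le),
      S.Lam.div_mem (S.Lam.mul_mem (S.Lam.mul_mem h.κ_mem (h.gam_mem l))
        (pow_mem (natCast_mem S.Lam p) l)) (pow_mem π_mem_Lam _)⟩⟩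

theorem eps_zero : h.eps 0 = 1 := by
  apply Subtype.ext
  change h.κ * S.gam 0 * (p : ℂ_[p]) ^ 0 / S.π ^ (S.Mb * p ^ 0) = 1
  have h1 := h.π_ne_zero
  have h2 := h.γ_ne_zero
  simp [κ, gam]
  field_simp

theorem dvd_eps (l : ℕ) : h.ϖ ^ (p ^ l - 1) ∣ h.eps l := (h.dvd_iff _ _).2 (h.norm_eps_le l)

theorem red_eps {l : ℕ} (hl : 0 < l) : h.red (h.eps l) = 0 := by
  have hp := one_lt_p (p := p)
  have := Nat.one_lt_pow hl.ne' hp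
  rw [h.isReduction.eq_zero_iff]
  exact (dvd_pow_self _ (by omega)).trans (h.dvd_eps l)

/-- The power series `∑ ε_l t^{p^l}`. -/
def epsSeries : PowerSeries S.integers := pSeries p h.eps

theorem finite_not_dvd_epsSeries (N : ℕ) :
    {m | ¬h.ϖ ^ N ∣ PowerSeries.coeff m h.epsSeries}.Finite := by
  have hp := one_lt_p (p := p)
  refine (Set.finite_Iic (N + 1)).subset fun m hm => ?_
  by_contra hlt
  rw [Set.mem_Iic, not_le] at hlt
  refine hm ?_
  by_cases hl : ∃ l, m = p ^ l
  · obtain ⟨l, rfl⟩ := hl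
    rw [epsSeries, coeff_pSeries_pow hp]
    exact (pow_dvd_pow _ (by omega)).trans (h.dvd_eps l)
  · rw [epsSeries, coeff_pSeries_of_forall_ne (by simpa using hl)]
    exact dvd_zero _

theorem map_red_epsSeries : PowerSeries.map h.red h.epsSeries = PowerSeries.X := by
  rw [epsSeries, map_pSeries one_lt_p]
  exact pSeries_eq_X one_lt_p (by rw [h.eps_zero, map_one]) fun l hl => h.red_eps hl

theorem denorm_mem {Φ : VarForm n r S.integers} {i : ℕ}
    (hΦ : IsGood h.ϖ S.d i Φ) : S.denorm Φ ∈ S.FOmega 0 i := by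
  refine ⟨fun J => ⟨fun hJ => ?_, fun m => ?_, fun m hm => ?_, ?_⟩, fun J m => ?_⟩
  · ext m
    rw [coeff_denorm, hΦ.1 J (by exact_mod_cast hJ)]
    simp
  · rw [coeff_denorm]
    exact S.Lam.mul_mem (pow_mem π_mem_Lam _) (coeff m (Φ J)).2.2
  · rw [coeff_denorm]
    by_contra h0
    refine hm ((degree_eq m J).trans (hΦ.2.2 J m fun h1 => h0 ?_))
    rw [h1]
    simp
  · rw [tendsto_zero_iff_norm_tendsto_zero, Metric.tendsto_nhds]
    intro ε hε
    obtain ⟨N, hN⟩ := exists_pow_lt_of_lt_one hε h.norm_π_lt_one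
    refine (hΦ.2.1 J N).subset fun m hm hd => hm ?_
    rw [h.dvd_iff] at hd
    change dist ‖coeff m (S.denorm Φ J) / S.π ^ (S.Mb * yDegree m)‖ 0 < ε
    rw [coeff_denorm, mul_add, pow_add, mul_assoc,
      mul_div_cancel_left₀ _ (pow_ne_zero _ h.π_ne_zero), dist_zero_right, norm_norm, norm_mul,
      norm_pow]
    refine lt_of_le_of_lt ((mul_le_of_le_one_left (norm_nonneg _)
      (pow_le_one₀ (norm_nonneg _) h.norm_π_lt_one.le)).trans hd) hN
  · refine ⟨((coeff m (Φ J) : S.integers) : ℂ_[p]), (coeff m (Φ J) : S.integers).2, ?_⟩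
    rw [coeff_denorm, zero_add, zpow_natCast]

theorem exists_denorm_eq {ω : DworkForm p n r} {i : ℕ} (hω : ω ∈ S.FOmega 0 i) :
    ∃ Φ, IsGood h.ϖ S.d i Φ ∧ ω = S.denorm Φ := by
  have h1 := hω.2
  choose A hA hAω using h1
  simp only [zero_add, zpow_natCast] at hAω
  have hpi : ∀ N : ℕ, S.π ^ N ≠ 0 := fun N => pow_ne_zero _ h.π_ne_zero
  have hz : ∀ J m, coeff m (ω J) = 0 → A J m = 0 := fun J m h0 => by
    rw [hAω] at h0
    exact (mul_eq_zero.1 h0).resolve_left (hpi _)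
  let Φ : VarForm n r S.integers :=
    fun J m => ⟨A J m, hA J m⟩
  have hΦ : ∀ J m, coeff m (Φ J) = ⟨A J m, hA J m⟩ := fun J m => rfl
  refine ⟨Φ, ⟨fun J hJ => ?_, fun J N => ?_, fun J m hm => ?_⟩, ?_⟩
  · ext m
    rw [hΦ]
    refine hz J m ?_
    rw [(hω.1 J).1 (by exact_mod_cast hJ), map_zero]
  · have h2 := (hω.1 J).2.2.2
    rw [tendsto_zero_iff_norm_tendsto_zero] at h2
    have h3 := h2.eventually (gt_mem_nhds (pow_pos h.norm_π_pos (N + S.Mb * yCard J)))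
    refine Set.Finite.subset h3 fun m hm hlt => hm ?_
    rw [hΦ, h.dvd_iff]
    change ‖coeff m (ω J) / S.π ^ (S.Mb * yDegree m)‖ < _ at hlt
    rw [hAω, mul_add, pow_add, mul_assoc, mul_div_cancel_left₀ _ (hpi _), norm_mul, norm_pow,
      pow_add, mul_comm (‖S.π‖ ^ N)] at hlt
    exact (lt_of_mul_lt_mul_left hlt (by positivity)).le
  · by_contra h0
    refine hm (Subtype.ext (hz J m ((hω.1 J).2.2.1 m fun h2 => h0 ?_)))
    rwa [degree_eq] at h2
  · funext J
    ext m
    rw [coeff_denorm, hΦ, hAω]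

/-- The normalized logarithmic derivatives of the parts of `H`. -/
def Q (j : Fin r) (v : DworkVar n r) : VarSeries n r S.integers :=
  ∑ u ∈ (S.f j).support, (expo j u v : S.integers) •
    monoSubst (expo j u) (h.tei ((S.f j).coeff u)) h.epsSeries

theorem scaleHom_Q (j : Fin r) (v : DworkVar n r) : scaleHom S.integers.subtype S.scal (h.Q j v) =
      h.κ • (X v * pderiv ℂ_[p] v (S.Hpart j)) := by
  have hp := one_lt_p (p := p)
  rw [Q, Hpart, map_sum, map_sum, mul_sum, smul_sum]
  refine sum_congr rfl fun u _ => ?_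
  have he : expo j u ≠ 0 := expo_ne_zero j u
  have hy : yDegree (expo j u : DworkVar n r →₀ ℕ) = 1 := by
    simp [yDegree, expo_inrₗ]
  have h1 : PowerSeries.rescale (S.π ^ S.Mb) (PowerSeries.map S.integers.subtype h.epsSeries) =
      h.κ • eulerSeries (pSeries p S.gam) := by
    rw [epsSeries, map_pSeries hp, rescale_pSeries hp, eulerSeries_pSeries hp, smul_pSeries hp]
    congr 1
    funext l
    change (S.π ^ S.Mb) ^ p ^ l * (h.κ * S.gam l * (p : ℂ_[p]) ^ l / S.π ^ (S.Mb * p ^ l)) = _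
    have := h.π_ne_zero
    rw [← pow_mul]
    field_simp
  rw [X_mul_pderiv_monoSubst he, Nat.cast_smul_eq_nsmul, Nat.cast_smul_eq_nsmul, map_nsmul,
    scaleHom_monoSubst _ _ he, prod_scal, hy, mul_one, monoSubst_mul_left he, h1,
    monoSubst_smul he, smul_comm h.κ]
  rfl

theorem coeff_Q_ne {j : Fin r} {v : DworkVar n r} {m : DworkVar n r →₀ ℕ}
    (hm : coeff m (h.Q j v) ≠ 0) :
    m v ≠ 0 ∧ m (inrₗ j) ≠ 0 ∧ ∃ u ∈ (S.f j).support, ∃ l : ℕ, m = l • expo j u := by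
  have hp := one_lt_p (p := p)
  rw [Q, map_sum] at hm
  obtain ⟨u, hu, hne⟩ := exists_ne_zero_of_sum_ne_zero hm
  rw [coeff_smul] at hne
  obtain ⟨l, rfl⟩ := exists_of_coeff_monoSubst_ne (right_ne_zero_of_mul hne)
  have hv : expo j u v ≠ 0 := fun h0 => left_ne_zero_of_mul hne (by rw [h0, Nat.cast_zero])
  have hl : l ≠ 0 := by
    rintro rfl
    refine right_ne_zero_of_mul hne ?_
    rw [coeff_monoSubst_smul (expo_ne_zero j u), epsSeries, coeff_pSeries_of_forall_ne, zero_mul]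
    intro l
    exact (pow_ne_zero l (by omega : p ≠ 0)).symm
  refine ⟨mul_ne_zero hl hv, ?_, u, hu, l, rfl⟩
  rw [Finsupp.smul_apply, expo_inrₗ, if_pos rfl]
  simpa using hl

theorem isNull_Q (j : Fin r) (v : DworkVar n r) : IsNull h.ϖ (h.Q j v) :=
  IsNull.sum fun u _ => (isNull_monoSubst (expo_ne_zero j u) h.finite_not_dvd_epsSeries).smul _

theorem map_red_Q (j : Fin r) (v : DworkVar n r) : MvPowerSeries.map h.red (h.Q j v) =
    ∑ u ∈ (S.f j).support, (expo j u v : h.Red) • monomial (expo j u)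
      (h.incl ((S.f j).coeff u)) := by
  rw [Q, map_sum]
  refine sum_congr rfl fun u _ => ?_
  rw [smul_eq_C_mul, map_mul, map_monoSubst _ (expo_ne_zero j u), h.map_red_epsSeries,
    monoSubst_X (expo_ne_zero j u), map_C, map_natCast, ← smul_eq_C_mul, incl_apply]

/-- The normalized derivatives of `H`. -/
def G (v : DworkVar n r) : VarSeries n r S.integers := divVar v (∑ j, h.Q j v)

theorem X_mul_G (v : DworkVar n r) : X v * h.G v = ∑ j, h.Q j v :=
  X_mul_divVar fun m hm => by
    rw [map_sum]
    refine sum_eq_zero fun j _ => ?_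
    by_contra h0
    exact (h.coeff_Q_ne h0).1 hm

theorem D_denorm (Φ : VarForm n r S.integers) : S.D (S.denorm Φ) = S.denorm (twD h.κO h.G Φ) := by
  rw [D_eq, denorm, denorm, twD_apply, twD_apply, scaleForm_add, scaleForm_smul, scaleForm_dForm]
  congr 1
  refine scaleForm_kw _ _ (fun v => ?_) Φ
  rw [X_mul_G, map_sum]
  simp only [scaleHom_Q]
  rw [← smul_sum, ← mul_sum, ← map_sum, Derivation.map_smul, mul_smul_comm]
  rfl

theorem denorm_injective {Φ Ψ : VarForm n r S.integers} (hΦ : S.denorm Φ = S.denorm Ψ) : Φ = Ψ :=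
  scaleForm_injective S.integers.subtype_injective (fun v => by
    induction v using dworkVar_cases with
    | hx i => exact one_ne_zero
    | hy j => exact pow_ne_zero _ h.π_ne_zero) hΦ

theorem theta_denorm (Φ : VarForm n r S.integers) :
    S.theta (S.denorm Φ) = S.denorm (eulerContr S.integers S.d Φ) := by
  rw [theta_eq, denorm, eulerContr, scaleForm_kc]; rfl

theorem denorm_add (Φ Ψ : VarForm n r S.integers) :
    S.denorm (Φ + Ψ) = S.denorm Φ + S.denorm Ψ := scaleForm_add _ _ _ _

theorem denorm_smul (c : S.integers) (Φ : VarForm n r S.integers) :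
    S.denorm (c • Φ) = c • S.denorm Φ := scaleForm_smul _ _ _ _

/-- The equations over the reduction of the ring of integers. -/
def fbar (j : Fin r) : MvPolynomial (Fin (n + 1)) h.Red := MvPolynomial.map h.incl (S.f j)

theorem X_mul_liftPoly (j : Fin r) :
    ((MvPolynomial.X (inrₗ j) * liftPoly h.fbar j : DworkPoly n r h.Red) : VarSeries n r h.Red) =
    ∑ u ∈ (S.f j).support, monomial (expo j u) (h.incl ((S.f j).coeff u)) := by
  have h1 : h.fbar j = ∑ u ∈ (S.f j).support,
      MvPolynomial.monomial u (h.incl ((S.f j).coeff u)) := by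
    conv_lhs => rw [fbar, (S.f j).as_sum, map_sum]
    simp only [MvPolynomial.map_monomial]
  rw [liftPoly, h1, map_sum, mul_sum, ← MvPolynomial.coeToMvPowerSeries.ringHom_apply,
    map_sum]
  refine sum_congr rfl fun u _ => ?_
  rw [MvPolynomial.rename_monomial, MvPolynomial.coeToMvPowerSeries.ringHom_apply, MvPolynomial.X,
    MvPolynomial.monomial_mul, one_mul, MvPolynomial.coe_monomial, add_comm]
  rfl

theorem coe_potential : (potential h.fbar : VarSeries n r h.Red) =
    ∑ j, ∑ u ∈ (S.f j).support, monomial (expo j u) (h.incl ((S.f j).coeff u)) := by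
  rw [potential, ← MvPolynomial.coeToMvPowerSeries.ringHom_apply, map_sum]
  exact sum_congr rfl fun j _ => h.X_mul_liftPoly j

theorem map_red_G (v : DworkVar n r) : MvPowerSeries.map h.red (h.G v) =
    (dPotential h.fbar v : VarSeries n r h.Red) := by
  apply X_mul_cancel (i := v)
  have h1 : X v * MvPowerSeries.map h.red (h.G v) = MvPowerSeries.map h.red (X v * h.G v) := by
    rw [map_mul, MvPowerSeries.map_X]
  rw [h1, X_mul_G, map_sum, dPotential, ← pderiv_coe, coe_potential, map_sum, mul_sum]
  refine sum_congr rfl fun j _ => ?_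
  rw [map_red_Q, map_sum, mul_sum]
  exact sum_congr rfl fun u _ => (X_mul_pderiv_monomial _ _ _).symm

theorem weight_of_coeff_Q_ne {j : Fin r}
    {v : DworkVar n r} {m : DworkVar n r →₀ ℕ} (hm : coeff m (h.Q j v) ≠ 0) :
    weight (dworkWt S.d) m = 0 := by
  obtain ⟨-, -, u, hu, l, rfl⟩ := h.coeff_Q_ne hm
  rw [map_nsmul, S.weight_expo j u ?_, smul_zero]
  have := h.hom j (MvPolynomial.mem_support_iff.1 hu)
  rw [← this, Finsupp.degree_eq_weight_one]
  rfl

theorem isDworkLift : IsDworkLift h.ϖ h.red S.d h.fbar h.κO h.G where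
  complete := h.isPiComplete
  red := h.isReduction
  jac := h.smooth.jacobianCriterion.map h.incl
  hom j := (h.hom j).map h.incl
  lt := h.lt
  dvd := h.dvd_κO
  null v := (IsNull.sum fun j _ => h.isNull_Q j v).divVar v
  weight v m hm := by
    rw [G, coeff_divVar, map_sum] at hm
    obtain ⟨j, -, hj⟩ := exists_ne_zero_of_sum_ne_zero hm
    have := h.weight_of_coeff_Q_ne hj
    rwa [map_add, weight_single, one_smul] at this
  map_eq := h.map_red_G
  comp_self ω := by
    apply h.denorm_injective
    rw [← D_denorm, ← D_denorm, D_D, denorm, scaleForm_zero]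

theorem sum_weight_mul_G : ∑ v, C (dworkWt S.d v : S.integers) * X v * h.G v = 0 := by
  simp only [mul_assoc, X_mul_G, Q]
  simp only [mul_sum, ← smul_eq_C_mul, smul_smul]
  rw [sum_comm]
  refine sum_eq_zero fun j _ => ?_
  rw [sum_comm]
  refine sum_eq_zero fun u hu => ?_
  rw [← Finset.sum_smul]
  have h1 := S.weight_expo j u (by
    rw [← h.hom j (MvPolynomial.mem_support_iff.1 hu), Finsupp.degree_eq_weight_one]; rfl)
  rw [weight_apply, sum_fintype _ _ (by simp)] at h1
  have h2 : ∑ v, (dworkWt S.d v : S.integers) * (expo j u v : S.integers) = 0 := by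
    have := congrArg (Int.cast : ℤ → S.integers) h1
    push_cast at this
    rw [← this]
    exact sum_congr rfl fun v _ => by rw [nsmul_eq_mul]; push_cast; ring
  rw [h2, zero_smul]

theorem D_mem {i : ℕ} {ω : DworkForm p n r} (hL : IsDworkLift h.ϖ h.red S.d h.fbar h.κO h.G)
    (hω : ω ∈ S.FOmega 0 i) : S.D ω ∈ S.FOmega 0 (i + 1) := by
  obtain ⟨Φ, hΦ, rfl⟩ := h.exists_denorm_eq hω
  rw [D_denorm]
  exact h.denorm_mem (by exact_mod_cast hΦ.twD _ hL.null hL.weight)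

theorem theta_mem {i : ℕ} {ω : DworkForm p n r} (hω : ω ∈ S.FOmega 0 (i + 1)) :
    S.theta ω ∈ S.FOmega 0 i := by
  obtain ⟨Φ, hΦ, rfl⟩ := h.exists_denorm_eq hω
  rw [h.theta_denorm]
  exact h.denorm_mem (IsGood.eulerContr (by exact_mod_cast hΦ))

theorem theta_D {i : ℕ} {ω : DworkForm p n r}
    (hω : ω ∈ S.FOmega 0 i) : S.theta (S.D ω) = -S.D (S.theta ω) := by
  obtain ⟨Φ, hΦ, rfl⟩ := h.exists_denorm_eq hω
  rw [D_denorm, h.theta_denorm, h.theta_denorm, h.D_denorm, eulerContr,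
    kc_twD_add (dworkWt S.d) _ (h.sum_weight_mul_G) hΦ.2.2, ← neg_one_smul S.integers, h.denorm_smul]
  exact neg_one_smul ℂ_[p] _

section
omit h [Fintype k]

theorem theta_theta (ω : DworkForm p n r) : S.theta (S.theta ω) = 0 := by
  rw [theta_eq, theta_eq]
  exact kc_self _ _

theorem constTerm_apply (ω : DworkForm p n r) : constTerm ω = coeff 0 (ω ∅) • zeroForm 1 := by
  funext J
  by_cases hJ : J = ∅
  · subst hJ
    rw [Pi.smul_apply, zeroForm_empty]
    simp only [constTerm, LinearMap.comp_apply, LinearMap.single_apply, LinearMap.proj_apply]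
    rw [show Pi.single ∅ _ ∅ = _ from Pi.single_eq_same _ _, monomial_zero_eq_C_apply,
      smul_eq_C_mul, mul_one]
  · rw [Pi.smul_apply, zeroForm_of_ne hJ, smul_zero]
    exact Pi.single_eq_of_ne hJ _

theorem constTerm_theta (ω : DworkForm p n r) : constTerm (S.theta ω) = 0 := by
  rw [constTerm_apply, theta_eq, eulerContr, kc_apply, map_sum, sum_eq_zero, zero_smul]
  intro v _
  rw [map_zsmul, smul_eq_mul, mul_assoc, coeff_C_mul, coeff_zero_X_mul, mul_zero, smul_zero]

end

theorem theta_exact {i : ℕ} {ω : DworkForm p n r}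
    (hω : ω ∈ S.FOmega 0 i) (h0 : S.thetaHat i ω = 0) : ∃ σ ∈ S.FOmega 0 (i + 1), S.theta σ = ω := by
  obtain ⟨Φ, hΦ, rfl⟩ := h.exists_denorm_eq hω
  have h1 : eulerContr S.integers S.d Φ = 0 ∧ coeff 0 (Φ ∅) = 0 := by
    cases i with
    | zero =>
      constructor
      · refine IsDeg.eq_zero_of_neg (k := -1) (by norm_num) ?_
        have := hΦ.1.kc fun v => C (dworkWt S.d v : S.integers) * X v
        exact_mod_cast this
      · change constTerm _ = 0 at h0
        have := congrArg (coeff 0) (congrFun h0 ∅)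
        rw [constTerm_apply, Pi.smul_apply, coeff_smul, zeroForm_empty, coeff_zero_one, mul_one,
          coeff_denorm] at this
        have h2 := (mul_eq_zero.1 this).resolve_left (pow_ne_zero _ h.π_ne_zero)
        exact Subtype.ext h2
    | succ i =>
      constructor
      · refine h.denorm_injective ?_
        rw [← h.theta_denorm]
        refine (h0 : S.theta _ = 0).trans ?_
        rw [denorm, scaleForm_zero]
      · rw [hΦ.1 ∅ (by simp; omega), map_zero]
  obtain ⟨Ψ, hΨ, hΨΦ⟩ := hΦ.exists_eulerContr_eq h.deg_pos h1.1 h1.2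
  exact ⟨_, h.denorm_mem (by exact_mod_cast hΨ), by rw [h.theta_denorm, hΨΦ]⟩

theorem zeroForm_one_mem : (zeroForm 1 : DworkForm p n r) ∈ S.FOmega 0 0 := by
  have h1 : (zeroForm 1 : DworkForm p n r) = S.denorm (constForm 1) := by
    funext J
    by_cases hJ : J = ∅
    · subst hJ
      rw [zeroForm_empty, denorm, scaleForm, constForm_empty, map_one, Finset.prod_empty, map_one,
        mul_one]
    · rw [zeroForm_of_ne hJ, denorm, scaleForm, constForm_of_ne hJ, map_zero, mul_zero]
  rw [h1]
  refine h.denorm_mem ⟨fun J hJ => constForm_of_ne (by rintro rfl; simp at hJ) 1, fun J N => ?_,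
    fun J m hm => ?_⟩
  · refine (Set.finite_singleton 0).subset fun m hm => ?_
    by_contra h0
    refine hm ?_
    by_cases hJ : J = ∅
    · rw [hJ, constForm_empty, coeff_one, if_neg (by exact h0)]; exact dvd_zero _
    · rw [constForm_of_ne hJ, map_zero]; exact dvd_zero _
  · by_cases hJ : J = ∅
    · rw [hJ, constForm_empty, coeff_one] at hm
      have h0 : m = 0 := by by_contra h0; exact hm (if_neg h0)
      rw [h0, hJ, map_zero, Finset.sum_empty, add_zero]
    · rw [constForm_of_ne hJ, map_zero] at hm
      exact absurd rfl hm

theorem map_thetaHat (i : ℕ) {z : DworkForm p n r} :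
    z ∈ S.FOmegaHat 0 i ↔ ∃ ω ∈ S.FOmega 0 i, S.thetaHat i ω = z := by
  cases i with
  | succ i => exact Iff.rfl
  | zero =>
    rw [FOmegaHat, zpow_zero, one_smul, Submodule.mem_span_singleton]
    constructor
    · rintro ⟨a, rfl⟩
      refine ⟨_, Submodule.smul_mem _ a h.zeroForm_one_mem, ?_⟩
      change constTerm _ = _
      rw [constTerm_apply, Pi.smul_apply, zeroForm_empty]
      change (coeff 0 ((a : ℂ_[p]) • (1 : DworkSeries p n r))) • _ = (a : ℂ_[p]) • (zeroForm 1 : DworkForm p n r)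
      rw [coeff_smul, coeff_zero_one, mul_one]
    · rintro ⟨ω, hω, rfl⟩
      obtain ⟨A, hA, h1⟩ := hω.2 ∅ 0
      refine ⟨⟨A, hA⟩, ?_⟩
      change _ = constTerm _
      rw [constTerm_apply, h1]
      simp [yDegree, yCard]
      rfl

theorem isThetaComplex {R : Type*} [CommRing R] [Module R (DworkForm p n r)]
    {C Ĉ : ℕ → Submodule R (DworkForm p n r)} {d d' t : ℕ → DworkForm p n r →ₗ[R] DworkForm p n r}
    (hdD : ∀ i ω, d i ω = S.D ω) (hd' : ∀ i ω, d' i ω = S.DHat i ω)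
    (ht : ∀ i ω, t i ω = S.thetaHat i ω) (T : Set ℂ_[p]) (hT : ∀ c ∈ T, c ≠ 0)
    (hC : ∀ i ω, ω ∈ C i ↔ ∃ c ∈ T, c • ω ∈ S.FOmega 0 i)
    (hĈ : ∀ i ω, ω ∈ Ĉ i ↔ ∃ c ∈ T, c • ω ∈ S.FOmegaHat 0 i) : IsThetaComplex C Ĉ d d' t r := by
  have hL := h.isDworkLift
  have hinv : ∀ c ∈ T, ∀ ω : DworkForm p n r, c • c⁻¹ • ω = ω := fun c hc ω =>
    smul_inv_smul₀ (hT c hc) ω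
  have hsm : ∀ c ∈ T, ∀ ω η : DworkForm p n r, c • ω = c • η → ω = η := fun c hc ω η he => by
    have := congrArg (c⁻¹ • ·) he
    simpa only [inv_smul_smul₀ (hT c hc)] using this
  constructor
  · intro i ω hω
    obtain ⟨c, hc, h1⟩ := (hC i ω).1 hω
    rw [hdD, hC]
    exact ⟨c, hc, by rw [← map_smul]; exact h.D_mem hL h1⟩
  · intro i ω _
    rw [hdD, hdD, D_D]
  · intro i
    ext z
    rw [hĈ]
    constructor
    · rintro ⟨ω, hω, rfl⟩
      obtain ⟨c, hc, h1⟩ := (hC i ω).1 hω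
      exact ⟨c, hc, (h.map_thetaHat i).2 ⟨_, h1, by rw [ht, map_smul]⟩⟩
    · rintro ⟨c, hc, h1⟩
      obtain ⟨ω, hω, h2⟩ := (h.map_thetaHat i).1 h1
      refine ⟨c⁻¹ • ω, (hC i _).2 ⟨c, hc, by rwa [hinv c hc]⟩, ?_⟩
      rw [ht, map_smul, h2, inv_smul_smul₀ (hT c hc)]
  · intro i ω hω
    obtain ⟨c, hc, h1⟩ := (hC i ω).1 hω
    rw [ht, ht, hdD, hd']
    apply hsm c hc
    change c • S.theta (S.D ω) = _
    rw [← map_smul, ← map_smul, h.theta_D h1]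
    cases i with
    | zero =>
      obtain ⟨Φ, hΦ, h2⟩ := h.exists_denorm_eq h1
      have h3 : eulerContr S.integers S.d Φ = 0 := by
        refine IsDeg.eq_zero_of_neg (k := -1) (by norm_num) ?_
        have := hΦ.1.kc fun v => MvPowerSeries.C (dworkWt S.d v : S.integers) * X v
        exact_mod_cast this
      rw [h2, h.theta_denorm, h3, denorm, scaleForm_zero, map_zero, neg_zero]
      exact (smul_zero c).symm
    | succ i =>
      rw [map_smul, map_smul, ← smul_neg]; rfl
  · intro i ω hω
    obtain ⟨c, hc, h1⟩ := (hC i ω).1 hω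
    rw [ht, hĈ]
    constructor
    · intro h0
      exact ⟨c, hc, h.theta_exact h1 (by rw [map_smul, h0, smul_zero])⟩
    · rintro ⟨c, hc, σ, -, hσ⟩
      apply hsm c hc
      rw [← map_smul, ← hσ, smul_zero]
      cases i with
      | zero => exact constTerm_theta σ
      | succ i => exact theta_theta σ
  · intro i z hz
    obtain ⟨c, hc, σ, hσ, h1⟩ := (hĈ _ z).1 hz
    exact (hC i z).2 ⟨c, hc, h1 ▸ h.theta_mem hσ⟩
  · intro i z _
    rw [hd', hdD]; rfl
  · intro i ω hi hω h0
    obtain ⟨c, hc, h1⟩ := (hC i ω).1 hω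
    obtain ⟨Φ, hΦ, h2⟩ := h.exists_denorm_eq h1
    rw [hdD] at h0
    obtain ⟨σ, hσ, rfl⟩ := hL.exists_eq_twD (by exact_mod_cast hi) hΦ (h.denorm_injective (by
      rw [← D_denorm, ← h2, map_smul, h0, smul_zero, denorm, scaleForm_zero]))
    rw [← D_denorm] at h2
    cases i with
    | zero =>
      rw [hσ.1.eq_zero_of_neg (by norm_num), denorm, scaleForm_zero, map_zero] at h2
      refine mem_coboundaries_zero.2 (hsm c hc _ _ ?_)
      rw [h2, smul_zero]
    | succ i =>
      refine ⟨c⁻¹ • S.denorm σ, (hC i _).2 ⟨c, hc, ?_⟩, ?_⟩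
      · rw [hinv c hc]
        refine h.denorm_mem ?_
        push_cast at hσ
        rwa [add_sub_cancel_right] at hσ
      · rw [hdD, map_smul, ← h2, inv_smul_smul₀ (hT c hc)]

omit h [Fintype k] in
theorem smul_mem_Omega {c : ℂ_[p]} (hc : c ∈ S.Lam) {i : ℕ} {ω : DworkForm p n r}
    (hω : ω ∈ S.Omega i) : c • ω ∈ S.Omega i :=
  (S.Omega i).smul_mem (⟨c, hc⟩ : S.Lam) hω

theorem mem_FOmega_iff {s : ℤ} {i : ℕ} {ω : DworkForm p n r} :
    ω ∈ S.FOmega s i ↔ S.π ^ (-s) • ω ∈ S.FOmega 0 i := by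
  have hπ := h.π_ne_zero
  have hL : ∀ s : ℤ, S.π ^ s ∈ S.Lam := fun s => zpow_mem π_mem_Lam s
  have key : ∀ (t : ℤ) (I m) (A : ℂ_[p]), coeff m ((S.π ^ (-s) • ω) I) =
      S.π ^ (0 + t) * A ↔ coeff m (ω I) = S.π ^ (s + t) * A := fun t I m A => by
    rw [Pi.smul_apply, coeff_smul, zpow_neg, zero_add, inv_mul_eq_iff_eq_mul₀ (zpow_ne_zero _ hπ),
      ← mul_assoc, ← zpow_add₀ hπ]
  constructor
  · rintro ⟨h1, h2⟩
    exact ⟨smul_mem_Omega (hL _) h1, fun I m => (h2 I m).imp fun A hA => ⟨hA.1, (key _ _ _ _).2 hA.2⟩⟩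
  · rintro ⟨h1, h2⟩
    refine ⟨?_, fun I m => (h2 I m).imp fun A hA => ⟨hA.1, (key _ _ _ _).1 hA.2⟩⟩
    have := smul_mem_Omega (hL s) h1
    rwa [smul_smul, ← zpow_add₀ hπ, add_neg_cancel, zpow_zero, one_smul] at this

theorem exists_pow_mul_le (x : ℝ) : ∃ N : ℕ, ‖S.π‖ ^ N * x ≤ 1 := by
  obtain ⟨N, hN⟩ := exists_pow_lt_of_lt_one (y := ‖S.π‖) (inv_pos.2 (by positivity : 0 < |x| + 1))
    h.norm_π_lt_one
  refine ⟨N, (mul_le_mul_of_nonneg_left ((le_abs_self x).trans (by linarith)) (by positivity)).trans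
    ((mul_le_mul_of_nonneg_right hN.le (by positivity)).trans
      (inv_mul_cancel₀ (by positivity : |x| + 1 ≠ 0)).le)⟩

theorem mem_Omega_iff {i : ℕ} {ω : DworkForm p n r} :
    ω ∈ S.Omega i ↔ ∃ N : ℕ, S.π ^ N • ω ∈ S.FOmega 0 i := by
  have hπ := h.π_ne_zero
  constructor
  · intro hω
    have hb : ∀ I, ∃ B : ℝ, ∀ m, ‖coeff m (ω I) / S.π ^ (S.Mb * yDegree m)‖ ≤ B := fun I => by
      obtain ⟨B, hB⟩ := (hω I).2.2.2.norm.bddAbove_range_of_cofinite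
      exact ⟨B, fun m => hB ⟨m, rfl⟩⟩
    choose B hB using hb
    have hN : ∀ I, ∃ N : ℕ, ‖S.π‖ ^ N * (B I / ‖S.π‖ ^ (S.Mb * yCard I)) ≤ 1 := fun I =>
      h.exists_pow_mul_le _
    choose N hN using hN
    refine ⟨∑ I, N I, smul_mem_Omega (pow_mem π_mem_Lam _) hω, fun I m => ?_⟩
    refine ⟨S.π ^ (∑ I, N I) * coeff m (ω I) / S.π ^ (S.Mb * (yDegree m + yCard I)),
      mem_integers_iff.2 ⟨?_, S.Lam.div_mem (S.Lam.mul_mem (pow_mem π_mem_Lam _) ((hω I).2.1 m))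
        (pow_mem π_mem_Lam _)⟩, ?_⟩
    · have h1 : S.π ^ (∑ I, N I) * coeff m (ω I) / S.π ^ (S.Mb * (yDegree m + yCard I)) =
          S.π ^ (∑ I, N I) * (coeff m (ω I) / S.π ^ (S.Mb * yDegree m) / S.π ^ (S.Mb * yCard I)) := by
        rw [mul_add, pow_add]
        field_simp
      rw [h1, norm_mul, norm_div _ (S.π ^ (S.Mb * yCard I)), norm_pow, norm_pow]
      have h2 : ‖S.π‖ ^ (∑ I, N I) ≤ ‖S.π‖ ^ N I := pow_le_pow_of_le_one (norm_nonneg _)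
        h.norm_π_lt_one.le (single_le_sum (fun _ _ => Nat.zero_le _) (mem_univ I))
      have h3 := h.norm_π_pos
      exact (mul_le_mul h2 (div_le_div_of_nonneg_right (hB I m) (by positivity)) (by positivity)
        (by positivity)).trans (hN I)
    · rw [zero_add, zpow_natCast, mul_div_cancel₀ _ (pow_ne_zero _ hπ)]
      rfl
  · rintro ⟨N, hN⟩
    have := smul_mem_Omega (inv_mem (pow_mem π_mem_Lam N)) hN.1
    rwa [inv_smul_smul₀ (pow_ne_zero _ hπ)] at this

theorem mem_FOmegaHat_iff {s : ℤ} {i : ℕ} {z : DworkForm p n r} :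
    z ∈ S.FOmegaHat s i ↔ S.π ^ (-s) • z ∈ S.FOmegaHat 0 i := by
  have hπ := zpow_ne_zero s h.π_ne_zero
  have h1 : ∀ z w : DworkForm p n r, w = S.π ^ (-s) • z ↔ S.π ^ s • w = z := fun z w => by
    rw [zpow_neg]
    exact eq_inv_smul_iff₀ hπ
  cases i with
  | zero =>
    rw [FOmegaHat, FOmegaHat, Submodule.mem_span_singleton, Submodule.mem_span_singleton]
    refine exists_congr fun a => ?_
    rw [h1, zpow_zero, one_smul, smul_comm]
  | succ i =>
    constructor
    · rintro ⟨σ, hσ, rfl⟩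
      exact ⟨_, h.mem_FOmega_iff.1 hσ, map_smul S.theta _ _⟩
    · rintro ⟨σ, hσ, h2⟩
      refine ⟨S.π ^ s • σ, h.mem_FOmega_iff.2 ?_, ?_⟩
      · rwa [← (h1 _ _).2 rfl]
      · rw [← (h1 _ _).1 h2]
        exact map_smul S.theta _ _

theorem exists_pow_mul_mem {a : ℂ_[p]} (ha : a ∈ S.Lam) : ∃ N : ℕ, S.π ^ N * a ∈ S.integers := by
  obtain ⟨N, hN⟩ := h.exists_pow_mul_le ‖a‖
  exact ⟨N, mem_integers_iff.2 ⟨by rwa [norm_mul, norm_pow], S.Lam.mul_mem (pow_mem π_mem_Lam _) ha⟩⟩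

theorem mem_OmegaHat_iff {i : ℕ} {z : DworkForm p n r} :
    z ∈ S.OmegaHat i ↔ ∃ N : ℕ, S.π ^ N • z ∈ S.FOmegaHat 0 i := by
  have hπ : ∀ N : ℕ, S.π ^ N ≠ 0 := fun N => pow_ne_zero N h.π_ne_zero
  cases i with
  | zero =>
    simp only [OmegaHat, FOmegaHat, Submodule.mem_span_singleton, zpow_zero, one_smul]
    constructor
    · rintro ⟨a, rfl⟩
      obtain ⟨N, hN⟩ := h.exists_pow_mul_mem a.2
      exact ⟨N, ⟨_, hN⟩, mul_smul (S.π ^ N) (a : ℂ_[p]) (zeroForm 1 : DworkForm p n r)⟩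
    · rintro ⟨N, a, ha⟩
      refine ⟨⟨(S.π ^ N)⁻¹ * a, S.Lam.mul_mem (inv_mem (pow_mem π_mem_Lam N)) a.2.2⟩, ?_⟩
      refine (mul_smul (S.π ^ N)⁻¹ (a : ℂ_[p]) (zeroForm 1 : DworkForm p n r)).trans ?_
      rw [inv_smul_eq_iff₀ (hπ N)]
      exact ha
  | succ i =>
    constructor
    · rintro ⟨ω, hω, rfl⟩
      obtain ⟨N, hN⟩ := h.mem_Omega_iff.1 hω
      exact ⟨N, _, hN, map_smul S.theta _ _⟩
    · rintro ⟨N, σ, hσ, h2⟩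
      refine ⟨(S.π ^ N)⁻¹ • σ, h.mem_Omega_iff.2 ⟨N, by rwa [smul_inv_smul₀ (hπ N)]⟩, ?_⟩
      refine (map_smul S.theta _ _).trans ?_
      rw [inv_smul_eq_iff₀ (hπ N)]
      exact h2

theorem isThetaComplex_FOmega (s : ℤ) :
    IsThetaComplex (S.FOmega s) (S.FOmegaHat s) S.dFOmega S.dFOmegaHat
      (fun i => (S.thetaHat i).restrictScalars S.integers) r :=
  h.isThetaComplex (fun _ _ => rfl) (fun _ _ => rfl) (fun _ _ => rfl) {S.π ^ (-s)}
    (by rintro _ rfl; exact zpow_ne_zero _ h.π_ne_zero)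
    (fun i ω => by rw [h.mem_FOmega_iff]; simp) (fun i ω => by rw [h.mem_FOmegaHat_iff]; simp)

theorem isThetaComplex_Omega : IsThetaComplex S.Omega S.OmegaHat S.dOmega S.dOmegaHat
      (fun i => (S.thetaHat i).restrictScalars S.Lam) r :=
  h.isThetaComplex (fun _ _ => rfl) (fun _ _ => rfl) (fun _ _ => rfl)
    (range fun N : ℕ => S.π ^ N) (by rintro _ ⟨N, rfl⟩; exact pow_ne_zero _ h.π_ne_zero)
    (fun i ω => by rw [h.mem_Omega_iff]; simp) (fun i ω => by rw [h.mem_OmegaHat_iff]; simp)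

/-- Multiplication by the two-form `ξ_1 / ∏ d_j`. -/
def xiMul : End (DworkSeries p n r) (DworkForm p n r) :=
  ∑ j, (h.κ / S.d j) • S.pairMul j

theorem xiMul_apply (ω : DworkForm p n r) : h.xiMul ω = ∑ j, (h.κ / S.d j) • S.pairMul j ω := by
  rw [xiMul, LinearMap.sum_apply]; rfl

theorem prod_smul_xiMul (ω : DworkForm p n r) : (∏ j, (S.d j : ℂ_[p])) • h.xiMul ω =
      h.κ • ∑ j, (∏ i ∈ univ.erase j, (S.d i : ℂ_[p])) • S.pairMul j ω := by
  rw [xiMul_apply, smul_sum, smul_sum]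
  refine sum_congr rfl fun j _ => ?_
  have hj : (S.d j : ℂ_[p]) ≠ 0 := Nat.cast_ne_zero.2 (by have := h.deg_pos j; omega)
  rw [smul_smul, smul_smul, ← Finset.mul_prod_erase _ _ (mem_univ j)]
  congr 1
  field_simp

theorem xiOne_eq : S.xiOne = (∏ j, (S.d j : ℂ_[p])) • h.xiMul (zeroForm 1) := by
  rw [h.prod_smul_xiMul, xiOne, zeroForm_eq]
  simp only [formalSum_eq]
  rfl

theorem wedge_xiOne (ω : DworkForm p n r) :
    wedge S.xiOne ω = (∏ j, (S.d j : ℂ_[p])) • h.xiMul ω := by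
  rw [h.xiOne_eq, h.prod_smul_xiMul, h.prod_smul_xiMul, wedge_eq, zeroForm_eq]
  change wedgeRight ω _ = _
  rw [map_smul, map_sum]
  congr 1
  refine sum_congr rfl fun j _ => ?_
  rw [map_smul]
  congr 1
  change wedgeForm _ ω = _
  rw [pairMul_apply, wedgeForm_kw, wedgeForm_kw, constForm, wedgeForm_one, pairMul_apply]

theorem xi_succ (i : ℕ) : S.xi (i + 1) = ((-1) ^ i / (i + 1 : ℂ_[p])) • h.xiMul (S.xi i) := by
  have hP : (∏ j, (S.d j : ℂ_[p])) ≠ 0 := prod_ne_zero_iff.2 fun j _ =>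
    Nat.cast_ne_zero.2 (by have := h.deg_pos j; omega)
  cases i with
  | zero =>
    rw [xi, xi, h.xiOne_eq, map_smul_of_tower]
    simp
  | succ i =>
    rw [xi, h.wedge_xiOne, smul_smul]
    congr 1
    have : (i + 2 : ℂ_[p]) ≠ 0 := by exact_mod_cast (by omega : i + 2 ≠ 0)
    have h2 : ((i + 1 : ℕ) + 1 : ℂ_[p]) = i + 2 := by push_cast; ring
    rw [h2]
    field_simp

theorem xi_eq (i : ℕ) : S.xi i =
    (∏ l ∈ Finset.range i, ((-1) ^ l / (l + 1 : ℂ_[p]))) • (h.xiMul ^ i) (S.xi 0) := by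
  induction i with
  | zero => simp
  | succ i ih =>
    rw [h.xi_succ, ih, map_smul_of_tower, smul_smul, Finset.prod_range_succ,
      pow_succ', mul_comm]
    rfl

/-- Multiplication by the one-form `π^{Mb} γ^{-1} dH`. -/
def dHMul : End (DworkSeries p n r) (DworkForm p n r) :=
  kw fun i => pderiv ℂ_[p] i (h.κ • ∑ j, S.Hpart j)

theorem dHMul_apply (ω : DworkForm p n r) :
    h.dHMul ω = ∑ j, h.κ • kw (fun v => pderiv ℂ_[p] v (S.Hpart j)) ω := by
  rw [dHMul, kw_eq]
  simp only [kw_eq, map_sum, smul_sum, Finset.sum_smul]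
  rw [sum_comm]
  refine sum_congr rfl fun j _ => sum_congr rfl fun v _ => ?_
  rw [Derivation.map_smul]
  exact smul_assoc h.κ (pderiv ℂ_[p] v (S.Hpart j)) _

theorem D_eq_add (ω : DworkForm p n r) : S.D ω = h.κ • dForm ω + h.dHMul ω := by
  rw [D_eq, twD_apply]; rfl

theorem dHMul_xiMul (ω : DworkForm p n r) : h.dHMul (h.xiMul ω) = h.xiMul (h.dHMul ω) := by
  rw [xiMul_apply, xiMul_apply, map_sum]
  refine sum_congr rfl fun j _ => ?_
  rw [map_smul_of_tower, dHMul, kw_pairMul]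

theorem dForm_xiMul (ω : DworkForm p n r) : dForm (h.xiMul ω) = h.xiMul (dForm ω) := by
  rw [xiMul_apply, xiMul_apply, map_sum]
  exact sum_congr rfl fun j _ => by rw [map_smul, dForm_pairMul]

theorem theta_xiMul
    (ω : DworkForm p n r) : S.theta (h.xiMul ω) = h.xiMul (S.theta ω) + h.dHMul ω := by
  rw [xiMul_apply, xiMul_apply, dHMul_apply, map_sum, ← sum_add_distrib]
  refine sum_congr rfl fun j _ => ?_
  have hj : (S.d j : ℂ_[p]) ≠ 0 := Nat.cast_ne_zero.2 (by have := h.deg_pos j; omega)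
  rw [map_smul, theta_pairMul _ h.hom, smul_add, smul_smul, div_mul_cancel₀ _ hj]

omit h [Fintype k] in
theorem theta_zeroForm : S.theta (zeroForm 1) = 0 := by
  rw [theta_eq, eulerContr, kc_eq]
  refine sum_eq_zero fun v _ => ?_
  rw [show contr (DworkSeries p n r) v (zeroForm 1 : DworkForm p n r) = 0 from ?_, smul_zero]
  funext J
  rw [contr_apply]
  split_ifs
  · rfl
  · refine (congrArg _ (zeroForm_of_ne (fun h0 => ?_) 1)).trans (smul_zero _)
    exact Finset.ne_empty_of_mem (Finset.mem_insert_self v J) (by convert h0)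

theorem D_xiMul_pow (i : ℕ) : S.D ((h.xiMul ^ i) (S.xi 0)) = h.dHMul ((h.xiMul ^ i) (S.xi 0)) := by
  have h1 : dForm (S.xi 0) = 0 := by
    rw [xi, map_smul, zeroForm_eq, dForm_constForm]
    have h2 : (fun i : DworkVar n r => pderiv ℂ_[p] i (1 : DworkSeries p n r)) = 0 :=
      funext fun i => pderiv_one
    rw [h2, kw_eq]
    simp
  have h2 : dForm ((h.xiMul ^ i) (S.xi 0)) = 0 := by
    induction i with
    | zero => exact h1
    | succ i ih =>
      rw [pow_succ']
      change dForm (h.xiMul _) = 0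
      rw [dForm_xiMul, ih, map_zero]
  rw [h.D_eq_add, h2, smul_zero, zero_add]

theorem theta_xiMul_pow (i : ℕ) : S.theta ((h.xiMul ^ (i + 1)) (S.xi 0)) =
      (i + 1 : ℂ_[p]) • h.dHMul ((h.xiMul ^ i) (S.xi 0)) := by
  induction i with
  | zero =>
    rw [zero_add, pow_one, h.theta_xiMul, xi, map_smul, theta_zeroForm, smul_zero, map_zero]
    simp
  | succ i ih =>
    rw [pow_succ']
    change S.theta (h.xiMul ((h.xiMul ^ (i + 1)) (S.xi 0))) = _
    rw [h.theta_xiMul, ih, map_smul_of_tower, ← dHMul_xiMul]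
    have h1 : h.xiMul ((h.xiMul ^ i) (S.xi 0)) = (h.xiMul ^ (i + 1)) (S.xi 0) := by
      rw [pow_succ']; rfl
    rw [h1, Nat.cast_succ, add_smul (_ + _) 1, one_smul]

theorem theta_xi (i : ℕ) : S.theta (S.xi (i + 1)) = (-1 : ℂ_[p]) ^ i • S.D (S.xi i) := by
  rw [h.xi_eq (i + 1), h.xi_eq i, map_smul, map_smul, h.theta_xiMul_pow, D_xiMul_pow,
    smul_smul, smul_smul, Finset.prod_range_succ]
  congr 1
  have : (i + 1 : ℂ_[p]) ≠ 0 := by exact_mod_cast (by omega : i + 1 ≠ 0)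
  field_simp

theorem xiMul_pow : (h.xiMul ^ r = r.factorial • ((finRange r).map fun j =>
    (h.κ / (S.d j : ℂ_[p])) • S.pairMul j).prod) ∧ h.xiMul ^ (r + 1) = 0 := by
  have := list_sum_pow_length ((finRange r).map fun j => (h.κ / (S.d j : ℂ_[p])) • S.pairMul j)
    (by
      intro a ha b hb
      obtain ⟨i, -, rfl⟩ := List.mem_map.1 ha
      obtain ⟨j, -, rfl⟩ := List.mem_map.1 hb
      exact ((S.pairMul_commute i j).smul_left _).smul_right _)
    (by
      intro a ha
      obtain ⟨i, -, rfl⟩ := List.mem_map.1 ha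
      rw [smul_mul_smul_comm, pairMul_mul_self, smul_zero])
  rwa [← Fin.sum_univ_def, List.length_map, List.length_finRange] at this

theorem D_xi : S.D (S.xi r) = 0 := by
  have h1 := h.theta_xiMul_pow r
  rw [h.xiMul_pow.2, LinearMap.zero_apply, map_zero] at h1
  have h2 := (smul_eq_zero.1 h1.symm).resolve_left (by exact_mod_cast (by omega : r + 1 ≠ 0))
  rw [h.xi_eq, map_smul, D_xiMul_pow, h2, smul_zero]

omit h [Fintype k] in
theorem prod_range_neg_one_div (r : ℕ) : (∏ l ∈ Finset.range r, ((-1) ^ l / (l + 1 : ℂ_[p]))) =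
    (-1) ^ (r * (r - 1) / 2) / (r.factorial : ℂ_[p]) := by
  rw [Finset.prod_div_distrib, Finset.prod_pow_eq_pow_sum, Finset.sum_range_id,
    ← Finset.prod_range_add_one_eq_factorial]
  push_cast
  rfl

/-- The normalized derivatives of `h_j` with respect to the variables other than `y_j`. -/
def gPart (j : Fin r) (v : DworkVar n r) : VarSeries n r S.integers :=
  if v = inrₗ j then 0 else divVar v (divVar (inrₗ j) (h.Q j v))

/-- The normalized version of multiplication by `dh_j ∧ dy_j`. -/
def normPairMul (j : Fin r) : End (VarSeries n r S.integers) (VarForm n r S.integers) :=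
  kw (h.gPart j) ∘ₗ kw (fun v => pderiv S.integers v (X (inrₗ j)))

omit h [Fintype k] in
theorem scaleHom_X (v : DworkVar n r) : scaleHom S.integers.subtype S.scal (X v) =
    C (S.scal v) * X v := by
  rw [X, scaleHom_monomial, Finsupp.prod_single_index (by simp), pow_one, map_one,
    ← smul_eq_C_mul, X, ← map_smul, smul_eq_mul]

omit h [Fintype k] in
theorem pairMul_smul (j : Fin r) (c : ℂ_[p]) (ω : DworkForm p n r) :
    S.pairMul j (c • ω) = c • S.pairMul j ω := map_smul_of_tower _ c ω

theorem denorm_normPairMul (j : Fin r) (Φ : VarForm n r S.integers) :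
    S.denorm (h.normPairMul j Φ) = h.κ • S.pairMul j (S.denorm Φ) := by
  set y : DworkVar n r := inrₗ j with hy
  have hπ : S.π ^ S.Mb ≠ 0 := pow_ne_zero _ h.π_ne_zero
  let s : DworkVar n r → DworkSeries p n r := fun v => C (S.π ^ S.Mb) * pderiv ℂ_[p] v (X y)
  let a : DworkVar n r → DworkSeries p n r := fun v =>
    if v = y then 0 else C (h.κ * (S.π ^ S.Mb)⁻¹) * pderiv ℂ_[p] v (S.hpart j)
  have h1 : kw s (S.denorm Φ) =
      S.denorm (kw (fun v => pderiv S.integers v (X y)) Φ) := by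
    refine scaleForm_kw _ _ (fun v => ?_) Φ
    by_cases hv : v = y
    · rw [show s v = C (S.π ^ S.Mb) * pderiv ℂ_[p] v (X y) from rfl, hv, pderiv_X_self, pderiv_X_self,
        mul_one, mul_one, scaleHom_X, mul_comm]
      rfl
    · rw [show s v = C (S.π ^ S.Mb) * pderiv ℂ_[p] v (X y) from rfl,
        pderiv_X_of_ne (Ne.symm hv), pderiv_X_of_ne (Ne.symm hv)]
      simp
  have h2 : ∀ Ψ, kw a (S.denorm Ψ) = S.denorm (kw (h.gPart j) Ψ) := fun Ψ => by
    refine scaleForm_kw _ _ (fun v => ?_) Ψ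
    by_cases hv : v = y
    · rw [show a v = _ from if_pos hv, gPart, if_pos hv]
      simp
    · rw [show a v = _ from if_neg hv, gPart, if_neg hv, X_mul_divVar fun m hm => by
        by_contra h0
        rw [coeff_divVar] at h0
        have := (h.coeff_Q_ne h0).1
        rw [Finsupp.add_apply, hm, single_eq_of_ne hv] at this
        exact this rfl]
      ext m
      have h3 := congrArg (coeff (m + single y 1)) (h.scaleHom_Q j v)
      rw [coeff_scaleHom, prod_scal, coeff_smul, coeff_X_mul_pderiv, Finsupp.add_apply,
        single_eq_of_ne hv, add_zero] at h3
      have h4 : yDegree (m + single y 1) = yDegree m + 1 := by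
        simp only [yDegree, Finsupp.add_apply, sum_add_distrib]
        congr 1
        rw [sum_eq_single j (fun i _ hi => single_eq_of_ne fun h0 =>
          hi (inrₗ_injective h0)) (by simp), single_eq_same]
      rw [h4, mul_add, mul_one, pow_add] at h3
      rw [mul_left_comm, coeff_C_mul, coeff_X_mul_pderiv, coeff_scaleHom, prod_scal, hpart,
        coeff_divVar, coeff_divVar, mul_right_comm, mul_inv_eq_iff_eq_mul₀ hπ]
      rw [← h3]
      ring
  change S.denorm (kw (h.gPart j) (kw (fun v => pderiv S.integers v (X y)) Φ)) = _
  rw [← h2, ← h1, pairMul_apply, show s = fun v => C (S.π ^ S.Mb) * pderiv ℂ_[p] v (X y) from rfl,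
    kw_smul_left, map_smul, kw_kw_congr (y := y) (a' := fun v => C (h.κ * (S.π ^ S.Mb)⁻¹) *
      pderiv ℂ_[p] v (S.hpart j)) (fun v hv => pderiv_X_of_ne (Ne.symm hv))
    (fun v hv => pderiv_X_of_ne (Ne.symm hv)) rfl (fun v hv => if_neg hv), kw_smul_left, smul_smul,
    ← map_mul, mul_left_comm, mul_inv_cancel₀ hπ, mul_one]
  funext J
  rw [Pi.smul_apply, Pi.smul_apply, smul_eq_C_mul, smul_eq_mul]

theorem isGood_normPairMul (j : Fin r) {i : ℤ} {Φ : VarForm n r S.integers}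
    (hΦ : IsGood h.ϖ S.d i Φ) : IsGood h.ϖ S.d (i + 2) (h.normPairMul j Φ) := by
  refine ⟨?_, fun J => ?_, fun J m hm => ?_⟩
  · have := (hΦ.1.kw fun v => pderiv S.integers v (X (inrₗ j))).kw (h.gPart j)
    rwa [add_assoc] at this
  · refine isNull_kw (fun v => ?_) (isNull_kw (fun v => isNull_C_pderiv_X _ _ v) hΦ.2.1) J
    rw [gPart]
    split_ifs
    · exact .zero
    · exact ((h.isNull_Q j v).divVar _).divVar _
  · have hs : ∀ v m, coeff m (pderiv S.integers v (X (inrₗ j) :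
        VarSeries n r S.integers)) ≠ 0 → weight (dworkWt S.d) m +
          dworkWt S.d v = dworkWt S.d (inrₗ j : DworkVar n r) := fun v m hm => by
      classical
      by_cases hv : v = inrₗ j
      · rw [hv, pderiv_X_self, coeff_one] at hm
        have h0 : m = 0 := by by_contra h0; exact hm (if_neg h0)
        rw [h0, hv, map_zero, zero_add]
      · rw [pderiv_X_of_ne (Ne.symm hv), map_zero] at hm
        exact absurd rfl hm
    have hg : ∀ v m, coeff m (h.gPart j v) ≠ 0 → weight (dworkWt S.d) m +
        dworkWt S.d v = -dworkWt S.d (inrₗ j : DworkVar n r) := fun v m hm => by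
      rw [gPart] at hm
      split_ifs at hm
      · exact absurd (map_zero _) hm
      · rw [coeff_divVar, coeff_divVar] at hm
        have := h.weight_of_coeff_Q_ne hm
        rw [map_add, map_add, weight_single, weight_single, one_smul,
          one_smul] at this
        linarith
    rw [weight_of_coeff_kw_ne hg (fun J m hm => weight_of_coeff_kw_ne hs hΦ.2.2 hm) hm]
    ring

theorem map_red_gPart (j : Fin r) {v : DworkVar n r} (hv : v ≠ inrₗ j) :
    MvPowerSeries.map h.red (h.gPart j v) = ((MvPolynomial.pderiv v (liftPoly h.fbar j) :
      DworkPoly n r h.Red) : VarSeries n r h.Red) := by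
  have h1 : X v * (X (inrₗ j) * h.gPart j v) = h.Q j v := by
    rw [mul_left_comm, gPart, if_neg hv, X_mul_divVar, X_mul_divVar]
    · intro m hm
      by_contra h0
      exact (h.coeff_Q_ne h0).2.1 hm
    · intro m hm
      by_contra h0
      rw [coeff_divVar] at h0
      have := (h.coeff_Q_ne h0).1
      rw [Finsupp.add_apply, hm, single_eq_of_ne hv] at this
      exact this rfl
  apply X_mul_cancel (i := inrₗ j)
  apply X_mul_cancel (i := v)
  have h2 := congrArg (MvPowerSeries.map h.red) h1
  rw [map_mul, map_mul, MvPowerSeries.map_X, MvPowerSeries.map_X, map_red_Q] at h2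
  rw [h2, ← pderiv_coe]
  have h3 : X (inrₗ j) * pderiv h.Red v (liftPoly h.fbar j : MvPowerSeries _ h.Red) =
      pderiv h.Red v (((MvPolynomial.X (inrₗ j) * liftPoly h.fbar j :
        DworkPoly n r h.Red) : VarSeries n r h.Red)) := by
    rw [MvPolynomial.coe_mul, MvPolynomial.coe_X, leibniz,
      pderiv_X_of_ne (Ne.symm hv), smul_zero, add_zero, smul_eq_mul]
  rw [h3, X_mul_liftPoly, map_sum, mul_sum]
  exact sum_congr rfl fun u _ => (X_mul_pderiv_monomial _ _ _).symm

theorem map_red_normPairMul (j : Fin r) {Φ : VarForm n r S.integers} {ω : PolyForm n r h.Red}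
    (hΦ : ∀ J, MvPowerSeries.map h.red (Φ J) = (ω J : VarSeries n r h.Red))
    (J : Finset (DworkVar n r)) : MvPowerSeries.map h.red (h.normPairMul j Φ J) =
      (kw (fun v => MvPolynomial.pderiv v (liftPoly h.fbar j)) (kw (Pi.single (inrₗ j) (1 : DworkPoly n r h.Red)) ω) J :
        DworkPoly n r h.Red) := by
  change MvPowerSeries.map h.red (kw (h.gPart j) (kw (fun v => pderiv S.integers v
    (X (inrₗ j))) Φ) J) = MvPolynomial.coeToMvPowerSeries.ringHom _
  have h1 := congrFun (kw_ringHom (MvPowerSeries.map h.red) (h.gPart j)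
    (kw (fun v => pderiv S.integers v (X (inrₗ j))) Φ)) J
  have h2 := congrFun (kw_ringHom (MvPolynomial.coeToMvPowerSeries.ringHom (R := h.Red))
    (fun v => MvPolynomial.pderiv v (liftPoly h.fbar j)) (kw (Pi.single (inrₗ j) (1 : DworkPoly n r h.Red)) ω)) J
  rw [← h1, ← h2, ← kw_ringHom, ← kw_ringHom]
  simp only [MvPolynomial.coeToMvPowerSeries.ringHom_apply, hΦ]
  refine congrFun (kw_kw_congr (y := inrₗ j) (fun v hv => ?_) (fun v hv => ?_) ?_
    (fun v hv => h.map_red_gPart j hv) _) J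
  · rw [pderiv_X_of_ne (Ne.symm hv), map_zero]
  · rw [Pi.single_eq_of_ne hv, MvPolynomial.coe_zero]
  · rw [pderiv_X_self, map_one, Pi.single_eq_same, MvPolynomial.coe_one]

/-- A list of two-forms `dh_j ∧ dy_j` applied to a constant, normalized. -/
def normWedge (L : List (Fin r)) (c : S.integers) : VarForm n r S.integers :=
  L.foldr (fun j => h.normPairMul j) (constForm (C c))

theorem isGood_normWedge (L : List (Fin r))
    (c : S.integers) : IsGood h.ϖ S.d (2 * L.length) (h.normWedge L c) := by
  induction L with
  | nil =>
    rw [List.length_nil, Nat.cast_zero, mul_zero]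
    exact constForm_C_mem S.d c
  | cons j L ih =>
    have := h.isGood_normPairMul j ih
    rwa [List.length_cons, Nat.cast_succ, mul_add, mul_one]

theorem map_red_normWedge (L : List (Fin r)) (c : S.integers) (J : Finset (DworkVar n r)) :
    MvPowerSeries.map h.red (h.normWedge L c J) = (wedgeList (L.flatMap fun j =>
      [(MvPolynomial.X (inrₗ j), fun v => (MvPolynomial.pderiv v) (liftPoly h.fbar j)),
        (liftPoly h.fbar j, Pi.single (inrₗ j) 1)]) (MvPolynomial.C (h.red c)) J :
          DworkPoly n r h.Red) := by
  induction L generalizing J with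
  | nil =>
    change MvPowerSeries.map h.red (constForm (C c) J) = ((Pi.single ∅ (MvPolynomial.C (h.red c)) :
      PolyForm n r h.Red) J : MvPolynomial _ h.Red)
    by_cases hJ : J = ∅
    · rw [hJ, constForm_empty, Pi.single_eq_same, map_C, MvPolynomial.coe_C]
    · rw [constForm_of_ne hJ, Pi.single_eq_of_ne hJ, map_zero, MvPolynomial.coe_zero]
  | cons j L ih => exact h.map_red_normPairMul j ih J

omit h [Fintype k] in
theorem denorm_constForm (c : S.integers) :
    S.denorm (constForm (C c)) = (c : ℂ_[p]) • zeroForm 1 := by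
  funext J
  rw [denorm, scaleForm, Pi.smul_apply]
  by_cases hJ : J = ∅
  · rw [hJ, constForm_empty, zeroForm_empty, Finset.prod_empty, map_one, one_mul,
      ← monomial_zero_eq_C_apply, scaleHom_monomial, Finsupp.prod_zero_index, one_mul,
      monomial_zero_eq_C_apply, smul_eq_C_mul, mul_one]
    rfl
  · rw [constForm_of_ne hJ, zeroForm_of_ne hJ, map_zero, mul_zero, smul_zero]

theorem list_prod_pairMul (L : List (Fin r)) (c : S.integers) :
    ((L.map fun j => (h.κ / (S.d j : ℂ_[p])) • S.pairMul j).prod) ((c : ℂ_[p]) • zeroForm 1) =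
      (L.map fun j => (S.d j : ℂ_[p])).prod⁻¹ • S.denorm (h.normWedge L c) := by
  induction L with
  | nil =>
    rw [List.map_nil, List.prod_nil, List.map_nil, List.prod_nil, inv_one, one_smul]
    exact (denorm_constForm c).symm
  | cons j L ih =>
    rw [List.map_cons, List.prod_cons, List.map_cons, List.prod_cons]
    have h1 : S.denorm (h.normWedge (j :: L) c) = h.κ • S.pairMul j (S.denorm (h.normWedge L c)) :=
      h.denorm_normPairMul j _
    rw [End.mul_apply, LinearMap.smul_apply, ih, pairMul_smul, mul_inv, h1, smul_smul, smul_smul]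
    congr 1
    ring

/-- The normalized form of `ξ_r`. -/
def normXi : VarForm n r S.integers :=
  h.normWedge (finRange r) ((-1) ^ (r * (r - 1) / 2))

theorem xi_eq_denorm : S.xi r = S.denorm h.normXi := by
  have hP : (∏ j, (S.d j : ℂ_[p])) ≠ 0 := prod_ne_zero_iff.2 fun j _ =>
    Nat.cast_ne_zero.2 (by have := h.deg_pos j; omega)
  have hfac : (r.factorial : ℂ_[p]) ≠ 0 := Nat.cast_ne_zero.2 r.factorial_ne_zero
  have h1 := h.list_prod_pairMul (finRange r) ((-1) ^ (r * (r - 1) / 2))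
  rw [← Fin.prod_univ_def, eq_inv_smul_iff₀ hP] at h1
  rw [h.xi_eq, h.xiMul_pow.1, prod_range_neg_one_div, normXi, ← h1, xi]
  rw [LinearMap.smul_apply, map_smul_of_tower, map_smul_of_tower,
    ← Nat.cast_smul_eq_nsmul ℂ_[p], smul_smul, smul_smul, smul_smul]
  congr 1
  push_cast
  field_simp

theorem xiMul_mem_Omega {i : ℕ} {ω : DworkForm p n r}
    (hω : ω ∈ S.Omega i) : h.xiMul ω ∈ S.Omega (i + 2) := by
  rw [xiMul_apply]
  refine Submodule.sum_mem _ fun j _ => ?_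
  obtain ⟨N, hN⟩ := h.mem_Omega_iff.1 hω
  obtain ⟨Φ, hΦ, h1⟩ := h.exists_denorm_eq hN
  have h2 := h.denorm_mem (i := i + 2) (by exact_mod_cast h.isGood_normPairMul j hΦ)
  have h3 : (h.κ / (S.d j : ℂ_[p])) • S.pairMul j ω =
      ((S.d j : ℂ_[p])⁻¹ * (S.π ^ N)⁻¹) • S.denorm (h.normPairMul j Φ) := by
    rw [h.denorm_normPairMul, ← h1, pairMul_smul, smul_smul, smul_smul]
    congr 1
    have := pow_ne_zero N h.π_ne_zero
    field_simp
  rw [h3]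
  exact smul_mem_Omega (S.Lam.mul_mem (inv_mem (natCast_mem _ _))
    (inv_mem (pow_mem π_mem_Lam N))) h2.1

theorem xi_mem_Omega (i : ℕ) : S.xi i ∈ S.Omega (2 * i) := by
  induction i with
  | zero => exact smul_mem_Omega (prod_mem fun j _ => natCast_mem _ _) h.zeroForm_one_mem.1
  | succ i ih =>
    rw [h.xi_succ]
    exact smul_mem_Omega (S.Lam.div_mem (pow_mem (neg_mem (one_mem _)) _)
      (add_mem (natCast_mem _ _) (one_mem _))) (h.xiMul_mem_Omega ih)

theorem dlogTerm_a (j : Fin r) (u : Fin (n + 1) →₀ ℕ) : S.dlogTerm S.a j u = (S.q : ℂ_[p]) •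
    monoSubst (S.q • expo j u) (S.teichmuller ((S.f j).coeff u)) S.eulerH := by
  have := h.teichmuller_pow ((S.f j).coeff u)
  rw [q] at this
  rw [dlogTerm, this, q, Nat.cast_pow]

theorem cartier_G₀_mul (i : DworkVar n r) (φ : DworkSeries p n r) :
    cartier S.q (S.G₀ * (X i * pderiv ℂ_[p] i φ + X i * pderiv ℂ_[p] i (∑ j, S.Hpart j) * φ)) =
      (S.q : ℂ_[p]) • (X i * pderiv ℂ_[p] i (cartier S.q (S.G₀ * φ)) +
        X i * pderiv ℂ_[p] i (∑ j, S.Hpart j) * cartier S.q (S.G₀ * φ)) := by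
  have hq : S.q ≠ 0 := by have := h.one_lt_q; omega
  set V := ∑ j, ∑ u ∈ (S.f j).support, (expo j u i : ℂ_[p]) •
    monoSubst (S.q • expo j u) (S.teichmuller ((S.f j).coeff u)) S.eulerH with hV
  have h1 : ∑ j, ∑ u ∈ (S.f j).support, (expo j u i : ℂ_[p]) • S.dlogTerm S.a j u =
      (S.q : ℂ_[p]) • V := by
    simp only [hV, smul_sum, h.dlogTerm_a]
    exact sum_congr rfl fun j _ => sum_congr rfl fun u _ => smul_comm _ _ _
  have h2 : cartier S.q V = X i * pderiv ℂ_[p] i (∑ j, S.Hpart j) := by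
    rw [X_mul_pderiv_Hpart]
    simp only [hV, map_sum, map_smul]
    refine sum_congr rfl fun j _ => sum_congr rfl fun u _ => ?_
    rw [cartier_monoSubst hq (expo_ne_zero j u), dlogTerm, pow_zero, pow_zero, one_smul, one_smul,
      pow_one]
  have h3 : ∀ m, coeff m V ≠ 0 → ∃ m', m = S.q • m' := fun m hm => by
    rw [hV, map_sum] at hm
    obtain ⟨j, -, hm⟩ := exists_ne_zero_of_sum_ne_zero hm
    rw [map_sum] at hm
    obtain ⟨u, -, hm⟩ := exists_ne_zero_of_sum_ne_zero hm
    exact exists_of_coeff_monoSubst_smul_ne (right_ne_zero_of_mul hm)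
  have h4 := S.X_mul_pderiv_G₀ i
  rw [h1] at h4
  have h5 : S.G₀ * (X i * pderiv ℂ_[p] i φ + X i * pderiv ℂ_[p] i (∑ j, S.Hpart j) * φ) =
      X i * pderiv ℂ_[p] i (S.G₀ * φ) + (S.q : ℂ_[p]) • (V * (S.G₀ * φ)) := by
    rw [leibniz, smul_eq_mul, smul_eq_mul, mul_add (X i), mul_left_comm (X i) φ, h4,
      smul_eq_C_mul, smul_eq_C_mul]
    ring
  rw [h5, map_add, map_smul, cartier_mul hq h3, h2, ← X_mul_pderiv_cartier, smul_add]

theorem logForm_D (ω : DworkForm p n r) (J : Finset (DworkVar n r)) : logForm (S.D ω) J =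
    h.κ • ∑ i ∈ J, ksign i J • (X i * pderiv ℂ_[p] i (logForm ω (J.erase i)) +
      X i * pderiv ℂ_[p] i (∑ j, S.Hpart j) * logForm ω (J.erase i)) := by
  rw [D_eq, twD_apply, logForm_add, logForm_smul, logForm_kw, Pi.add_apply, Pi.smul_apply,
    logForm_dForm, kw_apply, κ]
  rw [smul_sum (s := J), smul_sum (s := J), ← sum_add_distrib]
  refine sum_congr rfl fun i _ => ?_
  rw [smul_add (ksign i J), smul_add, Derivation.map_smul, mul_smul_comm, smul_eq_mul,
    smul_mul_assoc, smul_comm (ksign i J) (_ : ℂ_[p])]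
  rfl

theorem D_alpha (ω : DworkForm p n r) : S.D (S.alpha ω) = S.alpha (S.D ω) := by
  have hq : S.q ≠ 0 := by have := h.one_lt_q; omega
  refine form_ext_log (funext fun J => ?_)
  rw [h.logForm_D, S.logForm_alpha hq, h.logForm_D, mul_smul_comm, map_smul, smul_comm (_ ^ _ : ℂ_[p]) h.κ,
    mul_sum, map_sum, smul_sum (r := (_ ^ _ : ℂ_[p]))]
  congr 1
  refine sum_congr rfl fun i hi => ?_
  have hc : n + 1 + r - (J.erase i).card = n + 1 + r - J.card + 1 := by
    have h1 := Finset.card_le_univ J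
    have h2 : Fintype.card (DworkVar n r) = n + 1 + r := by
      rw [Fintype.card_congr ofLex]; simp
    have h3 := Finset.card_pos.2 ⟨i, hi⟩
    rw [Finset.card_erase_of_mem hi]
    omega
  rw [S.logForm_alpha hq, mul_smul_comm (ksign i J) S.G₀, map_zsmul, h.cartier_G₀_mul, hc,
    Derivation.map_smul, mul_smul_comm, mul_smul_comm, ← smul_add,
    smul_comm (ksign i J) (S.q : ℂ_[p]), smul_comm (ksign i J), smul_smul, pow_succ]

theorem theta_alpha (ω : DworkForm p n r) :
    S.theta (S.alpha ω) = (S.q : ℂ_[p])⁻¹ • S.alpha (S.theta ω) := by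
  have hq : S.q ≠ 0 := by have := h.one_lt_q; omega
  have hq' : (S.q : ℂ_[p]) ≠ 0 := Nat.cast_ne_zero.2 hq
  refine form_ext_log (funext fun J => ?_)
  rw [logForm_theta, logForm_smul, Pi.smul_apply, S.logForm_alpha hq, logForm_theta, kc_apply, kc_apply, mul_sum, map_sum, smul_sum,
    smul_sum]
  refine sum_congr rfl fun i hi => ?_
  have hc : n + 1 + r - J.card = n + 1 + r - (insert i J).card + 1 := by
    have h1 := Finset.card_le_univ (insert i J)
    have h2 : Fintype.card (DworkVar n r) = n + 1 + r := by
      rw [Fintype.card_congr ofLex]; simp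
    rw [Finset.card_insert_of_notMem (Finset.mem_compl.1 hi)] at h1 ⊢
    omega
  rw [S.logForm_alpha hq, hc, mul_smul_comm (ksign i J) S.G₀, map_zsmul, mul_smul_comm, map_smul,
    pow_succ', mul_smul (S.q : ℂ_[p]), inv_smul_smul₀ hq', smul_comm (_ ^ _ : ℂ_[p]) (ksign i J),
    smul_comm (_ ^ _ : ℂ_[p])]
  congr!

theorem coeff_splitting (l : ℕ) : PowerSeries.coeff l S.splitting ∈ S.Lam ∧
    ‖PowerSeries.coeff l S.splitting‖ ≤ (‖S.π‖ ^ g) ^ l := by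
  obtain ⟨z, hz⟩ := exists_coeff_artinHasse p l
  rw [splitting, PowerSeries.coeff_rescale, hz]
  refine ⟨S.Lam.mul_mem (pow_mem h.γ_mem l) (S.Lam.algebraMap_mem _), ?_⟩
  rw [norm_mul, norm_pow, h.γ_norm]
  refine mul_le_of_le_one_right (by positivity) ?_
  change ‖((z : ℚ_[p]) : ℂ_[p])‖ ≤ 1
  rw [PadicComplex.norm_extends']
  exact z.2

theorem G₀_mem {t : NNReal} (ht : (t : ℝ) ^ S.q = ‖S.π‖ ^ (S.Mb + 1)) : S.G₀ ∈ S.bounded t := by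
  rw [G₀_eq]
  refine prod_mem fun s hs => prod_mem fun j _ => prod_mem fun u hu m => ?_
  have hs := Finset.mem_range.1 hs
  have hp := one_lt_p (p := p)
  have ht1 : ‖S.π‖ ^ g ≤ (t : ℝ) ^ p ^ s := by
    refine le_of_pow_le_pow_left₀ (n := p ^ (S.a - s)) (pow_ne_zero _ (by omega)) (by positivity) ?_
    rw [← pow_mul, ← pow_mul, ← pow_add, Nat.add_sub_cancel' hs.le, ← q, ht]
    refine pow_le_pow_of_le_one (norm_nonneg _) h.norm_π_lt_one.le ?_
    have h2 : p ^ 1 ≤ p ^ (S.a - s) := Nat.pow_le_pow_right (by omega) (by omega)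
    have h3 := h.lt_g
    rw [pow_one] at h2
    nlinarith [Nat.mul_le_mul_left g h2]
  rw [factor]
  by_cases hm : ∃ l : ℕ, l • (p ^ s • expo j u) = m
  · obtain ⟨l, rfl⟩ := hm
    obtain ⟨h1, h2⟩ := h.coeff_splitting l
    obtain ⟨h3, h4⟩ := mem_integers_iff.1 (h.teichmuller_mem ((S.f j).coeff u))
    have hy : yDegree (expo j u : DworkVar n r →₀ ℕ) = 1 := by simp [yDegree, expo_inrₗ]
    rw [coeff_monoSubst_smul (pow_smul_expo_ne_zero s j u)]
    refine ⟨S.Lam.mul_mem h1 (pow_mem (pow_mem h4 _) _), ?_, fun _ => ?_⟩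
    · rw [norm_mul, norm_pow, norm_pow, yDegree_smul, yDegree_smul, hy, mul_one, mul_comm l, pow_mul]
      exact (mul_le_of_le_one_right (norm_nonneg _)
        (pow_le_one₀ (by positivity) (pow_le_one₀ (norm_nonneg _) h3))).trans
        (h2.trans (pow_le_pow_left₀ (by positivity) ht1 l))
    · rw [map_nsmul, map_nsmul, S.weight_expo j u ?_, smul_zero, smul_zero]
      have := h.hom j (MvPolynomial.mem_support_iff.1 hu)
      rw [← this, Finsupp.degree_eq_weight_one]
      rfl
  · rw [coeff_monoSubst_of_forall_ne (by simpa using hm)]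
    exact ⟨S.Lam.zero_mem, by rw [norm_zero]; positivity, fun h0 => absurd rfl h0⟩

theorem logForm_mem {i : ℕ} {ω : DworkForm p n r} (hω : ω ∈ S.FOmega 0 i) {t : NNReal}
    (ht : (t : ℝ) ^ S.q = ‖S.π‖ ^ (S.Mb + 1)) (J : Finset (DworkVar n r)) :
    logForm ω J ∈ S.bounded t := fun m => by
  have ht1 : ‖S.π‖ ^ S.Mb ≤ (t : ℝ) := by
    have hq := h.one_lt_q
    refine le_of_pow_le_pow_left₀ (n := S.q) (by omega) (by positivity) ?_
    rw [ht, ← pow_mul]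
    have h2 := h.g_pos
    have h3 := h.g_lt
    exact pow_le_pow_of_le_one (norm_nonneg _) h.norm_π_lt_one.le (by nlinarith)
  rw [logForm, coeff_monomial_mul, one_mul]
  split_ifs with hm
  · obtain ⟨A, hA, h1⟩ := hω.2 J (m - setMon J)
    rw [zero_add, zpow_natCast, ← yDegree_setMon, ← yDegree_add, tsub_add_cancel_of_le hm] at h1
    have h2 := (hω.1 J).2.2.1 (m - setMon J)
    rw [degree_eq, ← weight_setMon, ← map_add, tsub_add_cancel_of_le hm] at h2
    refine ⟨(hω.1 J).2.1 _, ?_, fun h0 => by_contra fun h3 => h0 (h2 h3)⟩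
    rw [h1, norm_mul, norm_pow, pow_mul]
    exact (mul_le_of_le_one_right (by positivity) (mem_integers_iff.1 hA).1).trans
      (pow_le_pow_left₀ (by positivity) ht1 _)
  · exact ⟨S.Lam.zero_mem, by rw [norm_zero]; positivity, fun h0 => absurd rfl h0⟩

theorem alpha_mem_of_FOmega {i : ℕ}
    {ω : DworkForm p n r} (hω : ω ∈ S.FOmega 0 i) : S.alpha ω ∈ S.Omega i := by
  have hq : S.q ≠ 0 := by have := h.one_lt_q; omega
  have hρ := h.norm_π_pos
  obtain ⟨t, ht⟩ : ∃ t : NNReal, (t : ℝ) ^ S.q = ‖S.π‖ ^ (S.Mb + 1) :=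
    ⟨_, congrArg NNReal.toReal (NNReal.rpow_inv_natCast_pow (‖S.π‖₊ ^ (S.Mb + 1)) hq)⟩
  have hc : ∀ J m, coeff m (S.alpha ω J) = (S.q : ℂ_[p]) ^ (n + 1 + r - J.card) *
      coeff (S.q • (m + setMon J)) (S.G₀ * logForm ω J) := fun J m => by
    rw [← logCoeff_add_setMon, logCoeff, S.logForm_alpha hq, coeff_smul, coeff_cartier]
  have hmem : ∀ J m, _ := fun J m =>
    (S.bounded t).mul_mem (h.G₀_mem ht) (h.logForm_mem hω ht J) (S.q • (m + setMon J))
  have hw : ∀ J m, coeff m (S.alpha ω J) ≠ 0 →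
      weight (dworkWt S.d) m + ∑ v ∈ J, dworkWt S.d v = 0 := fun J m h0 => by
    rw [hc] at h0
    have := (hmem J m).2.2 (right_ne_zero_of_mul h0)
    rwa [map_nsmul, smul_eq_zero_iff_right hq, map_add, weight_setMon] at this
  have hn : ∀ J m, ‖coeff m (S.alpha ω J)‖ ≤ (‖S.π‖ ^ (S.Mb + 1)) ^ yDegree m := fun J m => by
    rw [hc, norm_mul, norm_pow]
    have h1 := (hmem J m).2.1
    rw [yDegree_smul, pow_mul, ht, yDegree_add] at h1
    refine (mul_le_of_le_one_left (norm_nonneg _) (pow_le_one₀ (norm_nonneg _) ?_)).trans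
      (h1.trans (pow_le_pow_of_le_one (by positivity)
        (pow_le_one₀ hρ.le h.norm_π_lt_one.le) (Nat.le_add_right _ _)))
    exact (mem_integers_iff.1 (natCast_mem S.integers S.q)).1
  refine fun J => ⟨fun hJ => ?_, fun m => ?_, fun m hm => ?_, ?_⟩
  · ext m
    rw [hc, logForm, (hω.1 J).1 hJ, mul_zero, mul_zero, map_zero, mul_zero, map_zero]
  · rw [hc]
    exact S.Lam.mul_mem (pow_mem (natCast_mem S.Lam _) _) (hmem J m).1
  · by_contra h0
    exact hm (by rw [degree_eq]; exact hw J m h0)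
  · rw [Metric.tendsto_nhds]
    intro ε hε
    obtain ⟨N, hN⟩ := exists_pow_lt_of_lt_one hε h.norm_π_lt_one
    refine (Finsupp.finite_of_degree_le
      ((1 + ∑ j, (S.d j : ℤ)) * N - ∑ v ∈ J, dworkWt S.d v).toNat).subset fun m hm => ?_
    have h1 : ¬‖coeff m (S.alpha ω J) / S.π ^ (S.Mb * yDegree m)‖ < ε := by
      rwa [← dist_zero_right]
    have h2 : ‖coeff m (S.alpha ω J) / S.π ^ (S.Mb * yDegree m)‖ ≤ ‖S.π‖ ^ yDegree m := by
      rw [norm_div, norm_pow, div_le_iff₀ (by positivity), pow_mul, ← mul_pow, ← pow_succ']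
      exact hn J m
    have h3 : yDegree m ≤ N := by
      by_contra h3
      exact h1 ((h2.trans (pow_le_pow_of_le_one hρ.le h.norm_π_lt_one.le (by omega))).trans_lt hN)
    have h4 := hw J m fun h0 => h1 (by rwa [h0, zero_div, norm_zero])
    have h5 := S.degree_le_weight_add m
    have h6 : 0 ≤ ∑ j, (S.d j : ℤ) := by positivity
    have h7 : (1 + ∑ j, (S.d j : ℤ)) * yDegree m ≤ (1 + ∑ j, (S.d j : ℤ)) * N :=
      mul_le_mul_of_nonneg_left (by exact_mod_cast h3) (by positivity)
    change m.degree ≤ _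
    omega

theorem alpha_mem {i : ℕ} {ω : DworkForm p n r} (hω : ω ∈ S.Omega i) : S.alpha ω ∈ S.Omega i := by
  obtain ⟨N, hN⟩ := (h.mem_Omega_iff).1 hω
  have h1 := smul_mem_Omega (inv_mem (pow_mem π_mem_Lam N)) (h.alpha_mem_of_FOmega hN)
  rwa [map_smul, inv_smul_smul₀ (pow_ne_zero _ h.π_ne_zero)] at h1

theorem constTerm_alpha (ω : DworkForm p n r) :
    constTerm (S.alpha ω) = (S.q : ℂ_[p]) ^ (n + r + 1) • constTerm ω := by
  have hq : S.q ≠ 0 := by have := h.one_lt_q; omega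
  rw [constTerm_apply, constTerm_apply, ← logCoeff_add_setMon, logCoeff, S.logForm_alpha hq,
    coeff_smul, coeff_cartier, smul_smul, Finset.card_empty, add_right_comm]
  have h0 : S.q • (0 + setMon ∅ : DworkVar n r →₀ ℕ) = 0 := by simp [setMon]
  have h1 : logForm ω ∅ = ω ∅ := by simp [logForm, setMon]
  rw [h0, h1, coeff_zero_eq_constantCoeff_apply, map_mul, ← coeff_zero_eq_constantCoeff_apply,
    coeff_zero_G₀, one_mul, coeff_zero_eq_constantCoeff_apply]
  rfl

theorem thetaHat_alpha (i : ℕ) (ω : DworkForm p n r) :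
    S.thetaHat i (S.alpha ω) = S.alphaHat i (S.thetaHat i ω) := by
  cases i with
  | zero => exact h.constTerm_alpha ω
  | succ i => exact h.theta_alpha ω

theorem isGood_normXi : IsGood h.ϖ S.d (2 * r) h.normXi := by
  have := h.isGood_normWedge (finRange r) ((-1) ^ (r * (r - 1) / 2))
  rwa [List.length_finRange] at this

theorem xi_mem_FOmega : S.xi r ∈ S.FOmega 0 (2 * r) := by
  rw [h.xi_eq_denorm]
  exact h.denorm_mem (by exact_mod_cast h.isGood_normXi)

theorem isFreeGenerator_xi {R : Type*} [CommRing R] [Module R (DworkForm p n r)]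
    {C : ℕ → Submodule R (DworkForm p n r)} {d : ℕ → DworkForm p n r →ₗ[R] DworkForm p n r}
    (hdD : ∀ i ω, d i ω = S.D ω) (T : Set ℂ_[p]) (hT : ∀ c ∈ T, c ≠ 0)
    (hC : ∀ i ω, ω ∈ C i ↔ ∃ c ∈ T, c • ω ∈ S.FOmega 0 i)
    {x : DworkForm p n r} (hx : x ∈ C (2 * r)) (hxc : S.D x = 0)
    (hspan : ∀ c ∈ T, ∀ a : S.integers, ∃ b : R, b • x = (c⁻¹ * a) • S.xi r)
    (hfree : ∀ c ∈ T, ∀ b : R, ∃ (N : ℕ) (e : S.integers),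
      S.π ^ N • c • b • x = e • S.xi r ∧ (e = 0 → b = 0)) : IsFreeGenerator C d (2 * r) x := by
  have hL := h.isDworkLift
  have hξ := h.isGood_normXi
  have hξu := h.map_red_normWedge (finRange r) ((-1) ^ (r * (r - 1) / 2))
  have hu : IsUnit (h.red ((-1) ^ (r * (r - 1) / 2))) := (isUnit_one.neg.pow _).map h.red
  have hr := h.pos
  rw [h.xi_eq_denorm] at hspan hfree
  have hξc' : twD h.κO h.G h.normXi = 0 := h.denorm_injective (by
    rw [← D_denorm, ← h.xi_eq_denorm, h.D_xi, denorm, scaleForm_zero])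
  obtain ⟨r', hr'⟩ : ∃ r', 2 * r = r' + 1 := ⟨2 * r - 1, by omega⟩
  have hr'' : (2 * r - 1 : ℤ) = r' := by omega
  refine ⟨mem_cocycles.2 ⟨hx, by rw [hdD, hxc]⟩, fun ω hω => ?_, fun b hb => ?_⟩
  · obtain ⟨hω, hωc⟩ := mem_cocycles.1 hω
    rw [hdD] at hωc
    obtain ⟨c, hc, h1⟩ := (hC _ ω).1 hω
    obtain ⟨Φ, hΦ, h2⟩ := h.exists_denorm_eq h1
    obtain ⟨a, σ, hσ, rfl⟩ := hL.exists_eq_smul_add_twD_of_isGood hξ hξc' hu hξu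
      (by exact_mod_cast hΦ) (h.denorm_injective (by
        rw [← D_denorm, ← h2, map_smul, hωc, smul_zero, denorm, scaleForm_zero]))
    obtain ⟨b, hb⟩ := hspan c hc a
    refine ⟨b, ?_⟩
    rw [hr''] at hσ
    rw [hr', mem_coboundaries_succ]
    refine ⟨c⁻¹ • S.denorm σ, (hC _ _).2 ⟨c, hc, ?_⟩, ?_⟩
    · rw [smul_inv_smul₀ (hT c hc)]
      exact h.denorm_mem hσ
    · rw [hdD, map_smul, hb, h.D_denorm, inv_smul_eq_iff₀ (hT c hc), smul_sub, h2, h.denorm_add,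
        h.denorm_smul, smul_smul, mul_inv_cancel_left₀ (hT c hc)]
      exact (add_sub_cancel_left _ _).symm
  · rw [hr', mem_coboundaries_succ] at hb
    obtain ⟨σ, hσ, h1⟩ := hb
    obtain ⟨c, hc, h2⟩ := (hC _ σ).1 hσ
    obtain ⟨Ψ, hΨ, h3⟩ := h.exists_denorm_eq h2
    obtain ⟨N, e, h4, h5⟩ := hfree c hc b
    refine h5 (hL.eq_zero_of_smul_eq_twD h.deg_pos hu (ξ := h.normXi) hξu (σ := h.ϖ ^ N • Ψ) ?_
      (h.denorm_injective ?_))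
    · rw [hr'']
      exact hΨ.smul _
    · rw [← D_denorm, h.denorm_smul, h.denorm_smul, ← h4, ← h1, hdD, ← map_smul, ← map_smul, h3]
      rfl

theorem isFreeGenerator_xi_FOmega (s : ℤ) :
    IsFreeGenerator (S.FOmega s) S.dFOmega (2 * r) (S.π ^ s • S.xi r) := by
  have hπ := h.π_ne_zero
  have h1 : S.π ^ (-s) • S.π ^ s • S.xi r = S.xi r := by
    rw [smul_smul, ← zpow_add₀ hπ, neg_add_cancel, zpow_zero, one_smul]
  refine h.isFreeGenerator_xi (C := S.FOmega s) (d := S.dFOmega)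
    (fun _ _ => rfl) {S.π ^ (-s)} (by rintro _ rfl; exact zpow_ne_zero _ h.π_ne_zero)
    (fun i ω => by rw [h.mem_FOmega_iff]; simp) ?_ ?_ ?_ ?_
  · rw [h.mem_FOmega_iff, h1]
    exact h.xi_mem_FOmega
  · rw [map_smul, h.D_xi, smul_zero]
  · rintro _ rfl a
    refine ⟨a, ?_⟩
    change (a : ℂ_[p]) • S.π ^ s • S.xi r = _
    rw [smul_smul, zpow_neg, inv_inv, mul_comm]
  · rintro _ rfl b
    refine ⟨0, b, ?_, id⟩
    rw [pow_zero, one_smul, smul_comm, h1]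

theorem isFreeGenerator_xi_Omega : IsFreeGenerator S.Omega S.dOmega (2 * r) (S.xi r) := by
  have hπ := h.π_ne_zero
  refine h.isFreeGenerator_xi (C := S.Omega) (d := S.dOmega) (fun _ _ => rfl)
    (range fun N : ℕ => S.π ^ N) (by rintro _ ⟨N, rfl⟩; exact pow_ne_zero _ h.π_ne_zero)
    (fun i ω => by rw [h.mem_Omega_iff]; simp)
    h.xi_mem_FOmega.1 h.D_xi ?_ ?_
  · rintro _ ⟨N, rfl⟩ a
    exact ⟨⟨_, S.Lam.mul_mem (inv_mem (pow_mem π_mem_Lam N)) a.2.2⟩, rfl⟩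
  · rintro _ ⟨N, rfl⟩ b
    obtain ⟨N', hN'⟩ := h.exists_pow_mul_mem b.2
    refine ⟨N', ⟨_, S.integers.mul_mem (pow_mem h.π_mem N) hN'⟩, ?_, fun h0 => ?_⟩
    · change S.π ^ N' • S.π ^ N • (b : ℂ_[p]) • S.xi r =
        (S.π ^ N * (S.π ^ N' * (b : ℂ_[p]))) • S.xi r
      rw [smul_smul, smul_smul]
      congr 1
      ring
    · have := congrArg Subtype.val h0
      simpa [hπ] using this

omit h [Fintype k] in
theorem smul_zeroForm_one_eq_zero {a : ℂ_[p]} (ha : a • (zeroForm 1 : DworkForm p n r) = 0) :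
    a = 0 := by
  have := congrArg (coeff 0) (congrFun ha ∅)
  rwa [Pi.smul_apply, zeroForm_empty, coeff_smul, coeff_zero_one, mul_one, Pi.zero_apply,
    map_zero] at this

theorem isFreeGenerator_FOmegaHat_zero (s : ℤ) :
    IsFreeGenerator (S.FOmegaHat s) S.dFOmegaHat 0 (S.π ^ s • zeroForm 1) :=
  isFreeGenerator_zero rfl rfl fun a ha => by
    have h1 : ((a : ℂ_[p]) * S.π ^ s) • (zeroForm 1 : DworkForm p n r) = 0 := by
      rw [mul_smul]; exact ha
    exact Subtype.ext ((mul_eq_zero.1 (smul_zeroForm_one_eq_zero h1)).resolve_right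
      (zpow_ne_zero _ h.π_ne_zero))

omit h [Fintype k] in
theorem isFreeGenerator_OmegaHat_zero : IsFreeGenerator S.OmegaHat S.dOmegaHat 0 (zeroForm 1) :=
  isFreeGenerator_zero rfl rfl fun a ha => Subtype.ext (smul_zeroForm_one_eq_zero ha)

theorem exists_isEtaSequence : ∃ η, S.IsEtaSequence η := by
  have h0 := (h.isFreeGenerator_FOmegaHat_zero 0).mem
  rw [zpow_zero, one_smul] at h0
  obtain ⟨η, h1, h2⟩ := (h.isThetaComplex_FOmega 0).exists_seq h0
  refine ⟨η, h1, fun k _ => ⟨(h2 k).1, ?_⟩⟩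
  obtain ⟨τ, hτ, h3, h4⟩ := (h2 k).2
  exact ⟨τ, hτ, h3, by rw [h4]; exact (sub_self (S.D τ)).symm ▸ zero_mem _⟩

/-- The matrix entry of the map on cohomology. -/
def thetaCoeff (R : Type*) [CommRing R] (d : Fin r → ℕ) : R :=
  (-1) ^ (r * (r - 1) / 2) * ∏ j, (d j : R)

omit h [Fintype k] in
theorem thetaHat_xi_zero : S.thetaHat 0 (S.xi 0) = (∏ j, (S.d j : ℂ_[p])) • zeroForm 1 := by
  change constTerm ((∏ j, (S.d j : ℂ_[p])) • zeroForm 1) = _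
  rw [constTerm_apply, Pi.smul_apply, zeroForm_empty, coeff_smul, coeff_zero_one, mul_one]

theorem mapsCohomology_alpha (i : ℕ) :
    MapsCohomology S.Omega S.dOmega i S.Omega S.dOmega i (S.alpha.restrictScalars S.Lam) := by
  refine ⟨fun ω hω => mem_cocycles.2 ⟨h.alpha_mem hω.1, ?_⟩, fun ω hω => ?_⟩
  · have h1 : S.D ω = 0 := (mem_cocycles.1 hω).2
    exact (h.D_alpha ω).trans (by rw [h1, map_zero])
  · cases i with
    | zero =>
      rw [mem_coboundaries_zero.1 hω, map_zero]
      exact zero_mem _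
    | succ i =>
      obtain ⟨σ, hσ, rfl⟩ := hω
      exact ⟨S.alpha σ, h.alpha_mem hσ, h.D_alpha σ⟩

theorem mapsCohomology_alphaHat (i : ℕ) :
    MapsCohomology S.OmegaHat S.dOmegaHat i S.OmegaHat S.dOmegaHat i
      ((S.alphaHat i).restrictScalars S.Lam) := by
  have hT := h.isThetaComplex_Omega
  have key : ∀ {i z}, z ∈ S.OmegaHat i → S.alphaHat i z ∈ S.OmegaHat i ∧
      S.DHat i (S.alphaHat i z) = S.alphaHat (i + 1) (S.DHat i z) := fun {i z} hz => by
    rw [← hT.map_t] at hz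
    obtain ⟨ω, hω, rfl⟩ := hz
    have h1 := h.thetaHat_alpha i ω
    have h2 := h.alpha_mem hω
    have h3 : S.theta (S.D (S.alpha ω)) = S.DHat i (S.thetaHat i (S.alpha ω)) := hT.t_d h2
    have h4 : S.theta (S.D ω) = S.DHat i (S.thetaHat i ω) := hT.t_d hω
    have h5 : S.theta (S.alpha (S.D ω)) = S.alphaHat (i + 1) (S.theta (S.D ω)) :=
      h.thetaHat_alpha (i + 1) (S.D ω)
    rw [← h.D_alpha, h3, h4, h1] at h5
    exact ⟨h1 ▸ hT.t_mem h2, h5⟩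
  refine ⟨fun z hz => mem_cocycles.2 ⟨(key hz.1).1, ?_⟩, fun z hz => ?_⟩
  · have h1 : S.DHat i z = 0 := (mem_cocycles.1 hz).2
    exact (key hz.1).2.trans (by rw [h1, map_zero])
  · cases i with
    | zero =>
      rw [mem_coboundaries_zero.1 hz, map_zero]
      exact zero_mem _
    | succ i =>
      obtain ⟨σ, hσ, rfl⟩ := hz
      exact ⟨S.alphaHat i σ, (key hσ).1, (key hσ).2⟩

omit h [Fintype k] in
theorem thetaCoeff_Lam_ne_zero (hd : ∀ j, 1 ≤ S.d j) : thetaCoeff S.Lam S.d ≠ 0 :=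
  mul_ne_zero (pow_ne_zero _ (neg_ne_zero.2 one_ne_zero)) (prod_ne_zero_iff.2 fun j _ =>
    Nat.cast_ne_zero.2 (by have := hd j; omega))

theorem mem_coboundaries_OmegaHat {s : ℤ} {i : ℕ} {z : DworkForm p n r}
    (hz : z ∈ coboundaries (S.FOmegaHat s) S.dFOmegaHat i) :
    z ∈ coboundaries S.OmegaHat S.dOmegaHat i := by
  cases i with
  | zero => exact hz
  | succ i =>
    obtain ⟨σ, hσ, rfl⟩ := hz
    refine ⟨σ, ?_, rfl⟩
    have h1 : S.π ^ (-s) • σ ∈ S.OmegaHat i :=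
      h.mem_OmegaHat_iff.2 ⟨0, by rw [pow_zero, one_smul]; exact h.mem_FOmegaHat_iff.1 hσ⟩
    have h2 := (S.OmegaHat i).smul_mem (⟨S.π ^ s, zpow_mem π_mem_Lam s⟩ : S.Lam) h1
    change S.π ^ s • S.π ^ (-s) • σ ∈ _ at h2
    rwa [zpow_neg, smul_inv_smul₀ (zpow_ne_zero s h.π_ne_zero)] at h2

variable {η : ℕ → DworkForm p n r} (hη : S.IsEtaSequence η)
include hη

theorem eta_FOmega (s : ℤ) : ∀ k < r,
    ∃ τ ∈ S.FOmega s (2 * k), S.thetaHat (2 * k) τ = S.π ^ s • η k ∧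
      S.π ^ s • η (k + 1) - S.dFOmega (2 * k) τ ∈
        (S.FOmegaHat s (2 * k + 1)).map (S.dFOmega (2 * k)) := fun k hk => by
  have hπ := zpow_ne_zero s h.π_ne_zero
  obtain ⟨-, τ, hτ, h1, ρ, hρ, h2⟩ := hη.2 k hk
  refine ⟨S.π ^ s • τ, ?_, by rw [map_smul, h1], S.π ^ s • ρ, ?_, ?_⟩
  · rwa [h.mem_FOmega_iff, zpow_neg, inv_smul_smul₀ hπ]
  · refine h.mem_FOmegaHat_iff.2 ?_
    rwa [zpow_neg, inv_smul_smul₀ hπ]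
  · change S.D _ = _ - S.D _
    rw [map_smul, map_smul, ← smul_sub]
    exact congrArg _ h2

theorem eta_Omega : ∀ k < r,
    ∃ τ ∈ S.Omega (2 * k), S.thetaHat (2 * k) τ = η k ∧
      η (k + 1) - S.dOmega (2 * k) τ ∈ (S.OmegaHat (2 * k + 1)).map (S.dOmega (2 * k)) :=
  fun k hk => by
  obtain ⟨-, τ, hτ, h1, ρ, hρ, h2⟩ := hη.2 k hk
  exact ⟨τ, hτ.1, h1, ρ, h.mem_OmegaHat_iff.2 ⟨0, by rwa [pow_zero, one_smul]⟩, h2⟩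

theorem isFreeGenerator_eta_FOmega (s : ℤ) :
    IsFreeGenerator (S.FOmegaHat s) S.dFOmegaHat (2 * r) (S.π ^ s • η r) :=
  (h.isThetaComplex_FOmega s).isFreeGenerator (η := fun k => S.π ^ s • η k)
    (h.eta_FOmega hη s) (by rw [hη.1]; exact h.isFreeGenerator_FOmegaHat_zero s) le_rfl

theorem isFreeGenerator_eta_Omega :
    IsFreeGenerator S.OmegaHat S.dOmegaHat (2 * r) (η r) :=
  (h.isThetaComplex_Omega).isFreeGenerator (h.eta_Omega hη)
    (hη.1 ▸ isFreeGenerator_OmegaHat_zero) le_rfl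

theorem theta_xi_sub_mem :
    S.thetaHat (2 * r) (S.xi r) - (thetaCoeff S.Lam S.d) • η r ∈
      coboundaries S.OmegaHat S.dOmegaHat (2 * r) := by
  have h1 := (h.isThetaComplex_Omega).t_sub_mem (h.eta_Omega hη)
    (ω := S.xi) (e := fun k => (-1) ^ k) (b := ∏ j, (S.d j : S.Lam)) (h.xi_mem_Omega)
    (by
      rw [hη.1]
      exact thetaHat_xi_zero.trans (congrArg (· • zeroForm 1) (by simp)))
    (fun k => (h.theta_xi k).trans (congrArg (· • S.D (S.xi k)) (by simp))) le_rfl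
  rwa [Finset.prod_pow_eq_pow_sum, Finset.sum_range_id, mul_comm (∏ j, _)] at h1

theorem theta_alpha_xi_sub_mem :
    S.thetaHat (2 * r) (S.alpha (S.xi r)) - ((S.q : S.Lam) ^ (n + 1) * thetaCoeff S.Lam S.d) • η r ∈
      coboundaries S.OmegaHat S.dOmegaHat (2 * r) := by
  have hq : (S.q : S.Lam) ≠ 0 := Nat.cast_ne_zero.2 (by have := h.one_lt_q; omega)
  have h1 := (h.isThetaComplex_Omega).t_sub_mem (h.eta_Omega hη)
    (ω := fun k => S.alpha (S.xi k)) (e := fun k => (S.q : S.Lam)⁻¹ * (-1) ^ k)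
    (b := (S.q : S.Lam) ^ (n + r + 1) * ∏ j, (S.d j : S.Lam))
    (fun k => h.alpha_mem (h.xi_mem_Omega k))
    (by
      rw [hη.1]
      refine (h.thetaHat_alpha 0 _).trans ?_
      rw [thetaHat_xi_zero]
      change (S.q : ℂ_[p]) ^ (n + r + 1) • (∏ j, (S.d j : ℂ_[p])) •
        (zeroForm 1 : DworkForm p n r) = _
      rw [smul_smul]
      exact congrArg (· • zeroForm 1) (by simp))
    (fun k => by
      refine (h.thetaHat_alpha (2 * k + 2) _).trans ?_
      change (S.q : ℂ_[p])⁻¹ • S.alpha (S.theta (S.xi (k + 1))) = _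
      rw [h.theta_xi, map_smul, ← h.D_alpha, smul_smul]
      exact congrArg (· • S.D (S.alpha (S.xi k))) (by simp)) le_rfl
  have h2 : (S.q : S.Lam) ^ (n + r + 1) * (∏ j, (S.d j : S.Lam)) *
      ∏ k ∈ Finset.range r, (S.q : S.Lam)⁻¹ * (-1) ^ k =
      (S.q : S.Lam) ^ (n + 1) * thetaCoeff S.Lam S.d := by
    rw [Finset.prod_mul_distrib, Finset.prod_const, Finset.card_range, Finset.prod_pow_eq_pow_sum,
      Finset.sum_range_id, add_right_comm, pow_add, inv_pow, thetaCoeff]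
    field_simp
  rwa [h2] at h1

theorem alpha_xi_sub_mem :
    S.alpha (S.xi r) - (S.q : S.Lam) ^ (n + 1) • S.xi r ∈ coboundaries S.Omega S.dOmega (2 * r) := by
  have hT := h.isThetaComplex_Omega
  have hξ := h.isFreeGenerator_xi_Omega
  have hη' := h.isFreeGenerator_eta_Omega hη
  obtain ⟨a, ha⟩ := hξ.span (S.alpha (S.xi r)) (mem_cocycles.2 ⟨h.alpha_mem hξ.mem.1, by
    change S.D _ = 0
    rw [h.D_alpha, h.D_xi, map_zero]⟩)
  have h1 := hT.t_coboundary ha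
  rw [map_sub, map_smul] at h1
  have h2 := sub_mem (add_mem h1 (Submodule.smul_mem _ a (h.theta_xi_sub_mem hη)))
    (h.theta_alpha_xi_sub_mem hη)
  have h3 : ((S.q : S.Lam) ^ (n + 1) - a) * thetaCoeff S.Lam S.d = 0 := by
    refine hη'.free _ ?_
    convert h2 using 1
    rw [sub_mul, sub_smul, smul_sub, mul_smul a]
    simp only [LinearMap.restrictScalars_apply]
    abel
  rwa [← sub_eq_zero.1 ((mul_eq_zero.1 h3).resolve_right (thetaCoeff_Lam_ne_zero h.deg_pos))] at ha

theorem theta_smul_xi_sub_mem (s : ℤ) :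
    S.thetaHat (2 * r) (S.π ^ s • S.xi r) - (thetaCoeff S.integers S.d) • S.π ^ s • η r ∈
      coboundaries (S.FOmegaHat s) S.dFOmegaHat (2 * r) := by
  have hπ := zpow_ne_zero s h.π_ne_zero
  have hT := h.isThetaComplex_FOmega s
  have hξ := h.isFreeGenerator_xi_FOmega s
  have hη' := h.isFreeGenerator_eta_FOmega hη s
  have hη'' := h.isFreeGenerator_eta_Omega hη
  obtain ⟨a, ha⟩ := hη'.span _ (hT.t_cocycle hξ.mem)
  have h1 : S.thetaHat (2 * r) (S.π ^ s • S.xi r) - (a : ℂ_[p]) • S.π ^ s • η r ∈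
      coboundaries S.OmegaHat S.dOmegaHat (2 * r) :=
    h.mem_coboundaries_OmegaHat ha
  have h2 := sub_mem ((coboundaries S.OmegaHat S.dOmegaHat (2 * r)).smul_mem
    (⟨S.π ^ s, zpow_mem π_mem_Lam s⟩ : S.Lam) (h.theta_xi_sub_mem hη)) h1
  have h3 : (⟨S.π ^ s, zpow_mem π_mem_Lam s⟩ : S.Lam) * (⟨a, a.2.2⟩ - thetaCoeff S.Lam S.d) = 0 := by
    refine hη''.free _ ?_
    convert h2 using 1
    rw [map_smul, mul_smul, sub_smul, smul_sub, smul_sub]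
    change S.π ^ s • (a : ℂ_[p]) • η r - S.π ^ s • (thetaCoeff S.Lam S.d : ℂ_[p]) • η r =
      S.π ^ s • S.thetaHat (2 * r) (S.xi r) - S.π ^ s • (thetaCoeff S.Lam S.d : ℂ_[p]) • η r -
        (S.π ^ s • S.thetaHat (2 * r) (S.xi r) - (a : ℂ_[p]) • S.π ^ s • η r)
    rw [smul_comm (a : ℂ_[p])]
    abel
  have h4 : a = thetaCoeff S.integers S.d := by
    have h5 := sub_eq_zero.1 ((mul_eq_zero.1 h3).resolve_left fun h0 =>
      hπ (congrArg Subtype.val h0))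
    refine Subtype.ext ((congrArg Subtype.val h5).trans ?_)
    simp [thetaCoeff]
  rwa [h4] at ha

end IsSetup

theorem isSetup (hq : Fintype.card k = p ^ S.a) (hζ : S.ζ ^ p = 1) {b : ℚ}
    (hb₁ : 1 / ((p : ℚ) - 1) < b) (hb₂ : b < p / ((p : ℚ) - 1)) (hM : 0 < M)
    (hg : M = g * (p - 1)) (hMb : (S.Mb : ℚ) = M * b) (hπ : S.π ^ M = p)
    (hγ : S.γ ∈ IntermediateField.adjoin ℚ_[p] {S.ζ})
    (hγ₀ : HasSum (fun i : ℕ => S.γ ^ p ^ i / (p : ℂ_[p]) ^ i) 0)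
    (hγ₁ : ‖S.γ‖ = (p : ℝ) ^ (-(1 / ((p : ℝ) - 1)))) (hr : 1 ≤ r) (hrn : r < n)
    (hd : ∀ j, 1 ≤ S.d j) (hf : ∀ j, (S.f j).IsHomogeneous (S.d j))
    (hX : IsSmoothCompleteIntersection S.f) : S.IsSetup M g := by
  have hp := IsSetup.one_lt_p (p := p)
  have hp1 : (0 : ℚ) < (p : ℚ) - 1 := by
    rw [sub_pos]; exact_mod_cast hp
  have hMg : (M : ℚ) = g * ((p : ℚ) - 1) := by
    rw [hg, Nat.cast_mul, Nat.cast_sub hp.le, Nat.cast_one]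
  have hM' : (0 : ℚ) < M := by exact_mod_cast hM
  have hg0 : 0 < g := Nat.pos_of_ne_zero fun h0 => by rw [h0, zero_mul] at hg; omega
  refine ⟨hq, hg, hg0, ?_, ?_, hπ, hζ, ?_, hγ₀, ?_, hr, hrn, hd, hf, hX⟩
  · have h1 := mul_lt_mul_of_pos_left hb₁ hM'
    rw [← hMb, hMg, mul_one_div, mul_div_cancel_right₀ _ hp1.ne'] at h1
    exact_mod_cast h1
  · have h1 := mul_lt_mul_of_pos_left hb₂ hM'
    rw [← hMb, hMg, mul_assoc, mul_div_cancel₀ _ hp1.ne', mul_comm] at h1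
    exact_mod_cast h1
  · refine (IntermediateField.adjoin_le_iff.2 ?_ : _ ≤ S.Lam) hγ
    rintro _ rfl
    exact IntermediateField.subset_adjoin _ _ (by simp)
  · have hp' : (1 : ℝ) < p := by exact_mod_cast hp
    have h1 : ‖S.π‖ ^ M = (p : ℝ)⁻¹ := by rw [← norm_pow, hπ, norm_natCast_p]
    refine (pow_left_inj₀ (norm_nonneg _) (by positivity) (by omega : p - 1 ≠ 0)).1 ?_
    rw [← pow_mul, ← hg, h1, hγ₁, ← Real.rpow_natCast, ← Real.rpow_mul (by positivity),
      Nat.cast_sub hp.le, Nat.cast_one, neg_mul, one_div_mul_cancel (by linarith),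
      Real.rpow_neg_one]

end DworkDatum

end

theorem proposition6p14 (p : ℕ) [Fact p.Prime] {k : Type*} [Field k] [Fintype k] (n r : ℕ)
    (S : DworkDatum p k n r)
    -- `k = 𝔽_q` with `q = p ^ a`
    (hq : Fintype.card k = p ^ S.a)
    -- smooth complete intersection of multidegree `(d_1, …, d_r)` in projective `n`-space, `r < n`
    (hr : 1 ≤ r) (hrn : r < n)
    (hd : ∀ j, 1 ≤ S.d j) (hf : ∀ j, (S.f j).IsHomogeneous (S.d j))
    (hX : IsSmoothCompleteIntersection S.f)
    -- the constants `ζ_p`, `b`, `M`, `π`, `γ`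
    (hζ : IsPrimitiveRoot S.ζ p)
    (b : ℚ) (hb₁ : 1 / ((p : ℚ) - 1) < b) (hb₂ : b < p / ((p : ℚ) - 1))
    (M : ℕ) (hM : 0 < M) (hMb : (S.Mb : ℚ) = M * b) (hMb' : p * (p - 1) ∣ S.Mb)
    (hM' : p - 1 ∣ M) (hπ : S.π ^ M = p)
    (hγ : S.γ ∈ IntermediateField.adjoin ℚ_[p] {S.ζ})
    (hγ₀ : HasSum (fun i : ℕ => S.γ ^ p ^ i / (p : ℂ_[p]) ^ i) 0)
    (hγ₁ : ‖S.γ‖ = (p : ℝ) ^ (-(1 / ((p : ℝ) - 1)))) :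
    (∃ η, S.IsEtaSequence η) ∧ ∀ η, S.IsEtaSequence η →
      -- the integral statement, for all steps of the filtration
      (∀ s : ℤ,
        ∃ (ξB : Module.Basis Unit S.integers (Cohomology (S.FOmega s) S.dFOmega (2 * r)))
          (ηB : Module.Basis Unit S.integers (Cohomology (S.FOmegaHat s) S.dFOmegaHat (2 * r)))
          (Θ : Cohomology (S.FOmega s) S.dFOmega (2 * r) →ₗ[S.integers]
            Cohomology (S.FOmegaHat s) S.dFOmegaHat (2 * r)),
          IsClassOf (S.FOmega s) S.dFOmega (2 * r) (S.π ^ s • S.xi r) (ξB ()) ∧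
          IsClassOf (S.FOmegaHat s) S.dFOmegaHat (2 * r) (S.π ^ s • η r) (ηB ()) ∧
          IsInducedMap (S.FOmega s) S.dFOmega (2 * r) (S.FOmegaHat s) S.dFOmegaHat (2 * r)
            (S.thetaHat (2 * r)) Θ ∧
          LinearMap.toMatrix ξB ηB Θ =
            Matrix.of fun _ _ => (-1) ^ (r * (r - 1) / 2) * ∏ j, (S.d j : S.integers)) ∧
      -- the rational statement, with the action of Frobenius
      ∃ (ξB : Module.Basis Unit S.Lam (Cohomology S.Omega S.dOmega (2 * r)))
        (ηB : Module.Basis Unit S.Lam (Cohomology S.OmegaHat S.dOmegaHat (2 * r)))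
        (Θ : Cohomology S.Omega S.dOmega (2 * r) →ₗ[S.Lam]
          Cohomology S.OmegaHat S.dOmegaHat (2 * r))
        (A : Module.End S.Lam (Cohomology S.Omega S.dOmega (2 * r)))
        (A' : Module.End S.Lam (Cohomology S.OmegaHat S.dOmegaHat (2 * r))),
        IsClassOf S.Omega S.dOmega (2 * r) (S.xi r) (ξB ()) ∧
        IsClassOf S.OmegaHat S.dOmegaHat (2 * r) (η r) (ηB ()) ∧
        IsInducedMap S.Omega S.dOmega (2 * r) S.OmegaHat S.dOmegaHat (2 * r)
          (S.thetaHat (2 * r)) Θ ∧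
        IsInducedMap S.Omega S.dOmega (2 * r) S.Omega S.dOmega (2 * r) S.alpha A ∧
        IsInducedMap S.OmegaHat S.dOmegaHat (2 * r) S.OmegaHat S.dOmegaHat (2 * r)
          (S.alphaHat (2 * r)) A' ∧
        LinearMap.toMatrix ξB ηB Θ =
          Matrix.of (fun _ _ => (-1) ^ (r * (r - 1) / 2) * ∏ j, (S.d j : S.Lam)) ∧
        Function.Bijective Θ ∧ Θ ∘ₗ A = A' ∘ₗ Θ ∧
        (LinearMap.toMatrix ξB ξB A).charpolyRev =
          1 - Polynomial.C ((S.q : S.Lam) ^ (n + 1)) * Polynomial.X := by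
  obtain ⟨g, hg⟩ := hM'
  rw [mul_comm] at hg
  have h := DworkDatum.isSetup hq hζ.pow_eq_one hb₁ hb₂ hM hg hMb hπ hγ hγ₀ hγ₁ hr hrn hd hf hX
  refine ⟨h.exists_isEtaSequence, fun η hη => ⟨fun s => ?_, ?_⟩⟩
  · exact exists_bases_toMatrix_eq (h.isFreeGenerator_xi_FOmega s)
      (h.isFreeGenerator_eta_FOmega hη s)
      ((h.isThetaComplex_FOmega s).mapsCohomology (2 * r))
      (h.theta_smul_xi_sub_mem hη s)
  · exact exists_bases_charpolyRev_eq h.isFreeGenerator_xi_Omega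
      (h.isFreeGenerator_eta_Omega hη)
      ((h.isThetaComplex_Omega).mapsCohomology (2 * r))
      (h.mapsCohomology_alpha (2 * r)) (h.mapsCohomology_alphaHat (2 * r))
      (fun ω => h.thetaHat_alpha (2 * r) ω) (DworkDatum.IsSetup.thetaCoeff_Lam_ne_zero h.deg_pos).isUnit
      (h.theta_xi_sub_mem hη) (h.alpha_xi_sub_mem hη)
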